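/- Let $(M^m,g)$ and $(N^n,h)$ be smooth connected Riemannian manifolds without boundary, with $M$ compact. For a smooth map $\phi:M\to N$ let $\nabla^\phi$ be the connection on $\phi^{-1}TN$ induced by the Levi-Civita connection of $N$, let $\operatorname{Tr}$ denote the trace with respect to $g$, and let $\tau(\phi)=\operatorname{Tr}\nabla^\phi d\phi$ be the tension field. Curvatures are taken with the conventions $R(X,Y)Z=[\nabla_X,\nabla_Y]Z-\nabla_{[X,Y]}Z$, $\langle\operatorname{Ric}(X),Y\rangle=\operatorname{Tr}\{Z\mapsto R(Z,X)Y\}$, $\operatorname{Scal}=\operatorname{Tr}\operatorname{Ric}$, and $(\nabla R)(X,Y,Z,V)=(\nabla_XR)(Y,Z)V$; $\operatorname{Ric}$ and $\operatorname{Scal}$ without superscript are those of $(M,g)$. The c-bienergy is $$E_2^c(\phi)=\frac12\int_M\Big(|\tau(\phi)|^2+\tfrac23\operatorname{Scal}|d\phi|^2-2\operatorname{Tr}\langle d\phi(\operatorname{Ric}(\cdot)),d\phi(\cdot)\rangle\Big)\,v_g ,$$ and $\phi$ is called c-biharmonic if it is a critical point of $E_2^c$ with respect to all smooth variations. A Jacobi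 operator of $E_2^c$ at $\phi$ is a map $L$ from smooth sections of $\phi^{-1}TN$ to smooth sections of $\phi^{-1}TN$ such that, for every smooth map $\Phi:\mathbb R\times\mathbb R\times M\to N$, $\Phi(s,t,p)=\phi_{s,t}(p)$, with $\phi_{0,0}=\phi$, $V=\partial_s\phi_{s,0}|_{s=0}$ and $W=\partial_t\phi_{0,t}|_{t=0}$, $$\frac{\partial^2}{\partial s\,\partial t}\Big|_{(s,t)=(0,0)}E_2^c(\phi_{s,t})=\int_M\langle L(W),V\rangle\,v_g .$$ For a smooth section $W$ of $\phi^{-1}TN$ put $\big((\nabla^\phi)^2W\big)(X,Y)=\nabla^\phi_X\nabla^\phi_YW-\nabla^\phi_{\nabla_XY}W$, $\Delta^\phi W=-\operatorname{Tr}(\nabla^\phi)^2W$, $$J(W)=\Delta^\phi W+\operatorname{Tr}R^N(d\phi(\cdot),W)d\phi(\cdot),$$ $$\begin{aligned}J_2(W)={}&J(J(W))-R^N(\tau(\phi),W)\tau(\phi)-\operatorname{Tr}(\nabla^NR^N)(\tau(\phi),d\phi(\cdot),W,d\phi(\cdot))\\&+\operatorname{Tr}\big\{(\nabla^NR^N)(d\phi(\cdot),\tau(\phi),d\phi(\cdot),W)+2R^N(W,d\phi(\cdot))\nabla^\phi_{(\cdot)}\tau(\phi)+2R^N(\tau(\phi),d\phi(\cdot))\nabla^\phi_{(\cdot)}W\big\}.\end{aligned}$$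 **Theorem.** Let $\phi:(M,g)\to(N,h)$ be c-biharmonic. Then $E_2^c$ has exactly one Jacobi operator $J_2^c$ at $\phi$, and it is given, for every smooth section $W$ of $\phi^{-1}TN$, by $$J_2^c(W)=J_2(W)-2\operatorname{Tr}R^N\big(d\phi(\operatorname{Ric}(\cdot)),W\big)d\phi(\cdot)+\tfrac23\operatorname{Scal}J(W)+2\operatorname{Tr}\big((\nabla^\phi)^2W\big)(\operatorname{Ric}(\cdot),\cdot)+\tfrac13\nabla^\phi_{\nabla\operatorname{Scal}}W .$$ -/

import Mathlib

open Bundle Manifold MeasureTheory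
open scoped ContDiff

namespace ConformalBiharmonic

noncomputable section

/-- The model space `ℝⁿ` with its Euclidean structure. -/
abbrev Model (n : ℕ) : Type := EuclideanSpace ℝ (Fin n)

/-- The `i`-th standard basis vector of `ℝⁿ`. -/
def stdVec {n : ℕ} (i : Fin n) : Model n := EuclideanSpace.single i (1 : ℝ)

/-! ### Coordinates on a manifold -/

section Coordinates

variable {n : ℕ} {N : Type*} [TopologicalSpace N] [ChartedSpace (Model n) N]

/-- Coordinates of the tangent vector `v ∈ T_x N` in the chart around `q`. -/
def coords (q x : N) (v : TangentSpace (𝓡 n) x) : Model n :=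
  mfderiv (𝓡 n) 𝓘(ℝ, Model n) (extChartAt (𝓡 n) q) x v

/-- The tangent vector `∑ aⁱ ∂/∂yⁱ ∈ T_x N` with coordinates `a` in the chart `(yⁱ)` around `q`
(`x` in the domain of that chart). -/
def ofCoords (q x : N) (a : Model n) : TangentSpace (𝓡 n) x :=
  (mfderiv (𝓡 n) 𝓘(ℝ, Model n) (extChartAt (𝓡 n) q) x).inverse a

/-- An extension of the tangent vector `v ∈ T_q N` to a vector field near `q`: the field with
constant coordinates in the chart around `q`. Only its germ at `q` is ever used. -/
def extendVec (q : N) (v : TangentSpace (𝓡 n) q) (x : N) : TangentSpace (𝓡 n) x :=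
  ofCoords q x (coords q q v)

instance (q : N) : FiniteDimensional ℝ (TangentSpace (𝓡 n) q) :=
  inferInstanceAs (FiniteDimensional ℝ (Model n))

end Coordinates

/-! ### The Levi-Civita connection, curvature, and the Riemannian measure -/

section Riemannian

variable {n : ℕ} {N : Type*} [TopologicalSpace N] [ChartedSpace (Model n) N]
  [RiemannianBundle (fun x : N => TangentSpace (𝓡 n) x)]

/-- The metric matrix `(h_ij)` in the chart around `q`, as a function of the coordinates `z`. -/
def gram (q : N) (z : Model n) : Matrix (Fin n) (Fin n) ℝ :=
  Matrix.of fun i j =>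
    inner ℝ (ofCoords q ((extChartAt (𝓡 n) q).symm z) (stdVec i))
      (ofCoords q ((extChartAt (𝓡 n) q).symm z) (stdVec j))

/-- `∂h_jl/∂yⁱ` in the chart around `q`, as a function of the coordinates `z`. -/
def dGram (q : N) (z : Model n) (i j l : Fin n) : ℝ :=
  fderiv ℝ (fun z' => gram q z' j l) z (stdVec i)

/-- The Christoffel symbol `Γᵏ_ij` of the chart around `q`, as a function of the coordinates. -/
def christoffel (q : N) (z : Model n) (k i j : Fin n) : ℝ :=
  (1 / 2) * ∑ l, (gram q z)⁻¹ k l * (dGram q z i j l + dGram q z j i l - dGram q z l i j)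

/-- The vector with coordinates `Γᵏ_ij aⁱ bʲ`. -/
def christoffelVec (q : N) (z a b : Model n) : Model n :=
  WithLp.toLp 2 fun k => ∑ i, ∑ j, christoffel q z k i j * a i * b j

/-- The connection `∇^f` on the pull-back bundle `f⁻¹ TN` of a map `f : M → N`: for a section `W`
of `f⁻¹ TN`, this is `(∇^f_v W)(p)`, `v ∈ T_p M`. In the coordinates of `N` around `f p` it is
`v(Wᵏ) + Γᵏ_ij(f p) (df(v))ⁱ Wʲ`, with `Γ` the Levi-Civita connection of `N`. -/
def pullbackCov {m : ℕ} {M : Type*} [TopologicalSpace M] [ChartedSpace (Model m) M]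
    (f : M → N) (W : ∀ p : M, TangentSpace (𝓡 n) (f p)) (p : M) (v : TangentSpace (𝓡 m) p) :
    TangentSpace (𝓡 n) (f p) :=
  ofCoords (f p) (f p)
    ((show Model n from mfderiv (𝓡 m) 𝓘(ℝ, Model n) (fun x => coords (f p) (f x) (W x)) p v) +
      christoffelVec (f p) (extChartAt (𝓡 n) (f p) (f p))
        (coords (f p) (f p) (mfderiv (𝓡 m) (𝓡 n) f p v)) (coords (f p) (f p) (W p)))

/-- The Levi-Civita connection of `N`: `nabla X Y = ∇_X Y`. -/
def nabla (X Y : ∀ x : N, TangentSpace (𝓡 n) x) (x : N) : TangentSpace (𝓡 n) x :=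
  pullbackCov (m := n) (fun y : N => y) Y x (X x)

/-- `R(X,Y)Z = [∇_X, ∇_Y] Z - ∇_{[X,Y]} Z` for vector fields. -/
def curvField (X Y Z : ∀ x : N, TangentSpace (𝓡 n) x) (x : N) : TangentSpace (𝓡 n) x :=
  nabla X (nabla Y Z) x - nabla Y (nabla X Z) x
    - nabla (VectorField.mlieBracket (𝓡 n) X Y) Z x

/-- The curvature tensor `R(u,v)w` at a point. -/
def curv (q : N) (u v w : TangentSpace (𝓡 n) q) : TangentSpace (𝓡 n) q :=
  curvField (extendVec q u) (extendVec q v) (extendVec q w) q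

/-- `(∇R)(X,Y,Z,V) = ∇_X(R(Y,Z)V) - R(∇_X Y,Z)V - R(Y,∇_X Z)V - R(Y,Z)∇_X V`
for vector fields. -/
def dCurvField (X Y Z V : ∀ x : N, TangentSpace (𝓡 n) x) (x : N) : TangentSpace (𝓡 n) x :=
  nabla X (fun y => curv y (Y y) (Z y) (V y)) x - curv x (nabla X Y x) (Z x) (V x)
    - curv x (Y x) (nabla X Z x) (V x) - curv x (Y x) (Z x) (nabla X V x)

/-- The tensor `(∇R)(u,v,w,t) = (∇_u R)(v,w)t` at a point. -/
def dCurv (q : N) (u v w t : TangentSpace (𝓡 n) q) : TangentSpace (𝓡 n) q :=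
  dCurvField (extendVec q u) (extendVec q v) (extendVec q w) (extendVec q t) q

/-- The trace with respect to the metric of a bilinear map `B` on `T_q N`: the sum
`∑ B(e_i, e_i)` over an orthonormal basis. -/
def metricTrace (q : N) {F : Type*} [AddCommMonoid F]
    (B : TangentSpace (𝓡 n) q → TangentSpace (𝓡 n) q → F) : F :=
  ∑ i, B (stdOrthonormalBasis ℝ (TangentSpace (𝓡 n) q) i)
    (stdOrthonormalBasis ℝ (TangentSpace (𝓡 n) q) i)

/-- `Ric(u,v) = Tr {w ↦ R(w,u)v}`. -/
def ricciForm (q : N) (u v : TangentSpace (𝓡 n) q) : ℝ :=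
  metricTrace q fun w w' => inner ℝ (curv q w u v) w'

/-- The Ricci operator: `⟨Ric(u), v⟩ = Ric(u,v)`. -/
def ricci (q : N) (u : TangentSpace (𝓡 n) q) : TangentSpace (𝓡 n) q :=
  metricTrace q fun w w' => ricciForm q u w • w'

/-- The scalar curvature `Scal = Tr Ric`. -/
def scal (n : ℕ) {N : Type*} [TopologicalSpace N] [ChartedSpace (Model n) N]
    [RiemannianBundle (fun x : N => TangentSpace (𝓡 n) x)] (q : N) : ℝ :=
  metricTrace (n := n) q (ricciForm q)

/-- The gradient of a function: `⟨∇f, v⟩ = df(v)`. -/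
def grad (f : N → ℝ) (q : N) : TangentSpace (𝓡 n) q :=
  metricTrace q fun w w' => (show ℝ from mfderiv (𝓡 n) 𝓘(ℝ, ℝ) f q w) • w'

variable [MeasurableSpace N]

/-- The measure `√(det h_ij) dy¹ ⋯ dyⁿ` on the domain of the chart around `q`. -/
def chartVolume (q : N) : Measure N :=
  (((volume : Measure (Model n)).restrict (extChartAt (𝓡 n) q).target).withDensity
    fun z => ENNReal.ofReal (Real.sqrt (gram q z).det)).map (extChartAt (𝓡 n) q).symm

/-- The Riemannian measure `v_h`: the measure that equals `√(det h_ij) dy¹ ⋯ dyⁿ` in each chart.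
As these measures agree where two charts overlap, it is their least upper bound. -/
def riemVolume (n : ℕ) (N : Type*) [TopologicalSpace N] [ChartedSpace (Model n) N]
    [RiemannianBundle (fun x : N => TangentSpace (𝓡 n) x)] [MeasurableSpace N] : Measure N :=
  ⨆ q : N, chartVolume (n := n) q

end Riemannian

/-! ### Maps between Riemannian manifolds -/

section Maps

variable (m n : ℕ)
  {M : Type*} [TopologicalSpace M] [ChartedSpace (Model m) M]
  [RiemannianBundle (fun x : M => TangentSpace (𝓡 m) x)]
  {N : Type*} [TopologicalSpace N] [ChartedSpace (Model n) N]
  [RiemannianBundle (fun x : N => TangentSpace (𝓡 n) x)]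

/-- The differential `dφ_p`. -/
def dmap (φ : M → N) (p : M) (u : TangentSpace (𝓡 m) p) : TangentSpace (𝓡 n) (φ p) :=
  mfderiv (𝓡 m) (𝓡 n) φ p u

/-- `(∇^φ dφ)(u,v) = ∇^φ_u (dφ(V)) - dφ(∇_u V)`, where `V` extends `v`. -/
def hessMap (φ : M → N) (p : M) (u v : TangentSpace (𝓡 m) p) : TangentSpace (𝓡 n) (φ p) :=
  pullbackCov φ (fun x => dmap m n φ x (extendVec p v x)) p u
    - dmap m n φ p (nabla (extendVec p u) (extendVec p v) p)

/-- The tension field `τ(φ) = Tr ∇^φ dφ`. -/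
def tension (φ : M → N) (p : M) : TangentSpace (𝓡 n) (φ p) :=
  metricTrace p (hessMap m n φ p)

/-- `((∇^φ)² W)(u,v) = ∇^φ_u (∇^φ_V W) - ∇^φ_{∇_u V} W`, where `V` extends `v`. -/
def hessSec (φ : M → N) (W : ∀ p : M, TangentSpace (𝓡 n) (φ p)) (p : M)
    (u v : TangentSpace (𝓡 m) p) : TangentSpace (𝓡 n) (φ p) :=
  pullbackCov φ (fun x => pullbackCov φ W x (extendVec p v x)) p u
    - pullbackCov φ W p (nabla (extendVec p u) (extendVec p v) p)

/-- The rough Laplacian `Δ^φ W = - Tr (∇^φ)² W`. -/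
def roughLaplacian (φ : M → N) (W : ∀ p : M, TangentSpace (𝓡 n) (φ p)) (p : M) :
    TangentSpace (𝓡 n) (φ p) :=
  -metricTrace p (hessSec m n φ W p)

/-- The operator `J(W) = Δ^φ W + Tr R^N(dφ(·), W) dφ(·)`. -/
def jacobiE (φ : M → N) (W : ∀ p : M, TangentSpace (𝓡 n) (φ p)) (p : M) :
    TangentSpace (𝓡 n) (φ p) :=
  roughLaplacian m n φ W p + metricTrace p fun u v => curv (φ p) (dmap m n φ p u) (W p) (dmap m n φ p v)

/-- The operator
`J₂(W) = J(J(W)) - R^N(τ(φ), W)τ(φ) - Tr (∇^N R^N)(τ(φ), dφ(·), W, dφ(·))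
  + Tr {(∇^N R^N)(dφ(·), τ(φ), dφ(·), W) + 2 R^N(W, dφ(·))∇^φ_(·) τ(φ)
        + 2 R^N(τ(φ), dφ(·))∇^φ_(·) W}`. -/
def jacobiE2 (φ : M → N) (W : ∀ p : M, TangentSpace (𝓡 n) (φ p)) (p : M) :
    TangentSpace (𝓡 n) (φ p) :=
  jacobiE m n φ (jacobiE m n φ W) p
    - curv (φ p) (tension m n φ p) (W p) (tension m n φ p)
    - (metricTrace p fun u v => dCurv (φ p) (tension m n φ p) (dmap m n φ p u) (W p) (dmap m n φ p v))
    + metricTrace p fun u v =>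
        dCurv (φ p) (dmap m n φ p u) (tension m n φ p) (dmap m n φ p v) (W p)
          + (2 : ℝ) • curv (φ p) (W p) (dmap m n φ p u) (pullbackCov φ (tension m n φ) p v)
          + (2 : ℝ) • curv (φ p) (tension m n φ p) (dmap m n φ p u) (pullbackCov φ W p v)

/-- The operator
`J₂ᶜ(W) = J₂(W) - 2 Tr R^N(dφ(Ric(·)), W)dφ(·) + (2/3) Scal J(W)
  + 2 Tr ((∇^φ)² W)(Ric(·), ·) + (1/3) ∇^φ_{∇Scal} W`. -/
def jacobiE2c (φ : M → N) (W : ∀ p : M, TangentSpace (𝓡 n) (φ p)) (p : M) :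
    TangentSpace (𝓡 n) (φ p) :=
  jacobiE2 m n φ W p
    - (2 : ℝ) • (metricTrace p fun u v => curv (φ p) (dmap m n φ p (ricci p u)) (W p) (dmap m n φ p v))
    + (2 / 3 * scal m p : ℝ) • jacobiE m n φ W p
    + (2 : ℝ) • (metricTrace p fun u v => hessSec m n φ W p (ricci p u) v)
    + (1 / 3 : ℝ) • pullbackCov (m := m) φ W p (grad (n := m) (scal m) p)

variable [IsManifold (𝓡 n) ∞ N]

/-- Smooth sections of `φ⁻¹ TN`. -/
def IsSmoothSection (φ : M → N) (W : ∀ p : M, TangentSpace (𝓡 n) (φ p)) : Prop :=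
  ContMDiff (𝓡 m) (𝓡 n).tangent ∞ fun p => (⟨φ p, W p⟩ : TangentBundle (𝓡 n) N)

variable [MeasurableSpace M]

/-- The conformal bienergy
`E₂ᶜ(φ) = ½ ∫_M |τ(φ)|² + (2/3) Scal |dφ|² - 2 Tr ⟨dφ(Ric(·)), dφ(·)⟩ v_g`. -/
def cBienergy (φ : M → N) : ℝ :=
  1 / 2 * ∫ p, (inner ℝ (tension m n φ p) (tension m n φ p)
    + 2 / 3 * scal m p * (metricTrace p fun u v => inner ℝ (dmap m n φ p u) (dmap m n φ p v))
    - 2 * metricTrace p fun u v => inner ℝ (dmap m n φ p (ricci p u)) (dmap m n φ p v))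
    ∂(riemVolume m M)

/-- Conformal-biharmonic maps: smooth critical points of `E₂ᶜ`, i.e. `d/dt E₂ᶜ(φ_t) = 0` at `t = 0`
for every smooth variation `(φ_t)` of `φ`. -/
def IsCBiharmonic (φ : M → N) : Prop :=
  ContMDiff (𝓡 m) (𝓡 n) ∞ φ ∧
    ∀ Φ : ℝ → M → N,
      ContMDiff (𝓘(ℝ, ℝ).prod (𝓡 m)) (𝓡 n) ∞ (fun x : ℝ × M => Φ x.1 x.2) →
      Φ 0 = φ → HasDerivAt (fun t => cBienergy m n (Φ t)) 0 0

/-- `Φ` is a smooth two-parameter variation `φ_{s,t}` of `φ` with variation fields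
`V = ∂φ_{s,0}/∂s` and `W = ∂φ_{0,t}/∂t` at `0` (as elements of the tangent bundle). -/
structure IsVariation (φ : M → N) (V W : ∀ p : M, TangentSpace (𝓡 n) (φ p))
    (Φ : ℝ → ℝ → M → N) : Prop where
  smooth : ContMDiff (𝓘(ℝ, ℝ).prod (𝓘(ℝ, ℝ).prod (𝓡 m))) (𝓡 n) ∞
    (fun x : ℝ × ℝ × M => Φ x.1 x.2.1 x.2.2)
  base : Φ 0 0 = φ
  field_s : ∀ p, (⟨Φ 0 0 p, mfderiv 𝓘(ℝ, ℝ) (𝓡 n) (fun s => Φ s 0 p) 0 (1 : ℝ)⟩ :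
    TangentBundle (𝓡 n) N) = ⟨φ p, V p⟩
  field_t : ∀ p, (⟨Φ 0 0 p, mfderiv 𝓘(ℝ, ℝ) (𝓡 n) (fun t => Φ 0 t p) 0 (1 : ℝ)⟩ :
    TangentBundle (𝓡 n) N) = ⟨φ p, W p⟩

/-- `L` is a Jacobi operator of the functional `ℰ` at `φ`: it maps smooth sections of `φ⁻¹ TN` to
smooth sections, and `∂²/∂s∂t ℰ(φ_{s,t}) = ∫_M ⟨L(W), V⟩ v_g` at `(0,0)` for every smooth
two-parameter variation of `φ` with variation fields `V`, `W` (the derivatives exist). -/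
def IsJacobiOperator (ℰ : (M → N) → ℝ) (φ : M → N)
    (L : (∀ p : M, TangentSpace (𝓡 n) (φ p)) → ∀ p : M, TangentSpace (𝓡 n) (φ p)) : Prop :=
  (∀ W, IsSmoothSection m n φ W → IsSmoothSection m n φ (L W)) ∧
    ∀ V W Φ, IsVariation m n φ V W Φ →
      (∀ t, DifferentiableAt ℝ (fun s => ℰ (Φ s t)) 0) ∧
        HasDerivAt (fun t => deriv (fun s => ℰ (Φ s t)) 0)
          (∫ p, inner ℝ (L W p) (V p) ∂(riemVolume m M)) 0

end Maps

end

end ConformalBiharmonic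

/-! The strategy is to compute the gradient of the functional at every smooth map and then to
linearise that gradient at a critical point. For a smooth family `f t` with velocity ∂_t f, the
first variation is d/dt E(f t) = ∫⟨B(f t), ∂_t f⟩, where B is `bitension`: B(φ) = -J(τ(φ)) - (2/3)
Scal τ(φ) + 2 Tr ∇dφ(Ric(·),·) + (1/3) dφ(∇Scal). The term |τ|² is handled by ∇_t τ = -J(∂_t f)
(`timeD_tension`) and by the symmetry of J in L² (`integral_jacobiE_symm`). The two curvature terms
contribute ∫ Tr⟨T, ∇∂_t f⟩ with the one-form T = (2/3) Scal dφ - 2 dφ∘Ric. Integration by parts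
replaces T by minus its divergence, and the contracted Bianchi identity div Ric = ½ ∇Scal
(`metricTrace_dRicci`) produces the coefficient 2·½ - 2/3 = 1/3 in `divForm_stressForm`. The result
is `hasDerivAt_cBienergy`.

For a two-parameter variation, the s-derivative at s = 0 is ∫⟨B(φ_{0,t}), ∂_s φ_{s,t}⟩. Its
t-derivative at t = 0 is ∫⟨∇_t B, V⟩ + ∫⟨B(φ), ∇_t ∂_s φ_{s,t}⟩. The second integral vanishes
because a critical φ has B(φ) orthogonal to all smooth sections
(`IsCBiharmonic.integral_bitension`). In the first, ∇_t B equals J₂ᶜ(W) pointwise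
(`timeD_bitension`), with no further integration: each term of B is differentiated using ∇_t df(u) =
∇_u ∂_t f and the commutation of covariant derivatives up to curvature, and the curvature terms are
rearranged with the Bianchi identities (`second_variation_integrand`).

For uniqueness, let L be a second Jacobi operator and Z = L(W) - J₂ᶜ(W). By `exists_isVariation`
there is a variation with fields Z and W. Comparing the two second-variation formulas gives ∫|Z|² =
0, and Z = 0 because Z is smooth and the Riemannian measure charges every nonempty open set.

The differential geometry is carried out in charts. For a Christoffel map Γ on a normed space E and
a map into E from any normed space P, the operations `lcov`, `lcurv` and `ldcurv` satisfy the
commutation, Leibniz, Bianchi and skew-symmetry rules. With P the model space of M these are the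
rules on M; with P = ℝ × (model space) they cover families, time and space being the constant
directions (1,0) and (0,a). The transformation law `christoffelL_change` makes the local formulas
independent of the chart of N, so that `coords_covD`, `coords_curv`, `coords_hessMap` and their
analogues carry the rules back to the manifolds.

Integration rests on two facts: the Riemannian measure restricted to a chart domain is the chart
measure (`riemVolume_restrict_source`), and the density times the divergence is a Euclidean
divergence (`density_mul_divg`). A partition of unity then gives the divergence theorem
`integral_divg`. Variations with prescribed fields are also built by a partition of unity,
displacing the map in one chart of N at a time; no exponential map is needed. -/

namespace ConformalBiharmonic

noncomputable section

open scoped Topology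

set_option maxSynthPendingDepth 3

set_option linter.unusedSectionVars false

/-! ### Chart coordinates of tangent vectors and smoothness of sections. -/

section Charts

variable {n : ℕ} {N : Type*} [TopologicalSpace N] [ChartedSpace (Model n) N]

/-- `coords q x` as a continuous linear map. -/
def coordsL (q x : N) : TangentSpace (𝓡 n) x →L[ℝ] Model n :=
  mfderiv (𝓡 n) 𝓘(ℝ, Model n) (extChartAt (𝓡 n) q) x

/-- `ofCoords q x` as a continuous linear map. -/
def ofCoordsL (q x : N) : Model n →L[ℝ] TangentSpace (𝓡 n) x :=
  (mfderiv (𝓡 n) 𝓘(ℝ, Model n) (extChartAt (𝓡 n) q) x).inverse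

lemma coords_eq (q x : N) (v : TangentSpace (𝓡 n) x) : coords q x v = coordsL q x v := rfl

@[simp] lemma coords_add (q x : N) (v w : TangentSpace (𝓡 n) x) :
    coords q x (v + w) = coords q x v + coords q x w := map_add (coordsL q x) v w

@[simp] lemma coords_sub (q x : N) (v w : TangentSpace (𝓡 n) x) :
    coords q x (v - w) = coords q x v - coords q x w := map_sub (coordsL q x) v w

@[simp] lemma coords_neg (q x : N) (v : TangentSpace (𝓡 n) x) :
    coords q x (-v) = -coords q x v := map_neg (coordsL q x) v

@[simp] lemma coords_zero (q x : N) : coords q x (0 : TangentSpace (𝓡 n) x) = 0 :=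
  map_zero (coordsL q x)

@[simp] lemma coords_smul (q x : N) (c : ℝ) (v : TangentSpace (𝓡 n) x) :
    coords q x (c • v) = c • coords q x v := map_smul (coordsL q x) c v

@[simp] lemma coords_sum (q x : N) {ι : Type*} (s : Finset ι) (v : ι → TangentSpace (𝓡 n) x) :
    coords q x (∑ i ∈ s, v i) = ∑ i ∈ s, coords q x (v i) := map_sum (coordsL q x) v s

@[simp] lemma ofCoords_add (q x : N) (v w : Model n) :
    ofCoords q x (v + w) = ofCoords q x v + ofCoords q x w := map_add (ofCoordsL q x) v w

@[simp] lemma ofCoords_smul (q x : N) (c : ℝ) (v : Model n) :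
    ofCoords q x (c • v) = c • ofCoords q x v := map_smul (ofCoordsL q x) c v

@[simp] lemma ofCoords_zero (q x : N) : ofCoords q x (0 : Model n) = 0 :=
  map_zero (ofCoordsL q x)

@[simp] lemma ofCoords_sum (q x : N) {ι : Type*} (s : Finset ι) (v : ι → Model n) :
    ofCoords q x (∑ i ∈ s, v i) = ∑ i ∈ s, ofCoords q x (v i) := map_sum (ofCoordsL q x) v s

variable [IsManifold (𝓡 n) ∞ N]

lemma coords_ofCoords {q x : N} (hx : x ∈ (extChartAt (𝓡 n) q).source) (a : Model n) :
    coords q x (ofCoords q x a) = a := by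
  have : IsManifold (𝓡 n) 1 N := .of_le (n := ∞) (by norm_cast)
  have h : (mfderiv (𝓡 n) 𝓘(ℝ, Model n) (extChartAt (𝓡 n) q) x).IsInvertible :=
    isInvertible_mfderiv_extChartAt hx
  exact congrArg (fun L => L a) h.self_comp_inverse

lemma ofCoords_coords {q x : N} (hx : x ∈ (extChartAt (𝓡 n) q).source)
    (v : TangentSpace (𝓡 n) x) : ofCoords q x (coords q x v) = v := by
  have : IsManifold (𝓡 n) 1 N := .of_le (n := ∞) (by norm_cast)
  have h : (mfderiv (𝓡 n) 𝓘(ℝ, Model n) (extChartAt (𝓡 n) q) x).IsInvertible :=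
    isInvertible_mfderiv_extChartAt hx
  exact congrArg (fun L => L v) h.inverse_comp_self

lemma coords_injective {q x : N} (hx : x ∈ (extChartAt (𝓡 n) q).source)
    {v w : TangentSpace (𝓡 n) x} (h : coords q x v = coords q x w) : v = w := by
  rw [← ofCoords_coords hx v, h, ofCoords_coords hx]

lemma coords_extendVec {q x : N} (hx : x ∈ (extChartAt (𝓡 n) q).source)
    (v : TangentSpace (𝓡 n) q) : coords q x (extendVec q v x) = coords q q v :=
  coords_ofCoords hx _

lemma extendVec_self (q : N) (v : TangentSpace (𝓡 n) q) : extendVec q v q = v :=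
  ofCoords_coords (mem_extChartAt_source q) v

/-- The trivialisation of the tangent bundle at q is fibrewise the derivative of the chart. This
links `coords` with the smooth structure of the total space. -/
lemma coords_eq_trivializationAt {q x : N} (hx : x ∈ (extChartAt (𝓡 n) q).source)
    (v : TangentSpace (𝓡 n) x) :
    coords q x v = (trivializationAt (Model n) (TangentSpace (𝓡 n)) q ⟨x, v⟩).2 := by
  have : IsManifold (𝓡 n) 1 N := .of_le (n := ∞) (by norm_cast)
  rw [extChartAt_source] at hx
  have := TangentBundle.continuousLinearMapAt_trivializationAt (I := 𝓡 n) (𝕜 := ℝ) hx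
  refine (congrArg (fun L => L v) this).symm.trans ?_
  rw [Trivialization.continuousLinearMapAt_apply, Trivialization.linearMapAt_apply, if_pos]
  simpa using hx

variable {E' H' P : Type*} [NormedAddCommGroup E'] [NormedSpace ℝ E'] [TopologicalSpace H']
  {I : ModelWithCorners ℝ E' H'} [TopologicalSpace P] [ChartedSpace H' P]

/-- The criterion by which smoothness of a section along a map is reduced to smoothness of a
vector-valued function. The chart centre q is arbitrary, so one chart serves all nearby points. -/
lemma contMDiffAt_section_iff {f : P → N} {Y : ∀ p, TangentSpace (𝓡 n) (f p)} {p : P} {q : N}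
    (hf : ContMDiffAt I (𝓡 n) ∞ f p) (hq : f p ∈ (extChartAt (𝓡 n) q).source) :
    ContMDiffAt I (𝓡 n).tangent ∞ (fun p => (⟨f p, Y p⟩ : TangentBundle (𝓡 n) N)) p ↔
      ContMDiffAt I 𝓘(ℝ, Model n) ∞ (fun p => coords q (f p) (Y p)) p := by
  have he : (⟨f p, Y p⟩ : TangentBundle (𝓡 n) N) ∈
      (trivializationAt (Model n) (TangentSpace (𝓡 n)) q).source := by
    simpa [TangentBundle.trivializationAt_source] using hq
  have key := (trivializationAt (Model n) (TangentSpace (𝓡 n)) q).contMDiffAt_iff (IB := 𝓡 n)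
    (IM := I) (n := ∞) (f := fun p => (⟨f p, Y p⟩ : TangentBundle (𝓡 n) N)) (x₀ := p) he
  refine key.trans ((and_iff_right hf).trans ?_)
  refine Filter.EventuallyEq.contMDiffAt_iff ?_
  have : ∀ᶠ x in 𝓝 p, f x ∈ (extChartAt (𝓡 n) q).source :=
    hf.continuousAt.eventually ((isOpen_extChartAt_source q).mem_nhds hq)
  filter_upwards [this] with x hx
  exact (coords_eq_trivializationAt hx _).symm

lemma mfderiv_extChartAt_comp {f : P → N} {p : P} {q : N} (hf : MDifferentiableAt I (𝓡 n) f p)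
    (hq : f p ∈ (extChartAt (𝓡 n) q).source) (v : TangentSpace I p) :
    (mfderiv I 𝓘(ℝ, Model n) (fun x => extChartAt (𝓡 n) q (f x)) p v : Model n) =
      coords q (f p) (mfderiv I (𝓡 n) f p v) := by
  have : IsManifold (𝓡 n) 1 N := .of_le (n := ∞) (by norm_cast)
  rw [extChartAt_source] at hq
  have := mfderiv_comp p (mdifferentiableAt_extChartAt (I := 𝓡 n) hq) hf
  exact congrArg (fun L => L v) this

end Charts

/-! ### The metric and the Levi-Civita symbols in one chart: Koszul formula, symmetry,
compatibility. -/

section LocalMetric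

@[simp] lemma stdVec_apply {n : ℕ} (i k : Fin n) :
    (stdVec i : Model n) k = if k = i then 1 else 0 := PiLp.single_apply _ _ _ _ _

lemma sum_smul_stdVec {n : ℕ} (a : Model n) : ∑ i, a i • stdVec i = a := by
  ext k
  simp [Finset.sum_apply]

lemma span_range_stdVec (n : ℕ) : Submodule.span ℝ (Set.range (stdVec (n := n))) = ⊤ := by
  refine eq_top_iff.2 fun a _ => ?_
  rw [← sum_smul_stdVec a]
  exact Submodule.sum_mem _ fun i _ => Submodule.smul_mem _ _ (Submodule.subset_span ⟨i, rfl⟩)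

/-- The Koszul identity holds if it holds for the vectors of a spanning family. -/
lemma koszul_of_span {E ι : Type*} [NormedAddCommGroup E] [NormedSpace ℝ E] {e : ι → E}
    (he : Submodule.span ℝ (Set.range e) = ⊤) {Γ : E →L[ℝ] E →L[ℝ] E} {G : E →L[ℝ] E →L[ℝ] ℝ}
    {D : E →L[ℝ] E →L[ℝ] E →L[ℝ] ℝ}
    (h : ∀ i j l, 2 * G (Γ (e i) (e j)) (e l) =
      D (e i) (e j) (e l) + D (e j) (e i) (e l) - D (e l) (e i) (e j)) (a b c : E) :
    2 * G (Γ a b) c = D a b c + D b a c - D c a b := by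
  have key : ∀ {f g : E → ℝ}, IsLinearMap ℝ f → IsLinearMap ℝ g → (∀ i, f (e i) = g (e i)) →
      ∀ a, f a = g a := fun hf hg hfg a =>
    congrArg (fun L => L a) (LinearMap.ext_on_range (f := hf.mk' _) (g := hg.mk' _) he hfg)
  have h1 : ∀ i j c, 2 * G (Γ (e i) (e j)) c =
      D (e i) (e j) c + D (e j) (e i) c - D c (e i) (e j) := fun i j =>
    key ⟨by intros; simp; ring, by intros; simp; ring⟩
      ⟨by intros; simp; ring, by intros; simp; ring⟩ fun l => h i j l
  have h2 : ∀ i b c, 2 * G (Γ (e i) b) c = D (e i) b c + D b (e i) c - D c (e i) b :=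
    fun i b c => key (f := fun b => 2 * G (Γ (e i) b) c)
      (g := fun b => D (e i) b c + D b (e i) c - D c (e i) b)
      ⟨by intros; simp; ring, by intros; simp; ring⟩
      ⟨by intros; simp; ring, by intros; simp; ring⟩ (fun j => h1 i j c) b
  exact key (f := fun a => 2 * G (Γ a b) c) (g := fun a => D a b c + D b a c - D c a b)
    ⟨by intros; simp; ring, by intros; simp; ring⟩
    ⟨by intros; simp; ring, by intros; simp; ring⟩ (fun i => h2 i b c) a

variable {n : ℕ} {N : Type*} [TopologicalSpace N] [ChartedSpace (Model n) N]
  [RiemannianBundle (fun x : N => TangentSpace (𝓡 n) x)]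

/-- The metric in the chart around `q`, as a bilinear form on the model space. -/
def chartMetric (q : N) (z : Model n) : Model n →L[ℝ] Model n →L[ℝ] ℝ :=
  (innerSL ℝ).bilinearComp (ofCoordsL q ((extChartAt (𝓡 n) q).symm z))
    (ofCoordsL q ((extChartAt (𝓡 n) q).symm z))

lemma chartMetric_apply (q : N) (z a b : Model n) :
    chartMetric q z a b = inner ℝ (ofCoords q ((extChartAt (𝓡 n) q).symm z) a)
      (ofCoords q ((extChartAt (𝓡 n) q).symm z) b) := rfl

lemma gram_apply (q : N) (z : Model n) (i j : Fin n) :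
    gram q z i j = chartMetric q z (stdVec i) (stdVec j) := rfl

lemma chartMetric_comm (q : N) (z a b : Model n) : chartMetric q z a b = chartMetric q z b a := by
  rw [chartMetric_apply, chartMetric_apply, real_inner_comm]

/-- The Christoffel symbols of the chart around `q`, as a bilinear map on the model space. -/
def christoffelL (q : N) (z : Model n) : Model n →L[ℝ] Model n →L[ℝ] Model n :=
  ∑ k, ∑ i, ∑ j, christoffel q z k i j • (EuclideanSpace.proj (𝕜 := ℝ) i).smulRight
    ((EuclideanSpace.proj (𝕜 := ℝ) j).smulRight (stdVec k : Model n))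

lemma christoffelL_apply (q : N) (z a b : Model n) :
    christoffelL q z a b = christoffelVec q z a b := by
  ext l
  simp only [christoffelL, christoffelVec, sum_apply,
    smul_apply, ContinuousLinearMap.smulRight_apply, EuclideanSpace.coe_proj,
    PiLp.smul_apply, WithLp.ofLp_sum, Finset.sum_apply, stdVec_apply,
    smul_eq_mul, mul_ite, mul_one, mul_zero]
  rw [Finset.sum_eq_single l (fun k _ hk => by simp [hk.symm]) (by simp)]
  exact Finset.sum_congr rfl fun i _ => Finset.sum_congr rfl fun j _ => by simp; ring

variable [IsManifold (𝓡 n) ∞ N]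

lemma chartMetric_pos (q : N) {z : Model n} (hz : z ∈ (extChartAt (𝓡 n) q).target) {a : Model n}
    (ha : a ≠ 0) : 0 < chartMetric q z a a := by
  rw [chartMetric_apply, real_inner_self_pos]
  intro h
  apply ha
  rw [← coords_ofCoords ((extChartAt (𝓡 n) q).map_target hz) a, h, coords_zero]

lemma chartMetric_nondegenerate (q : N) {z : Model n} (hz : z ∈ (extChartAt (𝓡 n) q).target)
    {a b : Model n} (h : ∀ c, chartMetric q z a c = chartMetric q z b c) : a = b := by
  by_contra hab
  have := chartMetric_pos q hz (sub_ne_zero.2 hab)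
  rw [map_sub (chartMetric q z), sub_apply, h, sub_self] at this
  exact lt_irrefl _ this

lemma gram_posDef (q : N) {z : Model n} (hz : z ∈ (extChartAt (𝓡 n) q).target) :
    (gram q z).PosDef := by
  refine Matrix.posDef_gram_of_linearIndependent
    (v := fun i => ofCoords q ((extChartAt (𝓡 n) q).symm z) (stdVec i)) ?_
  rw [Fintype.linearIndependent_iff]
  intro g hg i
  have h1 : ofCoords q ((extChartAt (𝓡 n) q).symm z) (∑ i, g i • stdVec i) = 0 := by
    simpa only [ofCoords_sum, ofCoords_smul] using hg
  have h2 := coords_ofCoords ((extChartAt (𝓡 n) q).map_target hz) (∑ i, g i • stdVec i)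
  rw [h1, coords_zero] at h2
  have h3 := congrArg (fun a : Model n => a i) h2
  simpa using h3.symm

lemma gram_det_pos (q : N) {z : Model n} (hz : z ∈ (extChartAt (𝓡 n) q).target) :
    0 < (gram q z).det := (gram_posDef q hz).det_pos

lemma inner_eq_chartMetric {q x : N} (hx : x ∈ (extChartAt (𝓡 n) q).source)
    (v w : TangentSpace (𝓡 n) x) :
    inner ℝ v w = chartMetric q (extChartAt (𝓡 n) q x) (coords q x v) (coords q x w) := by
  rw [chartMetric_apply, (extChartAt (𝓡 n) q).left_inv hx, ofCoords_coords hx, ofCoords_coords hx]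

variable [IsContMDiffRiemannianBundle (𝓡 n) ∞ (Model n) (fun x : N => TangentSpace (𝓡 n) x)]

/-- The coordinate fields have constant coordinates, hence are smooth sections over the chart, and
inner products of smooth sections are smooth. Joint smoothness as an operator-valued map follows by
testing on fixed pairs of vectors. -/
lemma contDiffOn_chartMetric (q : N) :
    ContDiffOn ℝ ∞ (chartMetric q) (extChartAt (𝓡 n) q).target := by
  rw [contDiffOn_clm_apply]
  intro a
  rw [contDiffOn_clm_apply]
  intro b
  rw [← contMDiffOn_iff_contDiffOn]
  have key : ∀ a : Model n, ContMDiffOn 𝓘(ℝ, Model n) (𝓡 n).tangent ∞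
      (fun z => (⟨(extChartAt (𝓡 n) q).symm z, ofCoords q ((extChartAt (𝓡 n) q).symm z) a⟩ :
        TangentBundle (𝓡 n) N)) (extChartAt (𝓡 n) q).target := by
    intro a z hz
    have ho := (isOpen_extChartAt_target q).mem_nhds hz
    refine ContMDiffAt.contMDiffWithinAt ?_
    rw [contMDiffAt_section_iff (q := q)
      ((contMDiffOn_extChartAt_symm q).contMDiffAt ho) ((extChartAt (𝓡 n) q).map_target hz)]
    refine (contMDiffAt_const (c := a)).congr_of_eventuallyEq ?_
    filter_upwards [ho] with y hy
    exact coords_ofCoords ((extChartAt (𝓡 n) q).map_target hy) a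
  exact (key a).inner_bundle (key b)

lemma contDiffAt_chartMetric (q : N) {z : Model n} (hz : z ∈ (extChartAt (𝓡 n) q).target) :
    ContDiffAt ℝ ∞ (chartMetric q) z :=
  (contDiffOn_chartMetric q).contDiffAt ((isOpen_extChartAt_target q).mem_nhds hz)

lemma dGram_eq (q : N) {z : Model n} (hz : z ∈ (extChartAt (𝓡 n) q).target) (i j l : Fin n) :
    dGram q z i j l = fderiv ℝ (chartMetric q) z (stdVec i) (stdVec j) (stdVec l) := by
  have h := ((contDiffAt_chartMetric q hz).differentiableAt (by simp)).hasFDerivAt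
  have h2 := ((h.clm_apply (hasFDerivAt_const (stdVec j) z)).clm_apply
    (hasFDerivAt_const (stdVec l) z)).fderiv
  unfold dGram
  simp only [gram_apply]
  rw [h2]
  simp

lemma fderiv_chartMetric_comm (q : N) {z : Model n} (hz : z ∈ (extChartAt (𝓡 n) q).target)
    (a b c : Model n) :
    fderiv ℝ (chartMetric q) z a b c = fderiv ℝ (chartMetric q) z a c b := by
  have h := ((contDiffAt_chartMetric q hz).differentiableAt (by simp)).hasFDerivAt
  have h1 := ((h.clm_apply (hasFDerivAt_const b z)).clm_apply (hasFDerivAt_const c z)).fderiv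
  have h2 := ((h.clm_apply (hasFDerivAt_const c z)).clm_apply (hasFDerivAt_const b z)).fderiv
  simp only [chartMetric_comm q _ c b] at h2
  have := congrArg (fun L => L a) (h1.symm.trans h2)
  simpa using this

lemma contDiffAt_gram (q : N) {z : Model n} (hz : z ∈ (extChartAt (𝓡 n) q).target) (i j : Fin n) :
    ContDiffAt ℝ ∞ (fun z => gram q z i j) z :=
  ((contDiffAt_chartMetric q hz).clm_apply contDiffAt_const).clm_apply contDiffAt_const

lemma contDiffAt_gram_det (q : N) {z : Model n} (hz : z ∈ (extChartAt (𝓡 n) q).target) :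
    ContDiffAt ℝ ∞ (fun z => (gram q z).det) z := by
  simp only [Matrix.det_apply']
  exact ContDiffAt.sum fun σ _ => contDiffAt_const.mul
    (contDiffAt_prod fun i _ => contDiffAt_gram q hz _ _)

lemma contDiffAt_gram_inv (q : N) {z : Model n} (hz : z ∈ (extChartAt (𝓡 n) q).target)
    (i j : Fin n) : ContDiffAt ℝ ∞ (fun z => (gram q z)⁻¹ i j) z := by
  simp only [Matrix.inv_def, Matrix.smul_apply, Ring.inverse_eq_inv', smul_eq_mul,
    Matrix.adjugate_apply]
  refine ContDiffAt.mul ((contDiffAt_gram_det q hz).inv (gram_det_pos q hz).ne') ?_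
  · simp only [Matrix.det_apply']
    refine ContDiffAt.sum fun σ _ => contDiffAt_const.mul (contDiffAt_prod fun k _ => ?_)
    simp only [Matrix.updateRow_apply]
    split_ifs
    · exact contDiffAt_const
    · exact contDiffAt_gram q hz _ _

lemma contDiffOn_christoffelL (q : N) :
    ContDiffOn ℝ ∞ (christoffelL q) (extChartAt (𝓡 n) q).target := by
  rw [contDiffOn_clm_apply]
  intro a
  rw [contDiffOn_clm_apply]
  intro b z hz
  have hd : ∀ i j l : Fin n, ContDiffAt ℝ ∞ (fun z => dGram q z i j l) z := fun i j l => by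
    have : ContDiffAt ℝ ∞ (fderiv ℝ fun z => gram q z j l) z :=
      (contDiffAt_gram q hz j l).fderiv_right (by simp)
    exact this.clm_apply contDiffAt_const
  refine ContDiffAt.contDiffWithinAt ?_
  have e : (fun z => christoffelL q z a b) = fun z => christoffelVec q z a b :=
    funext fun z => christoffelL_apply q z a b
  rw [e, contDiffAt_piLp]
  intro k
  change ContDiffAt ℝ ∞ (fun z => ∑ i, ∑ j, christoffel q z k i j * a i * b j) z
  refine ContDiffAt.sum fun i _ => ContDiffAt.sum fun j _ =>
    ContDiffAt.mul (ContDiffAt.mul ?_ contDiffAt_const) contDiffAt_const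
  exact contDiffAt_const.mul (ContDiffAt.sum fun l _ => (contDiffAt_gram_inv q hz k l).mul
    (((hd i j l).add (hd j i l)).sub (hd l i j)))

lemma contDiffAt_christoffelL (q : N) {z : Model n} (hz : z ∈ (extChartAt (𝓡 n) q).target) :
    ContDiffAt ℝ ∞ (christoffelL q) z :=
  (contDiffOn_christoffelL q).contDiffAt ((isOpen_extChartAt_target q).mem_nhds hz)

/-- The Koszul formula in a chart. -/
lemma koszul (q : N) {z : Model n} (hz : z ∈ (extChartAt (𝓡 n) q).target) (a b c : Model n) :
    2 * chartMetric q z (christoffelL q z a b) c =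
      fderiv ℝ (chartMetric q) z a b c + fderiv ℝ (chartMetric q) z b a c
        - fderiv ℝ (chartMetric q) z c a b := by
  set D := fderiv ℝ (chartMetric q) z
  set G := chartMetric q z with hG
  have base : ∀ i j l : Fin n,
      2 * G (christoffelL q z (stdVec i) (stdVec j)) (stdVec l) =
      D (stdVec i) (stdVec j) (stdVec l) + D (stdVec j) (stdVec i) (stdVec l)
        - D (stdVec l) (stdVec i) (stdVec j) := by
    intro i j l
    have h1 : christoffelL q z (stdVec i) (stdVec j) = ∑ k, christoffel q z k i j • stdVec k := by
      rw [← sum_smul_stdVec (christoffelL q z (stdVec i) (stdVec j)), christoffelL_apply]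
      refine Finset.sum_congr rfl fun k _ => ?_
      congr 1
      simp [christoffelVec]
    -- Lowering the index with the Gram matrix cancels the inverse matrix in the definition of the
    -- Christoffel symbols.
    have h2 : ∑ k, (gram q z) l k * ∑ l', (gram q z)⁻¹ k l' *
        (dGram q z i j l' + dGram q z j i l' - dGram q z l' i j) =
        dGram q z i j l + dGram q z j i l - dGram q z l i j := by
      have h3 : (gram q z) * (gram q z)⁻¹ = 1 :=
        Matrix.mul_nonsing_inv _ (gram_det_pos q hz).ne'.isUnit
      have h4 := congrArg (fun A : Matrix (Fin n) (Fin n) ℝ => A.mulVec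
        (fun l' => dGram q z i j l' + dGram q z j i l' - dGram q z l' i j) l) h3
      simp only [Matrix.one_mulVec, ← Matrix.mulVec_mulVec] at h4
      exact h4
    rw [h1, map_sum G, sum_apply, Finset.mul_sum, ← dGram_eq q hz,
      ← dGram_eq q hz, ← dGram_eq q hz, ← h2]
    refine Finset.sum_congr rfl fun k _ => ?_
    rw [map_smul G, smul_apply, smul_eq_mul, gram_apply, ← hG,
      chartMetric_comm q z (stdVec l), christoffel]
    ring
  exact koszul_of_span (E := Model n) (span_range_stdVec n) base a b c

/-- The right side of the Koszul formula is symmetric in its first two vectors, and the metric is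
nondegenerate. -/
lemma christoffelL_comm (q : N) {z : Model n} (hz : z ∈ (extChartAt (𝓡 n) q).target)
    (a b : Model n) : christoffelL q z a b = christoffelL q z b a := by
  refine chartMetric_nondegenerate q hz fun c => ?_
  have h1 := koszul q hz a b c
  have h2 := koszul q hz b a c
  have h3 := fderiv_chartMetric_comm q hz c a b
  linarith

/-- The Levi-Civita connection is metric. -/
lemma fderiv_chartMetric (q : N) {z : Model n} (hz : z ∈ (extChartAt (𝓡 n) q).target)
    (a b c : Model n) : fderiv ℝ (chartMetric q) z a b c =
      chartMetric q z (christoffelL q z a b) c + chartMetric q z b (christoffelL q z a c) := by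
  have h1 := koszul q hz a b c
  have h2 := koszul q hz a c b
  have h3 := fderiv_chartMetric_comm q hz a b c
  have h4 := fderiv_chartMetric_comm q hz b a c
  have h5 := fderiv_chartMetric_comm q hz c a b
  have h6 := chartMetric_comm q z b (christoffelL q z a c)
  linarith

end LocalMetric

/-! ### Covariant calculus for an abstract Christoffel map on a normed space. -/

section LocalCalculus

variable {P E : Type*} [NormedAddCommGroup P] [NormedSpace ℝ P] [NormedAddCommGroup E]
  [NormedSpace ℝ E]

/-- Covariant derivative, along a map `F` into an open subset of `E` with Christoffel map `Γ`, of a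
vector field `Y` along `F`, at the point `x` in the direction `v`. -/
def lcov (Γ : E → E →L[ℝ] E →L[ℝ] E) (F Y : P → E) (x v : P) : E :=
  fderiv ℝ Y x v + Γ (F x) (fderiv ℝ F x v) (Y x)

/-- Curvature of the Christoffel map `Γ`. -/
def lcurv (Γ : E → E →L[ℝ] E →L[ℝ] E) (z a b c : E) : E :=
  fderiv ℝ Γ z a b c - fderiv ℝ Γ z b a c + Γ z a (Γ z b c) - Γ z b (Γ z a c)

/-- Covariant derivative of the curvature of the Christoffel map `Γ`. -/
def ldcurv (Γ : E → E →L[ℝ] E →L[ℝ] E) (z a b c d : E) : E :=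
  fderiv ℝ (fun z => lcurv Γ z b c d) z a + Γ z a (lcurv Γ z b c d) - lcurv Γ z (Γ z a b) c d
    - lcurv Γ z b (Γ z a c) d - lcurv Γ z b c (Γ z a d)

variable {Γ : E → E →L[ℝ] E →L[ℝ] E} {F Y : P → E} {x : P}

lemma contDiffAt_fderiv_apply {Y : P → E} {v : P → P} (hY : ContDiffAt ℝ ∞ Y x)
    (hv : ContDiffAt ℝ ∞ v x) : ContDiffAt ℝ ∞ (fun x => fderiv ℝ Y x (v x)) x :=
  (hY.fderiv_right (m := ∞) (by simp)).clm_apply hv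

lemma contDiffAt_lcov (hΓ : ContDiffAt ℝ ∞ Γ (F x)) (hF : ContDiffAt ℝ ∞ F x)
    (hY : ContDiffAt ℝ ∞ Y x) {v : P → P} (hv : ContDiffAt ℝ ∞ v x) :
    ContDiffAt ℝ ∞ (fun x => lcov Γ F Y x (v x)) x :=
  (contDiffAt_fderiv_apply hY hv).add
    (((hΓ.comp x hF).clm_apply (contDiffAt_fderiv_apply hF hv)).clm_apply hY)

lemma lcov_add_right (v w : P) : lcov Γ F Y x (v + w) = lcov Γ F Y x v + lcov Γ F Y x w := by
  simp only [lcov, map_add, add_apply]; abel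

lemma lcov_smul_right (c : ℝ) (v : P) : lcov Γ F Y x (c • v) = c • lcov Γ F Y x v := by
  simp only [lcov, map_smul, smul_apply, smul_add]

lemma lcov_add {Z : P → E} (hY : DifferentiableAt ℝ Y x) (hZ : DifferentiableAt ℝ Z x) (v : P) :
    lcov Γ F (fun x => Y x + Z x) x v = lcov Γ F Y x v + lcov Γ F Z x v := by
  have := fderiv_add hY hZ
  simp only [lcov, map_add]
  erw [this]
  simp only [add_apply]; abel

lemma lcov_congr {Z : P → E} (h : Y =ᶠ[𝓝 x] Z) (v : P) : lcov Γ F Y x v = lcov Γ F Z x v := by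
  simp only [lcov, h.fderiv_eq, h.eq_of_nhds]

lemma differentiableAt_of_infty {X : Type*} [NormedAddCommGroup X] [NormedSpace ℝ X] {f : P → X}
    (hf : ContDiffAt ℝ ∞ f x) : DifferentiableAt ℝ f x := hf.differentiableAt (by simp)

lemma hasFDerivAt_of_infty {X : Type*} [NormedAddCommGroup X] [NormedSpace ℝ X] {f : P → X}
    (hf : ContDiffAt ℝ ∞ f x) : HasFDerivAt f (fderiv ℝ f x) x :=
  (differentiableAt_of_infty hf).hasFDerivAt

lemma fderiv_fderiv_apply (hY : ContDiffAt ℝ ∞ Y x) (v w : P) :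
    fderiv ℝ (fun x => fderiv ℝ Y x v) x w = fderiv ℝ (fderiv ℝ Y) x w v := by
  have h : HasFDerivAt (fderiv ℝ Y) _ x :=
    hasFDerivAt_of_infty (hY.fderiv_right (m := ∞) (by simp))
  rw [(h.clm_apply (hasFDerivAt_const v x)).fderiv]
  simp

lemma fderiv_fderiv_comm (hY : ContDiffAt ℝ ∞ Y x) (v w : P) :
    fderiv ℝ (fderiv ℝ Y) x v w = fderiv ℝ (fderiv ℝ Y) x w v :=
  (hY.isSymmSndFDerivAt (by
    rw [minSmoothness_of_isRCLikeNormedField]; exact ENat.LEInfty.out)) v w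

/-- Derivative of `Γ(F, A) B`. -/
lemma fderiv_clm₂ {X : Type*} [NormedAddCommGroup X] [NormedSpace ℝ X]
    {G : E → E →L[ℝ] E →L[ℝ] X} {A B : P → E} (hG : DifferentiableAt ℝ G (F x))
    (hF : DifferentiableAt ℝ F x) (hA : DifferentiableAt ℝ A x) (hB : DifferentiableAt ℝ B x)
    (v : P) : fderiv ℝ (fun x => G (F x) (A x) (B x)) x v =
      fderiv ℝ G (F x) (fderiv ℝ F x v) (A x) (B x) + G (F x) (fderiv ℝ A x v) (B x)
        + G (F x) (A x) (fderiv ℝ B x v) := by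
  have h1 : HasFDerivAt (fun x => G (F x)) ((fderiv ℝ G (F x)).comp (fderiv ℝ F x)) x :=
    hG.hasFDerivAt.comp x hF.hasFDerivAt
  have h2 := h1.clm_apply hA.hasFDerivAt
  rw [(h2.clm_apply hB.hasFDerivAt).fderiv]
  simp only [add_apply, ContinuousLinearMap.comp_apply, ContinuousLinearMap.flip_apply]
  abel

/-- The second derivatives of Y and F are isolated here because they are symmetric in the two
directions. In a commutator they drop out and only curvature is left. -/
lemma lcov_lcov (hΓ : ContDiffAt ℝ ∞ Γ (F x)) (hF : ContDiffAt ℝ ∞ F x) (hY : ContDiffAt ℝ ∞ Y x)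
    (u v : P) : lcov Γ F (fun x => lcov Γ F Y x v) x u =
      fderiv ℝ (fderiv ℝ Y) x u v
        + (fderiv ℝ Γ (F x) (fderiv ℝ F x u) (fderiv ℝ F x v) (Y x)
          + Γ (F x) (fderiv ℝ (fderiv ℝ F) x u v) (Y x)
          + Γ (F x) (fderiv ℝ F x v) (fderiv ℝ Y x u))
        + (Γ (F x) (fderiv ℝ F x u) (fderiv ℝ Y x v)
          + Γ (F x) (fderiv ℝ F x u) (Γ (F x) (fderiv ℝ F x v) (Y x))) := by
  have hFv := contDiffAt_fderiv_apply hF (contDiffAt_const (c := v))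
  have hYv := contDiffAt_fderiv_apply hY (contDiffAt_const (c := v))
  have h1 := fderiv_clm₂ (differentiableAt_of_infty hΓ) (differentiableAt_of_infty hF)
    (differentiableAt_of_infty hFv) (differentiableAt_of_infty hY) u
  have h2 := (hasFDerivAt_of_infty hYv).add
    (hasFDerivAt_of_infty (((hΓ.comp x hF).clm_apply hFv).clm_apply hY))
  have h3 : fderiv ℝ (fun x => lcov Γ F Y x v) x u = _ := congrArg (fun L => L u) h2.fderiv
  rw [lcov, h3]
  simp only [add_apply, lcov, Function.comp_apply, map_add]
  rw [h1, fderiv_fderiv_apply hY, fderiv_fderiv_apply hF]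

/-- Covariant derivatives along commuting directions commute up to curvature. -/
lemma lcov_comm (hΓ : ContDiffAt ℝ ∞ Γ (F x)) (hF : ContDiffAt ℝ ∞ F x) (hY : ContDiffAt ℝ ∞ Y x)
    (u v : P) : lcov Γ F (fun x => lcov Γ F Y x v) x u =
      lcov Γ F (fun x => lcov Γ F Y x u) x v
        + lcurv Γ (F x) (fderiv ℝ F x u) (fderiv ℝ F x v) (Y x) := by
  rw [lcov_lcov hΓ hF hY, lcov_lcov hΓ hF hY, fderiv_fderiv_comm hY u v,
    fderiv_fderiv_comm hF u v, lcurv]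
  abel

/-- Absence of torsion along F: the second derivative of F and Γ are both symmetric. For a family
this says that ∇_t df(u) = ∇_u ∂_t f. -/
lemma lcov_fderiv_comm (hF : ContDiffAt ℝ ∞ F x) (hs : ∀ a b, Γ (F x) a b = Γ (F x) b a) (u v : P) :
    lcov Γ F (fun x => fderiv ℝ F x v) x u = lcov Γ F (fun x => fderiv ℝ F x u) x v := by
  rw [lcov, lcov, fderiv_fderiv_apply hF, fderiv_fderiv_apply hF, fderiv_fderiv_comm hF, hs]

/-- Second covariant derivative along a non-constant field of directions. -/
lemma lcov_lcov_field (hΓ : ContDiffAt ℝ ∞ Γ (F x)) (hF : ContDiffAt ℝ ∞ F x)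
    (hY : ContDiffAt ℝ ∞ Y x) {v : P → P} (hv : DifferentiableAt ℝ v x) (u : P) :
    lcov Γ F (fun y => lcov Γ F Y y (v y)) x u =
      lcov Γ F (fun y => lcov Γ F Y y (v x)) x u + lcov Γ F Y x (fderiv ℝ v x u) := by
  -- The full covariant derivative as an operator-valued map. Applying the product rule to B y (v y)
  -- separates the derivative of the direction field from the rest.
  set B : P → P →L[ℝ] E := fun y => fderiv ℝ Y y + ((Γ (F y)).flip (Y y)).comp (fderiv ℝ F y)
    with hB
  have hBd : ContDiffAt ℝ ∞ B x := by
    have h1 : ContDiffAt ℝ ∞ (fun y => (Γ (F y)).flip) x :=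
      (ContinuousLinearMap.flipₗᵢ ℝ E E E).toContinuousLinearEquiv.contDiff.contDiffAt.comp x
        (hΓ.comp x hF)
    exact (hY.fderiv_right (m := ∞) (by simp)).add
      ((h1.clm_apply hY).clm_comp (hF.fderiv_right (m := ∞) (by simp)))
  have e : ∀ w : P → P, (fun y => lcov Γ F Y y (w y)) = fun y => B y (w y) := fun w => rfl
  have hd := (differentiableAt_of_infty hBd).hasFDerivAt
  simp only [e]
  rw [lcov, (hd.clm_apply hv.hasFDerivAt).fderiv, lcov]
  erw [(hd.clm_apply (hasFDerivAt_const (v x) x)).fderiv]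
  simp only [add_apply, ContinuousLinearMap.comp_apply, ContinuousLinearMap.flip_apply,
    zero_apply, map_zero, hB, lcov]
  abel

/-! ### Bianchi identities and the Leibniz rule for the local curvature. -/

section Curvature

variable {z : E}

lemma fderiv_christoffel_symm (hΓ : ContDiffAt ℝ ∞ Γ z) (hs : ∀ᶠ y in 𝓝 z, ∀ a b, Γ y a b = Γ y b a)
    (a b c : E) : fderiv ℝ Γ z a b c = fderiv ℝ Γ z a c b := by
  have h := hasFDerivAt_of_infty hΓ
  have h1 := ((h.clm_apply (hasFDerivAt_const b z)).clm_apply (hasFDerivAt_const c z)).fderiv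
  have h2 := ((h.clm_apply (hasFDerivAt_const c z)).clm_apply (hasFDerivAt_const b z)).fderiv
  have h3 : (fun y => Γ y b c) =ᶠ[𝓝 z] fun y => Γ y c b := hs.mono fun y hy => hy b c
  rw [h3.fderiv_eq, h2] at h1
  simpa using congrArg (fun L => L a) h1.symm

/-- Only the symmetry of Γ, and hence of its derivative, is used: in the cyclic sum every term then
occurs twice with opposite signs. -/
lemma lcurv_bianchi (hΓ : ContDiffAt ℝ ∞ Γ z) (hs : ∀ᶠ y in 𝓝 z, ∀ a b, Γ y a b = Γ y b a)
    (a b c : E) : lcurv Γ z a b c + lcurv Γ z b c a + lcurv Γ z c a b = 0 := by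
  have h := hs.self_of_nhds
  simp only [lcurv]
  rw [fderiv_christoffel_symm hΓ hs a c b, fderiv_christoffel_symm hΓ hs b a c,
    fderiv_christoffel_symm hΓ hs c b a, h b c, h a c, h a b]
  abel

lemma lcurv_swap (a b c : E) : lcurv Γ z b a c = -lcurv Γ z a b c := by
  simp only [lcurv]; abel

lemma clm₃_smul_left (T : E →L[ℝ] E →L[ℝ] E →L[ℝ] E) (r : ℝ) (a b c : E) :
    T (r • a) b c = r • T a b c := by
  rw [map_smul]; rfl

lemma clm₂_smul_left (T : E →L[ℝ] E →L[ℝ] E) (r : ℝ) (a b : E) : T (r • a) b = r • T a b := by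
  rw [map_smul]; rfl

lemma lcurv_isLinear₁ (b c : E) : IsLinearMap ℝ (fun a => lcurv Γ z a b c) :=
  ⟨fun _ _ => by simp only [lcurv, map_add, add_apply]; abel,
    fun _ _ => by
      simp only [lcurv, clm₃_smul_left, clm₂_smul_left, map_smul (Γ z _), smul_sub,
        smul_add]⟩

lemma lcurv_isLinear₂ (a c : E) : IsLinearMap ℝ (fun b => lcurv Γ z a b c) :=
  ⟨fun _ _ => by simp only [lcurv, map_add, add_apply]; abel,
    fun _ _ => by
      simp only [lcurv, clm₃_smul_left, clm₂_smul_left,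
        map_smul (Γ z _), smul_sub, smul_add]⟩

lemma lcurv_isLinear₃ (a b : E) : IsLinearMap ℝ (fun c => lcurv Γ z a b c) :=
  ⟨fun _ _ => by simp only [lcurv, map_add]; abel,
    fun _ _ => by simp only [lcurv, map_smul, smul_sub, smul_add]⟩

lemma contDiffAt_lcurv (hΓ : ContDiffAt ℝ ∞ Γ (F x)) (hF : ContDiffAt ℝ ∞ F x) {A B C : P → E}
    (hA : ContDiffAt ℝ ∞ A x) (hB : ContDiffAt ℝ ∞ B x) (hC : ContDiffAt ℝ ∞ C x) :
    ContDiffAt ℝ ∞ (fun x => lcurv Γ (F x) (A x) (B x) (C x)) x := by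
  have h1 : ContDiffAt ℝ ∞ (fun x => fderiv ℝ Γ (F x)) x :=
    (hΓ.fderiv_right (m := ∞) (by simp)).comp x hF
  have h2 : ContDiffAt ℝ ∞ (fun x => Γ (F x)) x := hΓ.comp x hF
  have k1 : ∀ {A B : P → E}, ContDiffAt ℝ ∞ A x → ContDiffAt ℝ ∞ B x →
      ContDiffAt ℝ ∞ (fun x => fderiv ℝ Γ (F x) (A x) (B x) (C x)) x := fun hA hB => by
    have i1 := h1.clm_apply hA
    have i2 := i1.clm_apply hB
    exact i2.clm_apply hC
  have k2 : ∀ {A B : P → E}, ContDiffAt ℝ ∞ A x → ContDiffAt ℝ ∞ B x →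
      ContDiffAt ℝ ∞ (fun x => Γ (F x) (A x) (B x)) x := fun hA hB => by
    have i1 := h2.clm_apply hA
    exact i1.clm_apply hB
  exact (((k1 hA hB).sub (k1 hB hA)).add (k2 hA (k2 hB hC))).sub (k2 hB (k2 hA hC))

/-- Chain rule for a map that is linear in its last three arguments. -/
lemma fderiv_trilinear {K : E → E → E → E → E} {A B C : P → E}
    (hK : DifferentiableAt ℝ (fun p : E × E × E × E => K p.1 p.2.1 p.2.2.1 p.2.2.2)
      (F x, A x, B x, C x))
    (h₁ : ∀ z b c, IsLinearMap ℝ (fun a => K z a b c))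
    (h₂ : ∀ z a c, IsLinearMap ℝ (fun b => K z a b c))
    (h₃ : ∀ z a b, IsLinearMap ℝ (fun c => K z a b c))
    (hF : DifferentiableAt ℝ F x) (hA : DifferentiableAt ℝ A x) (hB : DifferentiableAt ℝ B x)
    (hC : DifferentiableAt ℝ C x) (v : P) :
    fderiv ℝ (fun x => K (F x) (A x) (B x) (C x)) x v =
      fderiv ℝ (fun z => K z (A x) (B x) (C x)) (F x) (fderiv ℝ F x v)
        + K (F x) (fderiv ℝ A x v) (B x) (C x) + K (F x) (A x) (fderiv ℝ B x v) (C x)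
        + K (F x) (A x) (B x) (fderiv ℝ C x v) := by
  set L := fderiv ℝ (fun p : E × E × E × E => K p.1 p.2.1 p.2.2.1 p.2.2.2) (F x, A x, B x, C x)
  have hL := hK.hasFDerivAt
  -- A linear map with a Fréchet derivative T equals T, by comparison of line derivatives. No
  -- continuity of the partial linear maps has to be proved beforehand.
  have lin : ∀ {g : E → E} {T : E →L[ℝ] E} {a : E}, IsLinearMap ℝ g → HasFDerivAt g T a →
      ∀ w, T w = g w := by
    intro g T a hg hT w
    have h1 := hT.hasLineDerivAt w
    have h2 : HasDerivAt (fun t : ℝ => g (a + t • w)) (g w) 0 := by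
      simp only [hg.map_add, hg.map_smul]
      simpa using ((hasDerivAt_id (0 : ℝ)).smul_const (g w)).const_add (g a)
    exact h1.unique h2
  have e0 : HasFDerivAt (fun z => K z (A x) (B x) (C x)) _ (F x) :=
    hL.comp (F x) (f := fun z => (z, A x, B x, C x)) ((hasFDerivAt_id (F x)).prodMk (hasFDerivAt_const (A x, B x, C x) (F x)))
  have e1 : HasFDerivAt (fun a => K (F x) a (B x) (C x)) _ (A x) :=
    hL.comp (A x) (f := fun a => (F x, a, B x, C x)) ((hasFDerivAt_const (F x) (A x)).prodMk
      ((hasFDerivAt_id (A x)).prodMk (hasFDerivAt_const (B x, C x) (A x))))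
  have e2 : HasFDerivAt (fun b => K (F x) (A x) b (C x)) _ (B x) :=
    hL.comp (B x) (f := fun b => (F x, A x, b, C x)) ((hasFDerivAt_const (F x) (B x)).prodMk ((hasFDerivAt_const (A x) (B x)).prodMk
      ((hasFDerivAt_id (B x)).prodMk (hasFDerivAt_const (C x) (B x)))))
  have e3 : HasFDerivAt (fun c => K (F x) (A x) (B x) c) _ (C x) :=
    hL.comp (C x) (f := fun c => (F x, A x, B x, c)) ((hasFDerivAt_const (F x) (C x)).prodMk ((hasFDerivAt_const (A x) (C x)).prodMk
      ((hasFDerivAt_const (B x) (C x)).prodMk (hasFDerivAt_id (C x)))))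
  have e : HasFDerivAt (fun x => K (F x) (A x) (B x) (C x)) _ x :=
    hL.comp x (f := fun x => (F x, A x, B x, C x)) (hF.hasFDerivAt.prodMk (hA.hasFDerivAt.prodMk (hB.hasFDerivAt.prodMk hC.hasFDerivAt)))
  rw [e.fderiv, e0.fderiv, ← lin (h₁ _ _ _) e1, ← lin (h₂ _ _ _) e2, ← lin (h₃ _ _ _) e3]
  simp only [ContinuousLinearMap.comp_apply, ContinuousLinearMap.prod_apply,
    zero_apply, ContinuousLinearMap.id_apply, ← map_add]
  simp

/-- The chain rule for a map linear in three slots. The Γ-corrections that `ldcurv` subtracts are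
those that complete the ordinary derivatives of A, B and C to covariant ones. -/
lemma lcov_lcurv (hΓ : ContDiffAt ℝ ∞ Γ (F x)) (hF : ContDiffAt ℝ ∞ F x) {A B C : P → E}
    (hA : ContDiffAt ℝ ∞ A x) (hB : ContDiffAt ℝ ∞ B x) (hC : ContDiffAt ℝ ∞ C x) (v : P) :
    lcov Γ F (fun x => lcurv Γ (F x) (A x) (B x) (C x)) x v =
      ldcurv Γ (F x) (fderiv ℝ F x v) (A x) (B x) (C x)
        + lcurv Γ (F x) (lcov Γ F A x v) (B x) (C x)
        + lcurv Γ (F x) (A x) (lcov Γ F B x v) (C x)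
        + lcurv Γ (F x) (A x) (B x) (lcov Γ F C x v) := by
  have hK : ContDiffAt ℝ ∞ (fun p : E × E × E × E => lcurv Γ p.1 p.2.1 p.2.2.1 p.2.2.2)
      (F x, A x, B x, C x) :=
    contDiffAt_lcurv (F := Prod.fst) (x := (F x, A x, B x, C x)) hΓ (by fun_prop) (by fun_prop)
      (by fun_prop) (by fun_prop)
  rw [lcov, fderiv_trilinear (differentiableAt_of_infty hK) (fun z b c => lcurv_isLinear₁ b c)
    (fun z a c => lcurv_isLinear₂ a c) (fun z a b => lcurv_isLinear₃ a b)
    (differentiableAt_of_infty hF) (differentiableAt_of_infty hA) (differentiableAt_of_infty hB)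
    (differentiableAt_of_infty hC)]
  simp only [ldcurv, lcov, (lcurv_isLinear₁ _ _).map_add, (lcurv_isLinear₂ _ _).map_add,
    (lcurv_isLinear₃ _ _).map_add]
  abel

lemma fderiv_lcurv (hΓ : ContDiffAt ℝ ∞ Γ z) (a b c d : E) :
    fderiv ℝ (fun z => lcurv Γ z b c d) z a =
      fderiv ℝ (fderiv ℝ Γ) z a b c d - fderiv ℝ (fderiv ℝ Γ) z a c b d
        + (fderiv ℝ Γ z a b (Γ z c d) + Γ z b (fderiv ℝ Γ z a c d))
        - (fderiv ℝ Γ z a c (Γ z b d) + Γ z c (fderiv ℝ Γ z a b d)) := by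
  have h1 := hasFDerivAt_of_infty (hΓ.fderiv_right (m := ∞) (by simp))
  have h0 := hasFDerivAt_of_infty hΓ
  have k1 : ∀ b c, HasFDerivAt (fun z => fderiv ℝ Γ z b c d) _ z := fun b c => by
    have i1 := h1.clm_apply (hasFDerivAt_const b z)
    have i2 := i1.clm_apply (hasFDerivAt_const c z)
    exact i2.clm_apply (hasFDerivAt_const d z)
  have k0 : ∀ b c, HasFDerivAt (fun z => Γ z b (Γ z c d)) _ z := fun b c => by
    have i1 := h0.clm_apply (hasFDerivAt_const c z)
    have i2 := i1.clm_apply (hasFDerivAt_const d z)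
    have i3 := h0.clm_apply (hasFDerivAt_const b z)
    exact i3.clm_apply i2
  have h := congrArg (fun L => L a) ((((k1 b c).sub (k1 c b)).add (k0 b c)).sub (k0 c b)).fderiv
  refine h.trans ?_
  simp
  abel

/-- The second Bianchi identity by direct expansion. The second derivatives of Γ cancel by symmetry
of the iterated derivative, and the remaining terms by symmetry of Γ. -/
lemma ldcurv_bianchi (hΓ : ContDiffAt ℝ ∞ Γ z) (hs : ∀ᶠ y in 𝓝 z, ∀ a b, Γ y a b = Γ y b a)
    (a b c d : E) : ldcurv Γ z a b c d + ldcurv Γ z b c a d + ldcurv Γ z c a b d = 0 := by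
  have h := hs.self_of_nhds
  have h2 : ∀ a b, fderiv ℝ (fderiv ℝ Γ) z a b = fderiv ℝ (fderiv ℝ Γ) z b a :=
    fun a b => fderiv_fderiv_comm hΓ a b
  simp only [ldcurv, fderiv_lcurv hΓ]
  rw [h2 b a, h2 c a, h2 c b, h b a, h c a, h c b]
  simp only [lcurv, map_add, map_sub]
  abel

end Curvature

/-! ### Variation of the second fundamental form and of second covariant derivatives, in charts. -/

section SecondVariation

lemma lcov_sub {Z : P → E} (hY : DifferentiableAt ℝ Y x) (hZ : DifferentiableAt ℝ Z x) (v : P) :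
    lcov Γ F (fun x => Y x - Z x) x v = lcov Γ F Y x v - lcov Γ F Z x v := by
  simp only [lcov, map_sub, fderiv_fun_sub hY hZ, sub_apply]; abel

/-- Derivative of the second fundamental form in a direction `t`. -/
lemma lcov_hess_map (hΓ : ∀ᶠ y in 𝓝 x, ContDiffAt ℝ ∞ Γ (F y))
    (hs : ∀ᶠ y in 𝓝 x, ∀ a b, Γ (F y) a b = Γ (F y) b a)
    (hF : ∀ᶠ y in 𝓝 x, ContDiffAt ℝ ∞ F y) (t a b c : P) :
    lcov Γ F (fun y => lcov Γ F (fun y => fderiv ℝ F y b) y a - fderiv ℝ F y c) x t =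
      lcov Γ F (fun y => lcov Γ F (fun y => fderiv ℝ F y t) y b) x a
        - lcov Γ F (fun y => fderiv ℝ F y t) x c
        + lcurv Γ (F x) (fderiv ℝ F x t) (fderiv ℝ F x a) (fderiv ℝ F x b) := by
  have hΓ0 := hΓ.self_of_nhds
  have hF0 := hF.self_of_nhds
  have hd : ∀ v, ContDiffAt ℝ ∞ (fun y => fderiv ℝ F y v) x :=
    fun v => contDiffAt_fderiv_apply hF0 contDiffAt_const
  -- The inner exchange of t and b is needed on a neighbourhood, since its result is differentiated
  -- again in the direction a. Only the outer exchange of t and a creates curvature.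
  have hc : (fun y => lcov Γ F (fun y => fderiv ℝ F y b) y t) =ᶠ[𝓝 x]
      fun y => lcov Γ F (fun y => fderiv ℝ F y t) y b := by
    filter_upwards [hF, hs] with y h1 h2 using lcov_fderiv_comm h1 h2 _ _
  rw [lcov_sub (differentiableAt_of_infty (contDiffAt_lcov hΓ0 hF0 (hd b) contDiffAt_const))
    (differentiableAt_of_infty (hd c)), lcov_comm hΓ0 hF0 (hd b), lcov_congr hc,
    lcov_fderiv_comm hF0 hs.self_of_nhds t c]
  abel

/-- Derivative of the second covariant derivative of a section in a direction `t`. -/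
lemma lcov_hess_sec (hΓ : ∀ᶠ y in 𝓝 x, ContDiffAt ℝ ∞ Γ (F y))
    (hF : ∀ᶠ y in 𝓝 x, ContDiffAt ℝ ∞ F y) (hY : ∀ᶠ y in 𝓝 x, ContDiffAt ℝ ∞ Y y) (t a b c : P) :
    lcov Γ F (fun y => lcov Γ F (fun y => lcov Γ F Y y b) y a - lcov Γ F Y y c) x t =
      lcov Γ F (fun y => lcov Γ F (fun y => lcov Γ F Y y t) y b) x a
        - lcov Γ F (fun y => lcov Γ F Y y t) x c
        + (ldcurv Γ (F x) (fderiv ℝ F x a) (fderiv ℝ F x t) (fderiv ℝ F x b) (Y x)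
          + lcurv Γ (F x) (lcov Γ F (fun y => fderiv ℝ F y t) x a) (fderiv ℝ F x b) (Y x)
          + lcurv Γ (F x) (fderiv ℝ F x t)
              (lcov Γ F (fun y => fderiv ℝ F y b) x a - fderiv ℝ F x c) (Y x)
          + lcurv Γ (F x) (fderiv ℝ F x t) (fderiv ℝ F x b) (lcov Γ F Y x a)
          + lcurv Γ (F x) (fderiv ℝ F x t) (fderiv ℝ F x a) (lcov Γ F Y x b)) := by
  have hΓ0 := hΓ.self_of_nhds
  have hF0 := hF.self_of_nhds
  have hY0 := hY.self_of_nhds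
  have hd : ∀ v, ContDiffAt ℝ ∞ (fun y => fderiv ℝ F y v) x :=
    fun v => contDiffAt_fderiv_apply hF0 contDiffAt_const
  have hl : ∀ v, ContDiffAt ℝ ∞ (fun y => lcov Γ F Y y v) x :=
    fun v => contDiffAt_lcov hΓ0 hF0 hY0 contDiffAt_const
  have hc : (fun y => lcov Γ F (fun y => lcov Γ F Y y b) y t) =ᶠ[𝓝 x]
      fun y => lcov Γ F (fun y => lcov Γ F Y y t) y b
        + lcurv Γ (F y) (fderiv ℝ F y t) (fderiv ℝ F y b) (Y y) := by
    filter_upwards [hF, hΓ, hY] with y h1 h2 h3 using lcov_comm h2 h1 h3 _ _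
  rw [lcov_sub (differentiableAt_of_infty (contDiffAt_lcov hΓ0 hF0 (hl b) contDiffAt_const))
    (differentiableAt_of_infty (hl c)), lcov_comm hΓ0 hF0 (hl b), lcov_congr hc,
    lcov_comm hΓ0 hF0 hY0 t c,
    lcov_add (differentiableAt_of_infty (contDiffAt_lcov hΓ0 hF0 (hl t) contDiffAt_const))
      (differentiableAt_of_infty (contDiffAt_lcurv hΓ0 hF0 (hd t) (hd b) hY0)),
    -- The curvature produced by exchanging t and c combines with the derivative of F in the
    -- directions a, b, so that the second fundamental form appears in the middle slot.
    lcov_lcurv hΓ0 hF0 (hd t) (hd b) hY0, (lcurv_isLinear₂ _ _).map_sub]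
  abel

end SecondVariation

/-! ### Metric compatibility and skew-symmetry of the curvature and of its derivative. -/

section Metric

variable {G : E → E →L[ℝ] E →L[ℝ] ℝ}

lemma fderiv_metric (hG : DifferentiableAt ℝ G (F x))
    (hc : ∀ a b c, fderiv ℝ G (F x) a b c = G (F x) (Γ (F x) a b) c + G (F x) b (Γ (F x) a c))
    (hF : DifferentiableAt ℝ F x) {A B : P → E} (hA : DifferentiableAt ℝ A x)
    (hB : DifferentiableAt ℝ B x) (v : P) :
    fderiv ℝ (fun x => G (F x) (A x) (B x)) x v =
      G (F x) (lcov Γ F A x v) (B x) + G (F x) (A x) (lcov Γ F B x v) := by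
  rw [fderiv_clm₂ hG hF hA hB, hc]
  simp only [lcov, map_add, add_apply]
  ring

lemma fderiv_metric_id {z : E} (hG : DifferentiableAt ℝ G z)
    (hc : ∀ a b c, fderiv ℝ G z a b c = G z (Γ z a b) c + G z b (Γ z a c))
    {A B : E → E} (hA : DifferentiableAt ℝ A z) (hB : DifferentiableAt ℝ B z) (v : E) :
    fderiv ℝ (fun x => G x (A x) (B x)) z v =
      G z (lcov Γ id A z v) (B z) + G z (A z) (lcov Γ id B z v) :=
  fderiv_metric (F := id) hG hc differentiableAt_id hA hB v

/-- For constant vectors c and d, differentiate the function G(c, d) twice by metric compatibility.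
The mixed terms are symmetric in the two directions, so equality of the second derivatives forces
G(R c, d) + G(c, R d) = 0. -/
lemma lcurv_skew {z : E} (hG : ∀ᶠ y in 𝓝 z, ContDiffAt ℝ ∞ G y)
    (hΓ : ∀ᶠ y in 𝓝 z, ContDiffAt ℝ ∞ Γ y)
    (hc : ∀ᶠ y in 𝓝 z, ∀ a b c, fderiv ℝ G y a b c = G y (Γ y a b) c + G y b (Γ y a c))
    (a b c d : E) : G z (lcurv Γ z a b c) d = -G z c (lcurv Γ z a b d) := by
  have hΓ0 := hΓ.self_of_nhds
  have hG0 := hG.self_of_nhds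
  have hc0 := hc.self_of_nhds
  have hcov : ∀ e v : E, ContDiffAt ℝ ∞ (fun y => lcov Γ id (fun _ => e) y v) z := fun e v =>
    contDiffAt_lcov hΓ0 contDiffAt_id contDiffAt_const contDiffAt_const
  have h1 : ∀ v : E, (fun y => fderiv ℝ (fun y => G y c d) y v) =ᶠ[𝓝 z] fun y =>
      G y (lcov Γ id (fun _ => c) y v) d + G y c (lcov Γ id (fun _ => d) y v) := fun v => by
    filter_upwards [hG, hc] with y g1 g2
    exact fderiv_metric_id (A := fun _ => c) (B := fun _ => d) (differentiableAt_of_infty g1) g2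
      (differentiableAt_const _) (differentiableAt_const _) v
  have hh : ContDiffAt ℝ ∞ (fun y => G y c d) z :=
    (hG0.clm_apply contDiffAt_const).clm_apply contDiffAt_const
  have h2 : ∀ u v : E, fderiv ℝ (fderiv ℝ (fun y => G y c d)) z u v =
      G z (lcov Γ id (fun y => lcov Γ id (fun _ => c) y v) z u) d
      + G z (lcov Γ id (fun _ => c) z v) (lcov Γ id (fun _ => d) z u)
      + (G z (lcov Γ id (fun _ => c) z u) (lcov Γ id (fun _ => d) z v)
      + G z c (lcov Γ id (fun y => lcov Γ id (fun _ => d) y v) z u)) := fun u v => by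
    have k : ∀ {A B : E → E}, ContDiffAt ℝ ∞ A z → ContDiffAt ℝ ∞ B z →
        DifferentiableAt ℝ (fun y => G y (A y) (B y)) z := fun hA hB =>
      differentiableAt_of_infty ((hG0.clm_apply hA).clm_apply hB)
    rw [← fderiv_fderiv_apply hh, (h1 v).fderiv_eq,
      fderiv_fun_add (k (hcov c v) contDiffAt_const) (k contDiffAt_const (hcov d v)), add_apply,
      fderiv_metric_id (A := fun y => lcov Γ id (fun _ => c) y v) (B := fun _ => d)
        (differentiableAt_of_infty hG0) hc0
        (differentiableAt_of_infty (hcov c v)) (differentiableAt_const _),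
      fderiv_metric_id (A := fun _ => c) (B := fun y => lcov Γ id (fun _ => d) y v)
        (differentiableAt_of_infty hG0) hc0 (differentiableAt_const _)
        (differentiableAt_of_infty (hcov d v))]
  have h3 := fderiv_fderiv_comm hh a b
  rw [h2, h2, lcov_comm (F := id) (Y := fun _ => c) hΓ0 contDiffAt_id contDiffAt_const a b,
    lcov_comm (F := id) (Y := fun _ => d) hΓ0 contDiffAt_id contDiffAt_const a b] at h3
  simp only [fderiv_id, ContinuousLinearMap.id_apply, id_eq, map_add, add_apply] at h3
  linarith

lemma lcov_id_const (z a b : E) : lcov Γ id (fun _ => b) z a = Γ z a b := by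
  simp [lcov]

/-- Differentiation of the skew-symmetry of the curvature, which holds near z. The Christoffel
corrections are removed by the same skew-symmetry applied to the corrected arguments. -/
lemma ldcurv_skew {z : E} (hG : ∀ᶠ y in 𝓝 z, ContDiffAt ℝ ∞ G y)
    (hΓ : ∀ᶠ y in 𝓝 z, ContDiffAt ℝ ∞ Γ y)
    (hc : ∀ᶠ y in 𝓝 z, ∀ a b c, fderiv ℝ G y a b c = G y (Γ y a b) c + G y b (Γ y a c))
    (a b c d e : E) : G z (ldcurv Γ z a b c d) e = -G z d (ldcurv Γ z a b c e) := by
  have hΓ0 := hΓ.self_of_nhds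
  have hG0 := hG.self_of_nhds
  have hc0 := hc.self_of_nhds
  have hR : ∀ d, ContDiffAt ℝ ∞ (fun y => lcurv Γ y b c d) z := fun d =>
    contDiffAt_lcurv (F := id) hΓ0 contDiffAt_id contDiffAt_const contDiffAt_const contDiffAt_const
  have h1 : (fun y => G y (lcurv Γ y b c d) e) =ᶠ[𝓝 z] fun y => -G y d (lcurv Γ y b c e) := by
    filter_upwards [hG.eventually_nhds, hΓ.eventually_nhds, hc.eventually_nhds] with y g1 g2 g3
      using lcurv_skew g1 g2 g3 b c d e
  have h2 := congrArg (fun L : E →L[ℝ] ℝ => L a) (h1.fderiv_eq (𝕜 := ℝ))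
  rw [fderiv_fun_neg] at h2
  change _ = -(fderiv ℝ (fun y => G y d (lcurv Γ y b c e)) z a) at h2
  rw [fderiv_metric_id (A := fun y => lcurv Γ y b c d) (B := fun _ => e)
      (differentiableAt_of_infty hG0) hc0
      (differentiableAt_of_infty (hR d)) (differentiableAt_const _),
    fderiv_metric_id (A := fun _ => d) (B := fun y => lcurv Γ y b c e)
      (differentiableAt_of_infty hG0) hc0 (differentiableAt_const _)
      (differentiableAt_of_infty (hR e))] at h2
  have h3 : ∀ d, lcov Γ id (fun y => lcurv Γ y b c d) z a = ldcurv Γ z a b c d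
      + lcurv Γ z (Γ z a b) c d + lcurv Γ z b (Γ z a c) d + lcurv Γ z b c (Γ z a d) := fun d => by
    simp [lcov, ldcurv]
    abel
  have sk := lcurv_skew hG hΓ hc
  rw [h3, h3, lcov_id_const, lcov_id_const] at h2
  simp only [map_add, add_apply] at h2
  linarith [sk (Γ z a b) c d e, sk b (Γ z a c) d e, sk b c (Γ z a d) e, sk b c d (Γ z a e)]

end Metric

end LocalCalculus

/-! ### Change of charts and the transformation law of the Christoffel symbols. -/

section ChartChange

variable {n : ℕ} {N : Type*} [TopologicalSpace N] [ChartedSpace (Model n) N]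
  [IsManifold (𝓡 n) ∞ N]

/-- The change of coordinates from the chart around `q` to the chart around `q'`. -/
def chartChange (q q' : N) (z : Model n) : Model n :=
  extChartAt (𝓡 n) q' ((extChartAt (𝓡 n) q).symm z)

lemma contDiffAt_chartChange {q q' : N} {z : Model n} (hz : z ∈ (extChartAt (𝓡 n) q).target)
    (hz' : (extChartAt (𝓡 n) q).symm z ∈ (extChartAt (𝓡 n) q').source) :
    ContDiffAt ℝ ∞ (chartChange q q') z := by
  rw [← contMDiffAt_iff_contDiffAt]
  rw [extChartAt_source] at hz'
  exact (contMDiffAt_extChartAt' hz').comp z ((contMDiffOn_extChartAt_symm q).contMDiffAt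
    ((isOpen_extChartAt_target q).mem_nhds hz))

lemma eventually_mem_chart_overlap {q q' : N} {z : Model n}
    (hz : z ∈ (extChartAt (𝓡 n) q).target)
    (hz' : (extChartAt (𝓡 n) q).symm z ∈ (extChartAt (𝓡 n) q').source) :
    ∀ᶠ y in 𝓝 z, y ∈ (extChartAt (𝓡 n) q).target ∧
      (extChartAt (𝓡 n) q).symm y ∈ (extChartAt (𝓡 n) q').source := by
  have ho := (isOpen_extChartAt_target q).mem_nhds hz
  have hc := ((contMDiffOn_extChartAt_symm (I := 𝓡 n) (n := ∞) q).contMDiffAt ho).continuousAt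
  filter_upwards [ho, hc.eventually ((isOpen_extChartAt_source q').mem_nhds hz')] with y h1 h2
    using ⟨h1, h2⟩

variable {E' H' P : Type*} [NormedAddCommGroup E'] [NormedSpace ℝ E'] [TopologicalSpace H']
  {I : ModelWithCorners ℝ E' H'} [TopologicalSpace P] [ChartedSpace H' P]

/-- The derivative of a vector-valued function on a manifold in a direction. -/
def dirD (I : ModelWithCorners ℝ E' H') {X : Type*} [NormedAddCommGroup X] [NormedSpace ℝ X]
    (h : P → X) (p : P) (v : TangentSpace I p) : X :=
  mfderiv I 𝓘(ℝ, X) h p v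

section Dir

variable {X Y : Type*} [NormedAddCommGroup X] [NormedSpace ℝ X]
    [NormedAddCommGroup Y] [NormedSpace ℝ Y] {u : P → X} {w : P → Y} {p : P}

lemma dirD_comp {K : X → Y} (hK : DifferentiableAt ℝ K (u p))
    (hu : MDifferentiableAt I 𝓘(ℝ, X) u p) (v : TangentSpace I p) :
    dirD I (fun x => K (u x)) p v = fderiv ℝ K (u p) (dirD I u p v) := by
  have := mfderiv_comp p hK.mdifferentiableAt hu
  rw [mfderiv_eq_fderiv] at this
  exact congrArg (fun L => L v) this

lemma dirD_prodMk (hu : MDifferentiableAt I 𝓘(ℝ, X) u p) (hw : MDifferentiableAt I 𝓘(ℝ, Y) w p)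
    (v : TangentSpace I p) :
    dirD I (fun x => (u x, w x)) p v = (dirD I u p v, dirD I w p v) := by
  have h1 := dirD_comp (I := I) (K := Prod.fst) (u := fun x => (u x, w x)) (p := p)
    differentiableAt_fst (hu.prodMk_space hw) v
  have h2 := dirD_comp (I := I) (K := Prod.snd) (u := fun x => (u x, w x)) (p := p)
    differentiableAt_snd (hu.prodMk_space hw) v
  rw [fderiv_fst] at h1
  rw [fderiv_snd] at h2
  exact Prod.ext h1.symm h2.symm

lemma dirD_congr {u' : P → X} (h : u =ᶠ[𝓝 p] u') (v : TangentSpace I p) :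
    dirD I u p v = dirD I u' p v := by
  have h2 := h.mfderiv_eq (I := I) (I' := 𝓘(ℝ, X))
  exact congrArg (fun L : TangentSpace I p →L[ℝ] X => L v) h2

lemma dirD_add_right (u : P → X) (v v' : TangentSpace I p) :
    dirD I u p (v + v') = dirD I u p v + dirD I u p v' :=
  map_add (show TangentSpace I p →L[ℝ] X from mfderiv I 𝓘(ℝ, X) u p) v v'

lemma dirD_smul_right (u : P → X) (c : ℝ) (v : TangentSpace I p) :
    dirD I u p (c • v) = c • dirD I u p v :=
  map_smul (show TangentSpace I p →L[ℝ] X from mfderiv I 𝓘(ℝ, X) u p) c v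

end Dir

lemma mdifferentiableAt_extChartAt_source {q x : N} (hx : x ∈ (extChartAt (𝓡 n) q).source) :
    MDifferentiableAt (𝓡 n) 𝓘(ℝ, Model n) (extChartAt (𝓡 n) q) x := by
  have : IsManifold (𝓡 n) 1 N := .of_le (n := ∞) (by norm_cast)
  rw [extChartAt_source] at hx
  exact mdifferentiableAt_extChartAt hx

lemma dirD_extChartAt_comp {f : P → N} {p : P} {q : N} (hf : MDifferentiableAt I (𝓡 n) f p)
    (hq : f p ∈ (extChartAt (𝓡 n) q).source) (v : TangentSpace I p) :
    dirD I (fun x => extChartAt (𝓡 n) q (f x)) p v = coords q (f p) (mfderiv I (𝓡 n) f p v) :=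
  mfderiv_extChartAt_comp hf hq v

/-- A manifold derivative in coordinates. -/
lemma dirD_eq_fderiv {X : Type*} [NormedAddCommGroup X] [NormedSpace ℝ X] {h : N → X}
    {q x : N} (hx : x ∈ (extChartAt (𝓡 n) q).source)
    (hh : DifferentiableAt ℝ (fun z => h ((extChartAt (𝓡 n) q).symm z)) (extChartAt (𝓡 n) q x))
    (v : TangentSpace (𝓡 n) x) :
    dirD (𝓡 n) h x v = fderiv ℝ (fun z => h ((extChartAt (𝓡 n) q).symm z)) (extChartAt (𝓡 n) q x)
        (coords q x v) := by
  have e : h =ᶠ[𝓝 x] fun y => h ((extChartAt (𝓡 n) q).symm (extChartAt (𝓡 n) q y)) := by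
    filter_upwards [(isOpen_extChartAt_source q).mem_nhds hx] with y hy
    rw [(extChartAt (𝓡 n) q).left_inv hy]
  rw [dirD_congr e]
  exact dirD_comp (I := 𝓡 n) (K := fun z => h ((extChartAt (𝓡 n) q).symm z))
    (u := extChartAt (𝓡 n) q) (p := x) hh (mdifferentiableAt_extChartAt_source hx) v

lemma coords_change {q q' x : N} (hx : x ∈ (extChartAt (𝓡 n) q).source)
    (hx' : x ∈ (extChartAt (𝓡 n) q').source) (v : TangentSpace (𝓡 n) x) :
    coords q' x v = fderiv ℝ (chartChange q q') (extChartAt (𝓡 n) q x) (coords q x v) := by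
  refine dirD_eq_fderiv (h := extChartAt (𝓡 n) q') hx ?_ v
  refine differentiableAt_of_infty (contDiffAt_chartChange ((extChartAt (𝓡 n) q).map_source hx) ?_)
  rwa [(extChartAt (𝓡 n) q).left_inv hx]

lemma fderiv_chartChange_surjective {q q' : N} {z : Model n}
    (hz : z ∈ (extChartAt (𝓡 n) q).target)
    (hz' : (extChartAt (𝓡 n) q).symm z ∈ (extChartAt (𝓡 n) q').source) (c : Model n) :
    ∃ a, fderiv ℝ (chartChange q q') z a = c := by
  have hs := (extChartAt (𝓡 n) q).map_target hz
  refine ⟨coords q _ (ofCoords q' ((extChartAt (𝓡 n) q).symm z) c), ?_⟩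
  have := coords_change hs hz' (ofCoords q' ((extChartAt (𝓡 n) q).symm z) c)
  rw [coords_ofCoords hz', (extChartAt (𝓡 n) q).right_inv hz] at this
  exact this.symm

section Metric

variable [RiemannianBundle (fun x : N => TangentSpace (𝓡 n) x)]

lemma chartMetric_change {q q' : N} {z : Model n} (hz : z ∈ (extChartAt (𝓡 n) q).target)
    (hz' : (extChartAt (𝓡 n) q).symm z ∈ (extChartAt (𝓡 n) q').source) (a b : Model n) :
    chartMetric q z a b = chartMetric q' (chartChange q q' z) (fderiv ℝ (chartChange q q') z a)
      (fderiv ℝ (chartChange q q') z b) := by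
  have hs := (extChartAt (𝓡 n) q).map_target hz
  have e : ∀ a : Model n, fderiv ℝ (chartChange q q') z a = coords q' _ (ofCoords q _ a) :=
    fun a => by
      rw [coords_change hs hz', coords_ofCoords hs, (extChartAt (𝓡 n) q).right_inv hz]
  rw [chartMetric_apply, inner_eq_chartMetric hz', e, e]
  rfl

variable [IsContMDiffRiemannianBundle (𝓡 n) ∞ (Model n) (fun x : N => TangentSpace (𝓡 n) x)]

/-- Transformation law of the Christoffel symbols. -/
lemma christoffelL_change {q q' : N} {z : Model n} (hz : z ∈ (extChartAt (𝓡 n) q).target)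
    (hz' : (extChartAt (𝓡 n) q).symm z ∈ (extChartAt (𝓡 n) q').source) (a b : Model n) :
    fderiv ℝ (chartChange q q') z (christoffelL q z a b) =
      christoffelL q' (chartChange q q' z) (fderiv ℝ (chartChange q q') z a)
        (fderiv ℝ (chartChange q q') z b) + fderiv ℝ (fderiv ℝ (chartChange q q')) z a b := by
  set T : Model n → Model n := chartChange q q'
  have hT : ContDiffAt ℝ ∞ T z := contDiffAt_chartChange hz hz'
  have htz : T z ∈ (extChartAt (𝓡 n) q').target := (extChartAt (𝓡 n) q').map_source hz'
  -- The derivative of the metric as a pull-back. Besides the transformed derivative it contains two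
  -- terms with the second derivative of the change of charts T.
  have key : ∀ a b c, fderiv ℝ (chartMetric q) z a b c =
      fderiv ℝ (chartMetric q') (T z) (fderiv ℝ T z a) (fderiv ℝ T z b) (fderiv ℝ T z c)
        + chartMetric q' (T z) (fderiv ℝ (fderiv ℝ T) z a b) (fderiv ℝ T z c)
        + chartMetric q' (T z) (fderiv ℝ T z b) (fderiv ℝ (fderiv ℝ T) z a c) := by
    intro a b c
    have h := hasFDerivAt_of_infty (contDiffAt_chartMetric q hz)
    have h1 := ((h.clm_apply (hasFDerivAt_const b z)).clm_apply (hasFDerivAt_const c z)).fderiv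
    have h2 : (fun y => chartMetric q y b c) =ᶠ[𝓝 z] fun y =>
        chartMetric q' (T y) (fderiv ℝ T y b) (fderiv ℝ T y c) := by
      filter_upwards [eventually_mem_chart_overlap hz hz'] with y hy
      exact chartMetric_change hy.1 hy.2 b c
    rw [h2.fderiv_eq] at h1
    have h3 := congrArg (fun L => L a) h1
    have hd : ∀ v, ContDiffAt ℝ ∞ (fun y => fderiv ℝ T y v) z :=
      fun v => contDiffAt_fderiv_apply hT contDiffAt_const
    rw [fderiv_clm₂ (differentiableAt_of_infty (contDiffAt_chartMetric q' htz))
      (differentiableAt_of_infty hT) (differentiableAt_of_infty (hd b))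
      (differentiableAt_of_infty (hd c)), fderiv_fderiv_apply hT, fderiv_fderiv_apply hT] at h3
    refine Eq.trans ?_ h3.symm
    simp
  -- The Koszul formulas of the two charts are compared. Of the six terms with second derivatives of
  -- T, four cancel by symmetry and two add up to the inhomogeneous term. Every test vector is an
  -- image under DT.
  refine chartMetric_nondegenerate q' htz fun c' => ?_
  obtain ⟨c, rfl⟩ := fderiv_chartChange_surjective hz hz' c'
  have h1 := koszul q hz a b c
  have h0 : chartMetric q z (christoffelL q z a b) c = chartMetric q' (T z)
      (fderiv ℝ T z (christoffelL q z a b)) (fderiv ℝ T z c) := chartMetric_change hz hz' _ _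
  rw [h0, key, key, key, ← fderiv_fderiv_comm hT a b, ← fderiv_fderiv_comm hT a c,
    ← fderiv_fderiv_comm hT b c] at h1
  have h2 := koszul q' htz (fderiv ℝ T z a) (fderiv ℝ T z b) (fderiv ℝ T z c)
  have c1 := chartMetric_comm q' (T z) (fderiv ℝ T z b) (fderiv ℝ (fderiv ℝ T) z a c)
  have c2 := chartMetric_comm q' (T z) (fderiv ℝ T z a) (fderiv ℝ (fderiv ℝ T) z b c)
  rw [map_add, add_apply]
  change chartMetric q' (T z) _ (fderiv ℝ T z c) = chartMetric q' (T z) _ (fderiv ℝ T z c) +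
    chartMetric q' (T z) _ (fderiv ℝ T z c)
  linarith

end Metric

end ChartChange

/-! ### The pull-back connection over an arbitrary domain, and its metric property. -/

section CovariantDerivative

variable {n : ℕ} {N : Type*} [TopologicalSpace N] [ChartedSpace (Model n) N]
  [IsManifold (𝓡 n) ∞ N] {E' H' P : Type*} [NormedAddCommGroup E'] [NormedSpace ℝ E'] [TopologicalSpace H']
  (I : ModelWithCorners ℝ E' H') [TopologicalSpace P] [ChartedSpace H' P]

/-- Smoothness at a point of a section of the pull-back `f⁻¹ TN`. -/
def SmoothSectionAt (f : P → N) (W : ∀ p, TangentSpace (𝓡 n) (f p))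
    (p : P) : Prop :=
  ContMDiffAt I (𝓡 n).tangent ∞ (fun p => (⟨f p, W p⟩ : TangentBundle (𝓡 n) N)) p

variable {I}
  {f : P → N} {W : ∀ p, TangentSpace (𝓡 n) (f p)} {p : P}

lemma SmoothSectionAt.base (h : SmoothSectionAt I f W p) : ContMDiffAt I (𝓡 n) ∞ f p :=
  (Bundle.contMDiffAt_totalSpace.1 h).1

lemma SmoothSectionAt.contMDiffAt_coords (h : SmoothSectionAt I f W p) {q : N}
    (hq : f p ∈ (extChartAt (𝓡 n) q).source) :
    ContMDiffAt I 𝓘(ℝ, Model n) ∞ (fun x => coords q (f x) (W x)) p :=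
  (contMDiffAt_section_iff h.base hq).1 h

lemma contMDiffAt_extChartAt_comp (hf : ContMDiffAt I (𝓡 n) ∞ f p) {q : N}
    (hq : f p ∈ (extChartAt (𝓡 n) q).source) :
    ContMDiffAt I 𝓘(ℝ, Model n) ∞ (fun x => extChartAt (𝓡 n) q (f x)) p := by
  rw [extChartAt_source] at hq
  exact (contMDiffAt_extChartAt' hq).comp p hf

variable [RiemannianBundle (fun x : N => TangentSpace (𝓡 n) x)]

variable (I) in
/-- The connection on the pull-back bundle, over an arbitrary domain. -/
def covD (f : P → N) (W : ∀ p, TangentSpace (𝓡 n) (f p)) (p : P) (v : TangentSpace I p) :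
    TangentSpace (𝓡 n) (f p) :=
  ofCoords (f p) (f p)
    (dirD I (fun x => coords (f p) (f x) (W x)) p v +
      christoffelVec (f p) (extChartAt (𝓡 n) (f p) (f p))
        (coords (f p) (f p) (mfderiv I (𝓡 n) f p v)) (coords (f p) (f p) (W p)))

variable [IsContMDiffRiemannianBundle (𝓡 n) ∞ (Model n) (fun x : N => TangentSpace (𝓡 n) x)]

/-- The covariant derivative in an arbitrary chart. -/
lemma coords_covD (h : SmoothSectionAt I f W p) {q : N} (hq : f p ∈ (extChartAt (𝓡 n) q).source)
    (v : TangentSpace I p) :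
    coords q (f p) (covD I f W p v) =
      dirD I (fun x => coords q (f x) (W x)) p v +
        christoffelL q (extChartAt (𝓡 n) q (f p)) (coords q (f p) (mfderiv I (𝓡 n) f p v))
          (coords q (f p) (W p)) := by
  have hs := mem_extChartAt_source (I := 𝓡 n) (f p)
  set z := extChartAt (𝓡 n) (f p) (f p) with hz
  have hzt : z ∈ (extChartAt (𝓡 n) (f p)).target := (extChartAt (𝓡 n) (f p)).map_source hs
  have hzl : (extChartAt (𝓡 n) (f p)).symm z = f p := (extChartAt (𝓡 n) (f p)).left_inv hs
  have hzq : (extChartAt (𝓡 n) (f p)).symm z ∈ (extChartAt (𝓡 n) q).source := by rwa [hzl]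
  set T : Model n → Model n := chartChange (f p) q with hTdef
  have hT : ContDiffAt ℝ ∞ T z := contDiffAt_chartChange hzt hzq
  have hTz : chartChange (f p) q z = extChartAt (𝓡 n) q (f p) := by rw [chartChange, hzl]
  have hu := (contMDiffAt_extChartAt_comp h.base hs).mdifferentiableAt (by simp)
  have hw := (h.contMDiffAt_coords hs).mdifferentiableAt (by simp)
  have hfd := h.base.mdifferentiableAt (by simp)
  set K : Model n × Model n → Model n := fun y => fderiv ℝ T y.1 y.2 with hK
  have hKd : HasFDerivAt K _ (z, coords (f p) (f p) (W p)) :=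
    ((hasFDerivAt_of_infty (hT.fderiv_right (m := ∞) (by simp))).comp
      (f := Prod.fst) (z, coords (f p) (f p) (W p)) hasFDerivAt_fst).clm_apply hasFDerivAt_snd
  -- `covD` is defined in the chart around f p, which moves with p; the formula is needed in a fixed
  -- chart q. Coordinates in q are DT applied to those around f p, and the second derivative of T
  -- arising here is the inhomogeneous term of the transformation law.
  have e : (fun x => coords q (f x) (W x)) =ᶠ[𝓝 p] fun x =>
      K (extChartAt (𝓡 n) (f p) (f x), coords (f p) (f x) (W x)) := by
    filter_upwards [h.base.continuousAt.eventually ((isOpen_extChartAt_source (f p)).mem_nhds hs),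
      h.base.continuousAt.eventually ((isOpen_extChartAt_source q).mem_nhds hq)] with x h1 h2
    exact coords_change h1 h2 (W x)
  have hKd' : DifferentiableAt ℝ K
      (extChartAt (𝓡 n) (f p) (f p), coords (f p) (f p) (W p)) := hKd.differentiableAt
  rw [dirD_congr e, dirD_comp (K := K)
    (u := fun x => (extChartAt (𝓡 n) (f p) (f x), coords (f p) (f x) (W x))) hKd'
    (hu.prodMk_space hw), dirD_prodMk hu hw, dirD_extChartAt_comp hfd hs]
  erw [hKd.fderiv]
  rw [covD, coords_change hs hq, coords_ofCoords hs, map_add, ← christoffelL_apply,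
    christoffelL_change hzt hzq, coords_change hs hq, coords_change hs hq (W p), hTz]
  simp only [add_apply, ContinuousLinearMap.comp_apply, ContinuousLinearMap.flip_apply,
    ContinuousLinearMap.coe_fst', ContinuousLinearMap.coe_snd', Function.comp_apply]
  abel

/-- The pull-back connection is metric. -/
lemma dirD_inner {X Y : ∀ p, TangentSpace (𝓡 n) (f p)} (hX : SmoothSectionAt I f X p)
    (hY : SmoothSectionAt I f Y p) (v : TangentSpace I p) :
    dirD I (fun x => (inner ℝ (X x) (Y x) : ℝ)) p v =
      inner ℝ (covD I f X p v) (Y p) + inner ℝ (X p) (covD I f Y p v) := by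
  have hs := mem_extChartAt_source (I := 𝓡 n) (f p)
  have hzt : extChartAt (𝓡 n) (f p) (f p) ∈ (extChartAt (𝓡 n) (f p)).target :=
    (extChartAt (𝓡 n) (f p)).map_source hs
  have hu := (contMDiffAt_extChartAt_comp hX.base hs).mdifferentiableAt (by simp)
  have hx := (hX.contMDiffAt_coords hs).mdifferentiableAt (by simp)
  have hy := (hY.contMDiffAt_coords hs).mdifferentiableAt (by simp)
  have hfd := hX.base.mdifferentiableAt (by simp)
  set K : Model n × Model n × Model n → ℝ := fun y => chartMetric (f p) y.1 y.2.1 y.2.2 with hK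
  set y₀ : Model n × Model n × Model n :=
    (extChartAt (𝓡 n) (f p) (f p), coords (f p) (f p) (X p), coords (f p) (f p) (Y p)) with hy₀
  have hc := contDiffAt_chartMetric (f p) hzt
  have hKd : DifferentiableAt ℝ K y₀ := by
    have h1 : DifferentiableAt ℝ (fun y : Model n × Model n × Model n => chartMetric (f p) y.1) y₀ :=
      DifferentiableAt.comp (g := chartMetric (f p)) y₀ (differentiableAt_of_infty hc)
        differentiableAt_fst
    exact (h1.clm_apply (by fun_prop)).clm_apply (by fun_prop)
  have e : (fun x => (inner ℝ (X x) (Y x) : ℝ)) =ᶠ[𝓝 p] fun x =>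
      K (extChartAt (𝓡 n) (f p) (f x), coords (f p) (f x) (X x), coords (f p) (f x) (Y x)) := by
    filter_upwards [hX.base.continuousAt.eventually
      ((isOpen_extChartAt_source (f p)).mem_nhds hs)] with x h1
    exact inner_eq_chartMetric h1 _ _
  rw [dirD_congr e, dirD_comp (K := K) (u := fun x => (extChartAt (𝓡 n) (f p) (f x),
    coords (f p) (f x) (X x), coords (f p) (f x) (Y x))) hKd
    (hu.prodMk_space (hx.prodMk_space hy)),
    dirD_prodMk hu (hx.prodMk_space hy), dirD_prodMk hx hy, dirD_extChartAt_comp hfd hs]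
  have e4 := fderiv_metric (P := Model n × Model n × Model n) (E := Model n) (x := y₀)
    (Γ := christoffelL (f p)) (G := chartMetric (f p))
    (F := Prod.fst) (A := fun y => y.2.1) (B := fun y => y.2.2) (differentiableAt_of_infty hc)
    (fderiv_chartMetric (f p) hzt) (by fun_prop) (by fun_prop) (by fun_prop)
  refine (e4 _).trans ?_
  rw [inner_eq_chartMetric hs, inner_eq_chartMetric hs, coords_covD hX hs, coords_covD hY hs]
  have d1 : fderiv ℝ (fun y : Model n × Model n × Model n => y.2.1) y₀ =
    (ContinuousLinearMap.fst ℝ _ _).comp (ContinuousLinearMap.snd ℝ _ _) :=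
    (hasFDerivAt_snd (p := y₀)).fst.fderiv
  have d2 : fderiv ℝ (fun y : Model n × Model n × Model n => y.2.2) y₀ =
    (ContinuousLinearMap.snd ℝ _ _).comp (ContinuousLinearMap.snd ℝ _ _) :=
    (hasFDerivAt_snd (p := y₀)).snd.fderiv
  simp only [lcov, d1, d2, fderiv_fst]
  rfl

end CovariantDerivative

/-! ### Maps and sections read in a pair of charts. -/

section ChartRepresentatives

variable {n : ℕ} {N : Type*} [TopologicalSpace N] [ChartedSpace (Model n) N]
  [IsManifold (𝓡 n) ∞ N]
  {m : ℕ} {M : Type*} [TopologicalSpace M] [ChartedSpace (Model m) M] [IsManifold (𝓡 m) ∞ M]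

lemma contMDiffAt_extChartAt_symm {q : N} {z : Model n} (hz : z ∈ (extChartAt (𝓡 n) q).target) :
    ContMDiffAt 𝓘(ℝ, Model n) (𝓡 n) ∞ (extChartAt (𝓡 n) q).symm z :=
  (contMDiffOn_extChartAt_symm q).contMDiffAt ((isOpen_extChartAt_target q).mem_nhds hz)

/-- A function on a manifold is smooth iff its representative in a chart is. -/
lemma contMDiffAt_iff_chart {X : Type*} [NormedAddCommGroup X] [NormedSpace ℝ X] {h : M → X}
    {p₀ p : M} (hp : p ∈ (extChartAt (𝓡 m) p₀).source) :
    ContMDiffAt (𝓡 m) 𝓘(ℝ, X) ∞ h p ↔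
      ContDiffAt ℝ ∞ (fun z => h ((extChartAt (𝓡 m) p₀).symm z)) (extChartAt (𝓡 m) p₀ p) := by
  have hl := (extChartAt (𝓡 m) p₀).left_inv hp
  rw [← contMDiffAt_iff_contDiffAt]
  constructor
  · intro hh
    refine ContMDiffAt.comp _ ?_ (contMDiffAt_extChartAt_symm ((extChartAt (𝓡 m) p₀).map_source hp))
    rwa [hl]
  · intro hh
    have hp' := hp
    rw [extChartAt_source] at hp'
    refine (hh.comp p (contMDiffAt_extChartAt' hp')).congr_of_eventuallyEq ?_
    filter_upwards [(isOpen_extChartAt_source p₀).mem_nhds hp] with y hy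
    simp only [Function.comp_apply, (extChartAt (𝓡 m) p₀).left_inv hy]

/-- The map `f` in the charts around `p₀` and `q`. -/
def mapRep (p₀ : M) (q : N) (f : M → N) (z : Model m) : Model n :=
  extChartAt (𝓡 n) q (f ((extChartAt (𝓡 m) p₀).symm z))

/-- The section `W` of `f⁻¹ TN` in the charts around `p₀` and `q`. -/
def secRep (p₀ : M) (q : N) (f : M → N) (W : ∀ p, TangentSpace (𝓡 n) (f p)) (z : Model m) :
    Model n :=
  coords q (f ((extChartAt (𝓡 m) p₀).symm z)) (W ((extChartAt (𝓡 m) p₀).symm z))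

variable {f : M → N} {W : ∀ p, TangentSpace (𝓡 n) (f p)} {p₀ p : M} {q : N}

lemma contDiffAt_mapRep (hf : ContMDiffAt (𝓡 m) (𝓡 n) ∞ f p)
    (hp : p ∈ (extChartAt (𝓡 m) p₀).source) (hq : f p ∈ (extChartAt (𝓡 n) q).source) :
    ContDiffAt ℝ ∞ (mapRep (n := n) p₀ q f) (extChartAt (𝓡 m) p₀ p) :=
  (contMDiffAt_iff_chart hp).1 (contMDiffAt_extChartAt_comp hf hq)

lemma smoothSectionAt_iff (hf : ContMDiffAt (𝓡 m) (𝓡 n) ∞ f p)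
    (hp : p ∈ (extChartAt (𝓡 m) p₀).source) (hq : f p ∈ (extChartAt (𝓡 n) q).source) :
    SmoothSectionAt (𝓡 m) f W p ↔
      ContDiffAt ℝ ∞ (secRep p₀ q f W) (extChartAt (𝓡 m) p₀ p) :=
  (contMDiffAt_section_iff hf hq).trans (contMDiffAt_iff_chart hp)

lemma fderiv_mapRep (hf : ContMDiffAt (𝓡 m) (𝓡 n) ∞ f p)
    (hp : p ∈ (extChartAt (𝓡 m) p₀).source) (hq : f p ∈ (extChartAt (𝓡 n) q).source)
    (v : TangentSpace (𝓡 m) p) :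
    fderiv ℝ (mapRep (n := n) p₀ q f) (extChartAt (𝓡 m) p₀ p) (coords p₀ p v) =
      coords q (f p) (mfderiv (𝓡 m) (𝓡 n) f p v) := by
  rw [← dirD_extChartAt_comp (hf.mdifferentiableAt (by simp)) hq, dirD_eq_fderiv hp
    (differentiableAt_of_infty (contDiffAt_mapRep hf hp hq))]
  rfl

lemma eventually_symm_mem (hf : ContinuousAt f p) (hp : p ∈ (extChartAt (𝓡 m) p₀).source)
    (hq : f p ∈ (extChartAt (𝓡 n) q).source) :
    ∀ᶠ z in 𝓝 (extChartAt (𝓡 m) p₀ p), z ∈ (extChartAt (𝓡 m) p₀).target ∧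
      f ((extChartAt (𝓡 m) p₀).symm z) ∈ (extChartAt (𝓡 n) q).source := by
  have ht := (extChartAt (𝓡 m) p₀).map_source hp
  have hl := (extChartAt (𝓡 m) p₀).left_inv hp
  have hc : ContinuousAt (fun z => f ((extChartAt (𝓡 m) p₀).symm z)) (extChartAt (𝓡 m) p₀ p) :=
    ContinuousAt.comp (by rwa [hl]) (contMDiffAt_extChartAt_symm ht).continuousAt
  filter_upwards [(isOpen_extChartAt_target p₀).mem_nhds ht,
    hc.eventually ((isOpen_extChartAt_source (I := 𝓡 n) q).mem_nhds (by
      simp only [hl]; exact hq))] with z h1 h2 using ⟨h1, h2⟩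

lemma eventually_chart {S : M → Prop} (hS : ∀ᶠ x in 𝓝 p, S x)
    (hp : p ∈ (extChartAt (𝓡 m) p₀).source) :
    ∀ᶠ z in 𝓝 (extChartAt (𝓡 m) p₀ p), S ((extChartAt (𝓡 m) p₀).symm z) := by
  have hc := (contMDiffAt_extChartAt_symm ((extChartAt (𝓡 m) p₀).map_source hp)).continuousAt
  refine hc.eventually ?_
  rwa [(extChartAt (𝓡 m) p₀).left_inv hp]

lemma secRep_apply (hp : p ∈ (extChartAt (𝓡 m) p₀).source) :
    secRep p₀ q f W (extChartAt (𝓡 m) p₀ p) = coords q (f p) (W p) := by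
  have : ∀ y, y = p → coords q (f y) (W y) = coords q (f p) (W p) := by rintro _ rfl; rfl
  exact this _ ((extChartAt (𝓡 m) p₀).left_inv hp)

lemma mapRep_apply (hp : p ∈ (extChartAt (𝓡 m) p₀).source) :
    mapRep (n := n) p₀ q f (extChartAt (𝓡 m) p₀ p) = extChartAt (𝓡 n) q (f p) := by
  rw [mapRep, (extChartAt (𝓡 m) p₀).left_inv hp]

variable [RiemannianBundle (fun x : N => TangentSpace (𝓡 n) x)]
  [IsContMDiffRiemannianBundle (𝓡 n) ∞ (Model n) (fun x : N => TangentSpace (𝓡 n) x)]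

/-- The bridge to the local calculus. Both charts are fixed while p varies, so the identity holds
near a point and may be differentiated. -/
lemma coords_covD_chart (h : SmoothSectionAt (𝓡 m) f W p)
    (hp : p ∈ (extChartAt (𝓡 m) p₀).source) (hq : f p ∈ (extChartAt (𝓡 n) q).source)
    (v : TangentSpace (𝓡 m) p) :
    coords q (f p) (covD (𝓡 m) f W p v) =
      lcov (christoffelL q) (mapRep (n := n) p₀ q f) (secRep p₀ q f W) (extChartAt (𝓡 m) p₀ p)
        (coords p₀ p v) := by
  rw [coords_covD h hq, lcov, fderiv_mapRep h.base hp hq, dirD_eq_fderiv hp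
    (differentiableAt_of_infty ((smoothSectionAt_iff h.base hp hq).1 h))]
  rw [secRep_apply hp, mapRep_apply hp]
  rfl

end ChartRepresentatives

/-! ### The curvature tensor and its covariant derivative in an arbitrary chart. -/

section Curvature

variable {n : ℕ} {N : Type*} [TopologicalSpace N] [ChartedSpace (Model n) N]
  [IsManifold (𝓡 n) ∞ N]

/-- Smoothness at a point of a vector field. -/
abbrev SmoothFieldAt (X : ∀ x : N, TangentSpace (𝓡 n) x) (x : N) : Prop :=
  SmoothSectionAt (𝓡 n) (fun y : N => y) X x

/-- A vector field in the chart around `q`. -/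
abbrev fieldRep (q : N) (X : ∀ x : N, TangentSpace (𝓡 n) x) : Model n → Model n :=
  secRep q q (fun y : N => y) X

lemma fieldRep_apply {q x : N} (hx : x ∈ (extChartAt (𝓡 n) q).source)
    (X : ∀ x : N, TangentSpace (𝓡 n) x) :
    fieldRep q X (extChartAt (𝓡 n) q x) = coords q x (X x) :=
  secRep_apply hx

lemma mapRep_id_eventuallyEq {q x : N} (hx : x ∈ (extChartAt (𝓡 n) q).source) :
    mapRep (n := n) q q (fun y : N => y) =ᶠ[𝓝 (extChartAt (𝓡 n) q x)] id := by
  filter_upwards [(isOpen_extChartAt_target q).mem_nhds ((extChartAt (𝓡 n) q).map_source hx)]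
    with z hz using (extChartAt (𝓡 n) q).right_inv hz

lemma smoothFieldAt_iff {q x : N} (hx : x ∈ (extChartAt (𝓡 n) q).source)
    {X : ∀ x : N, TangentSpace (𝓡 n) x} :
    SmoothFieldAt X x ↔ ContDiffAt ℝ ∞ (fieldRep q X) (extChartAt (𝓡 n) q x) :=
  smoothSectionAt_iff (m := n) (n := n) (M := N) (N := N) (f := fun y : N => y) (W := X)
    contMDiffAt_id hx hx

lemma smoothFieldAt_extendVec {q x : N} (hx : x ∈ (extChartAt (𝓡 n) q).source)
    (v : TangentSpace (𝓡 n) q) : SmoothFieldAt (extendVec q v) x := by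
  refine (smoothFieldAt_iff hx).2
    ((contDiffAt_const (c := coords q q v)).congr_of_eventuallyEq ?_)
  filter_upwards [(isOpen_extChartAt_target q).mem_nhds ((extChartAt (𝓡 n) q).map_source hx)]
    with z hz using coords_extendVec (N := N) (n := n) ((extChartAt (𝓡 n) q).map_target hz) v

lemma eventually_smoothFieldAt_extendVec (q : N) (v : TangentSpace (𝓡 n) q) :
    ∀ᶠ x in 𝓝 q, SmoothFieldAt (extendVec q v) x := by
  filter_upwards [(isOpen_extChartAt_source (I := 𝓡 n) q).mem_nhds
    (mem_extChartAt_source q)] with x hx using smoothFieldAt_extendVec hx v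

lemma mpullback_extChartAt_symm {q : N} {z : Model n} (hz : z ∈ (extChartAt (𝓡 n) q).target)
    (X : ∀ x : N, TangentSpace (𝓡 n) x) :
    VectorField.mpullback 𝓘(ℝ, Model n) (𝓡 n) (extChartAt (𝓡 n) q).symm X z = fieldRep q X z := by
  have : IsManifold (𝓡 n) 1 N := .of_le (n := ∞) (by norm_cast)
  have h1 := mfderiv_extChartAt_comp_mfderivWithin_extChartAt_symm (I := 𝓡 n) hz
  have h2 := mfderivWithin_extChartAt_symm_comp_mfderiv_extChartAt (I := 𝓡 n) hz
  rw [ModelWithCorners.range_eq_univ, mfderivWithin_univ] at h1 h2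
  rw [VectorField.mpullback_apply, ContinuousLinearMap.inverse_eq h2 h1]
  rfl

/-- The bracket is natural under pull-back by the inverse chart, where it becomes the bracket of the
coordinate representatives in the model space. -/
lemma coords_mlieBracket {q x : N} (hx : x ∈ (extChartAt (𝓡 n) q).source)
    {X Y : ∀ x : N, TangentSpace (𝓡 n) x} (hX : SmoothFieldAt X x) (hY : SmoothFieldAt Y x) :
    coords q x (VectorField.mlieBracket (𝓡 n) X Y x) =
      fderiv ℝ (fieldRep q Y) (extChartAt (𝓡 n) q x) (coords q x (X x)) -
        fderiv ℝ (fieldRep q X) (extChartAt (𝓡 n) q x) (coords q x (Y x)) := by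
  have : IsManifold (𝓡 n) (minSmoothness ℝ 3) N := by
    rw [minSmoothness_of_isRCLikeNormedField]; exact .of_le (n := ∞) ENat.LEInfty.out
  have ht := (extChartAt (𝓡 n) q).map_source hx
  have hl := (extChartAt (𝓡 n) q).left_inv hx
  have h1 := VectorField.mpullback_mlieBracket (I := 𝓘(ℝ, Model n)) (I' := 𝓡 n)
    (f := (extChartAt (𝓡 n) q).symm) (x₀ := extChartAt (𝓡 n) q x) (V := X) (W := Y) (n := ∞)
    (by rw [hl]; exact ContMDiffAt.mdifferentiableAt hX (by simp))
    (by rw [hl]; exact ContMDiffAt.mdifferentiableAt hY (by simp))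
    (contMDiffAt_extChartAt_symm ht)
    (by rw [minSmoothness_of_isRCLikeNormedField]; exact ENat.LEInfty.out)
  rw [mpullback_extChartAt_symm ht, fieldRep_apply hx] at h1
  have e : ∀ X : ∀ x : N, TangentSpace (𝓡 n) x,
      VectorField.mpullback 𝓘(ℝ, Model n) (𝓡 n) (extChartAt (𝓡 n) q).symm X
        =ᶠ[𝓝 (extChartAt (𝓡 n) q x)] fieldRep q X := fun X => by
    filter_upwards [(isOpen_extChartAt_target q).mem_nhds ht] with z hz
      using mpullback_extChartAt_symm hz X
  rw [h1, (e X).mlieBracket_vectorField_eq (e Y)]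
  have h2 := congrFun (VectorField.mlieBracketWithin_eq_lieBracketWithin (𝕜 := ℝ)
    (V := fieldRep q X) (W := fieldRep q Y) (s := Set.univ)) (extChartAt (𝓡 n) q x)
  refine (congrFun VectorField.mlieBracketWithin_univ.symm _).trans (h2.trans ?_)
  rw [VectorField.lieBracketWithin_univ, VectorField.lieBracket, fieldRep_apply hx,
    fieldRep_apply hx]

variable [RiemannianBundle (fun x : N => TangentSpace (𝓡 n) x)]
  [IsContMDiffRiemannianBundle (𝓡 n) ∞ (Model n) (fun x : N => TangentSpace (𝓡 n) x)]

lemma coords_nabla {q x : N} (hx : x ∈ (extChartAt (𝓡 n) q).source)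
    (X : ∀ x : N, TangentSpace (𝓡 n) x) {Y : ∀ x : N, TangentSpace (𝓡 n) x}
    (hY : SmoothFieldAt Y x) :
    coords q x (nabla X Y x) =
      lcov (christoffelL q) id (fieldRep q Y) (extChartAt (𝓡 n) q x) (coords q x (X x)) := by
  refine (coords_covD_chart (f := fun y : N => y) hY hx hx (X x)).trans ?_
  have h := mapRep_id_eventuallyEq hx
  rw [lcov, lcov, h.fderiv_eq, h.eq_of_nhds]

lemma fieldRep_nabla_eventuallyEq {q x : N} (hx : x ∈ (extChartAt (𝓡 n) q).source)
    (X : ∀ x : N, TangentSpace (𝓡 n) x) {Y : ∀ x : N, TangentSpace (𝓡 n) x}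
    (hY : ∀ᶠ y in 𝓝 x, SmoothFieldAt Y y) :
    fieldRep q (nabla X Y) =ᶠ[𝓝 (extChartAt (𝓡 n) q x)] fun z =>
      lcov (christoffelL q) id (fieldRep q Y) z (fieldRep q X z) := by
  filter_upwards [eventually_chart hY hx,
    (isOpen_extChartAt_target q).mem_nhds ((extChartAt (𝓡 n) q).map_source hx)] with z h1 hz
  have := coords_nabla ((extChartAt (𝓡 n) q).map_target hz) X h1
  rw [(extChartAt (𝓡 n) q).right_inv hz] at this
  exact this

lemma smoothFieldAt_nabla {x : N} {X Y : ∀ x : N, TangentSpace (𝓡 n) x} (hX : SmoothFieldAt X x)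
    (hY : ∀ᶠ y in 𝓝 x, SmoothFieldAt Y y) : SmoothFieldAt (nabla X Y) x := by
  have hx := mem_extChartAt_source (I := 𝓡 n) x
  rw [smoothFieldAt_iff hx]
  refine ContDiffAt.congr_of_eventuallyEq ?_ (fieldRep_nabla_eventuallyEq hx X hY)
  exact contDiffAt_lcov (P := Model n) (F := id) (v := fieldRep x X) (contDiffAt_christoffelL x ((extChartAt (𝓡 n) x).map_source hx))
    contDiffAt_id ((smoothFieldAt_iff hx).1 hY.self_of_nhds) ((smoothFieldAt_iff hx).1 hX)

lemma coords_nabla_nabla {q x : N} (hx : x ∈ (extChartAt (𝓡 n) q).source)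
    {X Y Z : ∀ x : N, TangentSpace (𝓡 n) x} (hY : SmoothFieldAt Y x)
    (hZ : ∀ᶠ y in 𝓝 x, SmoothFieldAt Z y) :
    coords q x (nabla X (nabla Y Z) x) =
      lcov (christoffelL q) id (fun z => lcov (christoffelL q) id (fieldRep q Z) z
        (coords q x (Y x))) (extChartAt (𝓡 n) q x) (coords q x (X x))
      + lcov (christoffelL q) id (fieldRep q Z) (extChartAt (𝓡 n) q x)
        (fderiv ℝ (fieldRep q Y) (extChartAt (𝓡 n) q x) (coords q x (X x))) := by
  rw [coords_nabla hx X (smoothFieldAt_nabla hY hZ),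
    lcov_congr (fieldRep_nabla_eventuallyEq hx Y hZ),
    lcov_lcov_field (P := Model n) (F := id) (v := fieldRep q Y) (contDiffAt_christoffelL q ((extChartAt (𝓡 n) q).map_source hx)) contDiffAt_id
      ((smoothFieldAt_iff hx).1 hZ.self_of_nhds)
      (differentiableAt_of_infty ((smoothFieldAt_iff hx).1 hY)), fieldRep_apply hx]

/-- The derivatives of X and Y enter the iterated covariant derivatives only as directions, and they
cancel against the bracket term. What remains is the commutator in constant directions. Hence the
field extensions used in `curv` do not matter. -/
lemma coords_curvField {q x : N} (hx : x ∈ (extChartAt (𝓡 n) q).source)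
    {X Y Z : ∀ x : N, TangentSpace (𝓡 n) x} (hX : SmoothFieldAt X x) (hY : SmoothFieldAt Y x)
    (hZ : ∀ᶠ y in 𝓝 x, SmoothFieldAt Z y) :
    coords q x (curvField X Y Z x) = lcurv (christoffelL q) (extChartAt (𝓡 n) q x)
      (coords q x (X x)) (coords q x (Y x)) (coords q x (Z x)) := by
  have hΓ := contDiffAt_christoffelL q ((extChartAt (𝓡 n) q).map_source hx)
  have hZ' := (smoothFieldAt_iff hx).1 hZ.self_of_nhds
  rw [curvField, coords_sub, coords_sub, coords_nabla_nabla hx hY hZ, coords_nabla_nabla hx hX hZ,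
    coords_nabla hx _ hZ.self_of_nhds, coords_mlieBracket hx hX hY,
    lcov_comm (F := id) hΓ contDiffAt_id hZ' (coords q x (X x)), sub_eq_add_neg (fderiv ℝ _ _ _),
    lcov_add_right, ← neg_one_smul ℝ (fderiv ℝ _ _ _), lcov_smul_right, fieldRep_apply hx]
  simp only [fderiv_id, ContinuousLinearMap.id_apply, id_eq, neg_one_smul]
  abel

/-- The curvature tensor in an arbitrary chart. -/
lemma coords_curv {q x : N} (hx : x ∈ (extChartAt (𝓡 n) q).source)
    (u v w : TangentSpace (𝓡 n) x) :
    coords q x (curv x u v w) = lcurv (christoffelL q) (extChartAt (𝓡 n) q x)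
      (coords q x u) (coords q x v) (coords q x w) := by
  have hs := mem_extChartAt_source (I := 𝓡 n) x
  rw [curv, coords_curvField hx (smoothFieldAt_extendVec hs u) (smoothFieldAt_extendVec hs v)
    (eventually_smoothFieldAt_extendVec x w)]
  simp only [extendVec_self]

lemma fieldRep_curv_eventuallyEq {q x : N} (hx : x ∈ (extChartAt (𝓡 n) q).source)
    (Y Z V : ∀ x : N, TangentSpace (𝓡 n) x) :
    fieldRep q (fun y => curv y (Y y) (Z y) (V y)) =ᶠ[𝓝 (extChartAt (𝓡 n) q x)] fun z =>
      lcurv (christoffelL q) z (fieldRep q Y z) (fieldRep q Z z) (fieldRep q V z) := by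
  filter_upwards [(isOpen_extChartAt_target q).mem_nhds ((extChartAt (𝓡 n) q).map_source hx)]
    with z hz
  have := coords_curv ((extChartAt (𝓡 n) q).map_target hz) (Y _) (Z _) (V _)
  rw [(extChartAt (𝓡 n) q).right_inv hz] at this
  exact this

/-- The derivative of the curvature tensor in an arbitrary chart. -/
lemma coords_dCurv {q x : N} (hx : x ∈ (extChartAt (𝓡 n) q).source)
    (u v w t : TangentSpace (𝓡 n) x) :
    coords q x (dCurv x u v w t) = ldcurv (christoffelL q) (extChartAt (𝓡 n) q x)
      (coords q x u) (coords q x v) (coords q x w) (coords q x t) := by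
  have hs := mem_extChartAt_source (I := 𝓡 n) x
  have hΓ := contDiffAt_christoffelL q ((extChartAt (𝓡 n) q).map_source hx)
  have hr : ∀ v : TangentSpace (𝓡 n) x,
      ContDiffAt ℝ ∞ (fieldRep q (extendVec x v)) (extChartAt (𝓡 n) q x) := fun v =>
    (smoothFieldAt_iff hx).1 (smoothFieldAt_extendVec hs v)
  have he := fieldRep_curv_eventuallyEq hx (extendVec x v) (extendVec x w) (extendVec x t)
  have hsm : SmoothFieldAt (fun y => curv y (extendVec x v y) (extendVec x w y) (extendVec x t y))
      x := (smoothFieldAt_iff hx).2 ((contDiffAt_lcurv (F := id) hΓ contDiffAt_id (hr v) (hr w)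
        (hr t)).congr_of_eventuallyEq he)
  have key := lcov_lcurv (F := id) hΓ contDiffAt_id (hr v) (hr w) (hr t) (coords q x u)
  simp only [id_eq] at key
  rw [dCurv, dCurvField, coords_sub, coords_sub, coords_sub, coords_curv hx, coords_curv hx,
    coords_curv hx, coords_nabla hx _ hsm, lcov_congr he, extendVec_self, key,
    coords_nabla hx _ (smoothFieldAt_extendVec hs v),
    coords_nabla hx _ (smoothFieldAt_extendVec hs w),
    coords_nabla hx _ (smoothFieldAt_extendVec hs t)]
  simp only [fieldRep_apply hx, extendVec_self, fderiv_id, ContinuousLinearMap.id_apply]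
  abel

end Curvature

/-! ### Algebra, product rules and smoothness for sections along a map. -/

section SectionOperations

variable {n : ℕ} {N : Type*} [TopologicalSpace N] [ChartedSpace (Model n) N]
  [IsManifold (𝓡 n) ∞ N] {E' H' P : Type*} [NormedAddCommGroup E'] [NormedSpace ℝ E']
  [TopologicalSpace H'] {I : ModelWithCorners ℝ E' H'} [TopologicalSpace P] [ChartedSpace H' P]
  {f : P → N} {W Z : ∀ p, TangentSpace (𝓡 n) (f p)} {p : P} {c : P → ℝ}

lemma SmoothSectionAt.add (hW : SmoothSectionAt I f W p) (hZ : SmoothSectionAt I f Z p) :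
    SmoothSectionAt I f (fun x => W x + Z x) p := by
  have hq := mem_extChartAt_source (I := 𝓡 n) (f p)
  refine (contMDiffAt_section_iff hW.base hq).2 ?_
  simp only [coords_add]
  exact (hW.contMDiffAt_coords hq).add (hZ.contMDiffAt_coords hq)

lemma SmoothSectionAt.smul (hc : ContMDiffAt I 𝓘(ℝ, ℝ) ∞ c p) (hW : SmoothSectionAt I f W p) :
    SmoothSectionAt I f (fun x => c x • W x) p := by
  have hq := mem_extChartAt_source (I := 𝓡 n) (f p)
  refine (contMDiffAt_section_iff hW.base hq).2 ?_
  simp only [coords_smul]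
  exact hc.smul (hW.contMDiffAt_coords hq)

lemma SmoothSectionAt.const_smul (r : ℝ) (hW : SmoothSectionAt I f W p) :
    SmoothSectionAt I f (fun x => r • W x) p := hW.smul contMDiffAt_const

lemma SmoothSectionAt.neg (hW : SmoothSectionAt I f W p) :
    SmoothSectionAt I f (fun x => -W x) p := by
  simpa only [neg_one_smul] using hW.const_smul (-1)

lemma SmoothSectionAt.sub (hW : SmoothSectionAt I f W p) (hZ : SmoothSectionAt I f Z p) :
    SmoothSectionAt I f (fun x => W x - Z x) p := by
  simpa only [sub_eq_add_neg] using hW.add hZ.neg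

lemma smoothSectionAt_zero (hf : ContMDiffAt I (𝓡 n) ∞ f p) :
    SmoothSectionAt I f (fun x => (0 : TangentSpace (𝓡 n) (f x))) p := by
  refine (contMDiffAt_section_iff hf (mem_extChartAt_source (I := 𝓡 n) (f p))).2 ?_
  simp only [coords_zero]
  exact contMDiffAt_const

lemma smoothSectionAt_sum (hf : ContMDiffAt I (𝓡 n) ∞ f p) {ι : Type*} (s : Finset ι)
    {W : ι → ∀ p, TangentSpace (𝓡 n) (f p)} (hW : ∀ i ∈ s, SmoothSectionAt I f (W i) p) :
    SmoothSectionAt I f (fun x => ∑ i ∈ s, W i x) p := by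
  classical
  induction s using Finset.induction_on with
  | empty => simpa using smoothSectionAt_zero hf
  | insert i s hi ih =>
    simp only [Finset.sum_insert hi]
    exact (hW i (Finset.mem_insert_self i s)).add
      (ih fun j hj => hW j (Finset.mem_insert_of_mem hj))

lemma SmoothSectionAt.congr (hW : SmoothSectionAt I f W p) (h : ∀ᶠ x in 𝓝 p, Z x = W x) :
    SmoothSectionAt I f Z p := by
  refine ContMDiffAt.congr_of_eventuallyEq hW ?_
  filter_upwards [h] with x hx
  rw [hx]

lemma SmoothSectionAt.comp {E'' H'' P' : Type*} [NormedAddCommGroup E''] [NormedSpace ℝ E'']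
    [TopologicalSpace H''] {I' : ModelWithCorners ℝ E'' H''} [TopologicalSpace P']
    [ChartedSpace H'' P'] {g : P' → P} {y : P'} (hW : SmoothSectionAt I f W (g y))
    (hg : ContMDiffAt I' I ∞ g y) :
    SmoothSectionAt I' (fun x => f (g x)) (fun x => W (g x)) y :=
  ContMDiffAt.comp y hW hg

lemma dirD_add {X : Type*} [NormedAddCommGroup X] [NormedSpace ℝ X] {u w : P → X}
    (hu : MDifferentiableAt I 𝓘(ℝ, X) u p) (hw : MDifferentiableAt I 𝓘(ℝ, X) w p)
    (v : TangentSpace I p) :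
    dirD I (fun x => u x + w x) p v = dirD I u p v + dirD I w p v := by
  rw [dirD_comp (K := fun y : X × X => y.1 + y.2) (u := fun x => (u x, w x)) (by fun_prop)
    (hu.prodMk_space hw), dirD_prodMk hu hw]
  have h : HasFDerivAt (fun y : X × X => y.1 + y.2)
      (ContinuousLinearMap.fst ℝ X X + ContinuousLinearMap.snd ℝ X X) (u p, w p) :=
    HasFDerivAt.add hasFDerivAt_fst hasFDerivAt_snd
  rw [h.fderiv]
  rfl

lemma dirD_smul {X : Type*} [NormedAddCommGroup X] [NormedSpace ℝ X] {u : P → X}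
    (hc : MDifferentiableAt I 𝓘(ℝ, ℝ) c p) (hu : MDifferentiableAt I 𝓘(ℝ, X) u p)
    (v : TangentSpace I p) :
    dirD I (fun x => c x • u x) p v = dirD I c p v • u p + c p • dirD I u p v := by
  rw [dirD_comp (K := fun y : ℝ × X => y.1 • y.2) (u := fun x => (c x, u x)) (by fun_prop)
    (hc.prodMk_space hu), dirD_prodMk hc hu]
  have h1 : HasFDerivAt Prod.fst (ContinuousLinearMap.fst ℝ ℝ X) (c p, u p) := hasFDerivAt_fst
  have h2 : HasFDerivAt Prod.snd (ContinuousLinearMap.snd ℝ ℝ X) (c p, u p) := hasFDerivAt_snd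
  have h : HasFDerivAt (fun y : ℝ × X => y.1 • y.2) _ (c p, u p) := h1.smul h2
  rw [h.fderiv]
  simp [add_comm]

lemma dirD_const {X : Type*} [NormedAddCommGroup X] [NormedSpace ℝ X] (a : X)
    (v : TangentSpace I p) : dirD I (fun _ : P => a) p v = 0 := by
  rw [dirD, mfderiv_const]; rfl

lemma dirD_self {E : Type*} [NormedAddCommGroup E] [NormedSpace ℝ E] {X : Type*}
    [NormedAddCommGroup X] [NormedSpace ℝ X] (h : E → X) (p v : E) :
    dirD 𝓘(ℝ, E) h p v = fderiv ℝ h p v := by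
  exact congrArg (fun L : E →L[ℝ] X => L v) mfderiv_eq_fderiv

variable [RiemannianBundle (fun x : N => TangentSpace (𝓡 n) x)]

lemma covD_add_right (v w : TangentSpace I p) :
    covD I f W p (v + w) = covD I f W p v + covD I f W p w := by
  simp only [covD, dirD_add_right, map_add, ← christoffelL_apply, coords_add, add_apply,
    ofCoords_add]
  abel

lemma covD_smul_right (r : ℝ) (v : TangentSpace I p) :
    covD I f W p (r • v) = r • covD I f W p v := by
  simp only [covD, dirD_smul_right, map_smul, ← christoffelL_apply, coords_smul,
    smul_apply, ofCoords_add, ofCoords_smul, smul_add]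

lemma covD_congr (h : ∀ᶠ x in 𝓝 p, Z x = W x) (v : TangentSpace I p) :
    covD I f Z p v = covD I f W p v := by
  have e : (fun x => coords (f p) (f x) (Z x)) =ᶠ[𝓝 p] fun x => coords (f p) (f x) (W x) := by
    filter_upwards [h] with x hx
    rw [hx]
  rw [covD, covD, dirD_congr e, h.self_of_nhds]

lemma covD_zero (v : TangentSpace I p) : covD I f (fun x => (0 : TangentSpace (𝓡 n) (f x))) p v = 0 := by
  simp only [covD, coords_zero, dirD_const, ← christoffelL_apply, map_zero, add_zero,
    ofCoords_zero]

lemma covD_add (hW : SmoothSectionAt I f W p) (hZ : SmoothSectionAt I f Z p)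
    (v : TangentSpace I p) :
    covD I f (fun x => W x + Z x) p v = covD I f W p v + covD I f Z p v := by
  have hq := mem_extChartAt_source (I := 𝓡 n) (f p)
  simp only [covD, coords_add, ← christoffelL_apply, map_add]
  rw [dirD_add ((hW.contMDiffAt_coords hq).mdifferentiableAt (by simp))
    ((hZ.contMDiffAt_coords hq).mdifferentiableAt (by simp)), ← ofCoords_add]
  congr 1
  abel

lemma covD_smul (hc : ContMDiffAt I 𝓘(ℝ, ℝ) ∞ c p) (hW : SmoothSectionAt I f W p)
    (v : TangentSpace I p) :
    covD I f (fun x => c x • W x) p v = dirD I c p v • W p + c p • covD I f W p v := by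
  have hq := mem_extChartAt_source (I := 𝓡 n) (f p)
  simp only [covD, coords_smul, ← christoffelL_apply, map_smul]
  rw [dirD_smul (hc.mdifferentiableAt (by simp))
    ((hW.contMDiffAt_coords hq).mdifferentiableAt (by simp))]
  simp only [ofCoords_add, ofCoords_smul, ofCoords_coords hq, smul_add, add_assoc]

lemma covD_const_smul (r : ℝ) (hW : SmoothSectionAt I f W p) (v : TangentSpace I p) :
    covD I f (fun x => r • W x) p v = r • covD I f W p v := by
  rw [covD_smul contMDiffAt_const hW, dirD_const, zero_smul, zero_add]

lemma covD_neg (hW : SmoothSectionAt I f W p) (v : TangentSpace I p) :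
    covD I f (fun x => -W x) p v = -covD I f W p v := by
  simpa only [neg_one_smul] using covD_const_smul (-1) hW v

lemma covD_sub (hW : SmoothSectionAt I f W p) (hZ : SmoothSectionAt I f Z p)
    (v : TangentSpace I p) :
    covD I f (fun x => W x - Z x) p v = covD I f W p v - covD I f Z p v := by
  simpa only [sub_eq_add_neg, covD_neg hZ] using covD_add hW hZ.neg v

lemma covD_sum (hf : ContMDiffAt I (𝓡 n) ∞ f p) {ι : Type*} (s : Finset ι)
    {W : ι → ∀ p, TangentSpace (𝓡 n) (f p)} (hW : ∀ i ∈ s, SmoothSectionAt I f (W i) p)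
    (v : TangentSpace I p) :
    covD I f (fun x => ∑ i ∈ s, W i x) p v = ∑ i ∈ s, covD I f (W i) p v := by
  classical
  induction s using Finset.induction_on with
  | empty => simpa using covD_zero v
  | insert i s hi ih =>
    simp only [Finset.sum_insert hi]
    rw [covD_add (hW i (Finset.mem_insert_self i s))
      (smoothSectionAt_sum hf s fun j hj => hW j (Finset.mem_insert_of_mem hj)),
      ih fun j hj => hW j (Finset.mem_insert_of_mem hj)]

variable [IsContMDiffRiemannianBundle (𝓡 n) ∞ (Model n) (fun x : N => TangentSpace (𝓡 n) x)]

lemma SmoothSectionAt.inner (hW : SmoothSectionAt I f W p) (hZ : SmoothSectionAt I f Z p) :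
    ContMDiffAt I 𝓘(ℝ, ℝ) ∞ (fun x => (inner ℝ (W x) (Z x) : ℝ)) p :=
  ContMDiffAt.inner_bundle hW hZ

lemma SmoothSectionAt.curv {Y : ∀ p, TangentSpace (𝓡 n) (f p)} (hW : SmoothSectionAt I f W p)
    (hZ : SmoothSectionAt I f Z p) (hY : SmoothSectionAt I f Y p) :
    SmoothSectionAt I f (fun x => curv (f x) (W x) (Z x) (Y x)) p := by
  have hq := mem_extChartAt_source (I := 𝓡 n) (f p)
  refine (contMDiffAt_section_iff hW.base hq).2 ?_
  have hΓ := contDiffAt_christoffelL (f p) ((extChartAt (𝓡 n) (f p)).map_source hq)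
  have hK : ContDiffAt ℝ ∞ (fun y : Model n × Model n × Model n × Model n =>
      lcurv (christoffelL (f p)) y.1 y.2.1 y.2.2.1 y.2.2.2)
      (extChartAt (𝓡 n) (f p) (f p), coords (f p) (f p) (W p), coords (f p) (f p) (Z p),
        coords (f p) (f p) (Y p)) :=
    contDiffAt_lcurv (F := Prod.fst) hΓ (by fun_prop) (by fun_prop) (by fun_prop) (by fun_prop)
  have h1 := hK.contMDiffAt.comp p ((contMDiffAt_extChartAt_comp hW.base hq).prodMk_space
    ((hW.contMDiffAt_coords hq).prodMk_space ((hZ.contMDiffAt_coords hq).prodMk_space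
      (hY.contMDiffAt_coords hq))))
  refine h1.congr_of_eventuallyEq ?_
  filter_upwards [hW.base.continuousAt.eventually
    ((isOpen_extChartAt_source (I := 𝓡 n) (f p)).mem_nhds hq)] with x hx
  exact coords_curv hx _ _ _

end SectionOperations

/-! ### Pointwise symmetries of the curvature and of its covariant derivative. -/

section CurvatureIdentities

variable {n : ℕ} {N : Type*} [TopologicalSpace N] [ChartedSpace (Model n) N]
  [IsManifold (𝓡 n) ∞ N] [RiemannianBundle (fun x : N => TangentSpace (𝓡 n) x)]
  [IsContMDiffRiemannianBundle (𝓡 n) ∞ (Model n) (fun x : N => TangentSpace (𝓡 n) x)] {q : N}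

lemma eventually_contDiffAt_christoffelL (q : N) :
    ∀ᶠ z in 𝓝 (extChartAt (𝓡 n) q q), ContDiffAt ℝ ∞ (christoffelL q) z := by
  filter_upwards [(isOpen_extChartAt_target q).mem_nhds (mem_extChartAt_target q)] with z hz
    using contDiffAt_christoffelL q hz

lemma eventually_christoffelL_comm (q : N) :
    ∀ᶠ z in 𝓝 (extChartAt (𝓡 n) q q), ∀ a b, christoffelL q z a b = christoffelL q z b a := by
  filter_upwards [(isOpen_extChartAt_target q).mem_nhds (mem_extChartAt_target q)] with z hz
    using christoffelL_comm q hz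

lemma eventually_contDiffAt_chartMetric (q : N) :
    ∀ᶠ z in 𝓝 (extChartAt (𝓡 n) q q), ContDiffAt ℝ ∞ (chartMetric q) z := by
  filter_upwards [(isOpen_extChartAt_target q).mem_nhds (mem_extChartAt_target q)] with z hz
    using contDiffAt_chartMetric q hz

lemma eventually_fderiv_chartMetric (q : N) :
    ∀ᶠ z in 𝓝 (extChartAt (𝓡 n) q q), ∀ a b c, fderiv ℝ (chartMetric q) z a b c =
      chartMetric q z (christoffelL q z a b) c + chartMetric q z b (christoffelL q z a c) := by
  filter_upwards [(isOpen_extChartAt_target q).mem_nhds (mem_extChartAt_target q)] with z hz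
    using fderiv_chartMetric q hz

lemma coords_inj {v w : TangentSpace (𝓡 n) q} (h : coords q q v = coords q q w) : v = w :=
  coords_injective (mem_extChartAt_source q) h

lemma coords_curv_self (u v w : TangentSpace (𝓡 n) q) :
    coords q q (curv q u v w) = lcurv (christoffelL q) (extChartAt (𝓡 n) q q)
      (coords q q u) (coords q q v) (coords q q w) := coords_curv (mem_extChartAt_source q) u v w

lemma coords_dCurv_self (u v w t : TangentSpace (𝓡 n) q) :
    coords q q (dCurv q u v w t) = ldcurv (christoffelL q) (extChartAt (𝓡 n) q q)
      (coords q q u) (coords q q v) (coords q q w) (coords q q t) :=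
  coords_dCurv (mem_extChartAt_source q) u v w t

lemma curv_swap (u v w : TangentSpace (𝓡 n) q) : curv q v u w = -curv q u v w :=
  coords_inj (by rw [coords_neg, coords_curv_self, coords_curv_self, lcurv_swap])

lemma curv_bianchi (u v w : TangentSpace (𝓡 n) q) :
    curv q u v w + curv q v w u + curv q w u v = 0 :=
  coords_inj (by
    simp only [coords_add, coords_curv_self, coords_zero]
    exact lcurv_bianchi (eventually_contDiffAt_christoffelL q).self_of_nhds
      (eventually_christoffelL_comm q) _ _ _)

lemma curv_isLinear₁ (v w : TangentSpace (𝓡 n) q) : IsLinearMap ℝ (fun u => curv q u v w) :=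
  ⟨fun _ _ => coords_inj (by simp only [coords_add, coords_curv_self, (lcurv_isLinear₁ _ _).map_add]),
   fun _ _ => coords_inj (by
    simp only [coords_smul, coords_curv_self, (lcurv_isLinear₁ _ _).map_smul])⟩

lemma curv_isLinear₂ (u w : TangentSpace (𝓡 n) q) : IsLinearMap ℝ (fun v => curv q u v w) :=
  ⟨fun _ _ => coords_inj (by simp only [coords_add, coords_curv_self, (lcurv_isLinear₂ _ _).map_add]),
   fun _ _ => coords_inj (by
    simp only [coords_smul, coords_curv_self, (lcurv_isLinear₂ _ _).map_smul])⟩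

lemma curv_isLinear₃ (u v : TangentSpace (𝓡 n) q) : IsLinearMap ℝ (curv q u v) :=
  ⟨fun _ _ => coords_inj (by simp only [coords_add, coords_curv_self, (lcurv_isLinear₃ _ _).map_add]),
   fun _ _ => coords_inj (by
    simp only [coords_smul, coords_curv_self, (lcurv_isLinear₃ _ _).map_smul])⟩

lemma inner_curv_skew (u v w t : TangentSpace (𝓡 n) q) :
    (inner ℝ (curv q u v w) t : ℝ) = -inner ℝ (curv q u v t) w := by
  have hs := mem_extChartAt_source (I := 𝓡 n) q
  rw [inner_eq_chartMetric hs, inner_eq_chartMetric hs, coords_curv hs, coords_curv hs,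
    lcurv_skew (eventually_contDiffAt_chartMetric q) (eventually_contDiffAt_christoffelL q)
      (eventually_fderiv_chartMetric q), chartMetric_comm]

lemma inner_dCurv_skew (a u v w t : TangentSpace (𝓡 n) q) :
    (inner ℝ (dCurv q a u v w) t : ℝ) = -inner ℝ (dCurv q a u v t) w := by
  have hs := mem_extChartAt_source (I := 𝓡 n) q
  rw [inner_eq_chartMetric hs, inner_eq_chartMetric hs, coords_dCurv hs, coords_dCurv hs,
    ldcurv_skew (eventually_contDiffAt_chartMetric q) (eventually_contDiffAt_christoffelL q)
      (eventually_fderiv_chartMetric q), chartMetric_comm]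

lemma dCurv_bianchi (a b c d : TangentSpace (𝓡 n) q) :
    dCurv q a b c d + dCurv q b c a d + dCurv q c a b d = 0 :=
  coords_inj (by
    simp only [coords_add, coords_dCurv_self, coords_zero]
    exact ldcurv_bianchi (eventually_contDiffAt_christoffelL q).self_of_nhds
      (eventually_christoffelL_comm q) _ _ _ _)

lemma ldcurv_swap {E : Type*} [NormedAddCommGroup E] [NormedSpace ℝ E]
    {Γ : E → E →L[ℝ] E →L[ℝ] E} (z a b c d : E) : ldcurv Γ z a c b d = -ldcurv Γ z a b c d := by
  simp only [ldcurv, fderiv_fun_neg, lcurv_swap b c d, lcurv_swap b (Γ z a c),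
    lcurv_swap (Γ z a b) c, lcurv_swap b c (Γ z a d), map_neg, neg_apply]
  abel

/-- The first Bianchi identity holds near z, so it passes to the covariant derivative of the
curvature. -/
lemma ldcurv_bianchi_right {E : Type*} [NormedAddCommGroup E] [NormedSpace ℝ E]
    {Γ : E → E →L[ℝ] E →L[ℝ] E} {z : E} (hΓ : ∀ᶠ y in 𝓝 z, ContDiffAt ℝ ∞ Γ y)
    (hs : ∀ᶠ y in 𝓝 z, ∀ a b, Γ y a b = Γ y b a) (a b c d : E) :
    ldcurv Γ z a b c d + ldcurv Γ z a c d b + ldcurv Γ z a d b c = 0 := by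
  have hd : ∀ b c d, DifferentiableAt ℝ (fun z => lcurv Γ z b c d) z := fun b c d =>
    differentiableAt_of_infty (contDiffAt_lcurv (F := id) hΓ.self_of_nhds contDiffAt_id
      contDiffAt_const contDiffAt_const contDiffAt_const)
  have hb : ∀ b c d, lcurv Γ z b c d + lcurv Γ z c d b + lcurv Γ z d b c = 0 :=
    fun b c d => lcurv_bianchi hΓ.self_of_nhds hs b c d
  have e : (fun z => lcurv Γ z b c d + lcurv Γ z c d b + lcurv Γ z d b c) =ᶠ[𝓝 z] fun _ => 0 := by
    filter_upwards [hΓ, hs.eventually_nhds] with y h1 h2 using lcurv_bianchi h1 h2 b c d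
  have h := congrArg (fun L => L a) (e.fderiv_eq (𝕜 := ℝ))
  have k := ((hd b c d).hasFDerivAt.add (hd c d b).hasFDerivAt).add (hd d b c).hasFDerivAt
  have h' : fderiv ℝ (fun z => lcurv Γ z b c d) z a + fderiv ℝ (fun z => lcurv Γ z c d b) z a
      + fderiv ℝ (fun z => lcurv Γ z d b c) z a = 0 := by
    have k2 := congrArg (fun L => L a) k.fderiv
    refine (k2.symm.trans h).trans ?_
    simp
  have hΓb := congrArg (Γ z a) (hb b c d)
  simp only [map_add, map_zero] at hΓb
  -- Terms are grouped by the argument that carries the Christoffel correction. Each group is an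
  -- instance of the first Bianchi identity, up to the differentiation or the application of Γ
  -- already performed.
  calc _ = (fderiv ℝ (fun z => lcurv Γ z b c d) z a + fderiv ℝ (fun z => lcurv Γ z c d b) z a
      + fderiv ℝ (fun z => lcurv Γ z d b c) z a)
      + (Γ z a (lcurv Γ z b c d) + Γ z a (lcurv Γ z c d b) + Γ z a (lcurv Γ z d b c))
      - (lcurv Γ z (Γ z a b) c d + lcurv Γ z c d (Γ z a b) + lcurv Γ z d (Γ z a b) c)
      - (lcurv Γ z b (Γ z a c) d + lcurv Γ z (Γ z a c) d b + lcurv Γ z d b (Γ z a c))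
      - (lcurv Γ z b c (Γ z a d) + lcurv Γ z c (Γ z a d) b + lcurv Γ z (Γ z a d) b c) := by
        simp only [ldcurv]; abel
    _ = 0 := by rw [h', hΓb, hb, hb, hb]; simp

lemma dCurv_swap (a u v w : TangentSpace (𝓡 n) q) : dCurv q a v u w = -dCurv q a u v w :=
  coords_inj (by rw [coords_neg, coords_dCurv_self, coords_dCurv_self, ldcurv_swap])

lemma dCurv_bianchi_right (a b c d : TangentSpace (𝓡 n) q) :
    dCurv q a b c d + dCurv q a c d b + dCurv q a d b c = 0 :=
  coords_inj (by
    simp only [coords_add, coords_dCurv_self, coords_zero]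
    exact ldcurv_bianchi_right (eventually_contDiffAt_christoffelL q)
      (eventually_christoffelL_comm q) _ _ _ _)

/-- The pair symmetry of an algebraic curvature tensor. -/
lemma pair_symm_of_bianchi {V : Type*} {R : V → V → V → V → ℝ}
    (h₁ : ∀ a b c d, R b a c d = -R a b c d) (h₂ : ∀ a b c d, R a b c d = -R a b d c)
    (h₃ : ∀ a b c d, R a b c d + R b c a d + R c a b d = 0) (a b c d : V) :
    R a b c d = R c d a b := by
  -- The octahedron argument: a combination of four cyclic sums, in which the two skew-symmetries
  -- cancel all terms except the two to be compared.
  linarith [h₃ a b c d, h₃ b c d a, h₃ c d a b, h₃ d a b c, h₁ a b c d, h₂ a b c d,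
    h₁ b c a d, h₂ b c a d, h₁ c a b d, h₂ c a b d, h₁ c d b a, h₂ c d b a, h₁ d b c a, h₂ d b c a,
    h₁ d a c b, h₂ d a c b, h₁ a c d b, h₂ a c d b, h₁ a b d c, h₂ b d a c, h₁ b d a c]

lemma inner_curv_pair_symm (a b c d : TangentSpace (𝓡 n) q) :
    (inner ℝ (curv q a b c) d : ℝ) = inner ℝ (curv q c d a) b :=
  pair_symm_of_bianchi (R := fun a b c d => (inner ℝ (curv q a b c) d : ℝ))
    (fun a b c d => by simp only [curv_swap a b c, inner_neg_left])
    (fun a b c d => inner_curv_skew a b c d)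
    (fun a b c d => by simp only [← inner_add_left, curv_bianchi, inner_zero_left]) a b c d

lemma inner_dCurv_pair_symm (e a b c d : TangentSpace (𝓡 n) q) :
    (inner ℝ (dCurv q e a b c) d : ℝ) = inner ℝ (dCurv q e c d a) b :=
  pair_symm_of_bianchi (R := fun a b c d => (inner ℝ (dCurv q e a b c) d : ℝ))
    (fun a b c d => by simp only [dCurv_swap e a b c, inner_neg_left])
    (fun a b c d => inner_dCurv_skew e a b c d)
    (fun a b c d => by simp only [← inner_add_left, dCurv_bianchi_right, inner_zero_left]) a b c d

end CurvatureIdentities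

/-! ### Metric traces: frame independence, smoothness and differentiation. -/

section MetricTrace

variable {m : ℕ} {M : Type*} [TopologicalSpace M] [ChartedSpace (Model m) M]
  [RiemannianBundle (fun x : M => TangentSpace (𝓡 m) x)]

/-- Bilinearity of a map of two variables. -/
def Bilin {V F : Type*} [AddCommGroup V] [Module ℝ V] [AddCommGroup F] [Module ℝ F]
    (B : V → V → F) : Prop :=
  (∀ v, IsLinearMap ℝ fun u => B u v) ∧ ∀ u, IsLinearMap ℝ (B u)

lemma _root_.IsLinearMap.map_sum' {V F ι : Type*} [AddCommGroup V] [Module ℝ V] [AddCommGroup F]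
    [Module ℝ F] {f : V → F} (hf : IsLinearMap ℝ f) (s : Finset ι) (c : ι → ℝ) (v : ι → V) :
    f (∑ i ∈ s, c i • v i) = ∑ i ∈ s, c i • f (v i) := by
  have := map_sum (hf.mk' f) (fun i => c i • v i) s
  simpa only [IsLinearMap.mk'_apply, hf.map_smul] using this

variable {p : M}

section Algebra

variable {F : Type*} [AddCommGroup F] {B C : TangentSpace (𝓡 m) p → TangentSpace (𝓡 m) p → F}

lemma metricTrace_congr (h : ∀ v, B v v = C v v) : metricTrace p B = metricTrace p C :=
  Finset.sum_congr rfl fun _ _ => h _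

lemma metricTrace_add :
    metricTrace p (fun u v => B u v + C u v) = metricTrace p B + metricTrace p C :=
  Finset.sum_add_distrib

lemma metricTrace_sub :
    metricTrace p (fun u v => B u v - C u v) = metricTrace p B - metricTrace p C :=
  Finset.sum_sub_distrib _ _

lemma metricTrace_neg : metricTrace p (fun u v => -B u v) = -metricTrace p B :=
  Finset.sum_neg_distrib _

lemma metricTrace_smul [Module ℝ F] (r : ℝ) :
    metricTrace p (fun u v => r • B u v) = r • metricTrace p B :=
  Finset.smul_sum.symm

lemma metricTrace_zero : metricTrace p (fun _ _ : TangentSpace (𝓡 m) p => (0 : F)) = 0 := Finset.sum_const_zero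

lemma metricTrace_const_mul (r : ℝ) (B : TangentSpace (𝓡 m) p → TangentSpace (𝓡 m) p → ℝ) :
    metricTrace p (fun u v => r * B u v) = r * metricTrace p B :=
  (Finset.mul_sum _ _ _).symm

lemma metricTrace_comm {M' : Type*} {m' : ℕ} [TopologicalSpace M'] [ChartedSpace (Model m') M']
    [RiemannianBundle (fun x : M' => TangentSpace (𝓡 m') x)] {p' : M'}
    (B : TangentSpace (𝓡 m) p → TangentSpace (𝓡 m) p →
      TangentSpace (𝓡 m') p' → TangentSpace (𝓡 m') p' → F) :
    metricTrace p (fun u u' => metricTrace p' (B u u')) =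
      metricTrace p' (fun w w' => metricTrace p fun u u' => B u u' w w') :=
  Finset.sum_comm

lemma inner_metricTrace_left {V : Type*} [NormedAddCommGroup V] [InnerProductSpace ℝ V]
    (B : TangentSpace (𝓡 m) p → TangentSpace (𝓡 m) p → V) (v : V) :
    (inner ℝ (metricTrace p B) v : ℝ) = metricTrace p fun u u' => inner ℝ (B u u') v :=
  sum_inner _ _ _

end Algebra

lemma sum_inner_smul_basis (v : TangentSpace (𝓡 m) p) :
    ∑ k, (inner ℝ v (stdOrthonormalBasis ℝ (TangentSpace (𝓡 m) p) k) : ℝ) •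
      stdOrthonormalBasis ℝ (TangentSpace (𝓡 m) p) k = v := by
  simp only [fun k => real_inner_comm (stdOrthonormalBasis ℝ (TangentSpace (𝓡 m) p) k) v]
  exact (stdOrthonormalBasis ℝ (TangentSpace (𝓡 m) p)).sum_repr' v

/-- The Riesz representation of a linear form. -/
lemma inner_metricTrace_smul {L : TangentSpace (𝓡 m) p → ℝ} (hL : IsLinearMap ℝ L)
    (v : TangentSpace (𝓡 m) p) :
    (inner ℝ (metricTrace p fun w w' => L w • w') v : ℝ) = L v := by
  rw [inner_metricTrace_left]
  conv_rhs => rw [← sum_inner_smul_basis v]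
  rw [hL.map_sum']
  refine Finset.sum_congr rfl fun k _ => ?_
  rw [smul_eq_mul, mul_comm, real_inner_comm]
  exact real_inner_smul_left _ _ _

/-- `Tr B(S·,·)` for a symmetric `S`. -/
lemma metricTrace_selfAdjoint {F : Type*} [AddCommGroup F] [Module ℝ F]
    {B : TangentSpace (𝓡 m) p → TangentSpace (𝓡 m) p → F} (hB : Bilin B)
    {S : TangentSpace (𝓡 m) p → TangentSpace (𝓡 m) p}
    (hS : ∀ v w, (inner ℝ (S v) w : ℝ) = inner ℝ v (S w)) :
    metricTrace p (fun u v => B (S u) v) = metricTrace p fun u v => B u (S v) := by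
  set e := stdOrthonormalBasis ℝ (TangentSpace (𝓡 m) p) with he
  change ∑ k, B (S (e k)) (e k) = ∑ k, B (e k) (S (e k))
  have h1 : ∀ k, B (S (e k)) (e k) = ∑ l, (inner ℝ (S (e k)) (e l) : ℝ) • B (e l) (e k) := fun k => by
    conv_lhs => rw [← sum_inner_smul_basis (S (e k))]
    exact (hB.1 (e k)).map_sum' _ _ _
  have h2 : ∀ k, B (e k) (S (e k)) = ∑ l, (inner ℝ (S (e k)) (e l) : ℝ) • B (e k) (e l) := fun k => by
    conv_lhs => rw [← sum_inner_smul_basis (S (e k))]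
    exact (hB.2 (e k)).map_sum' _ _ _
  simp only [h1, h2]
  rw [Finset.sum_comm]
  refine Finset.sum_congr rfl fun k _ => Finset.sum_congr rfl fun l _ => ?_
  rw [hS, real_inner_comm]

variable [IsManifold (𝓡 m) ∞ M] {p₀ x : M}

lemma sum_coords_smul (hx : x ∈ (extChartAt (𝓡 m) p₀).source) (v : TangentSpace (𝓡 m) x) :
    ∑ i, coords p₀ x v i • ofCoords p₀ x (stdVec i) = v := by
  conv_rhs => rw [← ofCoords_coords hx v, ← sum_smul_stdVec (coords p₀ x v)]
  simp only [ofCoords_sum, ofCoords_smul]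

lemma sum_inner_mul_coords (v : TangentSpace (𝓡 m) x) (i : Fin m) :
    ∑ k, (inner ℝ v (stdOrthonormalBasis ℝ (TangentSpace (𝓡 m) x) k) : ℝ) *
      coords p₀ x (stdOrthonormalBasis ℝ (TangentSpace (𝓡 m) x) k) i = coords p₀ x v i := by
  conv_rhs => rw [← sum_inner_smul_basis v]
  simp [coords_sum, coords_smul]

/-- The trace with respect to the metric in terms of the coordinate frame. -/
lemma metricTrace_eq_gram {F : Type*} [AddCommGroup F] [Module ℝ F]
    (hx : x ∈ (extChartAt (𝓡 m) p₀).source)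
    {B : TangentSpace (𝓡 m) x → TangentSpace (𝓡 m) x → F} (hB : Bilin B) :
    metricTrace x B = ∑ i, ∑ j, (gram p₀ (extChartAt (𝓡 m) p₀ x))⁻¹ i j •
      B (ofCoords p₀ x (stdVec i)) (ofCoords p₀ x (stdVec j)) := by
  set e := stdOrthonormalBasis ℝ (TangentSpace (𝓡 m) x) with he
  set c : _ → Fin m → ℝ := fun k i => coords p₀ x (e k) i with hc
  -- The inverse Gram matrix is the sum of the products of coordinates of the orthonormal vectors:
  -- contracted with the Gram matrix it gives Parseval's expansion of a coordinate vector.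
  have hinv : (gram p₀ (extChartAt (𝓡 m) p₀ x))⁻¹ = Matrix.of fun i j => ∑ k, c k i * c k j := by
    refine Matrix.inv_eq_right_inv ?_
    ext i l
    rw [Matrix.mul_apply]
    simp only [Matrix.of_apply, gram_apply, Finset.mul_sum]
    rw [Finset.sum_comm]
    have h1 : ∀ k, ∑ j, chartMetric p₀ (extChartAt (𝓡 m) p₀ x) (stdVec i) (stdVec j) *
        (c k j * c k l) = inner ℝ (ofCoords p₀ x (stdVec i)) (e k) * c k l := fun k => by
      rw [inner_eq_chartMetric hx, coords_ofCoords hx,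
        ← sum_smul_stdVec (coords p₀ x (e k)), map_sum, Finset.sum_mul]
      refine Finset.sum_congr rfl fun j _ => ?_
      rw [map_smul, smul_eq_mul]
      simp only [hc]
      ring
    simp only [h1]
    refine (sum_inner_mul_coords _ l).trans ?_
    rw [coords_ofCoords hx, stdVec_apply, Matrix.one_apply]
    simp only [eq_comm]
  have h2 : ∀ k, B (e k) (e k) = ∑ i, ∑ j, (c k i * c k j) •
      B (ofCoords p₀ x (stdVec i)) (ofCoords p₀ x (stdVec j)) := fun k => by
    conv_lhs => rw [← sum_coords_smul hx (e k)]
    rw [(hB.1 _).map_sum']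
    refine Finset.sum_congr rfl fun i _ => ?_
    rw [(hB.2 _).map_sum', Finset.smul_sum]
    refine Finset.sum_congr rfl fun j _ => ?_
    rw [smul_smul]
  change ∑ k, B (e k) (e k) = _
  simp only [h2, hinv, Matrix.of_apply]
  rw [Finset.sum_comm]
  refine Finset.sum_congr rfl fun i _ => ?_
  rw [Finset.sum_comm]
  refine Finset.sum_congr rfl fun j _ => ?_
  rw [Finset.sum_smul]

/-- The trace of an endomorphism in terms of the coordinate frame. -/
lemma metricTrace_inner_eq_sum_coords (hx : x ∈ (extChartAt (𝓡 m) p₀).source)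
    {S : TangentSpace (𝓡 m) x → TangentSpace (𝓡 m) x} (hS : IsLinearMap ℝ S) :
    metricTrace x (fun w w' => (inner ℝ (S w) w' : ℝ)) =
      ∑ i, coords p₀ x (S (ofCoords p₀ x (stdVec i))) i := by
  set e := stdOrthonormalBasis ℝ (TangentSpace (𝓡 m) x) with he
  change ∑ k, (inner ℝ (S (e k)) (e k) : ℝ) = _
  have h : ∀ k, (inner ℝ (S (e k)) (e k) : ℝ) =
      ∑ i, inner ℝ (S (ofCoords p₀ x (stdVec i))) (e k) * coords p₀ x (e k) i := fun k => by
    conv_lhs => rw [show S (e k) = ∑ i, coords p₀ x (e k) i • S (ofCoords p₀ x (stdVec i)) by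
      conv_lhs => rw [← sum_coords_smul hx (e k)]
      exact hS.map_sum' _ _ _]
    rw [sum_inner]
    exact Finset.sum_congr rfl fun i _ => by rw [real_inner_smul_left, mul_comm]
  simp only [h]
  rw [Finset.sum_comm]
  exact Finset.sum_congr rfl fun i _ => sum_inner_mul_coords _ i

/-- Cyclicity of the trace. In `dirD_metricTrace_inner` it cancels the two Christoffel corrections
in the covariant derivative of an endomorphism. -/
lemma sum_apply_comm {A B : Model m → Model m} (hA : IsLinearMap ℝ A) (hB : IsLinearMap ℝ B) :
    ∑ i, A (B (stdVec i)) i = ∑ i, B (A (stdVec i)) i := by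
  have h : ∀ {A B : Model m → Model m}, IsLinearMap ℝ A → ∀ i,
      A (B (stdVec i)) i = ∑ j, B (stdVec i) j * A (stdVec j) i := by
    intro A B hA i
    conv_lhs => rw [← sum_smul_stdVec (B (stdVec i)), hA.map_sum']
    simp
  simp only [h hA, h hB]
  rw [Finset.sum_comm]
  exact Finset.sum_congr rfl fun i _ => Finset.sum_congr rfl fun j _ => mul_comm _ _

section Smoothness

variable [IsContMDiffRiemannianBundle (𝓡 m) ∞ (Model m) (fun x : M => TangentSpace (𝓡 m) x)]
  {E' H' P : Type*} [NormedAddCommGroup E'] [NormedSpace ℝ E']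
  [TopologicalSpace H'] {I : ModelWithCorners ℝ E' H'} [TopologicalSpace P] [ChartedSpace H' P]
  {pr : P → M} {x₀ : P}

lemma extendVec_ofCoords (p : M) (a : Model m) (x : M) :
    extendVec p (ofCoords p p a) x = ofCoords p x a := by
  rw [extendVec, coords_ofCoords (mem_extChartAt_source p)]

lemma contMDiffAt_gram_inv_comp (hpr : ContMDiffAt I (𝓡 m) ∞ pr x₀) (i j : Fin m) :
    ContMDiffAt I 𝓘(ℝ, ℝ) ∞
      (fun x => (gram (pr x₀) (extChartAt (𝓡 m) (pr x₀) (pr x)))⁻¹ i j) x₀ := by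
  have hs := mem_extChartAt_source (I := 𝓡 m) (pr x₀)
  exact (contDiffAt_gram_inv (pr x₀)
    ((extChartAt (𝓡 m) (pr x₀)).map_source hs) i j).contMDiffAt.comp x₀
    (contMDiffAt_extChartAt_comp hpr hs)

/-- The orthonormal basis in `metricTrace` is chosen point by point, without any continuity.
Smoothness is therefore read off from the coordinate frame and the inverse Gram matrix, which vary
smoothly. -/
lemma contMDiffAt_metricTrace (hpr : ContMDiffAt I (𝓡 m) ∞ pr x₀)
    {B : ∀ x, TangentSpace (𝓡 m) (pr x) → TangentSpace (𝓡 m) (pr x) → ℝ}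
    (hB : ∀ᶠ x in 𝓝 x₀, Bilin (B x))
    (hs : ∀ v w : TangentSpace (𝓡 m) (pr x₀), ContMDiffAt I 𝓘(ℝ, ℝ) ∞
      (fun x => B x (extendVec (pr x₀) v (pr x)) (extendVec (pr x₀) w (pr x))) x₀) :
    ContMDiffAt I 𝓘(ℝ, ℝ) ∞ (fun x => metricTrace (pr x) (B x)) x₀ := by
  have hq := mem_extChartAt_source (I := 𝓡 m) (pr x₀)
  have h : ContMDiffAt I 𝓘(ℝ, ℝ) ∞ (fun x => ∑ i, ∑ j,
      (gram (pr x₀) (extChartAt (𝓡 m) (pr x₀) (pr x)))⁻¹ i j •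
      B x (ofCoords (pr x₀) (pr x) (stdVec i)) (ofCoords (pr x₀) (pr x) (stdVec j))) x₀ := by
    refine contMDiffAt_finsetSum fun i _ => contMDiffAt_finsetSum fun j _ => ?_
    refine (contMDiffAt_gram_inv_comp hpr i j).smul ?_
    simpa only [extendVec_ofCoords] using hs (ofCoords (pr x₀) _ (stdVec i)) (ofCoords (pr x₀) _ (stdVec j))
  refine h.congr_of_eventuallyEq ?_
  filter_upwards [hB, hpr.continuousAt.eventually
    ((isOpen_extChartAt_source (I := 𝓡 m) (pr x₀)).mem_nhds hq)] with x h1 h2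
  exact metricTrace_eq_gram h2 h1

variable {n : ℕ} {N : Type*} [TopologicalSpace N] [ChartedSpace (Model n) N]
  [IsManifold (𝓡 n) ∞ N] {g : P → N}

lemma smoothSectionAt_metricTrace (hpr : ContMDiffAt I (𝓡 m) ∞ pr x₀)
    (hg : ContMDiffAt I (𝓡 n) ∞ g x₀)
    {B : ∀ x, TangentSpace (𝓡 m) (pr x) → TangentSpace (𝓡 m) (pr x) → TangentSpace (𝓡 n) (g x)}
    (hB : ∀ᶠ x in 𝓝 x₀, Bilin (B x))
    (hs : ∀ v w : TangentSpace (𝓡 m) (pr x₀), SmoothSectionAt I g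
      (fun x => B x (extendVec (pr x₀) v (pr x)) (extendVec (pr x₀) w (pr x))) x₀) :
    SmoothSectionAt I g (fun x => metricTrace (pr x) (B x)) x₀ := by
  have hq := mem_extChartAt_source (I := 𝓡 m) (pr x₀)
  have h : SmoothSectionAt I g (fun x => ∑ i, ∑ j,
      (gram (pr x₀) (extChartAt (𝓡 m) (pr x₀) (pr x)))⁻¹ i j •
      B x (ofCoords (pr x₀) (pr x) (stdVec i)) (ofCoords (pr x₀) (pr x) (stdVec j))) x₀ := by
    refine smoothSectionAt_sum hg _ fun i _ => smoothSectionAt_sum hg _ fun j _ => ?_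
    refine SmoothSectionAt.smul (contMDiffAt_gram_inv_comp hpr i j) ?_
    simpa only [extendVec_ofCoords] using hs (ofCoords (pr x₀) _ (stdVec i)) (ofCoords (pr x₀) _ (stdVec j))
  refine h.congr ?_
  filter_upwards [hB, hpr.continuousAt.eventually
    ((isOpen_extChartAt_source (I := 𝓡 m) (pr x₀)).mem_nhds hq)] with x h1 h2
  exact metricTrace_eq_gram h2 h1

end Smoothness

section DerivativeOfTrace

variable [IsContMDiffRiemannianBundle (𝓡 m) ∞ (Model m) (fun x : M => TangentSpace (𝓡 m) x)]

/-- The derivative of the trace of an endomorphism is the trace of its covariant derivative. -/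
lemma dirD_metricTrace_inner {S : ∀ x : M, TangentSpace (𝓡 m) x → TangentSpace (𝓡 m) x}
    (hS : ∀ x, IsLinearMap ℝ (S x))
    (hs : ∀ w : TangentSpace (𝓡 m) p, SmoothFieldAt (fun x => S x (extendVec p w x)) p)
    (z : TangentSpace (𝓡 m) p) :
    dirD (𝓡 m) (fun x => metricTrace x fun w w' => (inner ℝ (S x w) w' : ℝ)) p z =
      metricTrace p fun w w' => inner ℝ (covD (𝓡 m) (fun x : M => x)
          (fun x => S x (extendVec p w x)) p z
        - S p (covD (𝓡 m) (fun x : M => x) (extendVec p w) p z)) w' := by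
  have hp := mem_extChartAt_source (I := 𝓡 m) p
  have he : ∀ w, SmoothFieldAt (extendVec p w) p := fun w => smoothFieldAt_extendVec hp w
  have hid : ∀ z : TangentSpace (𝓡 m) p, mfderiv (𝓡 m) (𝓡 m) (fun x : M => x) p z = z := fun z => by
    exact congrArg (fun L => L z) (mfderiv_id (I := 𝓡 m) (x := p))
  have hw : ∀ w, coords p p (covD (𝓡 m) (fun x : M => x) (extendVec p w) p z) =
      christoffelL p (extChartAt (𝓡 m) p p) (coords p p z) (coords p p w) := fun w => by
    refine (coords_covD (he w) hp z).trans ?_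
    rw [hid, extendVec_self, dirD_congr (u' := fun _ => coords p p w), dirD_const, zero_add]
    filter_upwards [(isOpen_extChartAt_source (I := 𝓡 m) p).mem_nhds hp] with y hy
      using coords_extendVec hy w
  have hsm : ∀ i : Fin m, MDifferentiableAt (𝓡 m) 𝓘(ℝ, Model m)
      (fun x => coords p x (S x (ofCoords p x (stdVec i)))) p := fun i => by
    have := ((hs (ofCoords p p (stdVec i))).contMDiffAt_coords hp).mdifferentiableAt (by simp)
    simpa only [extendVec_ofCoords] using this
  -- Written as the sum of the diagonal coordinates, the trace of an endomorphism no longer involves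
  -- the metric, so no derivative of the Gram matrix occurs.
  have e : (fun x => metricTrace x fun w w' => (inner ℝ (S x w) w' : ℝ)) =ᶠ[𝓝 p]
      fun x => ∑ i, coords p x (S x (ofCoords p x (stdVec i))) i := by
    filter_upwards [(isOpen_extChartAt_source (I := 𝓡 m) p).mem_nhds hp] with y hy
      using metricTrace_inner_eq_sum_coords hy (hS y)
  have hlin : IsLinearMap ℝ fun w => covD (𝓡 m) (fun x : M => x)
      (fun x => S x (extendVec p w x)) p z
        - S p (covD (𝓡 m) (fun x : M => x) (extendVec p w) p z) := by
    have ea : ∀ (v w : TangentSpace (𝓡 m) p) (x : M), extendVec p (v + w) x = extendVec p v x + extendVec p w x := fun v w x => by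
      simp only [extendVec, coords_add, ofCoords_add]
    have es : ∀ (r : ℝ) (w : TangentSpace (𝓡 m) p) (x : M), extendVec p (r • w) x = r • extendVec p w x := fun v w x => by
      simp only [extendVec, coords_smul, ofCoords_smul]
    refine ⟨fun v w => ?_, fun r w => ?_⟩
    · have h1 : extendVec p (v + w) = fun x => extendVec p v x + extendVec p w x :=
        funext (ea v w)
      simp only [ea, (hS _).map_add]
      rw [covD_add (hs v) (hs w), h1, covD_add (he v) (he w), (hS p).map_add]
      abel
    · have h1 : extendVec p (r • w) = fun x => r • extendVec p w x := funext (es r w)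
      simp only [es, (hS _).map_smul]
      rw [covD_const_smul r (hs w), h1, covD_const_smul r (he w), (hS p).map_smul, smul_sub]
  rw [dirD_congr e, metricTrace_inner_eq_sum_coords hp hlin]
  set Γz : Model m → Model m := fun a => christoffelL p (extChartAt (𝓡 m) p p) (coords p p z) a
  have hΓz : IsLinearMap ℝ Γz := ⟨fun a b => map_add _ _ _, fun r a => map_smul _ _ _⟩
  have hSp : IsLinearMap ℝ fun a => coords p p (S p (ofCoords p p a)) :=
    ⟨fun a b => by simp only [ofCoords_add, (hS p).map_add, coords_add],
      fun r a => by simp only [ofCoords_smul, (hS p).map_smul, coords_smul]⟩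
  have h1 : ∀ i : Fin m, coords p p (covD (𝓡 m) (fun x : M => x)
      (fun x => S x (extendVec p (ofCoords p p (stdVec i)) x)) p z
        - S p (covD (𝓡 m) (fun x : M => x) (extendVec p (ofCoords p p (stdVec i))) p z)) =
      dirD (𝓡 m) (fun x => coords p x (S x (ofCoords p x (stdVec i)))) p z
        + Γz (coords p p (S p (ofCoords p p (stdVec i))))
        - coords p p (S p (ofCoords p p (Γz (stdVec i)))) := fun i => by
    have h2 := coords_covD (hs (ofCoords p p (stdVec i))) hp z
    rw [hid, extendVec_self] at h2
    rw [coords_sub, h2]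
    simp only [extendVec_ofCoords]
    congr 3
    rw [← ofCoords_coords hp (covD (𝓡 m) (fun x : M => x) _ p z), hw, coords_ofCoords hp]
  simp only [h1]
  have h3 : dirD (𝓡 m) (fun x => ∑ i, coords p x (S x (ofCoords p x (stdVec i))) i) p z =
      ∑ i, dirD (𝓡 m) (fun x => coords p x (S x (ofCoords p x (stdVec i)))) p z i := by
    have hsum : ∀ s : Finset (Fin m), MDifferentiableAt (𝓡 m) 𝓘(ℝ, ℝ)
          (fun x => ∑ i ∈ s, coords p x (S x (ofCoords p x (stdVec i))) i) p ∧
        dirD (𝓡 m) (fun x => ∑ i ∈ s, coords p x (S x (ofCoords p x (stdVec i))) i) p z =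
        ∑ i ∈ s, dirD (𝓡 m) (fun x => coords p x (S x (ofCoords p x (stdVec i)))) p z i := by
      intro s
      have hK : ∀ i : Fin m, MDifferentiableAt (𝓡 m) 𝓘(ℝ, ℝ)
          (fun x => coords p x (S x (ofCoords p x (stdVec i))) i) p := fun i =>
        ((EuclideanSpace.proj (𝕜 := ℝ) i).differentiableAt.mdifferentiableAt).comp p (hsm i)
      classical
      induction s using Finset.induction_on with
      | empty =>
        simp only [Finset.sum_empty]
        exact ⟨mdifferentiableAt_const, dirD_const _ _⟩
      | insert i s hi ih =>
        simp only [Finset.sum_insert hi]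
        refine ⟨(hK i).add ih.1, ?_⟩
        rw [dirD_add (hK i) ih.1, ih.2]
        congr 1
        refine (dirD_comp (K := EuclideanSpace.proj (𝕜 := ℝ) i)
          (EuclideanSpace.proj (𝕜 := ℝ) i).differentiableAt (hsm i) z).trans ?_
        rw [ContinuousLinearMap.fderiv]
        rfl
    exact (hsum Finset.univ).2
  rw [h3]
  have h4 := sum_apply_comm hΓz hSp
  simp only [PiLp.sub_apply, PiLp.add_apply, Finset.sum_sub_distrib, Finset.sum_add_distrib]
  rw [h4]
  ring

end DerivativeOfTrace

end MetricTrace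

/-! ### Slices of maps on a product of normed spaces. -/

section LocalFamilies

variable {P Q E : Type*} [NormedAddCommGroup P] [NormedSpace ℝ P] [NormedAddCommGroup Q]
  [NormedSpace ℝ Q] [NormedAddCommGroup E] [NormedSpace ℝ E] {Γ : E → E →L[ℝ] E →L[ℝ] E}

lemma lcov_fderiv_field {F : P → E} {x : P} (hF : ContDiffAt ℝ ∞ F x) {v : P → P}
    (hv : DifferentiableAt ℝ v x) (u : P) :
    lcov Γ F (fun y => fderiv ℝ F y (v y)) x u =
      lcov Γ F (fun y => fderiv ℝ F y (v x)) x u + fderiv ℝ F x (fderiv ℝ v x u) := by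
  have h : HasFDerivAt (fderiv ℝ F) _ x := hasFDerivAt_of_infty (hF.fderiv_right (m := ∞) (by simp))
  rw [lcov, (h.clm_apply hv.hasFDerivAt).fderiv, lcov, fderiv_fderiv_apply hF]
  simp only [add_apply, ContinuousLinearMap.comp_apply, ContinuousLinearMap.flip_apply]
  abel

lemma fderiv_slice {X : Type*} [NormedAddCommGroup X] [NormedSpace ℝ X] {F : Q × P → X} {t : Q}
    {z : P} (hF : DifferentiableAt ℝ F (t, z)) (a : P) :
    fderiv ℝ (fun z => F (t, z)) z a = fderiv ℝ F (t, z) (0, a) := by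
  have h : HasFDerivAt (fun z => F (t, z)) _ z :=
    hF.hasFDerivAt.comp z ((hasFDerivAt_const t z).prodMk (hasFDerivAt_id z))
  rw [h.fderiv]
  simp

lemma fderiv_slice_left {X : Type*} [NormedAddCommGroup X] [NormedSpace ℝ X] {F : Q × P → X} {t : Q}
    {z : P} (hF : DifferentiableAt ℝ F (t, z)) (a : Q) :
    fderiv ℝ (fun t => F (t, z)) t a = fderiv ℝ F (t, z) (a, 0) := by
  have h : HasFDerivAt (fun t => F (t, z)) _ t :=
    hF.hasFDerivAt.comp t (f := fun t => (t, z)) ((hasFDerivAt_id t).prodMk (hasFDerivAt_const z t))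
  rw [h.fderiv]
  simp

/-- Together with `lcov_slice_left`, this turns space and time derivatives of a family into
directional derivatives of one map on the product, so that the general commutation rules apply to
them. -/
lemma lcov_slice {F Y : Q × P → E} {t : Q} {z : P} (hF : DifferentiableAt ℝ F (t, z))
    (hY : DifferentiableAt ℝ Y (t, z)) (a : P) :
    lcov Γ (fun z => F (t, z)) (fun z => Y (t, z)) z a = lcov Γ F Y (t, z) (0, a) := by
  rw [lcov, lcov, fderiv_slice hF, fderiv_slice hY]

lemma lcov_slice_left {F Y : Q × P → E} {t : Q} {z : P} (hF : DifferentiableAt ℝ F (t, z))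
    (hY : DifferentiableAt ℝ Y (t, z)) (a : Q) :
    lcov Γ (fun t => F (t, z)) (fun t => Y (t, z)) t a = lcov Γ F Y (t, z) (a, 0) := by
  rw [lcov, lcov, fderiv_slice_left hF, fderiv_slice_left hY]

end LocalFamilies

/-! ### Second fundamental form and second covariant derivative: tensoriality and chart formulas. -/

section Hessians

variable {n : ℕ} {N : Type*} [TopologicalSpace N] [ChartedSpace (Model n) N]
  [IsManifold (𝓡 n) ∞ N] [RiemannianBundle (fun x : N => TangentSpace (𝓡 n) x)]
  [IsContMDiffRiemannianBundle (𝓡 n) ∞ (Model n) (fun x : N => TangentSpace (𝓡 n) x)]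
  {m : ℕ} {M : Type*} [TopologicalSpace M] [ChartedSpace (Model m) M] [IsManifold (𝓡 m) ∞ M]
  {f : M → N} {p₀ p x : M} {q : N}

lemma coords_dmap (hf : ContMDiffAt (𝓡 m) (𝓡 n) ∞ f p)
    (hp : p ∈ (extChartAt (𝓡 m) p₀).source) (hq : f p ∈ (extChartAt (𝓡 n) q).source)
    (v : TangentSpace (𝓡 m) p) :
    coords q (f p) (dmap m n f p v) =
      fderiv ℝ (mapRep (n := n) p₀ q f) (extChartAt (𝓡 m) p₀ p) (coords p₀ p v) :=
  (fderiv_mapRep hf hp hq v).symm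

lemma secRep_dmap_eventuallyEq (hf : ∀ᶠ x in 𝓝 p, ContMDiffAt (𝓡 m) (𝓡 n) ∞ f x)
    (hp : p ∈ (extChartAt (𝓡 m) p₀).source) (hq : f p ∈ (extChartAt (𝓡 n) q).source)
    (A : ∀ x : M, TangentSpace (𝓡 m) x) :
    secRep p₀ q f (fun x => dmap m n f x (A x)) =ᶠ[𝓝 (extChartAt (𝓡 m) p₀ p)] fun z =>
      fderiv ℝ (mapRep (n := n) p₀ q f) z (fieldRep p₀ A z) := by
  filter_upwards [eventually_symm_mem hf.self_of_nhds.continuousAt hp hq, eventually_chart hf hp]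
    with z hz h
  have := coords_dmap (p₀ := p₀) h ((extChartAt (𝓡 m) p₀).map_target hz.1) hz.2
    (A ((extChartAt (𝓡 m) p₀).symm z))
  rw [(extChartAt (𝓡 m) p₀).right_inv hz.1] at this
  exact this

lemma contDiffAt_fieldRep (hp : p ∈ (extChartAt (𝓡 m) p₀).source)
    {A : ∀ x : M, TangentSpace (𝓡 m) x} (hA : SmoothFieldAt A p) :
    ContDiffAt ℝ ∞ (fieldRep p₀ A) (extChartAt (𝓡 m) p₀ p) := (smoothFieldAt_iff hp).1 hA

lemma smoothSectionAt_dmap (hf : ∀ᶠ x in 𝓝 p, ContMDiffAt (𝓡 m) (𝓡 n) ∞ f x)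
    {A : ∀ x : M, TangentSpace (𝓡 m) x} (hA : SmoothFieldAt A p) :
    SmoothSectionAt (𝓡 m) f (fun x => dmap m n f x (A x)) p := by
  have hp := mem_extChartAt_source (I := 𝓡 m) p
  have hq := mem_extChartAt_source (I := 𝓡 n) (f p)
  rw [smoothSectionAt_iff hf.self_of_nhds hp hq]
  exact (contDiffAt_fderiv_apply (contDiffAt_mapRep hf.self_of_nhds hp hq)
    (contDiffAt_fieldRep hp hA)).congr_of_eventuallyEq (secRep_dmap_eventuallyEq hf hp hq A)

lemma secRep_covD_eventuallyEq {W : ∀ p, TangentSpace (𝓡 n) (f p)}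
    (hW : ∀ᶠ x in 𝓝 p, SmoothSectionAt (𝓡 m) f W x)
    (hp : p ∈ (extChartAt (𝓡 m) p₀).source) (hq : f p ∈ (extChartAt (𝓡 n) q).source)
    (A : ∀ x : M, TangentSpace (𝓡 m) x) :
    secRep p₀ q f (fun x => covD (𝓡 m) f W x (A x)) =ᶠ[𝓝 (extChartAt (𝓡 m) p₀ p)] fun z =>
      lcov (christoffelL q) (mapRep (n := n) p₀ q f) (secRep p₀ q f W) z (fieldRep p₀ A z) := by
  filter_upwards [eventually_symm_mem hW.self_of_nhds.base.continuousAt hp hq,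
    eventually_chart hW hp] with z hz h
  have := coords_covD_chart (p₀ := p₀) h ((extChartAt (𝓡 m) p₀).map_target hz.1) hz.2
    (A ((extChartAt (𝓡 m) p₀).symm z))
  rw [(extChartAt (𝓡 m) p₀).right_inv hz.1] at this
  exact this

lemma smoothSectionAt_covD {W : ∀ p, TangentSpace (𝓡 n) (f p)}
    (hW : ∀ᶠ x in 𝓝 p, SmoothSectionAt (𝓡 m) f W x)
    {A : ∀ x : M, TangentSpace (𝓡 m) x} (hA : SmoothFieldAt A p) :
    SmoothSectionAt (𝓡 m) f (fun x => covD (𝓡 m) f W x (A x)) p := by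
  have hp := mem_extChartAt_source (I := 𝓡 m) p
  have hq := mem_extChartAt_source (I := 𝓡 n) (f p)
  have hf := hW.self_of_nhds.base
  rw [smoothSectionAt_iff hf hp hq]
  refine ContDiffAt.congr_of_eventuallyEq ?_ (secRep_covD_eventuallyEq hW hp hq A)
  refine contDiffAt_lcov (v := fieldRep p A) ?_ (contDiffAt_mapRep hf hp hq)
    ((smoothSectionAt_iff hf hp hq).1 hW.self_of_nhds) (contDiffAt_fieldRep hp hA)
  rw [mapRep_apply hp]
  exact contDiffAt_christoffelL _ ((extChartAt (𝓡 n) (f p)).map_source hq)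

variable [RiemannianBundle (fun x : M => TangentSpace (𝓡 m) x)]
  [IsContMDiffRiemannianBundle (𝓡 m) ∞ (Model m) (fun x : M => TangentSpace (𝓡 m) x)]

lemma coords_covD_id (hp : p ∈ (extChartAt (𝓡 m) p₀).source)
    {V : ∀ x : M, TangentSpace (𝓡 m) x} (hV : SmoothFieldAt V p) (u : TangentSpace (𝓡 m) p) :
    coords p₀ p (covD (𝓡 m) (fun x : M => x) V p u) =
      fderiv ℝ (fieldRep p₀ V) (extChartAt (𝓡 m) p₀ p) (coords p₀ p u) +
      christoffelL p₀ (extChartAt (𝓡 m) p₀ p) (coords p₀ p u) (coords p₀ p (V p)) := by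
  refine (coords_covD_chart (f := fun y : M => y) hV hp hp u).trans ?_
  have h := mapRep_id_eventuallyEq hp
  rw [lcov, h.fderiv_eq, h.eq_of_nhds, fderiv_id]
  rw [secRep_apply (f := fun y : M => y) hp]
  rfl

/-- The derivative of V occurs in both terms and cancels, so the outcome depends on V only through
its value at p. -/
lemma coords_hess_field (hf : ∀ᶠ x in 𝓝 p, ContMDiffAt (𝓡 m) (𝓡 n) ∞ f x)
    (hp : p ∈ (extChartAt (𝓡 m) p₀).source) (hq : f p ∈ (extChartAt (𝓡 n) q).source)
    {V : ∀ x : M, TangentSpace (𝓡 m) x} (hV : SmoothFieldAt V p) (u : TangentSpace (𝓡 m) p) :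
    coords q (f p) (covD (𝓡 m) f (fun x => dmap m n f x (V x)) p u
        - dmap m n f p (covD (𝓡 m) (fun x : M => x) V p u)) =
      lcov (christoffelL q) (mapRep (n := n) p₀ q f)
          (fun z => fderiv ℝ (mapRep (n := n) p₀ q f) z (coords p₀ p (V p)))
          (extChartAt (𝓡 m) p₀ p) (coords p₀ p u)
        - fderiv ℝ (mapRep (n := n) p₀ q f) (extChartAt (𝓡 m) p₀ p)
            (christoffelL p₀ (extChartAt (𝓡 m) p₀ p) (coords p₀ p u) (coords p₀ p (V p))) := by
  have hf0 := hf.self_of_nhds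
  rw [coords_sub, coords_covD_chart (smoothSectionAt_dmap hf hV) hp hq,
    lcov_congr (secRep_dmap_eventuallyEq hf hp hq V), coords_dmap hf0 hp hq, coords_covD_id hp hV,
    lcov_fderiv_field (v := fieldRep p₀ V) (contDiffAt_mapRep hf0 hp hq)
      (differentiableAt_of_infty (contDiffAt_fieldRep hp hV)), map_add, fieldRep_apply hp]
  abel

lemma hessMap_eq (f : M → N) (x : M) (u v : TangentSpace (𝓡 m) x) :
    hessMap m n f x u v = covD (𝓡 m) f (fun y => dmap m n f y (extendVec x v y)) x u
      - dmap m n f x (covD (𝓡 m) (fun y : M => y) (extendVec x v) x u) := by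
  have h := extendVec_self x u
  rw [hessMap, nabla, h]
  rfl

/-- The second fundamental form in an arbitrary pair of charts. -/
lemma coords_hessMap (hf : ∀ᶠ x in 𝓝 p, ContMDiffAt (𝓡 m) (𝓡 n) ∞ f x)
    (hp : p ∈ (extChartAt (𝓡 m) p₀).source) (hq : f p ∈ (extChartAt (𝓡 n) q).source)
    (u v : TangentSpace (𝓡 m) p) :
    coords q (f p) (hessMap m n f p u v) =
      lcov (christoffelL q) (mapRep (n := n) p₀ q f)
          (fun z => fderiv ℝ (mapRep (n := n) p₀ q f) z (coords p₀ p v))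
          (extChartAt (𝓡 m) p₀ p) (coords p₀ p u)
        - fderiv ℝ (mapRep (n := n) p₀ q f) (extChartAt (𝓡 m) p₀ p)
            (christoffelL p₀ (extChartAt (𝓡 m) p₀ p) (coords p₀ p u) (coords p₀ p v)) := by
  have h := coords_hess_field hf hp hq
    (smoothFieldAt_extendVec (mem_extChartAt_source (I := 𝓡 m) p) v) u
  rw [extendVec_self] at h
  rw [hessMap_eq, h]

/-- The definition of `hessMap` uses an extension of v centred at the point itself, which changes
with the point. Tensoriality permits one fixed smooth field instead, as is needed to prove
smoothness in p. -/
lemma hessMap_field (hf : ∀ᶠ x in 𝓝 p, ContMDiffAt (𝓡 m) (𝓡 n) ∞ f x)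
    {V : ∀ x : M, TangentSpace (𝓡 m) x} (hV : SmoothFieldAt V p) (u : TangentSpace (𝓡 m) p) :
    hessMap m n f p u (V p) = covD (𝓡 m) f (fun x => dmap m n f x (V x)) p u
        - dmap m n f p (covD (𝓡 m) (fun x : M => x) V p u) := by
  have hp := mem_extChartAt_source (I := 𝓡 m) p
  have hq := mem_extChartAt_source (I := 𝓡 n) (f p)
  exact coords_inj ((coords_hessMap hf hp hq u (V p)).trans (coords_hess_field hf hp hq hV u).symm)

lemma hessSec_eq (f : M → N) (W : ∀ p, TangentSpace (𝓡 n) (f p)) (x : M)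
    (u v : TangentSpace (𝓡 m) x) :
    hessSec m n f W x u v = covD (𝓡 m) f (fun y => covD (𝓡 m) f W y (extendVec x v y)) x u
      - covD (𝓡 m) f W x (covD (𝓡 m) (fun y : M => y) (extendVec x v) x u) := by
  have h := extendVec_self x u
  rw [hessSec, nabla, h]
  rfl

lemma coords_hessSec_field {W : ∀ p, TangentSpace (𝓡 n) (f p)}
    (hW : ∀ᶠ x in 𝓝 p, SmoothSectionAt (𝓡 m) f W x)
    (hp : p ∈ (extChartAt (𝓡 m) p₀).source) (hq : f p ∈ (extChartAt (𝓡 n) q).source)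
    {V : ∀ x : M, TangentSpace (𝓡 m) x} (hV : SmoothFieldAt V p) (u : TangentSpace (𝓡 m) p) :
    coords q (f p) (covD (𝓡 m) f (fun x => covD (𝓡 m) f W x (V x)) p u
        - covD (𝓡 m) f W p (covD (𝓡 m) (fun x : M => x) V p u)) =
      lcov (christoffelL q) (mapRep (n := n) p₀ q f)
          (fun z => lcov (christoffelL q) (mapRep (n := n) p₀ q f) (secRep p₀ q f W) z
            (coords p₀ p (V p)))
          (extChartAt (𝓡 m) p₀ p) (coords p₀ p u)
        - lcov (christoffelL q) (mapRep (n := n) p₀ q f) (secRep p₀ q f W) (extChartAt (𝓡 m) p₀ p)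
            (christoffelL p₀ (extChartAt (𝓡 m) p₀ p) (coords p₀ p u) (coords p₀ p (V p))) := by
  have hf := hW.self_of_nhds.base
  have hΓ : ContDiffAt ℝ ∞ (christoffelL q) (mapRep (n := n) p₀ q f (extChartAt (𝓡 m) p₀ p)) := by
    rw [mapRep_apply hp]
    exact contDiffAt_christoffelL _ ((extChartAt (𝓡 n) q).map_source hq)
  rw [coords_sub, coords_covD_chart (smoothSectionAt_covD hW hV) hp hq,
    lcov_congr (secRep_covD_eventuallyEq hW hp hq V), coords_covD_chart hW.self_of_nhds hp hq,
    coords_covD_id hp hV,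
    lcov_lcov_field (v := fieldRep p₀ V) hΓ (contDiffAt_mapRep hf hp hq)
      ((smoothSectionAt_iff hf hp hq).1 hW.self_of_nhds)
      (differentiableAt_of_infty (contDiffAt_fieldRep hp hV)), lcov_add_right, fieldRep_apply hp]
  abel

lemma coords_hessSec {W : ∀ p, TangentSpace (𝓡 n) (f p)}
    (hW : ∀ᶠ x in 𝓝 p, SmoothSectionAt (𝓡 m) f W x)
    (hp : p ∈ (extChartAt (𝓡 m) p₀).source) (hq : f p ∈ (extChartAt (𝓡 n) q).source)
    (u v : TangentSpace (𝓡 m) p) :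
    coords q (f p) (hessSec m n f W p u v) =
      lcov (christoffelL q) (mapRep (n := n) p₀ q f)
          (fun z => lcov (christoffelL q) (mapRep (n := n) p₀ q f) (secRep p₀ q f W) z
            (coords p₀ p v))
          (extChartAt (𝓡 m) p₀ p) (coords p₀ p u)
        - lcov (christoffelL q) (mapRep (n := n) p₀ q f) (secRep p₀ q f W) (extChartAt (𝓡 m) p₀ p)
            (christoffelL p₀ (extChartAt (𝓡 m) p₀ p) (coords p₀ p u) (coords p₀ p v)) := by
  have h := coords_hessSec_field hW hp hq
    (smoothFieldAt_extendVec (mem_extChartAt_source (I := 𝓡 m) p) v) u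
  rw [extendVec_self] at h
  rw [hessSec_eq, h]

lemma hessSec_field {W : ∀ p, TangentSpace (𝓡 n) (f p)}
    (hW : ∀ᶠ x in 𝓝 p, SmoothSectionAt (𝓡 m) f W x)
    {V : ∀ x : M, TangentSpace (𝓡 m) x} (hV : SmoothFieldAt V p) (u : TangentSpace (𝓡 m) p) :
    hessSec m n f W p u (V p) = covD (𝓡 m) f (fun x => covD (𝓡 m) f W x (V x)) p u
        - covD (𝓡 m) f W p (covD (𝓡 m) (fun x : M => x) V p u) := by
  have hp := mem_extChartAt_source (I := 𝓡 m) p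
  have hq := mem_extChartAt_source (I := 𝓡 n) (f p)
  exact coords_inj ((coords_hessSec hW hp hq u (V p)).trans
    (coords_hessSec_field hW hp hq hV u).symm)

lemma isLinearMap_dmap (f : M → N) (p : M) : IsLinearMap ℝ (dmap m n f p) :=
  ⟨fun _ _ => map_add _ _ _, fun _ _ => map_smul _ _ _⟩

lemma isLinearMap_covD (f : M → N) (W : ∀ p, TangentSpace (𝓡 n) (f p)) (p : M) :
    IsLinearMap ℝ (covD (𝓡 m) f W p) :=
  ⟨fun _ _ => covD_add_right _ _, fun _ _ => covD_smul_right _ _⟩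

lemma bilin_of_coords {B : TangentSpace (𝓡 m) p → TangentSpace (𝓡 m) p → TangentSpace (𝓡 n) q}
    {b : Model m → Model m → Model n} (h : ∀ u v, coords q q (B u v) = b (coords p p u) (coords p p v))
    (hb : Bilin b) : Bilin B :=
  ⟨fun _ => ⟨fun _ _ => coords_inj (by simp only [h, coords_add, (hb.1 _).map_add]),
      fun _ _ => coords_inj (by simp only [h, coords_smul, (hb.1 _).map_smul])⟩,
    fun _ => ⟨fun _ _ => coords_inj (by simp only [h, coords_add, (hb.2 _).map_add]),
      fun _ _ => coords_inj (by simp only [h, coords_smul, (hb.2 _).map_smul])⟩⟩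

lemma bilin_hessMap (hf : ∀ᶠ x in 𝓝 p, ContMDiffAt (𝓡 m) (𝓡 n) ∞ f x) :
    Bilin (hessMap m n f p) := by
  have hp := mem_extChartAt_source (I := 𝓡 m) p
  have hq := mem_extChartAt_source (I := 𝓡 n) (f p)
  have hF := contDiffAt_mapRep hf.self_of_nhds hp hq
  refine bilin_of_coords (b := fun a b =>
    lcov (christoffelL (f p)) (mapRep (n := n) p (f p) f)
          (fun z => fderiv ℝ (mapRep (n := n) p (f p) f) z b) (extChartAt (𝓡 m) p p) a
        - fderiv ℝ (mapRep (n := n) p (f p) f) (extChartAt (𝓡 m) p p)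
            (christoffelL p (extChartAt (𝓡 m) p p) a b)) (coords_hessMap hf hp hq) ⟨fun b => ⟨fun a a' => ?_, fun r a => ?_⟩,
    fun a => ⟨fun b b' => ?_, fun r b => ?_⟩⟩ <;>
  simp only [lcov, fderiv_fderiv_apply hF] <;>
  simp only [map_add, map_smul, add_apply, smul_apply, smul_add, smul_sub] <;> abel

lemma bilin_hessSec {W : ∀ p, TangentSpace (𝓡 n) (f p)}
    (hW : ∀ᶠ x in 𝓝 p, SmoothSectionAt (𝓡 m) f W x) : Bilin (hessSec m n f W p) := by
  have hp := mem_extChartAt_source (I := 𝓡 m) p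
  have hq := mem_extChartAt_source (I := 𝓡 n) (f p)
  have hf := hW.self_of_nhds.base
  have hΓ : ContDiffAt ℝ ∞ (christoffelL (f p)) (mapRep (n := n) p (f p) f (extChartAt (𝓡 m) p p)) := by
    rw [mapRep_apply hp]
    exact contDiffAt_christoffelL _ ((extChartAt (𝓡 n) (f p)).map_source hq)
  have hF := contDiffAt_mapRep hf hp hq
  have hY := (smoothSectionAt_iff hf hp hq).1 hW.self_of_nhds
  refine bilin_of_coords (b := fun a b =>
    lcov (christoffelL (f p)) (mapRep (n := n) p (f p) f)
          (fun z => lcov (christoffelL (f p)) (mapRep (n := n) p (f p) f) (secRep p (f p) f W) z b)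
          (extChartAt (𝓡 m) p p) a
        - lcov (christoffelL (f p)) (mapRep (n := n) p (f p) f) (secRep p (f p) f W)
            (extChartAt (𝓡 m) p p) (christoffelL p (extChartAt (𝓡 m) p p) a b))
    (coords_hessSec hW hp hq) ⟨fun b => ⟨fun a a' => ?_, fun r a => ?_⟩,
    fun a => ⟨fun b b' => ?_, fun r b => ?_⟩⟩ <;>
  simp only [lcov_lcov hΓ hF hY] <;>
  simp only [lcov_add_right, lcov_smul_right, map_add, map_smul, add_apply,
    smul_apply, smul_add, smul_sub] <;> abel

end Hessians

/-! ### One-parameter families of maps and of sections along them. -/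

section Families

variable {n : ℕ} {N : Type*} [TopologicalSpace N] [ChartedSpace (Model n) N]
  [IsManifold (𝓡 n) ∞ N]
  {m : ℕ} {M : Type*} [TopologicalSpace M] [ChartedSpace (Model m) M] [IsManifold (𝓡 m) ∞ M]

/-- Smoothness of a one-parameter family of maps. -/
abbrev SmoothFamily (f : ℝ → M → N) : Prop :=
  ContMDiff (𝓘(ℝ, ℝ).prod (𝓡 m)) (𝓡 n) ∞ fun x : ℝ × M => f x.1 x.2

variable (m) in
/-- Smoothness of a one-parameter family of sections along a family of maps. -/
abbrev SmoothFamAt (f : ℝ → M → N) (Y : ∀ t p, TangentSpace (𝓡 n) (f t p)) (t : ℝ) (p : M) : Prop :=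
  SmoothSectionAt (𝓘(ℝ, ℝ).prod (𝓡 m)) (fun x : ℝ × M => f x.1 x.2) (fun x => Y x.1 x.2) (t, p)

/-- A family of maps in charts. -/
def famRep (p₀ : M) (q : N) (f : ℝ → M → N) (y : ℝ × Model m) : Model n :=
  mapRep (n := n) p₀ q (f y.1) y.2

/-- A family of sections in charts. -/
def famSec (p₀ : M) (q : N) (f : ℝ → M → N) (Y : ∀ t p, TangentSpace (𝓡 n) (f t p))
    (y : ℝ × Model m) : Model n :=
  secRep p₀ q (f y.1) (Y y.1) y.2

/-- The velocity of a family of maps. -/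
def velo (f : ℝ → M → N) (t : ℝ) (p : M) : TangentSpace (𝓡 n) (f t p) :=
  mfderiv 𝓘(ℝ, ℝ) (𝓡 n) (fun s => f s p) t (1 : ℝ)

lemma contMDiffAt_prod_iff_chart {X : Type*} [NormedAddCommGroup X] [NormedSpace ℝ X]
    {h : ℝ × M → X} {p₀ p : M} (hp : p ∈ (extChartAt (𝓡 m) p₀).source) {t : ℝ} :
    ContMDiffAt (𝓘(ℝ, ℝ).prod (𝓡 m)) 𝓘(ℝ, X) ∞ h (t, p) ↔
      ContDiffAt ℝ ∞ (fun y : ℝ × Model m => h (y.1, (extChartAt (𝓡 m) p₀).symm y.2))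
        (t, extChartAt (𝓡 m) p₀ p) := by
  have hl := (extChartAt (𝓡 m) p₀).left_inv hp
  rw [← contMDiffAt_iff_contDiffAt]
  constructor
  · intro hh
    refine ContMDiffAt.comp (I' := 𝓘(ℝ, ℝ).prod (𝓡 m)) (g := h)
      (f := fun y : ℝ × Model m => (y.1, (extChartAt (𝓡 m) p₀).symm y.2)) _ ?_ ?_
    · simpa only [hl] using hh
    · refine ContMDiffAt.prodMk contDiff_fst.contMDiff.contMDiffAt ?_
      exact ContMDiffAt.comp (I' := 𝓘(ℝ, Model m)) (f := Prod.snd) (t, extChartAt (𝓡 m) p₀ p)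
        (contMDiffAt_extChartAt_symm ((extChartAt (𝓡 m) p₀).map_source hp))
        contDiff_snd.contMDiff.contMDiffAt
  · intro hh
    have hp' := hp
    rw [extChartAt_source] at hp'
    have h1 : ContMDiffAt (𝓘(ℝ, ℝ).prod (𝓡 m)) 𝓘(ℝ, ℝ × Model m) ∞
        (fun x : ℝ × M => (x.1, extChartAt (𝓡 m) p₀ x.2)) (t, p) :=
      contMDiffAt_fst.prodMk_space
        (ContMDiffAt.comp (g := extChartAt (𝓡 m) p₀) (f := Prod.snd) (t, p)
          (contMDiffAt_extChartAt' (x' := p) hp') contMDiffAt_snd)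
    refine (hh.comp (t, p) h1).congr_of_eventuallyEq ?_
    filter_upwards [continuousAt_snd.eventually
      ((isOpen_extChartAt_source (I := 𝓡 m) p₀).mem_nhds hp)] with y hy
    simp only [Function.comp_apply, (extChartAt (𝓡 m) p₀).left_inv hy]

variable {f : ℝ → M → N} {p₀ p : M} {q : N} {t : ℝ}
  {Y : ∀ t p, TangentSpace (𝓡 n) (f t p)}

lemma contDiffAt_famRep (hf : SmoothFamily (m := m) (n := n) f)
    (hp : p ∈ (extChartAt (𝓡 m) p₀).source) (hq : f t p ∈ (extChartAt (𝓡 n) q).source) :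
    ContDiffAt ℝ ∞ (famRep (n := n) p₀ q f) (t, extChartAt (𝓡 m) p₀ p) :=
  (contMDiffAt_prod_iff_chart hp).1
    (contMDiffAt_extChartAt_comp (f := fun x : ℝ × M => f x.1 x.2) (hf (t, p)) hq)

lemma smoothFamAt_iff (hf : SmoothFamily (m := m) (n := n) f)
    (hp : p ∈ (extChartAt (𝓡 m) p₀).source) (hq : f t p ∈ (extChartAt (𝓡 n) q).source) :
    SmoothFamAt m f Y t p ↔
      ContDiffAt ℝ ∞ (famSec p₀ q f Y) (t, extChartAt (𝓡 m) p₀ p) :=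
  (contMDiffAt_section_iff (f := fun x : ℝ × M => f x.1 x.2) (hf (t, p)) hq).trans
    (contMDiffAt_prod_iff_chart hp)

lemma SmoothFamily.slice (hf : SmoothFamily (m := m) (n := n) f) (t : ℝ) :
    ContMDiff (𝓡 m) (𝓡 n) ∞ (f t) :=
  ContMDiff.comp (g := fun x : ℝ × M => f x.1 x.2) (f := fun p => (t, p)) hf
    (contMDiff_const.prodMk contMDiff_id)

lemma SmoothFamily.curve (hf : SmoothFamily (m := m) (n := n) f) (p : M) :
    ContMDiff 𝓘(ℝ, ℝ) (𝓡 n) ∞ fun t => f t p :=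
  ContMDiff.comp (g := fun x : ℝ × M => f x.1 x.2) (f := fun t => (t, p)) hf
    (contMDiff_id.prodMk contMDiff_const)

lemma SmoothFamAt.slice (h : SmoothFamAt m f Y t p) : SmoothSectionAt (𝓡 m) (f t) (Y t) p :=
  SmoothSectionAt.comp (g := fun p => (t, p)) h (contMDiffAt_const.prodMk contMDiffAt_id)

lemma SmoothFamAt.curve (h : SmoothFamAt m f Y t p) :
    SmoothSectionAt 𝓘(ℝ, ℝ) (fun t => f t p) (fun t => Y t p) t :=
  SmoothSectionAt.comp (g := fun t => (t, p)) h (contMDiffAt_id.prodMk contMDiffAt_const)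

lemma eventually_fam (hf : SmoothFamily (m := m) (n := n) f)
    (hp : p ∈ (extChartAt (𝓡 m) p₀).source) (hq : f t p ∈ (extChartAt (𝓡 n) q).source) :
    ∀ᶠ y in 𝓝 (t, extChartAt (𝓡 m) p₀ p), y.2 ∈ (extChartAt (𝓡 m) p₀).target ∧
      f y.1 ((extChartAt (𝓡 m) p₀).symm y.2) ∈ (extChartAt (𝓡 n) q).source := by
  have ht := (extChartAt (𝓡 m) p₀).map_source hp
  have hl := (extChartAt (𝓡 m) p₀).left_inv hp
  have hc : ContinuousAt (fun y : ℝ × Model m => f y.1 ((extChartAt (𝓡 m) p₀).symm y.2))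
      (t, extChartAt (𝓡 m) p₀ p) := by
    refine ContinuousAt.comp (g := fun x : ℝ × M => f x.1 x.2)
      (f := fun y : ℝ × Model m => (y.1, (extChartAt (𝓡 m) p₀).symm y.2)) hf.continuous.continuousAt
      (continuousAt_fst.prodMk (ContinuousAt.comp (f := Prod.snd) ?_ continuousAt_snd))
    exact (contMDiffAt_extChartAt_symm ht).continuousAt
  filter_upwards [continuousAt_snd.eventually ((isOpen_extChartAt_target p₀).mem_nhds ht),
    hc.eventually ((isOpen_extChartAt_source (I := 𝓡 n) q).mem_nhds (by
      simp only [hl]; exact hq))] with z h1 h2 using ⟨h1, h2⟩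

lemma eventually_fam_chart {S : ℝ → M → Prop} (hS : ∀ᶠ x in 𝓝 (t, p), S x.1 x.2)
    (hp : p ∈ (extChartAt (𝓡 m) p₀).source) :
    ∀ᶠ y in 𝓝 (t, extChartAt (𝓡 m) p₀ p), S y.1 ((extChartAt (𝓡 m) p₀).symm y.2) := by
  have ht := (extChartAt (𝓡 m) p₀).map_source hp
  have hl := (extChartAt (𝓡 m) p₀).left_inv hp
  have hc : ContinuousAt (fun y : ℝ × Model m => (y.1, (extChartAt (𝓡 m) p₀).symm y.2))
      (t, extChartAt (𝓡 m) p₀ p) :=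
    continuousAt_fst.prodMk (ContinuousAt.comp (f := Prod.snd)
      (contMDiffAt_extChartAt_symm ht).continuousAt continuousAt_snd)
  refine hc.eventually (p := fun x : ℝ × M => S x.1 x.2) ?_
  simpa only [hl] using hS

lemma famRep_apply (hp : p ∈ (extChartAt (𝓡 m) p₀).source) :
    famRep (n := n) p₀ q f (t, extChartAt (𝓡 m) p₀ p) = extChartAt (𝓡 n) q (f t p) :=
  mapRep_apply hp

lemma famSec_apply (hp : p ∈ (extChartAt (𝓡 m) p₀).source) :
    famSec p₀ q f Y (t, extChartAt (𝓡 m) p₀ p) = coords q (f t p) (Y t p) :=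
  secRep_apply hp

/-- Two families of local representatives agree if they do so at the points of the charts. -/
lemma famSec_eventuallyEq (hf : SmoothFamily (m := m) (n := n) f)
    (hp : p ∈ (extChartAt (𝓡 m) p₀).source) (hq : f t p ∈ (extChartAt (𝓡 n) q).source)
    {S : ℝ → M → Prop} (hS : ∀ᶠ x in 𝓝 (t, p), S x.1 x.2) {Z : ℝ × Model m → Model n}
    (h : ∀ s x, S s x → x ∈ (extChartAt (𝓡 m) p₀).source → f s x ∈ (extChartAt (𝓡 n) q).source →
      coords q (f s x) (Y s x) = Z (s, extChartAt (𝓡 m) p₀ x)) :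
    famSec p₀ q f Y =ᶠ[𝓝 (t, extChartAt (𝓡 m) p₀ p)] Z := by
  filter_upwards [eventually_fam hf hp hq, eventually_fam_chart hS hp] with y hy hs
  have := h y.1 _ hs ((extChartAt (𝓡 m) p₀).map_target hy.1) hy.2
  rw [(extChartAt (𝓡 m) p₀).right_inv hy.1] at this
  exact this

variable [RiemannianBundle (fun x : N => TangentSpace (𝓡 n) x)]
  [IsContMDiffRiemannianBundle (𝓡 n) ∞ (Model n) (fun x : N => TangentSpace (𝓡 n) x)]

lemma coords_dmap_fam (hf : SmoothFamily (m := m) (n := n) f)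
    (hp : p ∈ (extChartAt (𝓡 m) p₀).source) (hq : f t p ∈ (extChartAt (𝓡 n) q).source)
    (v : TangentSpace (𝓡 m) p) :
    coords q (f t p) (dmap m n (f t) p v) =
      fderiv ℝ (famRep (n := n) p₀ q f) (t, extChartAt (𝓡 m) p₀ p) (0, coords p₀ p v) := by
  rw [coords_dmap (hf.slice t p) hp hq]
  exact fderiv_slice (differentiableAt_of_infty (contDiffAt_famRep hf hp hq)) _

lemma coords_velo (hf : SmoothFamily (m := m) (n := n) f)
    (hp : p ∈ (extChartAt (𝓡 m) p₀).source) (hq : f t p ∈ (extChartAt (𝓡 n) q).source) :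
    coords q (f t p) (velo f t p) =
      fderiv ℝ (famRep (n := n) p₀ q f) (t, extChartAt (𝓡 m) p₀ p) (1, 0) := by
  refine (dirD_extChartAt_comp (f := fun s => f s p)
    ((hf.curve p t).mdifferentiableAt (by simp)) hq (1 : ℝ)).symm.trans ?_
  refine (dirD_self _ _ _).trans ?_
  rw [← fderiv_slice_left (differentiableAt_of_infty (contDiffAt_famRep hf hp hq))]
  simp only [famRep_apply hp]

lemma contDiffAt_fieldRep_snd (hp : p ∈ (extChartAt (𝓡 m) p₀).source)
    {A : ∀ x : M, TangentSpace (𝓡 m) x} (hA : SmoothFieldAt A p) :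
    ContDiffAt ℝ ∞ (fun y : ℝ × Model m => ((0 : ℝ), fieldRep p₀ A y.2))
      (t, extChartAt (𝓡 m) p₀ p) :=
  contDiffAt_const.prodMk
    (ContDiffAt.comp (f := Prod.snd) (t, extChartAt (𝓡 m) p₀ p) (contDiffAt_fieldRep hp hA)
      contDiffAt_snd)

lemma smoothFamAt_dmap (hf : SmoothFamily (m := m) (n := n) f)
    {A : ∀ x : M, TangentSpace (𝓡 m) x} (hA : SmoothFieldAt A p) :
    SmoothFamAt m f (fun t p => dmap m n (f t) p (A p)) t p := by
  have hp := mem_extChartAt_source (I := 𝓡 m) p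
  have hq := mem_extChartAt_source (I := 𝓡 n) (f t p)
  rw [smoothFamAt_iff hf hp hq]
  refine (contDiffAt_fderiv_apply (contDiffAt_famRep hf hp hq)
    (contDiffAt_fieldRep_snd hp hA)).congr_of_eventuallyEq
    (famSec_eventuallyEq hf hp hq (S := fun _ _ => True) (.of_forall fun _ => trivial)
      fun s x _ hx hx' => ?_)
  rw [coords_dmap_fam hf hx hx', fieldRep_apply hx]

lemma smoothFamAt_velo (hf : SmoothFamily (m := m) (n := n) f) : SmoothFamAt m f (velo (n := n) f) t p := by
  have hp := mem_extChartAt_source (I := 𝓡 m) p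
  have hq := mem_extChartAt_source (I := 𝓡 n) (f t p)
  rw [smoothFamAt_iff hf hp hq]
  exact (contDiffAt_fderiv_apply (contDiffAt_famRep hf hp hq)
    contDiffAt_const).congr_of_eventuallyEq
    (famSec_eventuallyEq hf hp hq (S := fun _ _ => True) (.of_forall fun _ => trivial)
      fun s x _ hx hx' => coords_velo hf hx hx')

lemma famSec_velo_eventuallyEq (hf : SmoothFamily (m := m) (n := n) f)
    (hp : p ∈ (extChartAt (𝓡 m) p₀).source) (hq : f t p ∈ (extChartAt (𝓡 n) q).source) :
    famSec p₀ q f (velo (n := n) f) =ᶠ[𝓝 (t, extChartAt (𝓡 m) p₀ p)] fun y =>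
      fderiv ℝ (famRep (n := n) p₀ q f) y (1, 0) :=
  famSec_eventuallyEq hf hp hq (S := fun _ _ => True) (.of_forall fun _ => trivial)
    fun _ _ _ hx hx' => coords_velo hf hx hx'

/-- The covariant derivative of a vector field along a curve. -/
def curveD (γ : ℝ → N) (Z : ∀ t, TangentSpace (𝓡 n) (γ t)) (t : ℝ) : TangentSpace (𝓡 n) (γ t) :=
  covD 𝓘(ℝ, ℝ) γ Z t (1 : ℝ)

/-- The covariant derivative of a family of sections with respect to the parameter. -/
def timeD (f : ℝ → M → N) (Y : ∀ t p, TangentSpace (𝓡 n) (f t p)) (t : ℝ) (p : M) :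
    TangentSpace (𝓡 n) (f t p) :=
  curveD (fun s => f s p) (fun s => Y s p) t

lemma contDiffAt_christoffelL_fam (hp : p ∈ (extChartAt (𝓡 m) p₀).source)
    (hq : f t p ∈ (extChartAt (𝓡 n) q).source) :
    ContDiffAt ℝ ∞ (christoffelL q) (famRep (n := n) p₀ q f (t, extChartAt (𝓡 m) p₀ p)) := by
  rw [famRep_apply hp]
  exact contDiffAt_christoffelL _ ((extChartAt (𝓡 n) q).map_source hq)

lemma coords_curveD {γ : ℝ → N} {Z : ∀ t, TangentSpace (𝓡 n) (γ t)}
    (h : SmoothSectionAt 𝓘(ℝ, ℝ) γ Z t) (hq : γ t ∈ (extChartAt (𝓡 n) q).source) :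
    coords q (γ t) (curveD γ Z t) = lcov (christoffelL q) (fun s => extChartAt (𝓡 n) q (γ s))
      (fun s => coords q (γ s) (Z s)) t 1 := by
  have h1 := dirD_extChartAt_comp (h.base.mdifferentiableAt (by simp)) hq (1 : ℝ)
  refine (coords_covD h hq (1 : ℝ)).trans ?_
  rw [← h1]
  simp only [lcov]
  erw [dirD_self, dirD_self]

/-- The covariant derivative along a curve `s ↦ f s p` in charts. -/
lemma coords_curveD_fam (hf : SmoothFamily (m := m) (n := n) f)
    (hp : p ∈ (extChartAt (𝓡 m) p₀).source) (hq : f t p ∈ (extChartAt (𝓡 n) q).source)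
    {Z : ∀ s, TangentSpace (𝓡 n) (f s p)} {Zr : ℝ × Model m → Model n}
    (hZ : ContDiffAt ℝ ∞ Zr (t, extChartAt (𝓡 m) p₀ p))
    (h : ∀ᶠ s in 𝓝 t, coords q (f s p) (Z s) = Zr (s, extChartAt (𝓡 m) p₀ p)) :
    SmoothSectionAt 𝓘(ℝ, ℝ) (fun s => f s p) Z t ∧
      coords q (f t p) (curveD (fun s => f s p) Z t) =
        lcov (christoffelL q) (famRep (n := n) p₀ q f) Zr (t, extChartAt (𝓡 m) p₀ p) (1, 0) := by
  have hc : ContDiffAt ℝ ∞ (fun s => Zr (s, extChartAt (𝓡 m) p₀ p)) t :=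
    ContDiffAt.comp (f := fun s : ℝ => (s, extChartAt (𝓡 m) p₀ p)) t hZ
      (contDiffAt_id.prodMk contDiffAt_const)
  have hs : SmoothSectionAt 𝓘(ℝ, ℝ) (fun s => f s p) Z t := by
    refine (contMDiffAt_section_iff (f := fun s => f s p) (hf.curve p t) hq).2 ?_
    rw [contMDiffAt_iff_contDiffAt]
    exact hc.congr_of_eventuallyEq h
  refine ⟨hs, ?_⟩
  rw [coords_curveD (γ := fun s => f s p) hs hq, lcov_congr h]
  have := lcov_slice_left (Γ := christoffelL q)
    (differentiableAt_of_infty (contDiffAt_famRep hf hp hq)) (differentiableAt_of_infty hZ) (1 : ℝ)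
  simpa only [famRep_apply hp] using this

lemma coords_timeD (hf : SmoothFamily (m := m) (n := n) f)
    (hp : p ∈ (extChartAt (𝓡 m) p₀).source) (hq : f t p ∈ (extChartAt (𝓡 n) q).source)
    (hY : SmoothFamAt m f Y t p) :
    coords q (f t p) (timeD f Y t p) =
      lcov (christoffelL q) (famRep (n := n) p₀ q f) (famSec p₀ q f Y)
        (t, extChartAt (𝓡 m) p₀ p) (1, 0) :=
  (coords_curveD_fam hf hp hq (Z := fun s => Y s p) ((smoothFamAt_iff hf hp hq).1 hY)
    (.of_forall fun _ => (famSec_apply hp).symm)).2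

lemma famSec_timeD_eventuallyEq (hf : SmoothFamily (m := m) (n := n) f)
    (hp : p ∈ (extChartAt (𝓡 m) p₀).source) (hq : f t p ∈ (extChartAt (𝓡 n) q).source)
    (hY : ∀ s x, SmoothFamAt m f Y s x) :
    famSec p₀ q f (timeD f Y) =ᶠ[𝓝 (t, extChartAt (𝓡 m) p₀ p)] fun y =>
      lcov (christoffelL q) (famRep (n := n) p₀ q f) (famSec p₀ q f Y) y (1, 0) :=
  famSec_eventuallyEq hf hp hq (S := fun _ _ => True) (.of_forall fun _ => trivial)
    fun _ _ _ hx hx' => coords_timeD hf hx hx' (hY _ _)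

lemma smoothFamAt_timeD (hf : SmoothFamily (m := m) (n := n) f)
    (hY : ∀ s x, SmoothFamAt m f Y s x) : SmoothFamAt m f (timeD f Y) t p := by
  have hp := mem_extChartAt_source (I := 𝓡 m) p
  have hq := mem_extChartAt_source (I := 𝓡 n) (f t p)
  rw [smoothFamAt_iff hf hp hq]
  exact (contDiffAt_lcov (contDiffAt_christoffelL_fam hp hq) (contDiffAt_famRep hf hp hq)
    ((smoothFamAt_iff hf hp hq).1 (hY t p)) contDiffAt_const).congr_of_eventuallyEq
    (famSec_timeD_eventuallyEq hf hp hq hY)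

lemma coords_covD_fam (hf : SmoothFamily (m := m) (n := n) f)
    (hp : p ∈ (extChartAt (𝓡 m) p₀).source) (hq : f t p ∈ (extChartAt (𝓡 n) q).source)
    (hY : SmoothFamAt m f Y t p) (v : TangentSpace (𝓡 m) p) :
    coords q (f t p) (covD (𝓡 m) (f t) (Y t) p v) =
      lcov (christoffelL q) (famRep (n := n) p₀ q f) (famSec p₀ q f Y)
        (t, extChartAt (𝓡 m) p₀ p) (0, coords p₀ p v) := by
  rw [coords_covD_chart hY.slice hp hq]
  exact lcov_slice (differentiableAt_of_infty (contDiffAt_famRep hf hp hq))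
    (differentiableAt_of_infty ((smoothFamAt_iff hf hp hq).1 hY)) _

lemma smoothFamAt_covD (hf : SmoothFamily (m := m) (n := n) f)
    (hY : ∀ᶠ x in 𝓝 (t, p), SmoothFamAt m f Y x.1 x.2)
    {A : ∀ x : M, TangentSpace (𝓡 m) x} (hA : SmoothFieldAt A p) :
    SmoothFamAt m f (fun t p => covD (𝓡 m) (f t) (Y t) p (A p)) t p := by
  have hp := mem_extChartAt_source (I := 𝓡 m) p
  have hq := mem_extChartAt_source (I := 𝓡 n) (f t p)
  rw [smoothFamAt_iff hf hp hq]
  refine (contDiffAt_lcov (contDiffAt_christoffelL_fam hp hq) (contDiffAt_famRep hf hp hq)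
    ((smoothFamAt_iff hf hp hq).1 hY.self_of_nhds)
    (contDiffAt_fieldRep_snd hp hA)).congr_of_eventuallyEq
    (famSec_eventuallyEq hf hp hq (S := fun s x => SmoothFamAt m f Y s x) hY fun s x h hx hx' => ?_)
  rw [coords_covD_fam hf hx hx' h, fieldRep_apply hx]

variable [RiemannianBundle (fun x : M => TangentSpace (𝓡 m) x)]
  [IsContMDiffRiemannianBundle (𝓡 m) ∞ (Model m) (fun x : M => TangentSpace (𝓡 m) x)]

lemma coords_hessMap_fam (hf : SmoothFamily (m := m) (n := n) f)
    (hp : p ∈ (extChartAt (𝓡 m) p₀).source) (hq : f t p ∈ (extChartAt (𝓡 n) q).source)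
    (u v : TangentSpace (𝓡 m) p) :
    coords q (f t p) (hessMap m n (f t) p u v) =
      lcov (christoffelL q) (famRep (n := n) p₀ q f)
          (fun y => fderiv ℝ (famRep (n := n) p₀ q f) y (0, coords p₀ p v))
          (t, extChartAt (𝓡 m) p₀ p) (0, coords p₀ p u)
        - fderiv ℝ (famRep (n := n) p₀ q f) (t, extChartAt (𝓡 m) p₀ p)
            (0, christoffelL p₀ (extChartAt (𝓡 m) p₀ p) (coords p₀ p u) (coords p₀ p v)) := by
  have hF := contDiffAt_famRep hf hp hq
  rw [coords_hessMap (.of_forall (hf.slice t)) hp hq]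
  have e : (fun z => fderiv ℝ (mapRep (n := n) p₀ q (f t)) z (coords p₀ p v))
      =ᶠ[𝓝 (extChartAt (𝓡 m) p₀ p)] fun z =>
        fderiv ℝ (famRep (n := n) p₀ q f) (t, z) (0, coords p₀ p v) := by
    have hc : ContinuousAt (fun z : Model m => (t, z)) (extChartAt (𝓡 m) p₀ p) := by fun_prop
    filter_upwards [hc.eventually (eventually_fam hf hp hq)] with z hz
    have h1 := contDiffAt_famRep hf ((extChartAt (𝓡 m) p₀).map_target hz.1) hz.2
    rw [(extChartAt (𝓡 m) p₀).right_inv hz.1] at h1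
    exact fderiv_slice (differentiableAt_of_infty h1) _
  rw [lcov_congr e]
  congr 1
  · exact lcov_slice (F := famRep (n := n) p₀ q f)
      (Y := fun y => fderiv ℝ (famRep (n := n) p₀ q f) y (0, coords p₀ p v))
      (differentiableAt_of_infty hF)
      (differentiableAt_of_infty (contDiffAt_fderiv_apply hF contDiffAt_const)) _
  · exact fderiv_slice (differentiableAt_of_infty hF) _

lemma coords_hessSec_fam (hf : SmoothFamily (m := m) (n := n) f)
    (hY : ∀ s x, SmoothFamAt m f Y s x)
    (hp : p ∈ (extChartAt (𝓡 m) p₀).source) (hq : f t p ∈ (extChartAt (𝓡 n) q).source)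
    (u v : TangentSpace (𝓡 m) p) :
    coords q (f t p) (hessSec m n (f t) (Y t) p u v) =
      lcov (christoffelL q) (famRep (n := n) p₀ q f)
          (fun y => lcov (christoffelL q) (famRep (n := n) p₀ q f) (famSec p₀ q f Y) y
            (0, coords p₀ p v))
          (t, extChartAt (𝓡 m) p₀ p) (0, coords p₀ p u)
        - lcov (christoffelL q) (famRep (n := n) p₀ q f) (famSec p₀ q f Y)
            (t, extChartAt (𝓡 m) p₀ p)
            (0, christoffelL p₀ (extChartAt (𝓡 m) p₀ p) (coords p₀ p u) (coords p₀ p v)) := by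
  have hF := contDiffAt_famRep hf hp hq
  have hYr := (smoothFamAt_iff hf hp hq).1 (hY t p)
  rw [coords_hessSec (.of_forall fun x => (hY t x).slice) hp hq]
  have e : (fun z => lcov (christoffelL q) (mapRep (n := n) p₀ q (f t)) (secRep p₀ q (f t) (Y t)) z
        (coords p₀ p v))
      =ᶠ[𝓝 (extChartAt (𝓡 m) p₀ p)] fun z =>
        lcov (christoffelL q) (famRep (n := n) p₀ q f) (famSec p₀ q f Y) (t, z)
          (0, coords p₀ p v) := by
    have hc : ContinuousAt (fun z : Model m => (t, z)) (extChartAt (𝓡 m) p₀ p) := by fun_prop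
    filter_upwards [hc.eventually (eventually_fam hf hp hq)] with z hz
    have hz' := (extChartAt (𝓡 m) p₀).map_target hz.1
    have h1 := contDiffAt_famRep hf hz' hz.2
    have h2 := (smoothFamAt_iff hf hz' hz.2).1 (hY t _)
    rw [(extChartAt (𝓡 m) p₀).right_inv hz.1] at h1 h2
    exact lcov_slice (differentiableAt_of_infty h1) (differentiableAt_of_infty h2) _
  rw [lcov_congr e]
  congr 1
  · exact lcov_slice (F := famRep (n := n) p₀ q f)
      (Y := fun y => lcov (christoffelL q) (famRep (n := n) p₀ q f) (famSec p₀ q f Y) y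
            (0, coords p₀ p v))
      (differentiableAt_of_infty hF)
      (differentiableAt_of_infty (contDiffAt_lcov (contDiffAt_christoffelL_fam hp hq) hF hYr
        contDiffAt_const)) _
  · exact lcov_slice (differentiableAt_of_infty hF) (differentiableAt_of_infty hYr) _

/-- Joint smoothness in time and space: after replacing the moving extensions by the fixed field B,
only covariant derivatives along fixed smooth fields remain. -/
lemma smoothFamAt_hessMap (hf : SmoothFamily (m := m) (n := n) f)
    {A B : ∀ x : M, TangentSpace (𝓡 m) x} (hA : SmoothFieldAt A p)
    (hB : ∀ᶠ x in 𝓝 p, SmoothFieldAt B x) :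
    SmoothFamAt m f (fun t p => hessMap m n (f t) p (A p) (B p)) t p := by
  have hB' : ∀ᶠ x : ℝ × M in 𝓝 (t, p), SmoothFieldAt B x.2 := continuousAt_snd.eventually hB
  refine SmoothSectionAt.congr (W := fun x : ℝ × M =>
    covD (𝓡 m) (f x.1) (fun y => dmap m n (f x.1) y (B y)) x.2 (A x.2)
      - dmap m n (f x.1) x.2 (covD (𝓡 m) (fun y : M => y) B x.2 (A x.2))) ?_ ?_
  · refine SmoothSectionAt.sub ?_ ?_
    · exact smoothFamAt_covD hf (hB'.mono fun x hx => smoothFamAt_dmap hf hx) hA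
    · exact smoothFamAt_dmap hf (smoothSectionAt_covD hB hA)
  · filter_upwards [hB'] with x hx
      using hessMap_field (.of_forall (hf.slice x.1)) hx _

lemma smoothFamAt_hessSec (hf : SmoothFamily (m := m) (n := n) f)
    (hY : ∀ s x, SmoothFamAt m f Y s x)
    {A B : ∀ x : M, TangentSpace (𝓡 m) x} (hA : SmoothFieldAt A p)
    (hB : ∀ᶠ x in 𝓝 p, SmoothFieldAt B x) :
    SmoothFamAt m f (fun t p => hessSec m n (f t) (Y t) p (A p) (B p)) t p := by
  have hB' : ∀ᶠ x : ℝ × M in 𝓝 (t, p), SmoothFieldAt B x.2 := continuousAt_snd.eventually hB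
  refine SmoothSectionAt.congr (W := fun x : ℝ × M =>
    covD (𝓡 m) (f x.1) (fun y => covD (𝓡 m) (f x.1) (Y x.1) y (B y)) x.2 (A x.2)
      - covD (𝓡 m) (f x.1) (Y x.1) x.2 (covD (𝓡 m) (fun y : M => y) B x.2 (A x.2))) ?_ ?_
  · refine SmoothSectionAt.sub ?_ ?_
    · exact smoothFamAt_covD hf
        (Y := fun t p => covD (𝓡 m) (f t) (Y t) p (B p))
        (hB'.mono fun x hx => smoothFamAt_covD hf (.of_forall fun _ => hY _ _) hx) hA
    · exact smoothFamAt_covD hf (.of_forall fun _ => hY _ _) (smoothSectionAt_covD hB hA)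
  · filter_upwards [hB'] with x hx
      using hessSec_field (.of_forall fun y => (hY x.1 y).slice) hx _

end Families

/-! ### Ricci and scalar curvature, and the contracted second Bianchi identity. -/

section Ricci

variable {m : ℕ} {M : Type*} [TopologicalSpace M] [ChartedSpace (Model m) M]
  [IsManifold (𝓡 m) ∞ M] [RiemannianBundle (fun x : M => TangentSpace (𝓡 m) x)]
  [IsContMDiffRiemannianBundle (𝓡 m) ∞ (Model m) (fun x : M => TangentSpace (𝓡 m) x)] {p : M}

lemma isLinearMap_inner_left {V W : Type*} [AddCommGroup V] [Module ℝ V] [NormedAddCommGroup W]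
    [InnerProductSpace ℝ W] {S : V → W} (hS : IsLinearMap ℝ S) (w : W) :
    IsLinearMap ℝ fun v => (inner ℝ (S v) w : ℝ) :=
  ⟨fun _ _ => by rw [hS.map_add, inner_add_left],
    fun _ _ => by rw [hS.map_smul, real_inner_smul_left, smul_eq_mul]⟩

lemma bilin_inner {V W : Type*} [NormedAddCommGroup V] [InnerProductSpace ℝ V] [AddCommGroup W]
    [Module ℝ W] {S T : W → V} (hS : IsLinearMap ℝ S) (hT : IsLinearMap ℝ T) :
    Bilin fun v w => (inner ℝ (S v) (T w) : ℝ) :=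
  ⟨fun _ => isLinearMap_inner_left hS _,
    fun _ => ⟨fun _ _ => by simp only [hT.map_add, inner_add_right],
      fun _ _ => by simp only [hT.map_smul, real_inner_smul_right, smul_eq_mul]⟩⟩

lemma bilin_smul {V : Type*} [AddCommGroup V] [Module ℝ V] {L : V → ℝ} (hL : IsLinearMap ℝ L) :
    Bilin fun v w : V => L v • w :=
  ⟨fun _ => ⟨fun _ _ => by simp only [hL.map_add, add_smul],
      fun _ _ => by simp only [hL.map_smul, smul_assoc]⟩,
    fun _ => ⟨fun _ _ => smul_add _ _ _, fun _ _ => smul_comm _ _ _⟩⟩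

lemma isLinearMap_metricTrace {V F : Type*} [AddCommGroup V] [Module ℝ V] [AddCommGroup F]
    [Module ℝ F] {B : V → TangentSpace (𝓡 m) p → TangentSpace (𝓡 m) p → F}
    (h : ∀ w w', IsLinearMap ℝ fun v => B v w w') : IsLinearMap ℝ fun v => metricTrace p (B v) :=
  ⟨fun v w => by
      rw [← metricTrace_add]
      exact metricTrace_congr fun u => (h u u).map_add v w,
    fun r v => by
      rw [← metricTrace_smul]
      exact metricTrace_congr fun u => (h u u).map_smul r v⟩

lemma bilin_ricciForm (p : M) : Bilin (ricciForm (n := m) p) :=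
  ⟨fun v => isLinearMap_metricTrace fun w w' => isLinearMap_inner_left (curv_isLinear₂ w v) w',
    fun u => isLinearMap_metricTrace fun w w' => isLinearMap_inner_left (curv_isLinear₃ w u) w'⟩

/-- Pair symmetry of the curvature exchanges the two free arguments under the trace. The symmetry of
the Ricci operator obtained from this is used in the first variation. -/
lemma ricciForm_comm (u v : TangentSpace (𝓡 m) p) : ricciForm p u v = ricciForm p v u := by
  refine metricTrace_congr fun w => ?_
  rw [inner_curv_pair_symm, curv_swap, inner_neg_left, inner_curv_skew, neg_neg]

lemma inner_ricci (u v : TangentSpace (𝓡 m) p) : (inner ℝ (ricci p u) v : ℝ) = ricciForm p u v :=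
  inner_metricTrace_smul ((bilin_ricciForm p).2 u) v

lemma inner_ricci_comm (u v : TangentSpace (𝓡 m) p) :
    (inner ℝ (ricci p u) v : ℝ) = inner ℝ u (ricci p v) := by
  rw [inner_ricci, real_inner_comm, inner_ricci, ricciForm_comm]

lemma isLinearMap_ricci (p : M) : IsLinearMap ℝ (ricci (n := m) p) :=
  isLinearMap_metricTrace fun w w' =>
    ⟨fun _ _ => by rw [((bilin_ricciForm p).1 w).map_add, add_smul],
      fun _ _ => by rw [((bilin_ricciForm p).1 w).map_smul, smul_assoc]⟩

lemma contMDiffAt_ricciForm {A B : ∀ x : M, TangentSpace (𝓡 m) x} (hA : SmoothFieldAt A p)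
    (hB : SmoothFieldAt B p) : ContMDiffAt (𝓡 m) 𝓘(ℝ, ℝ) ∞ (fun x => ricciForm (n := m) x (A x) (B x)) p := by
  have hp := mem_extChartAt_source (I := 𝓡 m) p
  exact contMDiffAt_metricTrace (pr := fun x : M => x)
    (B := fun x w w' => (inner ℝ (curv x w (A x) (B x)) w' : ℝ)) contMDiffAt_id
    (.of_forall fun x => bilin_inner (T := fun w => w) (curv_isLinear₁ _ _)
      ⟨fun _ _ => rfl, fun _ _ => rfl⟩)
    fun v w => ((smoothFieldAt_extendVec hp v).curv hA hB).inner (smoothFieldAt_extendVec hp w)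

lemma smoothFieldAt_ricci {A : ∀ x : M, TangentSpace (𝓡 m) x} (hA : SmoothFieldAt A p) :
    SmoothFieldAt (fun x => ricci (n := m) x (A x)) p := by
  have hp := mem_extChartAt_source (I := 𝓡 m) p
  refine smoothSectionAt_metricTrace (pr := fun x : M => x) (g := fun x : M => x)
    (B := fun x w w' => ricciForm x (A x) w • w') contMDiffAt_id contMDiffAt_id
    (.of_forall fun x => bilin_smul ((bilin_ricciForm x).2 _)) fun v w =>
    (smoothFieldAt_extendVec hp w).smul (contMDiffAt_ricciForm hA (smoothFieldAt_extendVec hp v))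

lemma contMDiff_scal : ContMDiff (𝓡 m) 𝓘(ℝ, ℝ) ∞ (scal m (N := M)) := fun p => by
  have hp := mem_extChartAt_source (I := 𝓡 m) p
  exact contMDiffAt_metricTrace (pr := fun x : M => x)
    (B := fun x w w' => ricciForm x w w') contMDiffAt_id (.of_forall fun x => bilin_ricciForm x)
    fun v w => contMDiffAt_ricciForm (smoothFieldAt_extendVec hp v) (smoothFieldAt_extendVec hp w)

lemma inner_grad (f : M → ℝ) (v : TangentSpace (𝓡 m) p) :
    (inner ℝ (grad f p) v : ℝ) = dirD (𝓡 m) f p v :=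
  inner_metricTrace_smul (L := fun w => dirD (𝓡 m) f p w)
    ⟨fun _ _ => dirD_add_right _ _ _, fun _ _ => dirD_smul_right _ _ _⟩ v

lemma contMDiffAt_dirD {f : M → ℝ} (hf : ContMDiff (𝓡 m) 𝓘(ℝ, ℝ) ∞ f)
    {A : ∀ x : M, TangentSpace (𝓡 m) x} (hA : SmoothFieldAt A p) :
    ContMDiffAt (𝓡 m) 𝓘(ℝ, ℝ) ∞ (fun x => dirD (𝓡 m) f x (A x)) p := by
  have hp := mem_extChartAt_source (I := 𝓡 m) p
  rw [contMDiffAt_iff_chart hp]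
  have hr : ∀ x ∈ (extChartAt (𝓡 m) p).source, ContDiffAt ℝ ∞
      (fun z => f ((extChartAt (𝓡 m) p).symm z)) (extChartAt (𝓡 m) p x) := fun x hx =>
    (contMDiffAt_iff_chart hx).1 (hf x)
  refine (contDiffAt_fderiv_apply (hr p hp) (contDiffAt_fieldRep hp hA)).congr_of_eventuallyEq ?_
  filter_upwards [(isOpen_extChartAt_target p).mem_nhds ((extChartAt (𝓡 m) p).map_source hp)]
    with z hz
  have hz' := (extChartAt (𝓡 m) p).map_target hz
  rw [dirD_eq_fderiv hz' (differentiableAt_of_infty (hr _ hz')),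
    (extChartAt (𝓡 m) p).right_inv hz]
  rfl

lemma smoothFieldAt_grad {f : M → ℝ} (hf : ContMDiff (𝓡 m) 𝓘(ℝ, ℝ) ∞ f) (p : M) :
    SmoothFieldAt (fun x => grad (n := m) f x) p := by
  have hp := mem_extChartAt_source (I := 𝓡 m) p
  refine smoothSectionAt_metricTrace (pr := fun x : M => x) (g := fun x : M => x)
    (B := fun x w w' => dirD (𝓡 m) f x w • w') contMDiffAt_id contMDiffAt_id
    (.of_forall fun x => bilin_smul ⟨fun _ _ => dirD_add_right _ _ _,
      fun _ _ => dirD_smul_right _ _ _⟩) fun v w =>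
    (smoothFieldAt_extendVec hp w).smul (contMDiffAt_dirD hf (smoothFieldAt_extendVec hp v))

lemma covD_curv_extendVec (a u v w : TangentSpace (𝓡 m) p) :
    covD (𝓡 m) (fun x : M => x) (fun x => curv x (extendVec p u x) (extendVec p v x)
        (extendVec p w x)) p a =
      dCurv p a u v w + curv p (covD (𝓡 m) (fun x : M => x) (extendVec p u) p a) v w
        + curv p u (covD (𝓡 m) (fun x : M => x) (extendVec p v) p a) w
        + curv p u v (covD (𝓡 m) (fun x : M => x) (extendVec p w) p a) := by
  have h : dCurv p a u v w = covD (𝓡 m) (fun x : M => x) (fun x => curv x (extendVec p u x)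
      (extendVec p v x) (extendVec p w x)) p a
      - curv p (covD (𝓡 m) (fun x : M => x) (extendVec p u) p a) v w
      - curv p u (covD (𝓡 m) (fun x : M => x) (extendVec p v) p a) w
      - curv p u v (covD (𝓡 m) (fun x : M => x) (extendVec p w) p a) := by
    have e : ∀ u : TangentSpace (𝓡 m) p, extendVec p u p = u := extendVec_self p
    simp only [dCurv, dCurvField, nabla, e]
    rfl
  rw [h]
  abel

/-- The covariant derivative of the Ricci operator. -/
def dRicci (p : M) (a v : TangentSpace (𝓡 m) p) : TangentSpace (𝓡 m) p :=
  covD (𝓡 m) (fun x : M => x) (fun x => ricci x (extendVec p v x)) p a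
    - ricci p (covD (𝓡 m) (fun x : M => x) (extendVec p v) p a)

/-- Ric(v, z) is the trace of w ↦ R(w, v)z, and traces commute with covariant differentiation. The
derivatives of the extensions of v and z reproduce the Ricci terms on both sides and drop out. -/
lemma inner_dRicci (a v z : TangentSpace (𝓡 m) p) :
    (inner ℝ (dRicci p a v) z : ℝ) =
      metricTrace p fun w w' => inner ℝ (dCurv p a w v z) w' := by
  have hp := mem_extChartAt_source (I := 𝓡 m) p
  have hs : ∀ v : TangentSpace (𝓡 m) p, SmoothFieldAt (extendVec p v) p :=
    fun v => smoothFieldAt_extendVec hp v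
  have h1 := dirD_inner (f := fun x : M => x) (smoothFieldAt_ricci (hs v)) (hs z) a
  have h2 := dirD_metricTrace_inner (p := p)
    (S := fun x w => curv x w (extendVec p v x) (extendVec p z x))
    (fun x => curv_isLinear₁ _ _) (fun w => (hs w).curv (hs v) (hs z)) a
  have h3 : (fun x => (inner ℝ (ricci x (extendVec p v x)) (extendVec p z x) : ℝ)) = fun x =>
      metricTrace x fun w w' => (inner ℝ (curv x w (extendVec p v x) (extendVec p z x)) w' : ℝ) :=
    funext fun x => inner_ricci _ _
  rw [h3, h2, extendVec_self] at h1
  simp only [covD_curv_extendVec, extendVec_self] at h1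
  rw [dRicci, inner_sub_left, inner_ricci]
  rw [inner_ricci v] at h1
  have h4 : metricTrace p (fun w w' => (inner ℝ
      (dCurv p a w v z + curv p (covD (𝓡 m) (fun x : M => x) (extendVec p w) p a) v z +
          curv p w (covD (𝓡 m) (fun x : M => x) (extendVec p v) p a) z +
        curv p w v (covD (𝓡 m) (fun x : M => x) (extendVec p z) p a) -
      curv p (covD (𝓡 m) (fun x : M => x) (extendVec p w) p a) v z) w' : ℝ)) =
      metricTrace p (fun w w' => (inner ℝ (dCurv p a w v z) w' : ℝ))
      + ricciForm p (covD (𝓡 m) (fun x : M => x) (extendVec p v) p a) z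
      + ricciForm p v (covD (𝓡 m) (fun x : M => x) (extendVec p z) p a) := by
    rw [ricciForm, ricciForm, ← metricTrace_add, ← metricTrace_add]
    refine metricTrace_congr fun w => ?_
    rw [← inner_add_left, ← inner_add_left]
    congr 1
    abel
  rw [h4] at h1
  linarith

lemma dirD_scal (z : TangentSpace (𝓡 m) p) :
    dirD (𝓡 m) (scal m (N := M)) p z =
      metricTrace p fun u u' => inner ℝ (dRicci p z u) u' := by
  have hp := mem_extChartAt_source (I := 𝓡 m) p
  have h := dirD_metricTrace_inner (p := p) (S := fun x w => ricci x w)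
    (fun x => isLinearMap_ricci x) (fun w => smoothFieldAt_ricci (smoothFieldAt_extendVec hp w)) z
  rw [← show (scal m (N := M)) = fun x => metricTrace x fun w w' => (inner ℝ (ricci x w) w' : ℝ) from
    funext fun x => metricTrace_congr fun w => (inner_ricci w w).symm] at h
  exact h

/-- The contracted second Bianchi identity. -/
lemma metricTrace_dRicci (p : M) :
    metricTrace (n := m) p (dRicci p) = (1 / 2 : ℝ) • grad (n := m) (scal m (N := M)) p := by
  refine ext_inner_right ℝ fun z => ?_
  rw [real_inner_smul_left, inner_grad, dirD_scal, inner_metricTrace_left]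
  simp only [inner_dRicci]
  -- The second Bianchi identity in the first three slots; pair and skew symmetry then bring the
  -- other two terms into the form of a divergence of the Ricci tensor.
  have h1 : ∀ u w : TangentSpace (𝓡 m) p, (inner ℝ (dCurv p z w u u) w : ℝ) =
      inner ℝ (dCurv p w u w z) u + inner ℝ (dCurv p u w u z) w := fun u w => by
    have h := congrArg (fun x => (inner ℝ x w : ℝ)) (dCurv_bianchi z w u u)
    simp only [inner_add_left, inner_zero_left] at h
    rw [inner_dCurv_pair_symm w u z u w, inner_dCurv_skew w u w u z,
      inner_dCurv_pair_symm u z w u w, ← neg_neg (dCurv p u u w z), ← dCurv_swap,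
      inner_neg_left] at h
    linarith
  have h2 : (metricTrace p fun u u' => metricTrace p fun w w' =>
        (inner ℝ (dCurv p z w u u') w' : ℝ)) =
      (metricTrace p fun u u' => metricTrace p fun w w' => (inner ℝ (dCurv p w u w' z) u' : ℝ))
      + metricTrace p fun u u' => metricTrace p fun w w' =>
        (inner ℝ (dCurv p u w u' z) w' : ℝ) := by
    rw [← metricTrace_add]
    refine metricTrace_congr fun u => ?_
    rw [← metricTrace_add]
    exact metricTrace_congr fun w => h1 u w
  -- The two double traces differ only in the names of the summation vectors. Hence dScal is twice
  -- the divergence of Ric, which is the source of the factor 1/2.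
  have h3 : (metricTrace p fun u u' => metricTrace p fun w w' =>
      (inner ℝ (dCurv p w u w' z) u' : ℝ)) = metricTrace p fun u u' => metricTrace p fun w w' =>
      (inner ℝ (dCurv p u w u' z) w' : ℝ) :=
    metricTrace_comm fun u u' w w' => (inner ℝ (dCurv p w u w' z) u' : ℝ)
  rw [h2, h3]
  ring

end Ricci

/-! ### Covariant differentiation along curves in N. -/

section CurveDerivatives

variable {n : ℕ} {N : Type*} [TopologicalSpace N] [ChartedSpace (Model n) N]
  [IsManifold (𝓡 n) ∞ N] [RiemannianBundle (fun x : N => TangentSpace (𝓡 n) x)]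
  [IsContMDiffRiemannianBundle (𝓡 n) ∞ (Model n) (fun x : N => TangentSpace (𝓡 n) x)]
  {γ : ℝ → N} {A B C : ∀ t, TangentSpace (𝓡 n) (γ t)} {t : ℝ}

lemma curveD_add (hA : SmoothSectionAt 𝓘(ℝ, ℝ) γ A t) (hB : SmoothSectionAt 𝓘(ℝ, ℝ) γ B t) :
    curveD γ (fun s => A s + B s) t = curveD γ A t + curveD γ B t := covD_add hA hB _

lemma curveD_sub (hA : SmoothSectionAt 𝓘(ℝ, ℝ) γ A t) (hB : SmoothSectionAt 𝓘(ℝ, ℝ) γ B t) :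
    curveD γ (fun s => A s - B s) t = curveD γ A t - curveD γ B t := covD_sub hA hB _

lemma curveD_neg (hA : SmoothSectionAt 𝓘(ℝ, ℝ) γ A t) :
    curveD γ (fun s => -A s) t = -curveD γ A t := covD_neg hA _

lemma curveD_const_smul (r : ℝ) (hA : SmoothSectionAt 𝓘(ℝ, ℝ) γ A t) :
    curveD γ (fun s => r • A s) t = r • curveD γ A t := covD_const_smul r hA _

lemma deriv_inner (hA : SmoothSectionAt 𝓘(ℝ, ℝ) γ A t) (hB : SmoothSectionAt 𝓘(ℝ, ℝ) γ B t) :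
    HasDerivAt (fun s => (inner ℝ (A s) (B s) : ℝ))
      (inner ℝ (curveD γ A t) (B t) + inner ℝ (A t) (curveD γ B t)) t := by
  have h := dirD_inner hA hB (1 : ℝ)
  have hd : ContDiffAt ℝ ∞ (fun s => (inner ℝ (A s) (B s) : ℝ)) t :=
    contMDiffAt_iff_contDiffAt.1 (hA.inner hB)
  have h2 := (differentiableAt_of_infty hd).hasDerivAt
  refine h2.congr_deriv ?_
  exact (dirD_self (fun s => (inner ℝ (A s) (B s) : ℝ)) t 1).symm.trans h

lemma coords_deriv_curve (hγ : ContMDiffAt 𝓘(ℝ, ℝ) (𝓡 n) ∞ γ t) {q : N}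
    (hq : γ t ∈ (extChartAt (𝓡 n) q).source) :
    coords q (γ t) (mfderiv 𝓘(ℝ, ℝ) (𝓡 n) γ t (1 : ℝ)) =
      fderiv ℝ (fun s => extChartAt (𝓡 n) q (γ s)) t 1 :=
  (dirD_extChartAt_comp (hγ.mdifferentiableAt (by simp)) hq (1 : ℝ)).symm.trans (dirD_self _ _ _)

/-- The covariant derivative of the curvature tensor along a curve. -/
lemma curveD_curv (hA : SmoothSectionAt 𝓘(ℝ, ℝ) γ A t) (hB : SmoothSectionAt 𝓘(ℝ, ℝ) γ B t)
    (hC : SmoothSectionAt 𝓘(ℝ, ℝ) γ C t) :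
    curveD γ (fun s => curv (γ s) (A s) (B s) (C s)) t =
      dCurv (γ t) (mfderiv 𝓘(ℝ, ℝ) (𝓡 n) γ t (1 : ℝ)) (A t) (B t) (C t)
        + curv (γ t) (curveD γ A t) (B t) (C t) + curv (γ t) (A t) (curveD γ B t) (C t)
        + curv (γ t) (A t) (B t) (curveD γ C t) := by
  have hq := mem_extChartAt_source (I := 𝓡 n) (γ t)
  have hg := contMDiffAt_iff_contDiffAt.1 (contMDiffAt_extChartAt_comp hA.base hq)
  have hr : ∀ {A : ∀ t, TangentSpace (𝓡 n) (γ t)}, SmoothSectionAt 𝓘(ℝ, ℝ) γ A t →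
      ContDiffAt ℝ ∞ (fun s => coords (γ t) (γ s) (A s)) t := fun hA =>
    contMDiffAt_iff_contDiffAt.1 (hA.contMDiffAt_coords hq)
  have e : (fun s => coords (γ t) (γ s) (curv (γ s) (A s) (B s) (C s))) =ᶠ[𝓝 t] fun s =>
      lcurv (christoffelL (γ t)) (extChartAt (𝓡 n) (γ t) (γ s)) (coords (γ t) (γ s) (A s))
        (coords (γ t) (γ s) (B s)) (coords (γ t) (γ s) (C s)) := by
    filter_upwards [hA.base.continuousAt.eventually
      ((isOpen_extChartAt_source (I := 𝓡 n) (γ t)).mem_nhds hq)] with s hs using coords_curv hs _ _ _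
  refine coords_inj ?_
  rw [coords_curveD (hA.curv hB hC) hq, lcov_congr e,
    lcov_lcurv (F := fun s => extChartAt (𝓡 n) (γ t) (γ s))
      (contDiffAt_christoffelL _ ((extChartAt (𝓡 n) (γ t)).map_source hq)) hg (hr hA) (hr hB)
      (hr hC)]
  simp only [coords_add, coords_curv_self, coords_dCurv_self, coords_curveD hA hq,
    coords_curveD hB hq, coords_curveD hC hq, coords_deriv_curve hA.base hq]

end CurveDerivatives

/-! ### Variations of the differential and of the Hessians of a family. -/

section VariationFormulas

variable {n : ℕ} {N : Type*} [TopologicalSpace N] [ChartedSpace (Model n) N]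
  [IsManifold (𝓡 n) ∞ N] [RiemannianBundle (fun x : N => TangentSpace (𝓡 n) x)]
  [IsContMDiffRiemannianBundle (𝓡 n) ∞ (Model n) (fun x : N => TangentSpace (𝓡 n) x)]
  {m : ℕ} {M : Type*} [TopologicalSpace M] [ChartedSpace (Model m) M] [IsManifold (𝓡 m) ∞ M]
  [RiemannianBundle (fun x : M => TangentSpace (𝓡 m) x)]
  [IsContMDiffRiemannianBundle (𝓡 m) ∞ (Model m) (fun x : M => TangentSpace (𝓡 m) x)]
  {f : ℝ → M → N} {p : M} {t : ℝ} {Y : ∀ t p, TangentSpace (𝓡 n) (f t p)}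

lemma eventually_famRep_christoffel (hf : SmoothFamily (m := m) (n := n) f) (t : ℝ) (p : M) :
    ∀ᶠ y in 𝓝 (t, extChartAt (𝓡 m) p p),
      ContDiffAt ℝ ∞ (famRep (n := n) p (f t p) f) y ∧
      ContDiffAt ℝ ∞ (christoffelL (f t p)) (famRep (n := n) p (f t p) f y) ∧
      ∀ a b, christoffelL (f t p) (famRep (n := n) p (f t p) f y) a b =
        christoffelL (f t p) (famRep (n := n) p (f t p) f y) b a := by
  filter_upwards [eventually_fam hf (mem_extChartAt_source (I := 𝓡 m) p)
    (mem_extChartAt_source (I := 𝓡 n) (f t p))] with y hy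
  have h1 := contDiffAt_famRep hf ((extChartAt (𝓡 m) p).map_target hy.1) hy.2
  rw [(extChartAt (𝓡 m) p).right_inv hy.1] at h1
  have h2 : famRep (n := n) p (f t p) f y ∈ (extChartAt (𝓡 n) (f t p)).target :=
    (extChartAt (𝓡 n) (f t p)).map_source hy.2
  exact ⟨h1, contDiffAt_christoffelL _ h2, christoffelL_comm _ h2⟩

lemma eventually_famSec (hf : SmoothFamily (m := m) (n := n) f) (hY : ∀ s x, SmoothFamAt m f Y s x)
    (t : ℝ) (p : M) : ∀ᶠ y in 𝓝 (t, extChartAt (𝓡 m) p p),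
      ContDiffAt ℝ ∞ (famSec p (f t p) f Y) y := by
  filter_upwards [eventually_fam hf (mem_extChartAt_source (I := 𝓡 m) p)
    (mem_extChartAt_source (I := 𝓡 n) (f t p))] with y hy
  have h1 := (smoothFamAt_iff hf ((extChartAt (𝓡 m) p).map_target hy.1) hy.2).1 (hY y.1 _)
  rwa [(extChartAt (𝓡 m) p).right_inv hy.1] at h1

lemma eventually_mem_source_curve (hf : SmoothFamily (m := m) (n := n) f) (t : ℝ) (p : M) :
    ∀ᶠ s in 𝓝 t, f s p ∈ (extChartAt (𝓡 n) (f t p)).source :=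
  (hf.curve p).continuous.continuousAt.eventually
    ((isOpen_extChartAt_source (I := 𝓡 n) (f t p)).mem_nhds (mem_extChartAt_source (f t p)))

/-- The variation of the differential. -/
lemma curveD_dmap (hf : SmoothFamily (m := m) (n := n) f) (u : TangentSpace (𝓡 m) p) :
    SmoothSectionAt 𝓘(ℝ, ℝ) (fun s => f s p) (fun s => dmap m n (f s) p u) t ∧
    curveD (fun s => f s p) (fun s => dmap m n (f s) p u) t =
      covD (𝓡 m) (f t) (velo (n := n) f t) p u := by
  have hp := mem_extChartAt_source (I := 𝓡 m) p
  have hq := mem_extChartAt_source (I := 𝓡 n) (f t p)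
  have h0 := (eventually_famRep_christoffel hf t p).self_of_nhds
  have h := coords_curveD_fam hf hp hq (Z := fun s => dmap m n (f s) p u)
    (contDiffAt_fderiv_apply h0.1 (contDiffAt_const (c := ((0 : ℝ), coords p p u)))) (by
      filter_upwards [eventually_mem_source_curve hf t p] with s hs
        using coords_dmap_fam hf hp hs u)
  refine ⟨h.1, coords_inj ?_⟩
  rw [coords_covD_fam hf hp hq (smoothFamAt_velo hf), h.2,
    lcov_congr (famSec_velo_eventuallyEq hf hp hq), lcov_fderiv_comm h0.1 h0.2.2]

/-- The variation of the second fundamental form. -/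
lemma curveD_hessMap (hf : SmoothFamily (m := m) (n := n) f) (u v : TangentSpace (𝓡 m) p) :
    SmoothSectionAt 𝓘(ℝ, ℝ) (fun s => f s p) (fun s => hessMap m n (f s) p u v) t ∧
    curveD (fun s => f s p) (fun s => hessMap m n (f s) p u v) t =
      hessSec m n (f t) (velo (n := n) f t) p u v
        + curv (f t p) (velo f t p) (dmap m n (f t) p u) (dmap m n (f t) p v) := by
  have hp := mem_extChartAt_source (I := 𝓡 m) p
  have hq := mem_extChartAt_source (I := 𝓡 n) (f t p)
  have hev := eventually_famRep_christoffel hf t p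
  have h0 := hev.self_of_nhds
  have hb := contDiffAt_fderiv_apply h0.1 (contDiffAt_const (c := ((0 : ℝ), coords p p v)))
  have h := coords_curveD_fam hf hp hq (Z := fun s => hessMap m n (f s) p u v)
    -- The Christoffel vector of M is frozen at p: the representative has to agree with the family
    -- only along the curve through p, and M does not vary with time. This makes it the constant
    -- direction c of `lcov_hess_map`.
    (Zr := fun y => lcov (christoffelL (f t p)) (famRep (n := n) p (f t p) f)
        (fun y => fderiv ℝ (famRep (n := n) p (f t p) f) y (0, coords p p v)) y (0, coords p p u)
      - fderiv ℝ (famRep (n := n) p (f t p) f) y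
        (0, christoffelL p (extChartAt (𝓡 m) p p) (coords p p u) (coords p p v)))
    ((contDiffAt_lcov h0.2.1 h0.1 hb contDiffAt_const).sub
      (contDiffAt_fderiv_apply h0.1 contDiffAt_const)) (by
      filter_upwards [eventually_mem_source_curve hf t p] with s hs
        using coords_hessMap_fam hf hp hs u v)
  refine ⟨h.1, coords_inj ?_⟩
  have hv : ∀ a, (fun y => lcov (christoffelL (f t p)) (famRep (n := n) p (f t p) f)
      (famSec p (f t p) f (velo (n := n) f)) y a) =ᶠ[𝓝 (t, extChartAt (𝓡 m) p p)]
      fun y => lcov (christoffelL (f t p)) (famRep (n := n) p (f t p) f)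
        (fun y => fderiv ℝ (famRep (n := n) p (f t p) f) y (1, 0)) y a := fun a => by
    filter_upwards [(famSec_velo_eventuallyEq hf hp hq).eventuallyEq_nhds] with y hy
      using lcov_congr hy a
  rw [h.2, lcov_hess_map (hev.mono fun y hy => hy.2.1) (hev.mono fun y hy => hy.2.2)
      (hev.mono fun y hy => hy.1), coords_add,
    coords_hessSec_fam hf (fun s x => smoothFamAt_velo hf) hp hq, coords_curv_self,
    coords_velo hf hp hq, coords_dmap_fam hf hp hq, coords_dmap_fam hf hp hq, famRep_apply hp,
    lcov_congr (hv _), lcov_congr (famSec_velo_eventuallyEq hf hp hq)]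

/-- The variation of the second covariant derivative of a section. -/
lemma curveD_hessSec (hf : SmoothFamily (m := m) (n := n) f) (hY : ∀ s x, SmoothFamAt m f Y s x)
    (u v : TangentSpace (𝓡 m) p) :
    SmoothSectionAt 𝓘(ℝ, ℝ) (fun s => f s p) (fun s => hessSec m n (f s) (Y s) p u v) t ∧
    curveD (fun s => f s p) (fun s => hessSec m n (f s) (Y s) p u v) t =
      hessSec m n (f t) (timeD f Y t) p u v
        + (dCurv (f t p) (dmap m n (f t) p u) (velo f t p) (dmap m n (f t) p v) (Y t p)
          + curv (f t p) (covD (𝓡 m) (f t) (velo (n := n) f t) p u) (dmap m n (f t) p v) (Y t p)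
          + curv (f t p) (velo f t p) (hessMap m n (f t) p u v) (Y t p)
          + curv (f t p) (velo f t p) (dmap m n (f t) p v) (covD (𝓡 m) (f t) (Y t) p u)
          + curv (f t p) (velo f t p) (dmap m n (f t) p u) (covD (𝓡 m) (f t) (Y t) p v)) := by
  have hp := mem_extChartAt_source (I := 𝓡 m) p
  have hq := mem_extChartAt_source (I := 𝓡 n) (f t p)
  have hev := eventually_famRep_christoffel hf t p
  have hevY := eventually_famSec hf hY t p
  have h0 := hev.self_of_nhds
  have hb := contDiffAt_lcov h0.2.1 h0.1 hevY.self_of_nhds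
    (contDiffAt_const (c := ((0 : ℝ), coords p p v)))
  have h := coords_curveD_fam hf hp hq (Z := fun s => hessSec m n (f s) (Y s) p u v)
    (Zr := fun y => lcov (christoffelL (f t p)) (famRep (n := n) p (f t p) f)
        (fun y => lcov (christoffelL (f t p)) (famRep (n := n) p (f t p) f)
          (famSec p (f t p) f Y) y (0, coords p p v)) y (0, coords p p u)
      - lcov (christoffelL (f t p)) (famRep (n := n) p (f t p) f) (famSec p (f t p) f Y) y
        (0, christoffelL p (extChartAt (𝓡 m) p p) (coords p p u) (coords p p v)))
    ((contDiffAt_lcov h0.2.1 h0.1 hb contDiffAt_const).sub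
      (contDiffAt_lcov h0.2.1 h0.1 hevY.self_of_nhds contDiffAt_const)) (by
      filter_upwards [eventually_mem_source_curve hf t p] with s hs
        using coords_hessSec_fam hf hY hp hs u v)
  refine ⟨h.1, coords_inj ?_⟩
  have hv : ∀ a, (fun y => lcov (christoffelL (f t p)) (famRep (n := n) p (f t p) f)
      (famSec p (f t p) f (timeD f Y)) y a) =ᶠ[𝓝 (t, extChartAt (𝓡 m) p p)]
      fun y => lcov (christoffelL (f t p)) (famRep (n := n) p (f t p) f)
        (fun y => lcov (christoffelL (f t p)) (famRep (n := n) p (f t p) f)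
          (famSec p (f t p) f Y) y (1, 0)) y a := fun a => by
    filter_upwards [(famSec_timeD_eventuallyEq hf hp hq hY).eventuallyEq_nhds] with y hy
      using lcov_congr hy a
  rw [h.2, lcov_hess_sec (hev.mono fun y hy => hy.2.1) (hev.mono fun y hy => hy.1) hevY]
  simp only [coords_add, coords_curv_self, coords_dCurv_self]
  rw [coords_hessSec_fam hf (fun s x => smoothFamAt_timeD hf hY) hp hq,
    coords_velo hf hp hq, coords_dmap_fam hf hp hq, coords_dmap_fam hf hp hq,
    coords_covD_fam hf hp hq (smoothFamAt_velo hf), coords_covD_fam hf hp hq (hY t p),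
    coords_covD_fam hf hp hq (hY t p), coords_hessMap_fam hf hp hq,
    lcov_congr (hv _), lcov_congr (famSec_timeD_eventuallyEq hf hp hq hY),
    lcov_congr (famSec_velo_eventuallyEq hf hp hq), famRep_apply hp, famSec_apply hp]

/-- The base point p and its orthonormal basis are fixed along the curve, so the trace is a finite
sum with constant frame and is differentiated term by term. -/
lemma curveD_metricTrace (hf : SmoothFamily (m := m) (n := n) f)
    {B : ∀ s, TangentSpace (𝓡 m) p → TangentSpace (𝓡 m) p → TangentSpace (𝓡 n) (f s p)}
    {D : TangentSpace (𝓡 m) p → TangentSpace (𝓡 m) p → TangentSpace (𝓡 n) (f t p)}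
    (h : ∀ u v, SmoothSectionAt 𝓘(ℝ, ℝ) (fun s => f s p) (fun s => B s u v) t ∧
      curveD (fun s => f s p) (fun s => B s u v) t = D u v) :
    SmoothSectionAt 𝓘(ℝ, ℝ) (fun s => f s p) (fun s => metricTrace p (B s)) t ∧
      curveD (fun s => f s p) (fun s => metricTrace p (B s)) t = metricTrace p D := by
  refine ⟨smoothSectionAt_sum (f := fun s => f s p) (hf.curve p t) _ fun i _ => (h _ _).1, ?_⟩
  refine (covD_sum (f := fun s => f s p) (hf.curve p t) _ (fun i _ => (h _ _).1) _).trans ?_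
  exact Finset.sum_congr rfl fun i _ => (h _ _).2

end VariationFormulas

/-! ### The Euler-Lagrange operator and its linearisation. -/

section Bitension

variable {n : ℕ} {N : Type*} [TopologicalSpace N] [ChartedSpace (Model n) N]
  [IsManifold (𝓡 n) ∞ N] [RiemannianBundle (fun x : N => TangentSpace (𝓡 n) x)]
  [IsContMDiffRiemannianBundle (𝓡 n) ∞ (Model n) (fun x : N => TangentSpace (𝓡 n) x)]
  {m : ℕ} {M : Type*} [TopologicalSpace M] [ChartedSpace (Model m) M] [IsManifold (𝓡 m) ∞ M]
  [RiemannianBundle (fun x : M => TangentSpace (𝓡 m) x)]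
  [IsContMDiffRiemannianBundle (𝓡 m) ∞ (Model m) (fun x : M => TangentSpace (𝓡 m) x)]
  {f : ℝ → M → N} {p : M} {t : ℝ} {Y : ∀ t p, TangentSpace (𝓡 n) (f t p)}

variable (m n) in
/-- The Euler-Lagrange operator of the conformal bienergy. -/
def bitension (φ : M → N) (p : M) : TangentSpace (𝓡 n) (φ p) :=
  -jacobiE m n φ (tension m n φ) p - (2 / 3 * scal m p : ℝ) • tension m n φ p
    + (2 : ℝ) • (metricTrace p fun u v => hessMap m n φ p (ricci p u) v)
    + (1 / 3 : ℝ) • dmap m n φ p (grad (n := m) (scal m) p)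

lemma metricTrace_map {F G : Type*} [AddCommGroup F] [Module ℝ F] [AddCommGroup G] [Module ℝ G]
    {L : F → G} (hL : IsLinearMap ℝ L) (B : TangentSpace (𝓡 m) p → TangentSpace (𝓡 m) p → F) :
    L (metricTrace p B) = metricTrace p fun u v => L (B u v) :=
  map_sum (hL.mk' L) _ _

lemma bilin_curv {V F : Type*} [AddCommGroup V] [Module ℝ V] [AddCommGroup F] [Module ℝ F]
    {R : F → F → F → F} (h₁ : ∀ b c, IsLinearMap ℝ fun a => R a b c)
    (h₃ : ∀ a b, IsLinearMap ℝ (R a b)) {S : V → F} (hS : IsLinearMap ℝ S) (w : F) :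
    Bilin fun u v => R (S u) w (S v) :=
  ⟨fun _ => ⟨fun _ _ => by simp only [hS.map_add, (h₁ _ _).map_add],
      fun _ _ => by simp only [hS.map_smul, (h₁ _ _).map_smul]⟩,
    fun _ => ⟨fun _ _ => by simp only [hS.map_add, (h₃ _ _).map_add],
      fun _ _ => by simp only [hS.map_smul, (h₃ _ _).map_smul]⟩⟩

lemma Bilin.comp_left {V F : Type*} [AddCommGroup V] [Module ℝ V] [AddCommGroup F] [Module ℝ F]
    {B : V → V → F} (hB : Bilin B) {S : V → V} (hS : IsLinearMap ℝ S) :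
    Bilin fun u v => B (S u) v :=
  ⟨fun v => ⟨fun _ _ => by simp only [hS.map_add, (hB.1 v).map_add],
      fun _ _ => by simp only [hS.map_smul, (hB.1 v).map_smul]⟩, fun u => hB.2 (S u)⟩

lemma smoothFamAt_metricTrace (hf : SmoothFamily (m := m) (n := n) f)
    {B : ∀ t p, TangentSpace (𝓡 m) p → TangentSpace (𝓡 m) p → TangentSpace (𝓡 n) (f t p)}
    (hB : ∀ t p, Bilin (B t p))
    (hs : ∀ v w : TangentSpace (𝓡 m) p,
      SmoothFamAt m f (fun t x => B t x (extendVec p v x) (extendVec p w x)) t p) :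
    SmoothFamAt m f (fun t p => metricTrace p (B t p)) t p :=
  smoothSectionAt_metricTrace (pr := fun x : ℝ × M => x.2) (g := fun x : ℝ × M => f x.1 x.2)
    (B := fun x => B x.1 x.2) contMDiffAt_snd (hf (t, p)) (.of_forall fun x => hB x.1 x.2) hs

lemma smoothFamAt_tension (hf : SmoothFamily (m := m) (n := n) f) (t : ℝ) (p : M) :
    SmoothFamAt m f (fun t => tension m n (f t)) t p :=
  smoothFamAt_metricTrace hf (fun t _ => bilin_hessMap (.of_forall (hf.slice t))) fun v w =>
    smoothFamAt_hessMap hf (smoothFieldAt_extendVec (mem_extChartAt_source (I := 𝓡 m) p) v)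
      (eventually_smoothFieldAt_extendVec p w)

lemma smoothFamAt_jacobiE (hf : SmoothFamily (m := m) (n := n) f)
    (hY : ∀ s x, SmoothFamAt m f Y s x) (t : ℝ) (p : M) :
    SmoothFamAt m f (fun t => jacobiE m n (f t) (Y t)) t p := by
  have hs : ∀ v : TangentSpace (𝓡 m) p, SmoothFieldAt (extendVec p v) p :=
    smoothFieldAt_extendVec (mem_extChartAt_source (I := 𝓡 m) p)
  have h1 : SmoothFamAt m f (fun t p => metricTrace p (hessSec m n (f t) (Y t) p)) t p :=
    smoothFamAt_metricTrace hf (fun t _ => bilin_hessSec (.of_forall fun x => (hY t x).slice))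
      fun v w => smoothFamAt_hessSec hf hY (hs v) (eventually_smoothFieldAt_extendVec p w)
  have h2 : SmoothFamAt m f (fun t p => metricTrace p fun u v =>
      curv (f t p) (dmap m n (f t) p u) (Y t p) (dmap m n (f t) p v)) t p :=
    smoothFamAt_metricTrace hf (fun t _ => bilin_curv curv_isLinear₁ curv_isLinear₃
        (isLinearMap_dmap _ _) _)
      fun v w => SmoothSectionAt.curv (smoothFamAt_dmap hf (hs v)) (hY t p)
        (smoothFamAt_dmap hf (hs w))
  exact SmoothSectionAt.add (SmoothSectionAt.neg h1) h2

lemma contMDiffAt_comp_snd {h : M → ℝ} (hh : ContMDiff (𝓡 m) 𝓘(ℝ, ℝ) ∞ h) (t : ℝ) (p : M) :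
    ContMDiffAt (𝓘(ℝ, ℝ).prod (𝓡 m)) 𝓘(ℝ, ℝ) ∞ (fun x : ℝ × M => h x.2) (t, p) :=
  (hh p).comp (t, p) contMDiffAt_snd

lemma contMDiff_scal_mul : ContMDiff (𝓡 m) 𝓘(ℝ, ℝ) ∞ fun p : M => (2 / 3 * scal m p : ℝ) :=
  contMDiff_const.mul contMDiff_scal

lemma smoothFamAt_hessMap_ricci (hf : SmoothFamily (m := m) (n := n) f) (t : ℝ) (p : M) :
    SmoothFamAt m f (fun t p => metricTrace p fun u v => hessMap m n (f t) p (ricci p u) v) t p :=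
  smoothFamAt_metricTrace hf
    (fun t p => (bilin_hessMap (.of_forall (hf.slice t))).comp_left (isLinearMap_ricci p))
    fun v w => smoothFamAt_hessMap hf (smoothFieldAt_ricci
      (smoothFieldAt_extendVec (mem_extChartAt_source (I := 𝓡 m) p) v))
      (eventually_smoothFieldAt_extendVec p w)

lemma smoothFamAt_bitension (hf : SmoothFamily (m := m) (n := n) f) (t : ℝ) (p : M) :
    SmoothFamAt m f (fun t => bitension (m := m) (n := n) (f t)) t p :=
  SmoothSectionAt.add (SmoothSectionAt.add (SmoothSectionAt.sub
    (SmoothSectionAt.neg (smoothFamAt_jacobiE hf (smoothFamAt_tension hf) t p))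
    (SmoothSectionAt.smul (c := fun x : ℝ × M => (2 / 3 * scal m x.2 : ℝ))
      (contMDiffAt_comp_snd (contMDiff_scal_mul (M := M)) t p)
      (smoothFamAt_tension hf t p)))
    (SmoothSectionAt.const_smul 2 (smoothFamAt_hessMap_ricci hf t p)))
    (SmoothSectionAt.const_smul (1 / 3) (smoothFamAt_dmap hf (smoothFieldAt_grad contMDiff_scal p)))

/-- Taking the trace of the variation of the second fundamental form yields the trace of ∇²V plus
that of R(V, dφ(·))dφ(·). With the sign conventions of J this is -J(V). -/
lemma timeD_tension (hf : SmoothFamily (m := m) (n := n) f) (t : ℝ) (p : M) :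
    timeD f (fun t => tension m n (f t)) t p = -jacobiE m n (f t) (velo (n := n) f t) p := by
  have h := (curveD_metricTrace hf (p := p) (t := t) (B := fun s => hessMap m n (f s) p)
    (fun u v => curveD_hessMap hf u v)).2
  refine h.trans ?_
  rw [jacobiE, roughLaplacian, metricTrace_add, neg_add, neg_neg, ← metricTrace_neg]
  congr 1
  exact metricTrace_congr fun u => by rw [curv_swap]

lemma timeD_jacobiE (hf : SmoothFamily (m := m) (n := n) f)
    (hY : ∀ s x, SmoothFamAt m f Y s x) (t : ℝ) (p : M) :
    timeD f (fun t => jacobiE m n (f t) (Y t)) t p =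
      -metricTrace p (fun u v => hessSec m n (f t) (timeD f Y t) p u v
        + (dCurv (f t p) (dmap m n (f t) p u) (velo f t p) (dmap m n (f t) p v) (Y t p)
          + curv (f t p) (covD (𝓡 m) (f t) (velo (n := n) f t) p u) (dmap m n (f t) p v) (Y t p)
          + curv (f t p) (velo f t p) (hessMap m n (f t) p u v) (Y t p)
          + curv (f t p) (velo f t p) (dmap m n (f t) p v) (covD (𝓡 m) (f t) (Y t) p u)
          + curv (f t p) (velo f t p) (dmap m n (f t) p u) (covD (𝓡 m) (f t) (Y t) p v)))
      + metricTrace p fun u v =>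
        dCurv (f t p) (velo f t p) (dmap m n (f t) p u) (Y t p) (dmap m n (f t) p v)
          + curv (f t p) (covD (𝓡 m) (f t) (velo (n := n) f t) p u) (Y t p) (dmap m n (f t) p v)
          + curv (f t p) (dmap m n (f t) p u) (timeD f Y t p) (dmap m n (f t) p v)
          + curv (f t p) (dmap m n (f t) p u) (Y t p)
              (covD (𝓡 m) (f t) (velo (n := n) f t) p v) := by
  have h1 := curveD_metricTrace hf (p := p) (t := t) (B := fun s => hessSec m n (f s) (Y s) p)
    (fun u v => curveD_hessSec hf hY u v)
  have h2 := curveD_metricTrace hf (p := p) (t := t)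
    (B := fun s u v => curv (f s p) (dmap m n (f s) p u) (Y s p) (dmap m n (f s) p v))
    (fun u v => ⟨(curveD_dmap hf u).1.curv (hY t p).curve (curveD_dmap hf v).1,
      (curveD_curv (curveD_dmap hf u).1 (hY t p).curve (curveD_dmap hf v).1).trans rfl⟩)
  refine (curveD_add h1.1.neg h2.1).trans ?_
  rw [curveD_neg h1.1, h1.2, h2.2]
  congr 1
  refine metricTrace_congr fun u => ?_
  rw [(curveD_dmap hf u).2]
  rfl

lemma hessSec_neg {φ : M → N} {W : ∀ p, TangentSpace (𝓡 n) (φ p)}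
    (hW : ∀ x, SmoothSectionAt (𝓡 m) φ W x) (u v : TangentSpace (𝓡 m) p) :
    hessSec m n φ (fun x => -W x) p u v = -hessSec m n φ W p u v := by
  have hv := smoothFieldAt_extendVec (mem_extChartAt_source (I := 𝓡 m) p) v
  rw [hessSec_eq, hessSec_eq, covD_neg (hW p), neg_sub']
  congr 1
  have e : (fun y => covD (𝓡 m) φ (fun x => -W x) y (extendVec p v y)) =
      fun y => -covD (𝓡 m) φ W y (extendVec p v y) := funext fun y => covD_neg (hW y) _
  rw [e, covD_neg (smoothSectionAt_covD (.of_forall hW) hv)]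

/-- The algebra behind the second variation of the bienergy. -/
lemma second_variation_integrand {q : N} (a V τ h T S H W : TangentSpace (𝓡 n) q) :
    (-H + (dCurv q a V a τ + curv q T a τ + curv q V h τ + curv q V a S + curv q V a S))
      - (dCurv q V a τ a + curv q T τ a + curv q a (-W) a + curv q a τ T) =
    -H + curv q a W a + curv q V h τ - dCurv q τ a V a
      + (dCurv q a τ a V + (2 : ℝ) • curv q V a S + (2 : ℝ) • curv q τ a T) := by
  -- In the application a = dφ(u), V is the velocity, h = ∇dφ(u,u), T = ∇_u V, S = ∇_u τ, W = J(V)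
  -- and H = (∇²W)(u,u). The first Bianchi identity cancels R(T,τ)a and doubles the term R(τ,a)T.
  have e1 : curv q T a τ = curv q T τ a - curv q a τ T := by
    have := curv_bianchi T a τ
    rw [curv_swap T τ a] at this
    rw [eq_sub_iff_add_eq, ← sub_eq_zero, ← this]
    abel
  have e2 : curv q a (-W) a = -curv q a W a := by
    have := (curv_isLinear₂ a a).map_neg W
    exact this
  -- The second Bianchi identity here and the differentiated first one in the next step both produce
  -- (∇R)(a,τ,V,a). The two copies cancel in the total.
  have e3 : dCurv q V a τ a = dCurv q τ a V a - dCurv q a τ V a := by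
    have := dCurv_bianchi V a τ a
    rw [dCurv_swap τ a V a] at this
    rw [eq_sub_iff_add_eq, ← sub_eq_zero, ← this]
    abel
  have e4 : dCurv q a V a τ = dCurv q a τ a V - dCurv q a τ V a := by
    have := dCurv_bianchi_right a V a τ
    rw [dCurv_swap a τ a V] at this
    rw [eq_sub_iff_add_eq, ← sub_eq_zero, ← this]
    abel
  rw [e1, e2, e3, e4, two_smul, two_smul, curv_swap a τ T]
  abel

/-- The linearisation of the Euler-Lagrange operator. -/
lemma timeD_bitension (hf : SmoothFamily (m := m) (n := n) f) (t : ℝ) (p : M) :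
    timeD f (fun t => bitension (m := m) (n := n) (f t)) t p = jacobiE2c m n (f t) (velo (n := n) f t) p := by
  have hτ := smoothFamAt_tension hf
  have hJ := smoothFamAt_jacobiE hf hτ
  have hV : ∀ t p, SmoothFamAt m f (velo (n := n) f) t p := fun t p => smoothFamAt_velo hf
  have hJV := fun x => (smoothFamAt_jacobiE hf hV t x).slice
  set c : ℝ := 2 / 3 * scal m p with hc
  have hH := curveD_metricTrace hf (p := p) (t := t)
    (B := fun s u v => hessMap m n (f s) p (ricci p u) v) (fun u v => curveD_hessMap hf _ _)
  have hd := curveD_dmap hf (t := t) (grad (n := m) (scal m) p)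
  have hτc := (hτ t p).curve
  have h0 : timeD f (fun t => bitension (m := m) (n := n) (f t)) t p =
      -timeD f (fun t => jacobiE m n (f t) (tension m n (f t))) t p
        - c • timeD f (fun t => tension m n (f t)) t p
        + (2 : ℝ) • curveD (fun s => f s p) (fun s => metricTrace p
            fun u v => hessMap m n (f s) p (ricci p u) v) t
        + (1 / 3 : ℝ) • curveD (fun s => f s p)
            (fun s => dmap m n (f s) p (grad (n := m) (scal m) p)) t := by
    refine (curveD_add (((hJ t p).curve.neg.sub (hτc.const_smul c)).add (hH.1.const_smul 2))
      (hd.1.const_smul (1 / 3))).trans ?_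
    rw [curveD_add ((hJ t p).curve.neg.sub (hτc.const_smul c)) (hH.1.const_smul 2),
      curveD_sub (hJ t p).curve.neg (hτc.const_smul c), curveD_neg (hJ t p).curve,
      curveD_const_smul c hτc, curveD_const_smul 2 hH.1, curveD_const_smul (1 / 3) hd.1]
    rfl
  have e1 : timeD f (fun t => tension m n (f t)) t =
      fun p => -jacobiE m n (f t) (velo (n := n) f t) p := funext fun p => timeD_tension hf t p
  -- R(τ,V)τ does not come from one differentiated factor: it is the trace of the terms R(V,
  -- ∇dφ(u,u))τ, because τ is the trace of the second fundamental form.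
  have e2 : curv (f t p) (tension m n (f t) p) (velo f t p) (tension m n (f t) p) =
      -metricTrace p fun u v => curv (f t p) (velo f t p) (hessMap m n (f t) p u v)
        (tension m n (f t) p) := by
    rw [curv_swap, ← metricTrace_map (L := fun h => curv (f t p) (velo f t p) h
      (tension m n (f t) p)) (curv_isLinear₂ _ _)]
    rfl
  have key : -timeD f (fun t => jacobiE m n (f t) (tension m n (f t))) t p =
      jacobiE2 m n (f t) (velo (n := n) f t) p := by
    rw [timeD_jacobiE hf hτ, e1]
    rw [jacobiE2, e2]
    nth_rw 1 [jacobiE]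
    rw [roughLaplacian, neg_add, neg_neg, sub_neg_eq_add, ← sub_eq_add_neg, ← metricTrace_sub,
      ← metricTrace_neg, ← metricTrace_add, ← metricTrace_add, ← metricTrace_sub,
      ← metricTrace_add]
    refine metricTrace_congr fun u => ?_
    rw [hessSec_neg hJV]
    exact second_variation_integrand _ _ _ _ _ _ _ _
  have e3 : (metricTrace p fun u v => hessSec m n (f t) (velo (n := n) f t) p (ricci p u) v
        + curv (f t p) (velo f t p) (dmap m n (f t) p (ricci p u)) (dmap m n (f t) p v)) =
      (metricTrace p fun u v => hessSec m n (f t) (velo (n := n) f t) p (ricci p u) v)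
      - metricTrace p fun u v => curv (f t p) (dmap m n (f t) p (ricci p u)) (velo f t p)
        (dmap m n (f t) p v) := by
    rw [← metricTrace_sub]
    exact metricTrace_congr fun u => by rw [curv_swap, sub_eq_add_neg]
  rw [h0, key, hH.2, hd.2, e1, e3, jacobiE2c, smul_neg, sub_neg_eq_add, smul_sub]
  change _ = _ + (1 / 3 : ℝ) • covD (𝓡 m) (f t) (velo (n := n) f t) p (grad (n := m) (scal m) p)
  abel

end Bitension

/-! ### Derivative of the determinant. -/

section Determinant

/-- Jacobi's formula for the derivative of a determinant. -/
lemma hasDerivAt_det {n : ℕ} {G : ℝ → Matrix (Fin n) (Fin n) ℝ} {H : Matrix (Fin n) (Fin n) ℝ}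
    {t : ℝ} (hG : ∀ i j, HasDerivAt (fun s => G s i j) (H i j) t) (h0 : (G t).det ≠ 0) :
    HasDerivAt (fun s => (G s).det) ((G t).det * ((G t)⁻¹ * H).trace) t := by
  have hd : ∀ A : Fin n → Fin n → ℝ,
      DifferentiableAt ℝ (fun A : Fin n → Fin n → ℝ => (Matrix.of A).det) A := fun A => by
    simp only [Matrix.det_apply, Matrix.of_apply]
    fun_prop
  have hpi : ∀ {K : ℝ → Fin n → Fin n → ℝ} {K' : Fin n → Fin n → ℝ} {s : ℝ},
      (∀ i j, HasDerivAt (fun s => K s i j) (K' i j) s) → HasDerivAt K K' s := fun h =>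
    hasDerivAt_pi.2 fun i => hasDerivAt_pi.2 fun j => h i j
  have h1 := ((hd (G t)).hasFDerivAt).comp_hasDerivAt t (hpi (K := G) (K' := H) hG)
  have h2 : HasDerivAt (fun s : ℝ => fun i j => G t i j + s * H i j) H 0 :=
    hpi fun i j => by
      simpa using ((hasDerivAt_id (0 : ℝ)).mul_const (H i j)).const_add (G t i j)
  have h3 := HasFDerivAt.comp_hasDerivAt (0 : ℝ)
    (f := fun s : ℝ => fun i j => G t i j + s * H i j)
    (l := fun A : Fin n → Fin n → ℝ => (Matrix.of A).det) (hd _).hasFDerivAt h2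
  -- The differential of det in the direction H is found on the affine line G + sH, where det(G +
  -- sH) = det G · det(1 + s G⁻¹H) and the linear coefficient of the second factor is the trace of
  -- G⁻¹H.
  obtain ⟨P, hP⟩ : ∃ P : Polynomial ℝ, ∀ s : ℝ, (1 + s • ((G t)⁻¹ * H)).det =
      1 + ((G t)⁻¹ * H).trace * s + P.eval s * s ^ 2 :=
    ⟨_, fun s => Matrix.det_one_add_smul s _⟩
  have h4 : (fun s : ℝ => (Matrix.of fun i j => G t i j + s * H i j).det) = fun s =>
      (G t).det * (1 + ((G t)⁻¹ * H).trace * s + P.eval s * s ^ 2) := by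
    funext s
    rw [← hP, ← Matrix.det_mul, mul_add, mul_one, Matrix.mul_smul, ← mul_assoc,
      Matrix.mul_nonsing_inv _ (isUnit_iff_ne_zero.2 h0), one_mul]
    rfl
  have h5 : HasDerivAt (fun s : ℝ => (G t).det *
      (1 + ((G t)⁻¹ * H).trace * s + P.eval s * s ^ 2)) ((G t).det * ((G t)⁻¹ * H).trace) 0 := by
    have := ((((hasDerivAt_id (0 : ℝ)).const_mul ((G t)⁻¹ * H).trace).const_add 1).add
      ((P.hasDerivAt 0).mul (hasDerivAt_pow 2 (0 : ℝ)))).const_mul (G t).det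
    simpa using this
  rw [← h4] at h5
  have h6 := h3.unique h5
  have e : (fun i j => G t i j + 0 * H i j) = G t := by
    funext i j
    simp
  rw [e] at h6
  rw [h6] at h1
  exact h1

end Determinant

/-! ### The volume density and the divergence in a chart. -/

section Density

variable {m : ℕ} {M : Type*} [TopologicalSpace M] [ChartedSpace (Model m) M]
  [IsManifold (𝓡 m) ∞ M] [RiemannianBundle (fun x : M => TangentSpace (𝓡 m) x)]

/-- The density of the Riemannian measure in a chart. -/
def density (q : M) (z : Model m) : ℝ := Real.sqrt (gram q z).det

lemma density_pos (q : M) {z : Model m} (hz : z ∈ (extChartAt (𝓡 m) q).target) :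
    0 < density q z := Real.sqrt_pos.2 (gram_det_pos q hz)

lemma gram_change {q q' : M} {z : Model m} (hz : z ∈ (extChartAt (𝓡 m) q).target)
    (hz' : (extChartAt (𝓡 m) q).symm z ∈ (extChartAt (𝓡 m) q').source) :
    (gram q z).det = (fderiv ℝ (chartChange q q') z).det ^ 2 *
      (gram q' (chartChange q q' z)).det := by
  set A : Matrix (Fin m) (Fin m) ℝ :=
    Matrix.of fun i j => fderiv ℝ (chartChange q q') z (stdVec j) i with hA
  have hdet : (fderiv ℝ (chartChange q q') z).det = A.det := by
    rw [ContinuousLinearMap.det, ← LinearMap.det_toMatrix (EuclideanSpace.basisFun (Fin m) ℝ).toBasis]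
    congr 1
  have h : gram q z = A.transpose * gram q' (chartChange q q' z) * A := by
    ext i j
    rw [gram_apply, chartMetric_change hz hz', ← sum_smul_stdVec (fderiv ℝ (chartChange q q') z (stdVec i)),
      ← sum_smul_stdVec (fderiv ℝ (chartChange q q') z (stdVec j))]
    simp only [map_sum, map_smul, _root_.sum_apply, _root_.smul_apply,
      smul_eq_mul, Matrix.mul_apply, Matrix.transpose_apply, hA, Matrix.of_apply, Finset.sum_mul,
      ← gram_apply]
    refine Finset.sum_congr rfl fun k _ => ?_
    rw [Finset.mul_sum]
    exact Finset.sum_congr rfl fun l _ => by ring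
  rw [hdet, h, Matrix.det_mul, Matrix.det_mul, Matrix.det_transpose]
  ring

lemma density_change {q q' : M} {z : Model m} (hz : z ∈ (extChartAt (𝓡 m) q).target)
    (hz' : (extChartAt (𝓡 m) q).symm z ∈ (extChartAt (𝓡 m) q').source) :
    density q z = |(fderiv ℝ (chartChange q q') z).det| * density q' (chartChange q q' z) := by
  rw [density, gram_change hz hz', Real.sqrt_mul (sq_nonneg _), Real.sqrt_sq_eq_abs]
  rfl

variable [IsContMDiffRiemannianBundle (𝓡 m) ∞ (Model m) (fun x : M => TangentSpace (𝓡 m) x)]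

lemma contDiffAt_density (q : M) {z : Model m} (hz : z ∈ (extChartAt (𝓡 m) q).target) :
    ContDiffAt ℝ ∞ (density q) z :=
  (contDiffAt_gram_det q hz).sqrt (gram_det_pos q hz).ne'

/-- By metric compatibility the derivative of the Gram matrix G is CG + GCᵀ, with C the Christoffel
matrix in the direction a. Jacobi's formula then gives twice the trace of C for log det G, and the
square root halves it. -/
lemma fderiv_density (q : M) {z : Model m} (hz : z ∈ (extChartAt (𝓡 m) q).target) (a : Model m) :
    fderiv ℝ (density q) z a = density q z * ∑ i, christoffelL q z a (stdVec i) i := by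
  set C : Matrix (Fin m) (Fin m) ℝ := Matrix.of fun i k => christoffelL q z a (stdVec i) k with hC
  set H : Matrix (Fin m) (Fin m) ℝ := C * gram q z + gram q z * C.transpose with hH
  have hpos := gram_det_pos q hz
  have hline : HasDerivAt (fun s : ℝ => z + s • a) a 0 := by
    simpa using ((hasDerivAt_id (0 : ℝ)).smul_const a).const_add z
  have hz0 : z + (0 : ℝ) • a = z := by simp
  have hsum : ∀ i j, chartMetric q z (christoffelL q z a (stdVec i)) (stdVec j) =
      ∑ k, C i k * gram q z k j := fun i j => by
    nth_rw 1 [← sum_smul_stdVec (christoffelL q z a (stdVec i))]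
    simp only [map_sum, map_smul, _root_.sum_apply, _root_.smul_apply,
      smul_eq_mul, hC, Matrix.of_apply, gram_apply]
  have hH' : ∀ i j, fderiv ℝ (fun z => gram q z i j) z a = H i j := fun i j => by
    have hg := (contDiffAt_chartMetric q hz).differentiableAt (by simp)
    have e : fderiv ℝ (fun z => gram q z i j) z a =
        fderiv ℝ (chartMetric q) z a (stdVec i) (stdVec j) := by
      have h1 := ((hg.hasFDerivAt.clm_apply (hasFDerivAt_const (stdVec i) z)).clm_apply
        (hasFDerivAt_const (stdVec j) z)).fderiv
      have h2 : (fun z => gram q z i j) = fun z => chartMetric q z (stdVec i) (stdVec j) := rfl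
      rw [h2, h1]
      simp
    rw [e, fderiv_chartMetric q hz, hsum, chartMetric_comm q z (stdVec i), hsum, hH,
      Matrix.add_apply, Matrix.mul_apply, Matrix.mul_apply]
    congr 1
    refine Finset.sum_congr rfl fun k _ => ?_
    rw [Matrix.transpose_apply, mul_comm, gram_apply, gram_apply, chartMetric_comm]
  have hdet := hasDerivAt_det (G := fun s => gram q (z + s • a)) (H := H) (t := 0)
    (fun i j => by
      have := HasFDerivAt.comp_hasDerivAt_of_eq (0 : ℝ)
        (((contDiffAt_gram q hz i j).differentiableAt (by simp)).hasFDerivAt) hline hz0.symm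
      rw [hH'] at this
      exact this) (by rw [hz0]; exact hpos.ne')
  have htr : ((gram q z)⁻¹ * H).trace = 2 * C.trace := by
    have hu := isUnit_iff_ne_zero.2 hpos.ne'
    rw [hH, mul_add, Matrix.trace_add, ← mul_assoc, ← mul_assoc, Matrix.nonsing_inv_mul _ hu, one_mul,
      Matrix.trace_transpose, mul_assoc, Matrix.trace_mul_comm, mul_assoc,
      Matrix.mul_nonsing_inv _ hu, mul_one, two_mul]
  rw [hz0, htr] at hdet
  have hs := hdet.sqrt (by rw [hz0]; exact hpos.ne')
  have hd := HasFDerivAt.comp_hasDerivAt_of_eq (0 : ℝ)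
        (((contDiffAt_density q hz).differentiableAt (by simp)).hasFDerivAt) hline hz0.symm
  have := hd.unique hs
  rw [this, hz0]
  have hC' : C.trace = ∑ i, christoffelL q z a (stdVec i) i := rfl
  rw [← hC', density]
  have hsq := Real.mul_self_sqrt hpos.le
  have hne := (Real.sqrt_pos.2 hpos).ne'
  field_simp
  rw [sq, hsq, mul_comm]

/-- The divergence of a vector field. -/
def divg (X : ∀ x : M, TangentSpace (𝓡 m) x) (x : M) : ℝ :=
  metricTrace x fun u v => inner ℝ (covD (𝓡 m) (fun y : M => y) X x u) v

/-- The Christoffel trace in div X is the logarithmic derivative of the density, so the product rule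
assembles a Euclidean divergence. This reduces the divergence theorem to integrals over the model
space. -/
lemma density_mul_divg {q x : M} (hx : x ∈ (extChartAt (𝓡 m) q).source)
    {X : ∀ x : M, TangentSpace (𝓡 m) x} (hX : SmoothFieldAt X x) :
    density q (extChartAt (𝓡 m) q x) * divg X x =
      ∑ i, fderiv ℝ (fun z => density q z * fieldRep q X z i) (extChartAt (𝓡 m) q x)
        (stdVec i) := by
  set z := extChartAt (𝓡 m) q x with hz
  have hzt : z ∈ (extChartAt (𝓡 m) q).target := (extChartAt (𝓡 m) q).map_source hx
  have hXr : DifferentiableAt ℝ (fieldRep q X) z :=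
    ((smoothFieldAt_iff hx).1 hX).differentiableAt (by simp)
  have h1 : divg X x = ∑ i, (fderiv ℝ (fieldRep q X) z (stdVec i) i +
      christoffelL q z (stdVec i) (fieldRep q X z) i) := by
    rw [divg, metricTrace_inner_eq_sum_coords hx (isLinearMap_covD _ _ _)]
    refine Finset.sum_congr rfl fun i _ => ?_
    rw [coords_covD_id hx hX, coords_ofCoords hx, ← fieldRep_apply hx]
    rfl
  have h2 : ∀ i, fderiv ℝ (fun z => density q z * fieldRep q X z i) z (stdVec i) =
      density q z * fderiv ℝ (fieldRep q X) z (stdVec i) i +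
        fieldRep q X z i * fderiv ℝ (density q) z (stdVec i) := fun i => by
    have hi : HasFDerivAt (fun z => fieldRep q X z i)
        ((EuclideanSpace.proj i : Model m →L[ℝ] ℝ).comp (fderiv ℝ (fieldRep q X) z)) z :=
      (EuclideanSpace.proj i : Model m →L[ℝ] ℝ).hasFDerivAt.comp z hXr.hasFDerivAt
    have h := (((contDiffAt_density q hzt).differentiableAt (by simp)).hasFDerivAt).mul hi
    exact DFunLike.congr_fun h.fderiv _
  have h3 : ∑ i, fieldRep q X z i * fderiv ℝ (density q) z (stdVec i) =
      fderiv ℝ (density q) z (fieldRep q X z) := by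
    conv_rhs => rw [← sum_smul_stdVec (fieldRep q X z), map_sum]
    exact Finset.sum_congr rfl fun i _ => by rw [map_smul, smul_eq_mul]
  rw [Finset.sum_congr rfl fun i _ => h2 i, Finset.sum_add_distrib, h3, fderiv_density q hzt, h1,
    Finset.sum_add_distrib, mul_add, Finset.mul_sum]
  congr 2
  exact Finset.sum_congr rfl fun i _ => by rw [christoffelL_comm q hzt]

end Density

/-! ### The Riemannian measure in charts. -/

section ChartVolume

variable {m : ℕ} {M : Type*} [TopologicalSpace M] [ChartedSpace (Model m) M]
  [IsManifold (𝓡 m) ∞ M] [RiemannianBundle (fun x : M => TangentSpace (𝓡 m) x)]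
  [IsContMDiffRiemannianBundle (𝓡 m) ∞ (Model m) (fun x : M => TangentSpace (𝓡 m) x)]
  [MeasurableSpace M] [BorelSpace M]

lemma measurableSet_target (q : M) : MeasurableSet (extChartAt (𝓡 m) q).target :=
  (isOpen_extChartAt_target q).measurableSet

lemma measurableSet_source (q : M) : MeasurableSet (extChartAt (𝓡 m) q).source :=
  (isOpen_extChartAt_source (I := 𝓡 m) q).measurableSet

lemma aemeasurable_density (q : M) : AEMeasurable (fun z => ENNReal.ofReal (density q z))
    ((volume : Measure (Model m)).restrict (extChartAt (𝓡 m) q).target) :=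
  (ContinuousOn.aemeasurable (fun _ hz => (contDiffAt_density q hz).continuousAt.continuousWithinAt)
    (measurableSet_target q)).ennreal_ofReal

lemma aemeasurable_extChartAt_symm (q : M) : AEMeasurable (extChartAt (𝓡 m) q).symm
    ((volume : Measure (Model m)).restrict (extChartAt (𝓡 m) q).target) :=
  ContinuousOn.aemeasurable (continuousOn_extChartAt_symm q) (measurableSet_target q)

lemma chartVolume_eq (q : M) : chartVolume (n := m) q =
    (((volume : Measure (Model m)).restrict (extChartAt (𝓡 m) q).target).withDensity
      fun z => ENNReal.ofReal (density q z)).map (extChartAt (𝓡 m) q).symm := rfl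

lemma chartVolume_apply (q : M) {A : Set M} (hA : MeasurableSet A) :
    chartVolume (n := m) q A =
      ∫⁻ z in (extChartAt (𝓡 m) q).target ∩ (extChartAt (𝓡 m) q).symm ⁻¹' A,
        ENNReal.ofReal (density q z) := by
  have hm := (aemeasurable_extChartAt_symm q).mono_ac
    (withDensity_absolutelyContinuous _ fun z => ENNReal.ofReal (density (m := m) q z))
  have hn : NullMeasurableSet ((extChartAt (𝓡 m) q).symm ⁻¹' A)
      ((volume : Measure (Model m)).restrict (extChartAt (𝓡 m) q).target) :=
    (aemeasurable_extChartAt_symm q).nullMeasurableSet_preimage hA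
  rw [chartVolume_eq, Measure.map_apply_of_aemeasurable hm hA, withDensity_apply',
    Measure.restrict_restrict₀ hn, Set.inter_comm]

lemma measurableSet_image_chart (q : M) {A : Set M} (hA : MeasurableSet A) :
    MeasurableSet ((extChartAt (𝓡 m) q).target ∩ (extChartAt (𝓡 m) q).symm ⁻¹' A) := by
  have h := (continuousOn_extChartAt_symm (I := 𝓡 m) q)
  rw [continuousOn_iff_continuous_domRestrict] at h
  have := (MeasurableEmbedding.subtype_coe (measurableSet_target (m := m) q)).measurableSet_image.2
    (h.measurable hA)
  convert this using 1
  ext z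
  simp only [Set.mem_inter_iff, Set.mem_preimage, Set.mem_image, Subtype.exists,
    Set.domRestrict_apply, exists_and_right, exists_eq_right]
  exact ⟨fun ⟨h1, h2⟩ => ⟨h1, h2⟩, fun ⟨h1, h2⟩ => ⟨h1, h2⟩⟩

lemma chartVolume_compl_source (q : M) :
    chartVolume (n := m) q (extChartAt (𝓡 m) q).sourceᶜ = 0 := by
  rw [chartVolume_apply q (measurableSet_source q).compl]
  have : (extChartAt (𝓡 m) q).target ∩ (extChartAt (𝓡 m) q).symm ⁻¹'
      (extChartAt (𝓡 m) q).sourceᶜ = ∅ :=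
    Set.eq_empty_of_forall_notMem fun z hz => hz.2 ((extChartAt (𝓡 m) q).map_target hz.1)
  rw [this, Measure.restrict_empty, lintegral_zero_measure]

/-- The change-of-variables formula: the Jacobian of the change of charts is the factor relating the
two densities. -/
lemma chartVolume_eq_on_overlap (q q' : M) {A : Set M} (hA : MeasurableSet A)
    (hq : A ⊆ (extChartAt (𝓡 m) q).source) (hq' : A ⊆ (extChartAt (𝓡 m) q').source) :
    chartVolume (n := m) q' A = chartVolume (n := m) q A := by
  set B := (extChartAt (𝓡 m) q).target ∩ (extChartAt (𝓡 m) q).symm ⁻¹' A with hB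
  have himg : (extChartAt (𝓡 m) q').target ∩ (extChartAt (𝓡 m) q').symm ⁻¹' A =
      chartChange q q' '' B := by
    ext z
    constructor
    · rintro ⟨h1, h2⟩
      refine ⟨extChartAt (𝓡 m) q ((extChartAt (𝓡 m) q').symm z),
        ⟨(extChartAt (𝓡 m) q).map_source (hq h2), ?_⟩, ?_⟩
      · rw [Set.mem_preimage, (extChartAt (𝓡 m) q).left_inv (hq h2)]
        exact h2
      · rw [chartChange, (extChartAt (𝓡 m) q).left_inv (hq h2),
          (extChartAt (𝓡 m) q').right_inv h1]
    · rintro ⟨y, ⟨h1, h2⟩, rfl⟩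
      refine ⟨(extChartAt (𝓡 m) q').map_source (hq' h2), ?_⟩
      rw [Set.mem_preimage, chartChange, (extChartAt (𝓡 m) q').left_inv (hq' h2)]
      exact h2
  have hinj : Set.InjOn (chartChange q q') B := fun y hy y' hy' h => by
    have := congrArg (extChartAt (𝓡 m) q').symm h
    rw [chartChange, chartChange, (extChartAt (𝓡 m) q').left_inv (hq' hy.2),
      (extChartAt (𝓡 m) q').left_inv (hq' hy'.2)] at this
    rw [← (extChartAt (𝓡 m) q).right_inv hy.1, this, (extChartAt (𝓡 m) q).right_inv hy'.1]
  have hBm : MeasurableSet B := measurableSet_image_chart q hA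
  rw [chartVolume_apply q hA, chartVolume_apply q' hA, himg,
    lintegral_image_eq_lintegral_abs_det_fderiv_mul volume hBm
      (f' := fun z => fderiv ℝ (chartChange q q') z)
      (fun z hz => ((contDiffAt_chartChange hz.1 (hq' hz.2)).differentiableAt
        (by simp)).hasFDerivAt.hasFDerivWithinAt) hinj]
  refine setLIntegral_congr_fun hBm fun z hz => ?_
  rw [← ENNReal.ofReal_mul (abs_nonneg _), ← density_change hz.1 (hq' hz.2)]

/-- The supremum of the chart measures lies below ν, the chart measure of q plus the part of the
Riemannian measure outside the chart domain: inside the domain every other chart measure is at most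
that of q by agreement on overlaps. The reverse inequality is the definition of a supremum. -/
lemma riemVolume_restrict_source (q : M) :
    (riemVolume m M).restrict (extChartAt (𝓡 m) q).source = chartVolume (n := m) q := by
  set S := (extChartAt (𝓡 m) q).source with hS
  have hSm : MeasurableSet S := measurableSet_source q
  set ν := chartVolume (n := m) q + (riemVolume m M).restrict Sᶜ with hν
  have hle : riemVolume m M ≤ ν := by
    refine iSup_le fun q' => Measure.le_iff.2 fun A hA => ?_
    set S' := (extChartAt (𝓡 m) q').source with hS'
    have hSm' : MeasurableSet S' := measurableSet_source q'
    have h0 : chartVolume (n := m) q' ((A ∩ S) \ S') = 0 :=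
      measure_mono_null (fun x hx => hx.2) (chartVolume_compl_source q')
    rw [hν, Measure.add_apply, Measure.restrict_apply hA, ← measure_inter_add_sdiff A hSm]
    refine add_le_add ?_ ?_
    · rw [← measure_inter_add_sdiff (A ∩ S) hSm', h0, add_zero,
        chartVolume_eq_on_overlap q q' ((hA.inter hSm).inter hSm') (fun x hx => hx.1.2)
          fun x hx => hx.2]
      exact measure_mono fun x hx => hx.1.1
    · exact le_iSup (fun q' : M => chartVolume (n := m) q') q' _
  refine le_antisymm (Measure.le_iff.2 fun A hA => ?_) (Measure.le_iff.2 fun A hA => ?_)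
  · rw [Measure.restrict_apply hA]
    refine (hle _).trans ?_
    rw [hν, Measure.add_apply, Measure.restrict_apply (hA.inter hSm)]
    have : A ∩ S ∩ Sᶜ = ∅ := Set.eq_empty_of_forall_notMem fun x hx => hx.2 hx.1.2
    rw [this, measure_empty, add_zero]
    exact measure_mono Set.inter_subset_left
  · rw [Measure.restrict_apply hA, ← measure_inter_add_sdiff A hSm]
    have h0 : chartVolume (n := m) q (A \ S) = 0 :=
      measure_mono_null (fun x hx => hx.2) (chartVolume_compl_source q)
    rw [h0, add_zero]
    exact le_iSup (fun q' : M => chartVolume (n := m) q') q _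

lemma setIntegral_source (q : M) {h : M → ℝ} (hh : Continuous h) :
    ∫ x in (extChartAt (𝓡 m) q).source, h x ∂(riemVolume m M) =
      ∫ z in (extChartAt (𝓡 m) q).target, density q z * h ((extChartAt (𝓡 m) q).symm z) := by
  rw [riemVolume_restrict_source, chartVolume_eq, integral_map ((aemeasurable_extChartAt_symm q).mono_ac
    (withDensity_absolutelyContinuous _ _)) hh.aestronglyMeasurable,
    integral_withDensity_eq_integral_toReal_smul₀ (aemeasurable_density q)
      (.of_forall fun _ => ENNReal.ofReal_lt_top)]
  refine setIntegral_congr_fun (measurableSet_target q) fun z hz => ?_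
  rw [ENNReal.toReal_ofReal (density_pos q hz).le, smul_eq_mul]

/-- The density is bounded on a compact neighbourhood in the chart. On a compact manifold this makes
all continuous functions integrable. -/
instance : IsLocallyFiniteMeasure (riemVolume m M) := ⟨fun x => by
  have hS := isOpen_extChartAt_source (I := 𝓡 m) x
  set e := extChartAt (𝓡 m) x with he
  have ht : e.target ∈ 𝓝 (e x) := extChartAt_target_mem_nhds x
  obtain ⟨K, hK, hKt, hKc⟩ := local_compact_nhds ht
  have hc : ContinuousAt e x := continuousAt_extChartAt x
  refine ⟨e ⁻¹' interior K ∩ e.source, Filter.inter_mem (hc (interior_mem_nhds.2 hK))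
    (extChartAt_source_mem_nhds x), ?_⟩
  have hA : MeasurableSet (e ⁻¹' interior K ∩ e.source) := by
    rw [Set.inter_comm]
    exact ((continuousOn_extChartAt (I := 𝓡 m) x).isOpen_inter_preimage hS
      isOpen_interior).measurableSet
  have h1 : riemVolume m M (e ⁻¹' interior K ∩ e.source) =
      chartVolume (n := m) x (e ⁻¹' interior K ∩ e.source) := by
    rw [← riemVolume_restrict_source, Measure.restrict_apply hA, Set.inter_assoc, Set.inter_self]
  rw [h1, chartVolume_apply x hA]
  have hsub : (extChartAt (𝓡 m) x).target ∩ (extChartAt (𝓡 m) x).symm ⁻¹'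
      (e ⁻¹' interior K ∩ e.source) ⊆ K := fun z hz => by
    have := hz.2.1
    rw [Set.mem_preimage, he, (extChartAt (𝓡 m) x).right_inv hz.1] at this
    exact interior_subset this
  have hint : IntegrableOn (density x) K := ContinuousOn.integrableOn_compact hKc
    fun z hz => (contDiffAt_density x (hKt hz)).continuousAt.continuousWithinAt
  refine (lintegral_mono_set hsub).trans_lt ?_
  refine (lintegral_mono fun z => ?_).trans_lt hint.2
  rw [← ofReal_norm]
  exact ENNReal.ofReal_le_ofReal (le_abs_self _)⟩

/-- The density is strictly positive, so a nonempty open set already has positive mass in a chart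
around one of its points. The uniqueness argument relies on this. -/
instance : (riemVolume m M).IsOpenPosMeasure := ⟨fun U hU ⟨x, hx⟩ => by
  have h1 : chartVolume (n := m) x U ≤ riemVolume m M U :=
    le_iSup (fun q' : M => chartVolume (n := m) q') x _
  refine fun h0 => ?_
  have h2 : chartVolume (n := m) x U = 0 := le_antisymm (h1.trans h0.le) bot_le
  have hU' : IsOpen ((extChartAt (𝓡 m) x).target ∩ (extChartAt (𝓡 m) x).symm ⁻¹' U) :=
    (continuousOn_extChartAt_symm x).isOpen_inter_preimage (isOpen_extChartAt_target x) hU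
  have hne : ((extChartAt (𝓡 m) x).target ∩ (extChartAt (𝓡 m) x).symm ⁻¹' U).Nonempty :=
    ⟨extChartAt (𝓡 m) x x, mem_extChartAt_target x, by
      rwa [Set.mem_preimage, extChartAt_to_inv]⟩
  rw [chartVolume_apply x hU.measurableSet, lintegral_eq_zero_iff'
    ((aemeasurable_density x).mono_measure (Measure.restrict_mono_set _ Set.inter_subset_left))] at h2
  rw [Filter.EventuallyEq, ae_restrict_iff' hU'.measurableSet] at h2
  have h3 : volume ((extChartAt (𝓡 m) x).target ∩ (extChartAt (𝓡 m) x).symm ⁻¹' U) = 0 := by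
    refine measure_mono_null (fun z hz => ?_) h2
    intro h4
    have := h4 hz
    simp only [Pi.zero_apply, ENNReal.ofReal_eq_zero] at this
    exact absurd this (not_le.2 (density_pos x hz.1))
  exact (hU'.measure_pos volume hne).ne' h3⟩

end ChartVolume

/-! ### Divergence of compactly supported fields in one chart. -/

section Divergence

/-- Integration by parts against the constant function 1. -/
lemma integral_fderiv_eq_zero {m : ℕ} {g : Model m → ℝ} (hg : ContDiff ℝ ∞ g)
    (hc : HasCompactSupport g) (v : Model m) : ∫ z, fderiv ℝ g z v = 0 := by
  have h1 : Continuous fun z => fderiv ℝ g z v :=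
    (hg.continuous_fderiv (by simp)).clm_apply continuous_const
  have h2 : HasCompactSupport fun z => fderiv ℝ g z v := hc.fderiv_apply ℝ v
  have := integral_mul_fderiv_eq_neg_fderiv_mul_of_integrable (μ := (volume : Measure (Model m)))
    (f := fun _ : Model m => (1 : ℝ)) (g := g) (v := v) (by simp)
    (by simpa using h1.integrable_of_hasCompactSupport h2)
    (by simpa using hg.continuous.integrable_of_hasCompactSupport hc)
    (fun _ _ => differentiableAt_const _) (fun z _ => (hg.differentiable (by simp)) z)
  simpa using this

variable {m : ℕ} {M : Type*} [TopologicalSpace M] [ChartedSpace (Model m) M]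
  [IsManifold (𝓡 m) ∞ M] [RiemannianBundle (fun x : M => TangentSpace (𝓡 m) x)]
  [IsContMDiffRiemannianBundle (𝓡 m) ∞ (Model m) (fun x : M => TangentSpace (𝓡 m) x)]

lemma smoothFieldAt_covD {X Y : ∀ x : M, TangentSpace (𝓡 m) x} {p : M}
    (hY : ∀ᶠ x in 𝓝 p, SmoothFieldAt Y x) (hX : SmoothFieldAt X p) :
    SmoothFieldAt (fun x => covD (𝓡 m) (fun y : M => y) Y x (X x)) p :=
  smoothSectionAt_covD hY hX

lemma contMDiff_divg {X : ∀ x : M, TangentSpace (𝓡 m) x} (hX : ∀ x, SmoothFieldAt X x) :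
    ContMDiff (𝓡 m) 𝓘(ℝ, ℝ) ∞ (divg X) := fun p =>
  contMDiffAt_metricTrace (pr := fun x : M => x)
    (B := fun x u v => inner ℝ (covD (𝓡 m) (fun y : M => y) X x u) v) contMDiffAt_id
    (.of_forall fun _ => bilin_inner (isLinearMap_covD _ _ _) (IsLinearMap.mk (fun _ _ => rfl)
      fun _ _ => rfl))
    fun v w => SmoothSectionAt.inner (smoothFieldAt_covD (.of_forall hX)
      (smoothFieldAt_extendVec (mem_extChartAt_source (I := 𝓡 m) p) v))
      (smoothFieldAt_extendVec (mem_extChartAt_source (I := 𝓡 m) p) w)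

lemma divg_eq_zero {X : ∀ x : M, TangentSpace (𝓡 m) x} {p : M} (h : ∀ᶠ x in 𝓝 p, X x = 0) :
    divg X p = 0 := by
  have e : ∀ u, covD (𝓡 m) (fun y : M => y) X p u = 0 := fun u =>
    (covD_congr (f := fun y : M => y) (Z := X) (W := fun _ => 0) h u).trans (covD_zero u)
  exact (metricTrace_congr fun u => by rw [e, inner_zero_left]).trans
    (metricTrace_zero (m := m) (p := p) (F := ℝ))

lemma divg_sum {ι : Type*} (s : Finset ι) {X : ι → ∀ x : M, TangentSpace (𝓡 m) x} {p : M}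
    (hX : ∀ i ∈ s, SmoothFieldAt (X i) p) :
    divg (fun x => ∑ i ∈ s, X i x) p = ∑ i ∈ s, divg (X i) p := by
  simp only [divg, metricTrace]
  rw [Finset.sum_comm]
  refine Finset.sum_congr rfl fun k _ => ?_
  rw [covD_sum (f := fun y : M => y) contMDiffAt_id s hX, sum_inner]

variable [T2Space M] [MeasurableSpace M] [BorelSpace M]

/-- In the chart the integrand is a sum of partial derivatives of compactly supported functions,
each of which integrates to zero. -/
lemma integral_divg_of_support {X : ∀ x : M, TangentSpace (𝓡 m) x} (hX : ∀ x, SmoothFieldAt X x)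
    {q : M} {K : Set M} (hK : IsCompact K) (hKq : K ⊆ (extChartAt (𝓡 m) q).source)
    (h0 : ∀ x ∉ K, X x = 0) : ∫ x, divg X x ∂(riemVolume m M) = 0 := by
  have hev : ∀ x ∉ K, divg X x = 0 := fun x hx =>
    divg_eq_zero (by filter_upwards [hK.isClosed.isOpen_compl.mem_nhds hx] with y hy using h0 y hy)
  rw [← setIntegral_eq_integral_of_forall_compl_eq_zero
    (s := (extChartAt (𝓡 m) q).source) fun x hx => hev x fun h => hx (hKq h),
    setIntegral_source q (contMDiff_divg hX).continuous]
  set T := (extChartAt (𝓡 m) q).target with hT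
  have hTo : IsOpen T := isOpen_extChartAt_target q
  set K' := extChartAt (𝓡 m) q '' K with hK'
  have hKc : IsCompact K' := hK.image_of_continuousOn ((continuousOn_extChartAt q).mono hKq)
  have hKT : K' ⊆ T := by
    rintro _ ⟨x, hx, rfl⟩
    exact (extChartAt (𝓡 m) q).map_source (hKq hx)
  set r : Fin m → Model m → ℝ := fun i z => density q z * fieldRep q X z i with hr
  -- Extension by zero outside the chart target. It is smooth on the whole model space because r i
  -- already vanishes off the compact set K' inside the target.
  set g : Fin m → Model m → ℝ := fun i => T.indicator (r i) with hg
  have hgT : ∀ i, ∀ z ∈ T, g i =ᶠ[𝓝 z] r i := fun i z hz => by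
    filter_upwards [hTo.mem_nhds hz] with y hy using Set.indicator_of_mem hy _
  have hg0 : ∀ i, ∀ z ∉ K', g i z = 0 := fun i z hz => by
    by_cases hzT : z ∈ T
    · have hx : (extChartAt (𝓡 m) q).symm z ∉ K := fun h =>
        hz ⟨_, h, (extChartAt (𝓡 m) q).right_inv hzT⟩
      have h1 : fieldRep q X z = 0 := by
        change coords q _ (X ((extChartAt (𝓡 m) q).symm z)) = 0
        rw [h0 _ hx, coords_eq, map_zero]
      rw [hg]
      simp only
      rw [Set.indicator_of_mem hzT, hr]
      simp only
      rw [h1]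
      simp
    · exact Set.indicator_of_notMem hzT _
  have hrs : ∀ i, ∀ z ∈ T, ContDiffAt ℝ ∞ (r i) z := fun i z hz => by
    have h1 := (smoothFieldAt_iff ((extChartAt (𝓡 m) q).map_target hz)).1
      (hX ((extChartAt (𝓡 m) q).symm z))
    rw [(extChartAt (𝓡 m) q).right_inv hz] at h1
    exact (contDiffAt_density q hz).mul
      ((EuclideanSpace.proj i : Model m →L[ℝ] ℝ).contDiff.contDiffAt.comp z h1)
  have hgs : ∀ i, ContDiff ℝ ∞ (g i) := fun i => contDiff_iff_contDiffAt.2 fun z => by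
    by_cases hz : z ∈ K'
    · exact (hrs i z (hKT hz)).congr_of_eventuallyEq (hgT i z (hKT hz))
    · refine (contDiffAt_const (c := (0 : ℝ))).congr_of_eventuallyEq ?_
      filter_upwards [hKc.isClosed.isOpen_compl.mem_nhds hz] with y hy using hg0 i y hy
  have hgc : ∀ i, HasCompactSupport (g i) := fun i => HasCompactSupport.intro hKc (hg0 i)
  have hcont : ∀ i v, Continuous fun z => fderiv ℝ (g i) z v := fun i v =>
    ((hgs i).continuous_fderiv (by simp)).clm_apply continuous_const
  have e1 : ∀ z ∈ T, density q z * divg X ((extChartAt (𝓡 m) q).symm z) =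
      ∑ i, fderiv ℝ (g i) z (stdVec i) := fun z hz => by
    have := density_mul_divg ((extChartAt (𝓡 m) q).map_target hz)
      (hX ((extChartAt (𝓡 m) q).symm z))
    rw [(extChartAt (𝓡 m) q).right_inv hz] at this
    rw [this]
    exact Finset.sum_congr rfl fun i _ => by rw [(hgT i z hz).fderiv_eq]
  rw [setIntegral_congr_fun (measurableSet_target q) e1,
    setIntegral_eq_integral_of_forall_compl_eq_zero, integral_finsetSum]
  · exact Finset.sum_eq_zero fun i _ => integral_fderiv_eq_zero (hgs i) (hgc i) _
  · exact fun i _ => (hcont i _).integrable_of_hasCompactSupport ((hgc i).fderiv_apply ℝ _)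
  · intro z hz
    refine Finset.sum_eq_zero fun i _ => ?_
    have : g i =ᶠ[𝓝 z] fun _ => 0 := by
      filter_upwards [hKc.isClosed.isOpen_compl.mem_nhds fun h => hz (hKT h)] with y hy
        using hg0 i y hy
    rw [this.fderiv_eq]
    simp

end Divergence

/-! ### Finite partitions of unity. -/

section Partition

variable {m : ℕ} {M : Type*} [TopologicalSpace M] [ChartedSpace (Model m) M]
  [IsManifold (𝓡 m) ∞ M] [T2Space M] [CompactSpace M]

/-- Finite smooth partitions of unity on a compact manifold. -/
lemma exists_finite_partition {U : M → Set M} (ho : ∀ x, IsOpen (U x)) (hx : ∀ x, x ∈ U x) :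
    ∃ (s : Finset M) (ρ : M → M → ℝ), (∀ i, ContMDiff (𝓡 m) 𝓘(ℝ, ℝ) ∞ (ρ i)) ∧
      (∀ i, tsupport (ρ i) ⊆ U i) ∧ ∀ x, ∑ i ∈ s, ρ i x = 1 := by
  obtain ⟨f, hf⟩ := SmoothPartitionOfUnity.exists_isSubordinate (𝓡 m) (isClosed_univ (X := M)) U ho
    fun x _ => Set.mem_iUnion.2 ⟨x, hx x⟩
  have hfin := f.locallyFinite.finite_nonempty_of_compact
  refine ⟨hfin.toFinset, fun i => f i, fun i => (f i).contMDiff, hf, fun x => ?_⟩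
  rw [← f.sum_eq_one (Set.mem_univ x), finsum_eq_sum_of_support_subset]
  intro i hi
  rw [Set.Finite.coe_toFinset]
  exact ⟨x, hi⟩

end Partition

/-! ### The divergence theorem on a compact manifold. -/

section DivergenceTheorem

variable {m : ℕ} {M : Type*} [TopologicalSpace M] [ChartedSpace (Model m) M]
  [IsManifold (𝓡 m) ∞ M] [RiemannianBundle (fun x : M => TangentSpace (𝓡 m) x)]
  [IsContMDiffRiemannianBundle (𝓡 m) ∞ (Model m) (fun x : M => TangentSpace (𝓡 m) x)]
  [T2Space M] [CompactSpace M] [MeasurableSpace M] [BorelSpace M]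

lemma integrable_of_contMDiff {h : M → ℝ} (hh : ContMDiff (𝓡 m) 𝓘(ℝ, ℝ) ∞ h) :
    Integrable h (riemVolume m M) :=
  hh.continuous.integrable_of_hasCompactSupport (HasCompactSupport.of_compactSpace h)

/-- A partition of unity subordinate to the chart domains splits X into finitely many fields, each
with compact support in one chart. -/
theorem integral_divg {X : ∀ x : M, TangentSpace (𝓡 m) x} (hX : ∀ x, SmoothFieldAt X x) :
    ∫ x, divg X x ∂(riemVolume m M) = 0 := by
  obtain ⟨s, ρ, hρ, hsub, hsum⟩ := exists_finite_partition (m := m) (M := M)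
    (U := fun q => (extChartAt (𝓡 m) q).source) (fun q => isOpen_extChartAt_source (I := 𝓡 m) q)
    fun q => mem_extChartAt_source q
  have hρX : ∀ i x, SmoothFieldAt (fun x => ρ i x • X x) x := fun i x => (hX x).smul (hρ i x)
  have e : divg X = fun x => ∑ i ∈ s, divg (fun x => ρ i x • X x) x := funext fun x => by
    rw [← divg_sum s fun i _ => hρX i x]
    congr 1
    funext y
    rw [← Finset.sum_smul, hsum, one_smul]
  rw [e, integral_finsetSum _ fun i _ => integrable_of_contMDiff (contMDiff_divg (hρX i))]
  refine Finset.sum_eq_zero fun i _ => integral_divg_of_support (hρX i)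
    (isClosed_tsupport (ρ i)).isCompact (hsub i) fun x hx => ?_
  rw [image_eq_zero_of_notMem_tsupport hx, zero_smul]

end DivergenceTheorem

/-! ### Integration by parts along a map, symmetry of J, and the stress form. -/

section IntegrationByParts

variable {n : ℕ} {N : Type*} [TopologicalSpace N] [ChartedSpace (Model n) N]
  [IsManifold (𝓡 n) ∞ N] [RiemannianBundle (fun x : N => TangentSpace (𝓡 n) x)]
  [IsContMDiffRiemannianBundle (𝓡 n) ∞ (Model n) (fun x : N => TangentSpace (𝓡 n) x)]
  {m : ℕ} {M : Type*} [TopologicalSpace M] [ChartedSpace (Model m) M] [IsManifold (𝓡 m) ∞ M]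
  [RiemannianBundle (fun x : M => TangentSpace (𝓡 m) x)]
  [IsContMDiffRiemannianBundle (𝓡 m) ∞ (Model m) (fun x : M => TangentSpace (𝓡 m) x)]
  {φ : M → N} {V U : ∀ p, TangentSpace (𝓡 n) (φ p)}

/-- The divergence of a `φ⁻¹ TN`-valued one-form. -/
def divForm (φ : M → N) (T : ∀ x, TangentSpace (𝓡 m) x → TangentSpace (𝓡 n) (φ x)) (p : M) :
    TangentSpace (𝓡 n) (φ p) :=
  metricTrace p fun u v => covD (𝓡 m) φ (fun x => T x (extendVec p v x)) p u
    - T p (covD (𝓡 m) (fun x : M => x) (extendVec p v) p u)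

/-- Smoothness of a `φ⁻¹ TN`-valued one-form. -/
structure SmoothForm (φ : M → N) (T : ∀ x, TangentSpace (𝓡 m) x → TangentSpace (𝓡 n) (φ x)) :
    Prop where
  linear : ∀ x, IsLinearMap ℝ (T x)
  smooth : ∀ {A : ∀ x : M, TangentSpace (𝓡 m) x} {p : M}, SmoothFieldAt A p →
    SmoothSectionAt (𝓡 m) φ (fun x => T x (A x)) p

/-- The vector field dual to `⟨T(·), V⟩`. -/
def dualField (T : ∀ x, TangentSpace (𝓡 m) x → TangentSpace (𝓡 n) (φ x))
    (V : ∀ p, TangentSpace (𝓡 n) (φ p)) (x : M) : TangentSpace (𝓡 m) x :=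
  metricTrace x fun u v => (inner ℝ (T x u) (V x) : ℝ) • v

lemma inner_dualField {T : ∀ x, TangentSpace (𝓡 m) x → TangentSpace (𝓡 n) (φ x)}
    (hT : SmoothForm φ T) (x : M) (v : TangentSpace (𝓡 m) x) :
    (inner ℝ (dualField T V x) v : ℝ) = inner ℝ (T x v) (V x) :=
  inner_metricTrace_smul (L := fun u => inner ℝ (T x u) (V x))
    (isLinearMap_inner_left (hT.linear x) _) v

lemma smoothFieldAt_dualField {T : ∀ x, TangentSpace (𝓡 m) x → TangentSpace (𝓡 n) (φ x)}
    (hT : SmoothForm φ T) (hV : ∀ x, SmoothSectionAt (𝓡 m) φ V x) (p : M) :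
    SmoothFieldAt (dualField T V) p :=
  smoothSectionAt_metricTrace (pr := fun x : M => x) (g := fun x : M => x)
    (B := fun x u v => (inner ℝ (T x u) (V x) : ℝ) • v) contMDiffAt_id contMDiffAt_id
    (.of_forall fun x => bilin_smul (isLinearMap_inner_left (hT.linear x) _)) fun v w =>
      (smoothFieldAt_extendVec (mem_extChartAt_source (I := 𝓡 m) p) w).smul
        ((hT.smooth (smoothFieldAt_extendVec (mem_extChartAt_source (I := 𝓡 m) p) v)).inner (hV p))

/-- The Leibniz rule for ⟨T(·), V⟩, once by compatibility on M and once by compatibility of the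
pull-back connection. Integrated with the divergence theorem it becomes `integral_form_covD`. -/
lemma divg_dualField {T : ∀ x, TangentSpace (𝓡 m) x → TangentSpace (𝓡 n) (φ x)}
    (hT : SmoothForm φ T) (hV : ∀ x, SmoothSectionAt (𝓡 m) φ V x) (p : M) :
    divg (dualField T V) p = inner ℝ (divForm φ T p) (V p) +
      metricTrace p fun u v => inner ℝ (T p u) (covD (𝓡 m) φ V p v) := by
  rw [divForm, inner_metricTrace_left, ← metricTrace_add]
  refine metricTrace_congr fun u => ?_
  have hu := smoothFieldAt_extendVec (mem_extChartAt_source (I := 𝓡 m) p) u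
  have h1 := dirD_inner (f := fun x : M => x) (smoothFieldAt_dualField hT hV p) hu u
  have h2 := dirD_inner (hT.smooth hu) (hV p) u
  have e : (fun x => (inner ℝ (dualField T V x) (extendVec p u x) : ℝ)) =
      fun x => inner ℝ (T x (extendVec p u x)) (V x) := funext fun x => inner_dualField hT x _
  rw [e, h2, inner_dualField hT, extendVec_self] at h1
  rw [inner_sub_left]
  linarith

variable [T2Space M] [CompactSpace M] [MeasurableSpace M] [BorelSpace M]

lemma contMDiff_metricTrace_form_covD
    {T : ∀ x, TangentSpace (𝓡 m) x → TangentSpace (𝓡 n) (φ x)} (hT : SmoothForm φ T)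
    (hV : ∀ x, SmoothSectionAt (𝓡 m) φ V x) : ContMDiff (𝓡 m) 𝓘(ℝ, ℝ) ∞ fun p =>
      (metricTrace p fun u v => (inner ℝ (T p u) (covD (𝓡 m) φ V p v) : ℝ)) := fun p =>
  contMDiffAt_metricTrace (pr := fun x : M => x)
    (B := fun x u v => (inner ℝ (T x u) (covD (𝓡 m) φ V x v) : ℝ)) contMDiffAt_id
    (.of_forall fun x => bilin_inner (hT.linear x) (isLinearMap_covD φ V x)) fun v w =>
      (hT.smooth (smoothFieldAt_extendVec (mem_extChartAt_source (I := 𝓡 m) p) v)).inner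
        (smoothSectionAt_covD (.of_forall hV)
          (smoothFieldAt_extendVec (mem_extChartAt_source (I := 𝓡 m) p) w))

lemma inner_divForm {T : ∀ x, TangentSpace (𝓡 m) x → TangentSpace (𝓡 n) (φ x)}
    (hT : SmoothForm φ T) (hV : ∀ x, SmoothSectionAt (𝓡 m) φ V x) :
    (fun p => (inner ℝ (divForm φ T p) (V p) : ℝ)) = fun p => divg (dualField T V) p -
      metricTrace p fun u v => (inner ℝ (T p u) (covD (𝓡 m) φ V p v) : ℝ) := funext fun p => by
  rw [divg_dualField hT hV, add_sub_cancel_right]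

lemma integrable_divForm {T : ∀ x, TangentSpace (𝓡 m) x → TangentSpace (𝓡 n) (φ x)}
    (hT : SmoothForm φ T) (hV : ∀ x, SmoothSectionAt (𝓡 m) φ V x) :
    Integrable (fun p => (inner ℝ (divForm φ T p) (V p) : ℝ)) (riemVolume m M) := by
  rw [inner_divForm hT hV]
  exact (integrable_of_contMDiff (contMDiff_divg (smoothFieldAt_dualField hT hV))).sub
    (integrable_of_contMDiff (contMDiff_metricTrace_form_covD hT hV))

/-- Integration by parts. -/
lemma integral_form_covD {T : ∀ x, TangentSpace (𝓡 m) x → TangentSpace (𝓡 n) (φ x)}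
    (hT : SmoothForm φ T) (hV : ∀ x, SmoothSectionAt (𝓡 m) φ V x) :
    ∫ p, (inner ℝ (divForm φ T p) (V p) : ℝ) ∂(riemVolume m M) =
      -∫ p, (metricTrace p fun u v => (inner ℝ (T p u) (covD (𝓡 m) φ V p v) : ℝ))
        ∂(riemVolume m M) := by
  have hX := smoothFieldAt_dualField hT hV
  rw [inner_divForm hT hV, integral_sub (integrable_of_contMDiff (contMDiff_divg hX))
    (integrable_of_contMDiff (contMDiff_metricTrace_form_covD hT hV)), integral_divg hX, zero_sub]

lemma smoothSectionAt_jacobiE (hφ : ContMDiff (𝓡 m) (𝓡 n) ∞ φ)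
    (hV : ∀ x, SmoothSectionAt (𝓡 m) φ V x) (p : M) :
    SmoothSectionAt (𝓡 m) φ (jacobiE m n φ V) p :=
  (smoothFamAt_jacobiE (f := fun _ => φ) (Y := fun _ => V) (hφ.comp contMDiff_snd)
    (fun _ x => (hV x).comp (g := fun y : ℝ × M => y.2) contMDiffAt_snd) 0 p).slice

lemma smoothForm_covD (hV : ∀ x, SmoothSectionAt (𝓡 m) φ V x) :
    SmoothForm φ (fun x => covD (𝓡 m) φ V x) :=
  ⟨isLinearMap_covD φ V, fun hA => smoothSectionAt_covD (.of_forall hV) hA⟩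

lemma divForm_covD (φ : M → N) (V : ∀ p, TangentSpace (𝓡 n) (φ p)) (p : M) :
    divForm φ (fun x => covD (𝓡 m) φ V x) p = metricTrace p (hessSec m n φ V p) :=
  metricTrace_congr fun u => (hessSec_eq φ V p u u).symm

/-- The curvature part of J is pointwise symmetric by pair symmetry, so only the rough Laplacians
contribute. Their integrals agree after one integration by parts each. -/
lemma inner_jacobiE_sub (V U : ∀ p, TangentSpace (𝓡 n) (φ p)) (p : M) :
    (inner ℝ (jacobiE m n φ V p) (U p) : ℝ) - inner ℝ (V p) (jacobiE m n φ U p) =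
      inner ℝ (divForm φ (fun x => covD (𝓡 m) φ U x) p) (V p)
        - inner ℝ (divForm φ (fun x => covD (𝓡 m) φ V x) p) (U p) := by
  have e : (metricTrace p fun u v => (inner ℝ (curv (φ p) (dmap m n φ p u) (V p)
      (dmap m n φ p v)) (U p) : ℝ)) = metricTrace p fun u v =>
        (inner ℝ (curv (φ p) (dmap m n φ p u) (U p) (dmap m n φ p v)) (V p) : ℝ) :=
    metricTrace_congr fun u => inner_curv_pair_symm _ _ _ _
  rw [jacobiE, jacobiE, roughLaplacian, roughLaplacian, ← divForm_covD, ← divForm_covD,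
    real_inner_comm _ (V p), inner_add_left, inner_add_left, inner_neg_left, inner_neg_left,
    inner_metricTrace_left, inner_metricTrace_left, e]
  ring

/-- The Jacobi operator of the energy is symmetric. -/
lemma integral_jacobiE_symm (hφ : ContMDiff (𝓡 m) (𝓡 n) ∞ φ)
    (hV : ∀ x, SmoothSectionAt (𝓡 m) φ V x) (hU : ∀ x, SmoothSectionAt (𝓡 m) φ U x) :
    ∫ p, (inner ℝ (jacobiE m n φ V p) (U p) : ℝ) ∂(riemVolume m M) =
      ∫ p, (inner ℝ (V p) (jacobiE m n φ U p) : ℝ) ∂(riemVolume m M) := by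
  have h1 := smoothSectionAt_jacobiE hφ hV
  have h2 := smoothSectionAt_jacobiE hφ hU
  rw [← sub_eq_zero, ← integral_sub (integrable_of_contMDiff fun p => (h1 p).inner (hU p))
    (integrable_of_contMDiff fun p => (hV p).inner (h2 p))]
  simp only [inner_jacobiE_sub]
  rw [integral_sub (integrable_divForm (smoothForm_covD hU) hV)
    (integrable_divForm (smoothForm_covD hV) hU), integral_form_covD (smoothForm_covD hU) hV,
    integral_form_covD (smoothForm_covD hV) hU, sub_eq_zero]
  congr 2
  funext p
  exact metricTrace_congr fun u => real_inner_comm _ _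

/-- The one-form appearing in the first variation of the conformal bienergy. -/
def stressForm (φ : M → N) (x : M) (u : TangentSpace (𝓡 m) x) : TangentSpace (𝓡 n) (φ x) :=
  (2 / 3 * scal m x : ℝ) • dmap m n φ x u - (2 : ℝ) • dmap m n φ x (ricci x u)

lemma smoothForm_stressForm (hφ : ContMDiff (𝓡 m) (𝓡 n) ∞ φ) :
    SmoothForm φ (stressForm (m := m) (n := n) φ) where
  linear x := by
    have h1 := isLinearMap_dmap (m := m) (n := n) φ x
    have h2 := isLinearMap_ricci (m := m) x
    refine ⟨fun u v => ?_, fun c u => ?_⟩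
    · simp only [stressForm, h1.map_add, h2.map_add, smul_add]
      abel
    · simp only [stressForm, h1.map_smul, h2.map_smul, smul_sub, smul_comm c]
  smooth hA := ((smoothSectionAt_dmap (.of_forall hφ) hA).smul (contMDiff_scal_mul _)).sub
    ((smoothSectionAt_dmap (.of_forall hφ) (smoothFieldAt_ricci hA)).const_smul 2)

/-- The gradient of the scalar curvature enters twice: with 2/3 from differentiating the factor
Scal, and with -2·½ from the divergence of Ric. The sum of these is -1/3. Symmetry of Ric moves it
to the first slot of the second fundamental form. -/
lemma divForm_stressForm (hφ : ContMDiff (𝓡 m) (𝓡 n) ∞ φ) (p : M) :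
    divForm φ (stressForm (m := m) (n := n) φ) p =
      -(1 / 3 : ℝ) • dmap m n φ p (grad (n := m) (scal m) p)
        + (2 / 3 * scal m p : ℝ) • tension m n φ p
        - (2 : ℝ) • metricTrace p fun u v => hessMap m n φ p (ricci p u) v := by
  have hφ' : ∀ᶠ x in 𝓝 p, ContMDiffAt (𝓡 m) (𝓡 n) ∞ φ x := .of_forall hφ
  have hs := mem_extChartAt_source (I := 𝓡 m) p
  have hL := isLinearMap_dmap (m := m) (n := n) φ p
  have hdc : ∀ u : TangentSpace (𝓡 m) p, dirD (𝓡 m) (fun x : M => (2 / 3 * scal m x : ℝ)) p u =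
      2 / 3 * dirD (𝓡 m) (scal m (N := M)) p u := fun u => by
    have h1 := dirD_smul (c := fun _ : M => (2 / 3 : ℝ)) (u := scal m (N := M)) (p := p)
      mdifferentiableAt_const
      ((contMDiff_scal p).mdifferentiableAt (by simp)) u
    rw [dirD_const, zero_smul, zero_add] at h1
    exact h1
  have key : ∀ u : TangentSpace (𝓡 m) p,
      covD (𝓡 m) φ (fun x => stressForm φ x (extendVec p u x)) p u
        - stressForm φ p (covD (𝓡 m) (fun x : M => x) (extendVec p u) p u) =
      ((2 / 3 : ℝ) • dmap m n φ p (dirD (𝓡 m) (scal m (N := M)) p u • u)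
        + (2 / 3 * scal m p : ℝ) • hessMap m n φ p u u)
        - (2 : ℝ) • (hessMap m n φ p u (ricci p u) + dmap m n φ p (dRicci p u u)) := fun u => by
    have hu := smoothFieldAt_extendVec hs u
    have s1 := smoothSectionAt_dmap hφ' hu
    have s2 := smoothSectionAt_dmap hφ' (smoothFieldAt_ricci hu)
    have h1 := hessMap_field hφ' hu u
    have h2 := hessMap_field hφ' (smoothFieldAt_ricci hu) u
    simp only [extendVec_self] at h1 h2
    rw [dRicci, hL.map_sub, h1, h2]
    simp only [stressForm]
    rw [covD_sub (s1.smul (contMDiff_scal_mul p)) (s2.const_smul 2),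
      covD_smul (contMDiff_scal_mul p) s1, covD_const_smul 2 s2, hdc, extendVec_self, hL.map_smul]
    module
  have h1 := metricTrace_congr (p := p) (B := fun u v =>
    covD (𝓡 m) φ (fun x => stressForm φ x (extendVec p v x)) p u
        - stressForm φ p (covD (𝓡 m) (fun x : M => x) (extendVec p v) p u))
    (C := fun u v => ((2 / 3 : ℝ) • dmap m n φ p (dirD (𝓡 m) (scal m (N := M)) p u • v)
        + (2 / 3 * scal m p : ℝ) • hessMap m n φ p u v)
        - (2 : ℝ) • (hessMap m n φ p u (ricci p v) + dmap m n φ p (dRicci p u v))) key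
  have h2 := metricTrace_selfAdjoint (bilin_hessMap (n := n) hφ') (S := ricci (n := m) p)
    (inner_ricci_comm (m := m))
  rw [divForm, h1, metricTrace_sub, metricTrace_add, metricTrace_smul, metricTrace_smul,
    metricTrace_smul, metricTrace_add, ← metricTrace_map hL, ← metricTrace_map hL, h2]
  have h3 : metricTrace p (dRicci p) = (1 / 2 : ℝ) • grad (n := m) (scal m (N := M)) p :=
    metricTrace_dRicci p
  have h4 : (metricTrace p fun u v => dirD (𝓡 m) (scal m (N := M)) p u • v) =
    grad (n := m) (scal m (N := M)) p := rfl
  change (2 / 3 : ℝ) • dmap m n φ p _ + _ - (2 : ℝ) • (_ + dmap m n φ p (metricTrace p (dRicci p))) = _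
  rw [h3, h4, hL.map_smul, tension]
  module

end IntegrationByParts

/-! ### The first variation of the conformal bienergy. -/

section FirstVariation

variable {m : ℕ} {M : Type*} [TopologicalSpace M] [ChartedSpace (Model m) M] [IsManifold (𝓡 m) ∞ M]

lemma contMDiff_deriv_param {h : ℝ → M → ℝ}
    (hh : ContMDiff (𝓘(ℝ, ℝ).prod (𝓡 m)) 𝓘(ℝ, ℝ) ∞ fun x : ℝ × M => h x.1 x.2) :
    ContMDiff (𝓘(ℝ, ℝ).prod (𝓡 m)) 𝓘(ℝ, ℝ) ∞
      fun x : ℝ × M => deriv (fun s => h s x.2) x.1 := by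
  rintro ⟨t, p⟩
  have hp := mem_extChartAt_source (I := 𝓡 m) p
  rw [contMDiffAt_prod_iff_chart hp]
  have h1 := (contMDiffAt_prod_iff_chart hp).1 (hh (t, p))
  have h2 := contDiffAt_fderiv_apply h1 (contDiffAt_const (c := ((1 : ℝ), (0 : Model m))))
  refine h2.congr_of_eventuallyEq ?_
  filter_upwards [(h1.of_le (m := 1) (by simp)).eventually (by simp)] with y hy
  have := fderiv_slice_left (F := fun y : ℝ × Model m => h y.1 ((extChartAt (𝓡 m) p).symm y.2))
    (t := y.1) (z := y.2) (hy.differentiableAt (by simp)) 1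
  rw [← this]
  exact fderiv_apply_one_eq_deriv.symm

variable [RiemannianBundle (fun x : M => TangentSpace (𝓡 m) x)]
  [IsContMDiffRiemannianBundle (𝓡 m) ∞ (Model m) (fun x : M => TangentSpace (𝓡 m) x)]
  [CompactSpace M] [MeasurableSpace M] [BorelSpace M]

/-- The parameter derivative is jointly continuous, hence bounded on a compact time interval times
the compact manifold. Since the measure is finite, this bound is the dominating function. -/
lemma hasDerivAt_integral_param {h : ℝ → M → ℝ}
    (hh : ContMDiff (𝓘(ℝ, ℝ).prod (𝓡 m)) 𝓘(ℝ, ℝ) ∞ fun x : ℝ × M => h x.1 x.2) (t : ℝ) :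
    HasDerivAt (fun t => ∫ p, h t p ∂(riemVolume m M))
      (∫ p, deriv (fun s => h s p) t ∂(riemVolume m M)) t := by
  have hc : ∀ s, Continuous (h s) := fun s => hh.continuous.comp (Continuous.prodMk_right s)
  have hd := (contMDiff_deriv_param hh).continuous
  have hdc : Continuous fun p => deriv (fun s => h s p) t := hd.comp (Continuous.prodMk_right t)
  have hK : IsCompact (Set.Icc (t - 1) (t + 1) ×ˢ (Set.univ : Set M)) :=
    isCompact_Icc.prod isCompact_univ
  obtain ⟨C, hC⟩ := hK.exists_bound_of_continuousOn hd.continuousOn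
  refine (hasDerivAt_integral_of_dominated_loc_of_deriv_le
    (F' := fun t p => deriv (fun s => h s p) t) (bound := fun _ => C)
    (Icc_mem_nhds (by linarith : t - 1 < t) (by linarith : t < t + 1))
    (.of_forall fun s => (hc s).aestronglyMeasurable)
    ((hc t).integrable_of_hasCompactSupport (HasCompactSupport.of_compactSpace _))
    hdc.aestronglyMeasurable
    (.of_forall fun p s hs => hC (s, p) ⟨hs, Set.mem_univ _⟩) (integrable_const _)
    (.of_forall fun p s _ => ?_)).2
  have : MDifferentiableAt 𝓘(ℝ, ℝ) 𝓘(ℝ, ℝ) (fun s => h s p) s :=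
    ((hh (s, p)).comp (f := fun s : ℝ => (s, p)) s
      (contMDiffAt_id.prodMk contMDiffAt_const)).mdifferentiableAt (by simp)
  exact (mdifferentiableAt_iff_differentiableAt.1 this).hasDerivAt

variable {n : ℕ} {N : Type*} [TopologicalSpace N] [ChartedSpace (Model n) N]
  [IsManifold (𝓡 n) ∞ N] [RiemannianBundle (fun x : N => TangentSpace (𝓡 n) x)]
  [IsContMDiffRiemannianBundle (𝓡 n) ∞ (Model n) (fun x : N => TangentSpace (𝓡 n) x)]
  {f : ℝ → M → N} {p : M} {t : ℝ} {φ : M → N}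

variable (m n) in
/-- Twice the integrand of the conformal bienergy. -/
def energyDensity (φ : M → N) (p : M) : ℝ :=
  inner ℝ (tension m n φ p) (tension m n φ p)
    + 2 / 3 * scal m p * (metricTrace p fun u v => inner ℝ (dmap m n φ p u) (dmap m n φ p v))
    - 2 * metricTrace p fun u v => inner ℝ (dmap m n φ p (ricci p u)) (dmap m n φ p v)

lemma contMDiff_energyDensity (hf : SmoothFamily (m := m) (n := n) f) :
    ContMDiff (𝓘(ℝ, ℝ).prod (𝓡 m)) 𝓘(ℝ, ℝ) ∞
      fun x : ℝ × M => energyDensity m n (f x.1) x.2 := by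
  rintro ⟨t, p⟩
  have hs : ∀ v : TangentSpace (𝓡 m) p, SmoothFieldAt (extendVec p v) p :=
    smoothFieldAt_extendVec (mem_extChartAt_source (I := 𝓡 m) p)
  have hτ := smoothFamAt_tension hf t p
  have h1 := contMDiffAt_metricTrace (I := 𝓘(ℝ, ℝ).prod (𝓡 m)) (pr := fun x : ℝ × M => x.2)
    (x₀ := (t, p)) (B := fun x u v => inner ℝ (dmap m n (f x.1) x.2 u) (dmap m n (f x.1) x.2 v))
    contMDiffAt_snd (.of_forall fun x => bilin_inner (isLinearMap_dmap _ _) (isLinearMap_dmap _ _))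
    fun v w => SmoothSectionAt.inner (smoothFamAt_dmap hf (hs v)) (smoothFamAt_dmap hf (hs w))
  have h2 := contMDiffAt_metricTrace (I := 𝓘(ℝ, ℝ).prod (𝓡 m)) (pr := fun x : ℝ × M => x.2)
    (x₀ := (t, p)) (B := fun x u v => inner ℝ (dmap m n (f x.1) x.2 (ricci x.2 u))
      (dmap m n (f x.1) x.2 v))
    contMDiffAt_snd (.of_forall fun x => (bilin_inner (isLinearMap_dmap (f x.1) x.2)
      (isLinearMap_dmap _ _)).comp_left (isLinearMap_ricci x.2))
    fun v w => SmoothSectionAt.inner (smoothFamAt_dmap hf (smoothFieldAt_ricci (hs v)))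
      (smoothFamAt_dmap hf (hs w))
  exact ((hτ.inner hτ).add ((contMDiffAt_comp_snd (contMDiff_scal_mul (M := M)) t p).mul h1)).sub
    (contMDiffAt_const.mul h2)

lemma hasDerivAt_inner_dmap (hf : SmoothFamily (m := m) (n := n) f) (u v : TangentSpace (𝓡 m) p) :
    HasDerivAt (fun s => (inner ℝ (dmap m n (f s) p u) (dmap m n (f s) p v) : ℝ))
      (inner ℝ (covD (𝓡 m) (f t) (velo (n := n) f t) p u) (dmap m n (f t) p v)
        + inner ℝ (dmap m n (f t) p u) (covD (𝓡 m) (f t) (velo (n := n) f t) p v)) t := by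
  have h := deriv_inner (curveD_dmap hf u).1 (curveD_dmap hf v (t := t)).1
  rw [(curveD_dmap hf u).2, (curveD_dmap hf v).2] at h
  exact h

lemma hasDerivAt_metricTrace {B : ℝ → TangentSpace (𝓡 m) p → TangentSpace (𝓡 m) p → ℝ}
    {D : TangentSpace (𝓡 m) p → TangentSpace (𝓡 m) p → ℝ}
    (h : ∀ u v, HasDerivAt (fun s => B s u v) (D u v) t) :
    HasDerivAt (fun s => metricTrace p (B s)) (metricTrace p D) t := by
  simp only [metricTrace]
  exact HasDerivAt.fun_sum fun i _ => h _ _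

/-- The overall factor 2 offsets the 1/2 in front of the energy. In the Ricci term the two halves of
the product rule coincide after Ric is moved across the trace by symmetry, so the stress form
appears. -/
lemma hasDerivAt_energyDensity (hf : SmoothFamily (m := m) (n := n) f) (t : ℝ) (p : M) :
    HasDerivAt (fun s => energyDensity m n (f s) p)
      (2 * (-inner ℝ (jacobiE m n (f t) (velo (n := n) f t) p) (tension m n (f t) p)
        + metricTrace p fun u v => (inner ℝ (stressForm (n := n) (f t) p u)
          (covD (𝓡 m) (f t) (velo (n := n) f t) p v) : ℝ))) t := by
  have hτ := (smoothFamAt_tension hf t p).curve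
  have h1 := deriv_inner hτ hτ
  have e1 : curveD (fun s => f s p) (fun s => tension m n (f s) p) t =
    -jacobiE m n (f t) (velo (n := n) f t) p := timeD_tension hf t p
  rw [e1] at h1
  have h2 := hasDerivAt_metricTrace fun u v => hasDerivAt_inner_dmap hf (t := t) (p := p) u v
  have h3 := hasDerivAt_metricTrace fun u v => hasDerivAt_inner_dmap hf (t := t) (p := p)
    (ricci p u) v
  refine ((h1.add (h2.const_mul (2 / 3 * scal m p))).sub (h3.const_mul 2)).congr_deriv ?_
  have hL := isLinearMap_covD (m := m) (f t) (velo (n := n) f t) p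
  have hD := isLinearMap_dmap (m := m) (n := n) (f t) p
  have e2 := metricTrace_selfAdjoint (bilin_inner hL hD) (S := ricci (n := m) p)
    (inner_ricci_comm (m := m))
  have e3 : (metricTrace p fun u v => (inner ℝ (covD (𝓡 m) (f t) (velo (n := n) f t) p u)
      (dmap m n (f t) p (ricci p v)) : ℝ)) = metricTrace p fun u v =>
        (inner ℝ (dmap m n (f t) p (ricci p u))
          (covD (𝓡 m) (f t) (velo (n := n) f t) p v) : ℝ) :=
    metricTrace_congr fun u => real_inner_comm _ _
  have e4 : (metricTrace p fun u v => (inner ℝ (covD (𝓡 m) (f t) (velo (n := n) f t) p u)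
      (dmap m n (f t) p v) : ℝ)) = metricTrace p fun u v =>
        (inner ℝ (dmap m n (f t) p u) (covD (𝓡 m) (f t) (velo (n := n) f t) p v) : ℝ) :=
    metricTrace_congr fun u => real_inner_comm _ _
  have e5 : (metricTrace p fun u v => (inner ℝ (stressForm (n := n) (f t) p u)
      (covD (𝓡 m) (f t) (velo (n := n) f t) p v) : ℝ)) =
      2 / 3 * scal m p * (metricTrace p fun u v =>
        (inner ℝ (dmap m n (f t) p u) (covD (𝓡 m) (f t) (velo (n := n) f t) p v) : ℝ))
      - 2 * metricTrace p fun u v => (inner ℝ (dmap m n (f t) p (ricci p u))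
          (covD (𝓡 m) (f t) (velo (n := n) f t) p v) : ℝ) := by
    rw [← metricTrace_const_mul, ← metricTrace_const_mul, ← metricTrace_sub]
    refine metricTrace_congr fun u => ?_
    rw [stressForm, inner_sub_left, real_inner_smul_left, real_inner_smul_left]
  rw [metricTrace_add, metricTrace_add, e2, e3, e4, e5, inner_neg_left, inner_neg_right,
    real_inner_comm (tension m n (f t) p)]
  ring

variable [T2Space M]

/-- The first variation formula. -/
lemma hasDerivAt_cBienergy (hf : SmoothFamily (m := m) (n := n) f) (t : ℝ) :
    HasDerivAt (fun s => cBienergy m n (f s))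
      (∫ p, (inner ℝ (bitension (m := m) (n := n) (f t) p) (velo (n := n) f t p) : ℝ)
        ∂(riemVolume m M)) t := by
  have hφ := hf.slice t
  have hV : ∀ p, SmoothSectionAt (𝓡 m) (f t) (velo (n := n) f t) p :=
    fun p => (smoothFamAt_velo hf).slice
  have hτ : ∀ p, SmoothSectionAt (𝓡 m) (f t) (tension m n (f t)) p :=
    fun p => (smoothFamAt_tension hf t p).slice
  have h := (hasDerivAt_integral_param (h := fun t => energyDensity m n (f t))
    (contMDiff_energyDensity hf) t).const_mul (1 / 2 : ℝ)
  refine h.congr_deriv ?_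
  have e1 : ∀ p, deriv (fun s => energyDensity m n (f s) p) t = _ := fun p =>
    (hasDerivAt_energyDensity hf t p).deriv
  simp only [e1]
  have i1 := integrable_of_contMDiff fun p => (smoothSectionAt_jacobiE hφ hV p).inner (hτ p)
  have i2 := integrable_of_contMDiff
    (contMDiff_metricTrace_form_covD (smoothForm_stressForm hφ) hV)
  have i3 := integrable_of_contMDiff fun p => (hV p).inner (smoothSectionAt_jacobiE hφ hτ p)
  have i4 := integrable_divForm (smoothForm_stressForm hφ) hV
  have h1 := (integral_add i1.neg i2).symm
  have h2 := integral_add i3.neg i4.neg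
  simp only [Pi.neg_apply, integral_neg] at h1 h2
  -- J is moved from the velocity to the tension field, and the covariant derivative of the velocity
  -- is traded for minus the divergence of the stress form. The integrand is then an inner product
  -- with the velocity itself.
  rw [integral_const_mul, ← h1, integral_jacobiE_symm hφ hV hτ,
    ← neg_eq_iff_eq_neg.2 (integral_form_covD (smoothForm_stressForm hφ) hV), ← h2, ← mul_assoc]
  norm_num
  refine integral_congr_ae (.of_forall fun p => ?_)
  simp only
  rw [divForm_stressForm hφ, bitension, real_inner_comm _ (velo (n := n) f t p), ← inner_neg_left,
    ← sub_eq_add_neg, ← inner_sub_left]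
  congr 1
  module

end FirstVariation

/-! ### Construction of two-parameter variations with prescribed fields. -/

section Variations

variable {n : ℕ} {N : Type*} [TopologicalSpace N] [ChartedSpace (Model n) N]
  [IsManifold (𝓡 n) ∞ N]

/-- A bounded reparametrisation of the line that is tangent to the identity at the origin. -/
lemma exists_bounded_reparam {δ : ℝ} (hδ : 0 < δ) : ∃ θ : ℝ → ℝ, ContDiff ℝ ∞ θ ∧ θ 0 = 0 ∧
    HasDerivAt θ 1 0 ∧ ∀ s, |θ s| < δ := by
  have hpos : ∀ s : ℝ, 0 < δ ^ 2 + s ^ 2 := fun s => by positivity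
  -- The value is bounded by δ/2, since 2δ|s| ≤ δ² + s², and the slope at the origin is δ²/δ² = 1.
  refine ⟨fun s => δ ^ 2 * s / (δ ^ 2 + s ^ 2), ?_, by simp, ?_, fun s => ?_⟩
  · exact (contDiff_const.mul contDiff_id).div (contDiff_const.add (contDiff_id.pow 2))
      fun s => (hpos s).ne'
  · have h1 : HasDerivAt (fun s : ℝ => δ ^ 2 * s) (δ ^ 2) 0 := by
      simpa using (hasDerivAt_id (0 : ℝ)).const_mul (δ ^ 2)
    have h2 : HasDerivAt (fun s : ℝ => δ ^ 2 + s ^ 2) 0 0 := by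
      simpa using (hasDerivAt_pow 2 (0 : ℝ)).const_add (δ ^ 2)
    refine (h1.div h2 (hpos 0).ne').congr_deriv ?_
    field_simp
    ring
  · rw [abs_div, abs_mul, abs_of_pos (hpos s), abs_of_pos (pow_pos hδ 2), div_lt_iff₀ (hpos s)]
    have h : δ * |s| < δ ^ 2 + s ^ 2 := by
      nlinarith [sq_nonneg (δ - |s|), sq_abs s, hpos s]
    nlinarith [mul_lt_mul_of_pos_left h hδ]

lemma velocity_eq_iff {γ : ℝ → N} (hγ : ContMDiffAt 𝓘(ℝ, ℝ) (𝓡 n) ∞ γ 0) {x q : N}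
    (hx : γ 0 = x) (hq : x ∈ (extChartAt (𝓡 n) q).source) (v : TangentSpace (𝓡 n) x) :
    (⟨γ 0, mfderiv 𝓘(ℝ, ℝ) (𝓡 n) γ 0 (1 : ℝ)⟩ : TangentBundle (𝓡 n) N) = ⟨x, v⟩ ↔
      HasDerivAt (fun s => extChartAt (𝓡 n) q (γ s)) (coords q x v) 0 := by
  subst hx
  have h1 := (dirD_extChartAt_comp (hγ.mdifferentiableAt (by simp)) hq (1 : ℝ)).symm.trans
    (dirD_self _ _ _)
  have hd : DifferentiableAt ℝ (fun s => extChartAt (𝓡 n) q (γ s)) 0 :=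
    (contMDiffAt_iff_contDiffAt.1 (contMDiffAt_extChartAt_comp hγ hq)).differentiableAt (by simp)
  have h2 : fderiv ℝ (fun s => extChartAt (𝓡 n) q (γ s)) 0 1 =
    deriv (fun s => extChartAt (𝓡 n) q (γ s)) 0 := fderiv_apply_one_eq_deriv
  rw [h2] at h1
  constructor
  · intro h
    have h3 := eq_of_heq (Bundle.TotalSpace.mk.inj h).2
    rw [← h3, h1]
    exact hd.hasDerivAt
  · intro h
    rw [coords_injective hq (h1.trans h.deriv)]

/-- In the chart the displacement c θ(s) v adds c v to the velocity, while the reparametrisation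
leaves the velocity of γ unchanged because θ has slope 1 at the origin. -/
lemma velocity_chart_move {γ γ' : ℝ → N} (hγ : ContMDiffAt 𝓘(ℝ, ℝ) (𝓡 n) ∞ γ 0)
    (hγ' : ContMDiffAt 𝓘(ℝ, ℝ) (𝓡 n) ∞ γ' 0) {x q : N}
    (hq : x ∈ (extChartAt (𝓡 n) q).source) {a v : TangentSpace (𝓡 n) x}
    (ha : (⟨γ 0, mfderiv 𝓘(ℝ, ℝ) (𝓡 n) γ 0 (1 : ℝ)⟩ : TangentBundle (𝓡 n) N) = ⟨x, a⟩)
    {θ : ℝ → ℝ} (hθ : θ 0 = 0) (hθ' : HasDerivAt θ 1 0) {c : ℝ}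
    (h : ∀ᶠ s in 𝓝 0, γ' s = (extChartAt (𝓡 n) q).symm
      (extChartAt (𝓡 n) q (γ (θ s)) + c • θ s • coords q x v)) :
    (⟨γ' 0, mfderiv 𝓘(ℝ, ℝ) (𝓡 n) γ' 0 (1 : ℝ)⟩ : TangentBundle (𝓡 n) N) = ⟨x, a + c • v⟩ := by
  have hx : γ 0 = x := (Bundle.TotalSpace.mk.inj ha).1
  have hx' : γ' 0 = x := by
    rw [h.self_of_nhds, hθ, zero_smul, smul_zero, add_zero, hx, (extChartAt (𝓡 n) q).left_inv hq]
  rw [velocity_eq_iff hγ hx hq] at ha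
  rw [velocity_eq_iff hγ' hx' hq]
  have h1 : HasDerivAt (fun s => extChartAt (𝓡 n) q (γ (θ s)) + c • θ s • coords q x v)
      (coords q x (a + c • v)) 0 := by
    have h2 := HasDerivAt.scomp_of_eq (0 : ℝ) ha hθ' hθ.symm
    have h3 := (hθ'.smul_const (coords q x v)).const_smul c
    refine (h2.add h3).congr_deriv ?_
    rw [one_smul, one_smul, coords_eq, coords_eq, coords_eq, map_add, map_smul]
  refine h1.congr_of_eventuallyEq ?_
  have ht : ∀ᶠ s in 𝓝 (0 : ℝ), extChartAt (𝓡 n) q (γ (θ s)) + c • θ s • coords q x v ∈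
      (extChartAt (𝓡 n) q).target := by
    refine h1.continuousAt.eventually_mem ?_
    rw [hθ, zero_smul, smul_zero, add_zero, hx]
    exact (isOpen_extChartAt_target q).mem_nhds ((extChartAt (𝓡 n) q).map_source hq)
  filter_upwards [h, ht] with s hs hst
  rw [hs, (extChartAt (𝓡 n) q).right_inv hst]

variable {m : ℕ} {M : Type*} [TopologicalSpace M] [ChartedSpace (Model m) M]
  [IsManifold (𝓡 m) ∞ M] {φ : M → N} {V W A B : ∀ p, TangentSpace (𝓡 n) (φ p)}
  {Φ : ℝ → ℝ → M → N}

lemma IsVariation.curve_s (h : IsVariation m n φ V W Φ) (t : ℝ) (p : M) :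
    ContMDiff 𝓘(ℝ, ℝ) (𝓡 n) ∞ fun s => Φ s t p :=
  h.smooth.comp (contMDiff_id.prodMk (contMDiff_const (c := (t, p))))

lemma IsVariation.curve_t (h : IsVariation m n φ V W Φ) (s : ℝ) (p : M) :
    ContMDiff 𝓘(ℝ, ℝ) (𝓡 n) ∞ fun t => Φ s t p :=
  h.smooth.comp ((contMDiff_const (c := s)).prodMk (contMDiff_id.prodMk (contMDiff_const (c := p))))

lemma isVariation_const (hφ : ContMDiff (𝓡 m) (𝓡 n) ∞ φ) :
    IsVariation m n φ (fun _ => 0) (fun _ => 0) fun _ _ => φ := by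
  refine ⟨hφ.comp (contMDiff_snd.comp contMDiff_snd), rfl, fun p => ?_, fun p => ?_⟩ <;>
  · rw [mfderiv_const]
    rfl

variable [T2Space M] [CompactSpace M]

/-- The given variation is displaced in a single chart of N by ρ(sV + tW), which adds ρV and ρW to
its fields. The parameters are first made small by a bounded reparametrisation, since a variation
must be defined for all real s and t. -/
lemma exists_variation_step (hΦ : IsVariation m n φ A B Φ)
    (hV : ∀ p, SmoothSectionAt (𝓡 m) φ V p) (hW : ∀ p, SmoothSectionAt (𝓡 m) φ W p) {ρ : M → ℝ}
    (hρ : ContMDiff (𝓡 m) 𝓘(ℝ, ℝ) ∞ ρ) {q : N}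
    (hsub : tsupport ρ ⊆ φ ⁻¹' (extChartAt (𝓡 n) q).source) :
    ∃ Φ', IsVariation m n φ (fun p => A p + ρ p • V p) (fun p => B p + ρ p • W p) Φ' := by
  classical
  set e := extChartAt (𝓡 n) q with he
  set K := tsupport ρ with hK
  have hKc : IsCompact K := (isClosed_tsupport ρ).isCompact
  have hρ0 : ∀ p ∉ K, ρ p = 0 := fun p hp => image_eq_zero_of_notMem_tsupport hp
  have hφ : ContMDiff (𝓡 m) (𝓡 n) ∞ φ := fun p => (hV p).base
  set F : ℝ × ℝ × M → N := fun x => Φ x.1 x.2.1 x.2.2 with hF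
  have hFs := hΦ.smooth
  have hF0 : ∀ p, F (0, 0, p) = φ p := fun p => congrFun hΦ.base p
  set v : M → Model n := fun p => coords q (φ p) (V p) with hv
  set w : M → Model n := fun p => coords q (φ p) (W p) with hw
  set G : ℝ × ℝ × M → Model n := fun x =>
    e (F x) + ρ x.2.2 • (x.1 • v x.2.2 + x.2.1 • w x.2.2) with hG
  have hp2 : ContMDiff (𝓘(ℝ, ℝ).prod (𝓘(ℝ, ℝ).prod (𝓡 m))) (𝓡 m) ∞
      fun x : ℝ × ℝ × M => x.2.2 := contMDiff_snd.comp contMDiff_snd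
  have hp1 : ContMDiff (𝓘(ℝ, ℝ).prod (𝓘(ℝ, ℝ).prod (𝓡 m))) 𝓘(ℝ, ℝ) ∞
      fun x : ℝ × ℝ × M => x.2.1 := contMDiff_fst.comp contMDiff_snd
  have hGs : ∀ x, F x ∈ e.source → φ x.2.2 ∈ e.source →
      ContMDiffAt (𝓘(ℝ, ℝ).prod (𝓘(ℝ, ℝ).prod (𝓡 m))) 𝓘(ℝ, Model n) ∞ G x := fun x h1 h2 => by
    have a1 := contMDiffAt_extChartAt_comp (hFs x) h1
    have a2 := ((hV x.2.2).contMDiffAt_coords h2).comp x (hp2 x)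
    have a3 := ((hW x.2.2).contMDiffAt_coords h2).comp x (hp2 x)
    exact a1.add ((hρ.comp hp2 x).smul ((contMDiffAt_fst.smul a2).add ((hp1 x).smul a3)))
  have hQ : ∀ x, F x ∈ e.source → φ x.2.2 ∈ e.source → G x ∈ e.target → ∀ᶠ y in 𝓝 x,
      F y ∈ e.source ∧ φ y.2.2 ∈ e.source ∧ G y ∈ e.target := fun x h1 h2 h3 => by
    have hs : IsOpen e.source := isOpen_extChartAt_source (I := 𝓡 n) q
    exact (hFs.continuous.continuousAt.eventually_mem (hs.mem_nhds h1)).and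
      (((hφ.comp hp2).continuous.continuousAt.eventually_mem (hs.mem_nhds h2)).and
      ((hGs x h1 h2).continuousAt.eventually_mem ((isOpen_extChartAt_target q).mem_nhds h3)))
  have hQ0 : ∀ p ∈ K, F (0, 0, p) ∈ e.source ∧ φ p ∈ e.source ∧ G (0, 0, p) ∈ e.target :=
    fun p hp => by
      have h1 : φ p ∈ e.source := hsub hp
      refine ⟨by rw [hF0]; exact h1, h1, ?_⟩
      simp only [hG, hF0, zero_smul, add_zero, smul_zero]
      exact e.map_source h1
  -- Compactness of the support of ρ provides one neighbourhood of parameters for which the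
  -- displaced points stay in the chart, uniformly over the support.
  have htube : ∀ᶠ y : ℝ × ℝ in 𝓝 (0, 0), ∀ p ∈ K,
      F (y.1, y.2, p) ∈ e.source ∧ φ p ∈ e.source ∧ G (y.1, y.2, p) ∈ e.target := by
    refine hKc.eventually_forall_of_forall_eventually fun p hp => ?_
    have hc : ContinuousAt (fun z : (ℝ × ℝ) × M => (z.1.1, z.1.2, z.2)) ((0, 0), p) := by fun_prop
    exact hc.eventually (hQ (0, 0, p) (hQ0 p hp).1 (hQ0 p hp).2.1 (hQ0 p hp).2.2)
  obtain ⟨δ, hδ, hball⟩ := Metric.eventually_nhds_iff.1 htube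
  obtain ⟨θ, hθs, hθ0, hθ1, hθb⟩ := exists_bounded_reparam hδ
  have hgood : ∀ s t : ℝ, ∀ p ∈ K, F (θ s, θ t, p) ∈ e.source ∧ φ p ∈ e.source ∧
      G (θ s, θ t, p) ∈ e.target := fun s t => by
    refine hball (y := (θ s, θ t)) ?_
    rw [Prod.dist_eq, Real.dist_eq, Real.dist_eq, sub_zero, sub_zero]
    exact max_lt (hθb s) (hθb t)
  set Θ : ℝ × ℝ × M → ℝ × ℝ × M := fun x => (θ x.1, θ x.2.1, x.2.2) with hΘ
  have hΘs : ContMDiff (𝓘(ℝ, ℝ).prod (𝓘(ℝ, ℝ).prod (𝓡 m)))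
      (𝓘(ℝ, ℝ).prod (𝓘(ℝ, ℝ).prod (𝓡 m))) ∞ Θ :=
    (hθs.contMDiff.comp contMDiff_fst).prodMk ((hθs.contMDiff.comp hp1).prodMk hp2)
  -- Where ρ = 0 the displacement is zero and both branches agree. Hence near every point one of the
  -- two smooth formulas represents Ψ.
  set Ψ : ℝ × ℝ × M → N := fun x => if x.2.2 ∈ K then e.symm (G (Θ x)) else F (Θ x) with hΨ
  have hΨK : ∀ x, x.2.2 ∉ K → Ψ =ᶠ[𝓝 x] fun y => F (Θ y) := fun x hx => by
    filter_upwards [hp2.continuous.continuousAt.eventually_mem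
      (hKc.isClosed.isOpen_compl.mem_nhds hx)] with y hy
    exact if_neg hy
  have hΨG : ∀ x, x.2.2 ∈ K → Ψ =ᶠ[𝓝 x] fun y => e.symm (G (Θ y)) := fun x hx => by
    have h1 := hgood x.1 x.2.1 x.2.2 hx
    filter_upwards [hΘs.continuous.continuousAt.eventually (hQ (Θ x) h1.1 h1.2.1 h1.2.2)] with y hy
    by_cases hyK : y.2.2 ∈ K
    · exact if_pos hyK
    · have h2 : G (Θ y) = e (F (Θ y)) := by
        simp only [hG, hΘ, hρ0 _ hyK, zero_smul, add_zero]
      rw [h2, e.left_inv hy.1]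
      exact if_neg hyK
  have hΨs : ContMDiff (𝓘(ℝ, ℝ).prod (𝓘(ℝ, ℝ).prod (𝓡 m))) (𝓡 n) ∞ Ψ := fun x => by
    by_cases hx : x.2.2 ∈ K
    · have h1 := hgood x.1 x.2.1 x.2.2 hx
      refine ContMDiffAt.congr_of_eventuallyEq ?_ (hΨG x hx)
      exact (contMDiffAt_extChartAt_symm h1.2.2).comp x ((hGs (Θ x) h1.1 h1.2.1).comp x (hΘs x))
    · exact (hFs.comp hΘs x).congr_of_eventuallyEq (hΨK x hx)
  have hΨ0 : ∀ p, Ψ (0, 0, p) = φ p := fun p => by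
    by_cases hp : p ∈ K
    · have : Ψ (0, 0, p) = e.symm (G (Θ (0, 0, p))) := if_pos hp
      rw [this]
      simp only [hG, hΘ, hθ0, hF0, zero_smul, add_zero, smul_zero]
      exact e.left_inv (hsub hp)
    · have : Ψ (0, 0, p) = F (Θ (0, 0, p)) := if_neg hp
      rw [this]
      simp only [hΘ, hθ0, hF0]
  have hc1 : ∀ p : M, ContMDiff 𝓘(ℝ, ℝ) (𝓘(ℝ, ℝ).prod (𝓘(ℝ, ℝ).prod (𝓡 m))) ∞
      fun s : ℝ => (s, (0 : ℝ), p) := fun p => contMDiff_id.prodMk contMDiff_const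
  have hc2 : ∀ p : M, ContMDiff 𝓘(ℝ, ℝ) (𝓘(ℝ, ℝ).prod (𝓘(ℝ, ℝ).prod (𝓡 m))) ∞
      fun s : ℝ => ((0 : ℝ), s, p) := fun p =>
    contMDiff_const.prodMk (contMDiff_id.prodMk contMDiff_const)
  refine ⟨fun s t p => Ψ (s, t, p), hΨs, funext hΨ0, fun p => ?_, fun p => ?_⟩
  · by_cases hp : p ∈ K
    · refine velocity_chart_move (q := q) (hΦ.curve_s 0 p 0) (hΨs.comp (hc1 p) 0) (hsub hp)
        (hΦ.field_s p) hθ0 hθ1 ?_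
      filter_upwards [(hc1 p).continuous.continuousAt.eventually (hΨG (0, 0, p) hp)] with s hs
      refine hs.trans ?_
      simp only [hG, hΘ, hθ0, zero_smul, add_zero, hF]
      rfl
    · refine velocity_chart_move (q := φ p) (hΦ.curve_s 0 p 0) (hΨs.comp (hc1 p) 0)
        (mem_extChartAt_source (I := 𝓡 n) (φ p)) (hΦ.field_s p) hθ0 hθ1 ?_
      have hm : ∀ᶠ s in 𝓝 (0 : ℝ), Φ (θ s) 0 p ∈ (extChartAt (𝓡 n) (φ p)).source := by
        refine ((hΦ.curve_s 0 p).comp hθs.contMDiff).continuous.continuousAt.eventually_mem ?_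
        have : Φ (θ 0) 0 p = φ p := by rw [hθ0]; exact hF0 p
        rw [Function.comp_apply, this]
        exact extChartAt_source_mem_nhds (I := 𝓡 n) (φ p)
      filter_upwards [(hc1 p).continuous.continuousAt.eventually (hΨK (0, 0, p) hp), hm] with s hs hm
      refine hs.trans ?_
      rw [hρ0 p hp, zero_smul, add_zero, (extChartAt (𝓡 n) (φ p)).left_inv hm]
      simp only [hΘ, hθ0, hF]
  · by_cases hp : p ∈ K
    · refine velocity_chart_move (q := q) (hΦ.curve_t 0 p 0) (hΨs.comp (hc2 p) 0) (hsub hp)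
        (hΦ.field_t p) hθ0 hθ1 ?_
      filter_upwards [(hc2 p).continuous.continuousAt.eventually (hΨG (0, 0, p) hp)] with s hs
      refine hs.trans ?_
      simp only [hG, hΘ, hθ0, zero_smul, zero_add, hF]
      rfl
    · refine velocity_chart_move (q := φ p) (hΦ.curve_t 0 p 0) (hΨs.comp (hc2 p) 0)
        (mem_extChartAt_source (I := 𝓡 n) (φ p)) (hΦ.field_t p) hθ0 hθ1 ?_
      have hm : ∀ᶠ s in 𝓝 (0 : ℝ), Φ 0 (θ s) p ∈ (extChartAt (𝓡 n) (φ p)).source := by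
        refine ((hΦ.curve_t 0 p).comp hθs.contMDiff).continuous.continuousAt.eventually_mem ?_
        have : Φ 0 (θ 0) p = φ p := by rw [hθ0]; exact hF0 p
        rw [Function.comp_apply, this]
        exact extChartAt_source_mem_nhds (I := 𝓡 n) (φ p)
      filter_upwards [(hc2 p).continuous.continuousAt.eventually (hΨK (0, 0, p) hp), hm] with s hs hm
      refine hs.trans ?_
      rw [hρ0 p hp, zero_smul, add_zero, (extChartAt (𝓡 n) (φ p)).left_inv hm]
      simp only [hΘ, hθ0, hF]

/-- Every pair of sections consists of the variation fields of a two-parameter variation. -/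
theorem exists_isVariation (hφ : ContMDiff (𝓡 m) (𝓡 n) ∞ φ)
    (hV : ∀ p, SmoothSectionAt (𝓡 m) φ V p) (hW : ∀ p, SmoothSectionAt (𝓡 m) φ W p) :
    ∃ Φ, IsVariation m n φ V W Φ := by
  classical
  obtain ⟨s, ρ, hρ, hsub, hsum⟩ := exists_finite_partition (m := m) (M := M)
    (U := fun p => φ ⁻¹' (extChartAt (𝓡 n) (φ p)).source)
    (fun p => (isOpen_extChartAt_source (I := 𝓡 n) (φ p)).preimage hφ.continuous)
    fun p => mem_extChartAt_source (I := 𝓡 n) (φ p)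
  -- Induction over the partition: each step adds one summand ρ i to both fields, starting from the
  -- constant variation. The full sum is 1.
  have h : ∀ s' : Finset M, ∃ Φ, IsVariation m n φ (fun p => ∑ i ∈ s', ρ i p • V p)
      (fun p => ∑ i ∈ s', ρ i p • W p) Φ := fun s' => by
    induction s' using Finset.induction_on with
    | empty => exact ⟨_, by simpa using isVariation_const hφ⟩
    | insert i s' hi ih =>
      obtain ⟨Φ, hΦ⟩ := ih
      obtain ⟨Φ', hΦ'⟩ := exists_variation_step hΦ hV hW (hρ i) (hsub i)
      refine ⟨Φ', ?_⟩
      simpa only [Finset.sum_insert hi, add_comm] using hΦ'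
  obtain ⟨Φ, hΦ⟩ := h s
  refine ⟨Φ, ?_⟩
  simpa only [← Finset.sum_smul, hsum, one_smul] using hΦ

end Variations

/-! ### Second variation at a critical point. -/

section SecondVariation

variable {n : ℕ} {N : Type*} [TopologicalSpace N] [ChartedSpace (Model n) N]
  [IsManifold (𝓡 n) ∞ N] {m : ℕ} {M : Type*} [TopologicalSpace M] [ChartedSpace (Model m) M]
  [IsManifold (𝓡 m) ∞ M] {φ : M → N} {V W : ∀ p, TangentSpace (𝓡 n) (φ p)} {Φ : ℝ → ℝ → M → N}

lemma IsVariation.smoothFamily_s (h : IsVariation m n φ V W Φ) (t : ℝ) :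
    SmoothFamily (m := m) (n := n) fun s => Φ s t :=
  h.smooth.comp (contMDiff_fst.prodMk ((contMDiff_const (c := t)).prodMk contMDiff_snd))

lemma IsVariation.smoothFamily_t (h : IsVariation m n φ V W Φ) (s : ℝ) :
    SmoothFamily (m := m) (n := n) (Φ s) :=
  h.smooth.comp ((contMDiff_const (c := s)).prodMk contMDiff_id)

lemma IsVariation.contDiffAt_chart (h : IsVariation m n φ V W Φ) {s t : ℝ} {p₀ x : M} {q : N}
    (hx : x ∈ (extChartAt (𝓡 m) p₀).source) (hq : Φ s t x ∈ (extChartAt (𝓡 n) q).source) :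
    ContDiffAt ℝ ∞ (fun y : ℝ × ℝ × Model m =>
      extChartAt (𝓡 n) q (Φ y.1 y.2.1 ((extChartAt (𝓡 m) p₀).symm y.2.2)))
      (s, t, extChartAt (𝓡 m) p₀ x) := by
  have hl := (extChartAt (𝓡 m) p₀).left_inv hx
  have h1 : ContMDiffAt 𝓘(ℝ, ℝ × ℝ × Model m) (𝓡 n) ∞ (fun y : ℝ × ℝ × Model m =>
      Φ y.1 y.2.1 ((extChartAt (𝓡 m) p₀).symm y.2.2)) (s, t, extChartAt (𝓡 m) p₀ x) := by
    refine ContMDiffAt.comp (I' := 𝓘(ℝ, ℝ).prod (𝓘(ℝ, ℝ).prod (𝓡 m)))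
      (g := fun x : ℝ × ℝ × M => Φ x.1 x.2.1 x.2.2)
      (f := fun y : ℝ × ℝ × Model m => (y.1, y.2.1, (extChartAt (𝓡 m) p₀).symm y.2.2)) _
      (h.smooth _) ?_
    refine ContMDiffAt.prodMk contDiff_fst.contMDiff.contMDiffAt (ContMDiffAt.prodMk
      (contDiff_fst.comp contDiff_snd).contMDiff.contMDiffAt ?_)
    exact ContMDiffAt.comp (I' := 𝓘(ℝ, Model m)) (f := fun y : ℝ × ℝ × Model m => y.2.2)
        (s, t, extChartAt (𝓡 m) p₀ x)
        (contMDiffAt_extChartAt_symm ((extChartAt (𝓡 m) p₀).map_source hx))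
        (contDiff_snd.comp contDiff_snd).contMDiff.contMDiffAt
  refine contMDiffAt_iff_contDiffAt.1 (contMDiffAt_extChartAt_comp h1 ?_)
  simpa only [hl] using hq

variable [RiemannianBundle (fun x : N => TangentSpace (𝓡 n) x)]
  [IsContMDiffRiemannianBundle (𝓡 n) ∞ (Model n) (fun x : N => TangentSpace (𝓡 n) x)]

/-- The s-velocity at s = 0 is a smooth family of sections along t ↦ φ_{0,t}. This allows ∇_t ∂_s
φ_{s,t} to be formed and used as a test section. -/
lemma IsVariation.smoothFamAt_field (h : IsVariation m n φ V W Φ) (t : ℝ) (p : M) :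
    SmoothFamAt m (Φ 0) (fun t p => velo (n := n) (fun s => Φ s t) 0 p) t p := by
  have hp := mem_extChartAt_source (I := 𝓡 m) p
  have hq := mem_extChartAt_source (I := 𝓡 n) (Φ 0 t p)
  have hf := h.smoothFamily_t 0
  rw [smoothFamAt_iff hf hp hq]
  have h1 := (contDiffAt_fderiv_apply (h.contDiffAt_chart hp hq)
    (contDiffAt_const (c := ((1 : ℝ), (0 : ℝ × Model m))))).comp (t, extChartAt (𝓡 m) p p)
    (f := fun y : ℝ × Model m => ((0 : ℝ), y)) (contDiffAt_const.prodMk contDiffAt_id)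
  refine h1.congr_of_eventuallyEq (famSec_eventuallyEq hf hp hq (S := fun _ _ => True)
    (.of_forall fun _ => trivial) fun s x _ hx hx' => ?_)
  have h2 := fderiv_slice_left ((h.contDiffAt_chart hx hx').differentiableAt (by simp)) (1 : ℝ)
  refine (coords_deriv_curve (h.curve_s s x 0) hx').trans (Eq.trans ?_ h2)
  simp only [(extChartAt (𝓡 m) p).left_inv hx]

variable [RiemannianBundle (fun x : M => TangentSpace (𝓡 m) x)]
  [IsContMDiffRiemannianBundle (𝓡 m) ∞ (Model m) (fun x : M => TangentSpace (𝓡 m) x)]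
  [T2Space M] [CompactSpace M]

/-- Smoothness is inherited from the linearisation: realise W as the velocity of a smooth family and
use that the time derivative of the smooth family `bitension` is smooth. No term of J₂ᶜ has to be
treated separately. -/
lemma smoothSectionAt_jacobiE2c (hW : ∀ p, SmoothSectionAt (𝓡 m) φ W p) (p : M) :
    SmoothSectionAt (𝓡 m) φ (jacobiE2c m n φ W) p := by
  obtain ⟨Φ, hΦ⟩ := exists_isVariation (fun p => (hW p).base) hW hW
  obtain rfl := hΦ.base
  have hW' : velo (n := n) (Φ 0) 0 = W :=
    funext fun p => eq_of_heq (Bundle.TotalSpace.mk.inj (hΦ.field_t p)).2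
  have hg := hΦ.smoothFamily_t 0
  have h := (smoothFamAt_timeD hg (smoothFamAt_bitension hg) (t := 0) (p := p)).slice
  refine h.congr (.of_forall fun x => ?_)
  rw [timeD_bitension hg, hW']

variable [MeasurableSpace M] [BorelSpace M]

/-- The Euler-Lagrange equation in weak form. -/
lemma IsCBiharmonic.integral_bitension (hφ : IsCBiharmonic m n φ)
    (hV : ∀ p, SmoothSectionAt (𝓡 m) φ V p) :
    ∫ p, (inner ℝ (bitension (m := m) (n := n) φ p) (V p) : ℝ) ∂(riemVolume m M) = 0 := by
  obtain ⟨Φ, hΦ⟩ := exists_isVariation hφ.1 hV hV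
  obtain rfl := hΦ.base
  have hV' : velo (n := n) (fun s => Φ s 0) 0 = V :=
    funext fun p => eq_of_heq (Bundle.TotalSpace.mk.inj (hΦ.field_s p)).2
  have h1 := hasDerivAt_cBienergy (hΦ.smoothFamily_s 0) 0
  rw [hV'] at h1
  exact h1.unique (hφ.2 (fun s => Φ s 0) (hΦ.smoothFamily_s 0) rfl)

/-- The second variation formula. -/
lemma IsCBiharmonic.second_variation (hφ : IsCBiharmonic m n φ) (hΦ : IsVariation m n φ V W Φ) :
    (∀ t, DifferentiableAt ℝ (fun s => cBienergy m n (Φ s t)) 0) ∧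
      HasDerivAt (fun t => deriv (fun s => cBienergy m n (Φ s t)) 0)
        (∫ p, (inner ℝ (jacobiE2c m n φ W p) (V p) : ℝ) ∂(riemVolume m M)) 0 := by
  have h1 := fun t => hasDerivAt_cBienergy (hΦ.smoothFamily_s t) 0
  refine ⟨fun t => (h1 t).differentiableAt, ?_⟩
  -- After φ is replaced by Φ 0 0, the velocities and the fields V and W lie in the same fibres, so
  -- the equalities in the tangent bundle become equalities of sections.
  obtain rfl := hΦ.base
  have hV' : velo (n := n) (fun s => Φ s 0) 0 = V :=
    funext fun p => eq_of_heq (Bundle.TotalSpace.mk.inj (hΦ.field_s p)).2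
  have hW' : velo (n := n) (Φ 0) 0 = W :=
    funext fun p => eq_of_heq (Bundle.TotalSpace.mk.inj (hΦ.field_t p)).2
  have hg := hΦ.smoothFamily_t 0
  have hB := smoothFamAt_bitension hg
  have hY := hΦ.smoothFamAt_field
  have hD := fun p => (smoothFamAt_timeD hg hY (t := 0) (p := p)).slice
  have hV : ∀ p, SmoothSectionAt (𝓡 m) (Φ 0 0) V p := fun p => hV' ▸ (hY 0 p).slice
  have hW : ∀ p, SmoothSectionAt (𝓡 m) (Φ 0 0) W p :=
    fun p => hW' ▸ (smoothFamAt_velo hg (t := 0) (p := p)).slice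
  have e : (fun t => deriv (fun s => cBienergy m n (Φ s t)) 0) = fun t =>
      ∫ p, (inner ℝ (bitension (m := m) (n := n) (Φ 0 t) p)
        (velo (n := n) (fun s => Φ s t) 0 p) : ℝ) ∂(riemVolume m M) :=
    funext fun t => (h1 t).deriv
  rw [e]
  refine (hasDerivAt_integral_param (h := fun t p => (inner ℝ
    (bitension (m := m) (n := n) (Φ 0 t) p) (velo (n := n) (fun s => Φ s t) 0 p) : ℝ))
    (fun x => (hB x.1 x.2).inner (hY x.1 x.2)) 0).congr_deriv ?_
  -- Metric product rule: the derivative of the gradient is the linearised operator applied to W,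
  -- and the other term pairs the gradient with the mixed acceleration.
  have e2 : ∀ p, deriv (fun t => (inner ℝ (bitension (m := m) (n := n) (Φ 0 t) p)
      (velo (n := n) (fun s => Φ s t) 0 p) : ℝ)) 0 =
      inner ℝ (jacobiE2c m n (Φ 0 0) W p) (V p) + inner ℝ (bitension (m := m) (n := n) (Φ 0 0) p)
        (timeD (Φ 0) (fun t p => velo (n := n) (fun s => Φ s t) 0 p) 0 p) := fun p => by
    have h2 := (deriv_inner (hB 0 p).curve (hY 0 p).curve).deriv
    have h3 := timeD_bitension hg 0 p
    rw [hW'] at h3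
    rw [← h3, ← hV']
    exact h2
  simp only [e2]
  -- The mixed acceleration is a smooth section along φ, so its pairing with the gradient integrates
  -- to zero. This is the only use of criticality in the formula, and it makes the result depend on
  -- V and W alone.
  rw [integral_add (integrable_of_contMDiff fun p => (smoothSectionAt_jacobiE2c hW p).inner (hV p))
    (integrable_of_contMDiff fun p => ((hB 0 p).slice).inner (hD p)),
    hφ.integral_bitension hD, add_zero]

/-- A continuous nonnegative function with zero integral vanishes almost everywhere, hence
everywhere because open sets have positive measure. -/
lemma eq_zero_of_integral_inner_self {Z : ∀ p, TangentSpace (𝓡 n) (φ p)}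
    (hZ : ∀ p, SmoothSectionAt (𝓡 m) φ Z p)
    (h : ∫ p, (inner ℝ (Z p) (Z p) : ℝ) ∂(riemVolume m M) = 0) (p : M) : Z p = 0 := by
  have hs : ContMDiff (𝓡 m) 𝓘(ℝ, ℝ) ∞ fun p => (inner ℝ (Z p) (Z p) : ℝ) :=
    fun p => (hZ p).inner (hZ p)
  rw [integral_eq_zero_iff_of_nonneg (fun p => real_inner_self_nonneg)
    (integrable_of_contMDiff hs)] at h
  have := congrFun ((hs.continuous.ae_eq_iff_eq _ continuous_const).1 h) p
  exact inner_self_eq_zero.1 this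

end SecondVariation

end

end ConformalBiharmonic

/-! ### Existence and uniqueness of the Jacobi operator. -/

theorem mainTheorem3 {m n : ℕ}
    {M : Type*} [TopologicalSpace M] [ChartedSpace (EuclideanSpace ℝ (Fin m)) M]
    [IsManifold (𝓡 m) ∞ M] [T2Space M] [CompactSpace M] [ConnectedSpace M]
    [MeasurableSpace M] [BorelSpace M]
    [RiemannianBundle (fun x : M => TangentSpace (𝓡 m) x)]
    [IsContMDiffRiemannianBundle (𝓡 m) ∞ (EuclideanSpace ℝ (Fin m))
      (fun x : M => TangentSpace (𝓡 m) x)]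
    {N : Type*} [TopologicalSpace N] [ChartedSpace (EuclideanSpace ℝ (Fin n)) N]
    [IsManifold (𝓡 n) ∞ N] [T2Space N] [SecondCountableTopology N] [ConnectedSpace N]
    [RiemannianBundle (fun x : N => TangentSpace (𝓡 n) x)]
    [IsContMDiffRiemannianBundle (𝓡 n) ∞ (EuclideanSpace ℝ (Fin n))
      (fun x : N => TangentSpace (𝓡 n) x)]
    (φ : M → N) (hφ : ConformalBiharmonic.IsCBiharmonic m n φ) :
    ConformalBiharmonic.IsJacobiOperator m n
        (ConformalBiharmonic.cBienergy m n) φ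
        (ConformalBiharmonic.jacobiE2c m n φ) ∧
      ∀ L : (∀ p : M, TangentSpace (𝓡 n) (φ p)) → ∀ p : M, TangentSpace (𝓡 n) (φ p),
        ConformalBiharmonic.IsJacobiOperator m n
          (ConformalBiharmonic.cBienergy m n) φ L →
        ∀ W, ConformalBiharmonic.IsSmoothSection m n φ W →
          L W = ConformalBiharmonic.jacobiE2c m n φ W := by
  have hJ : ConformalBiharmonic.IsJacobiOperator m n (ConformalBiharmonic.cBienergy m n) φ
      (ConformalBiharmonic.jacobiE2c m n φ) :=
    ⟨fun W hW => ConformalBiharmonic.smoothSectionAt_jacobiE2c hW, fun V W Φ hΦ => hφ.second_variation hΦ⟩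
  refine ⟨hJ, fun L hL W hW => ?_⟩
  have hZ : ∀ p, ConformalBiharmonic.SmoothSectionAt (𝓡 m) φ
      (fun p => L W p - ConformalBiharmonic.jacobiE2c m n φ W p) p :=
    fun p => ConformalBiharmonic.SmoothSectionAt.sub (hL.1 W hW p) (hJ.1 W hW p)
  -- The s-field is the difference of the two candidate operators at W, and the t-field is W.
  -- Uniqueness of the derivative then equates the two integrals, and their difference is the
  -- squared L² norm of that s-field.
  obtain ⟨Φ, hΦ⟩ := ConformalBiharmonic.exists_isVariation hφ.1 hZ hW
  have h := (hL.2 _ _ _ hΦ).2.unique (hJ.2 _ _ _ hΦ).2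
  rw [← sub_eq_zero, ← MeasureTheory.integral_sub
    (ConformalBiharmonic.integrable_of_contMDiff fun p =>
      ConformalBiharmonic.SmoothSectionAt.inner (hL.1 W hW p) (hZ p))
    (ConformalBiharmonic.integrable_of_contMDiff fun p =>
      ConformalBiharmonic.SmoothSectionAt.inner (hJ.1 W hW p) (hZ p))] at h
  simp only [← inner_sub_left] at h
  exact funext fun p => sub_eq_zero.1
    (ConformalBiharmonic.eq_zero_of_integral_inner_self hZ h p)
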